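/- **Setting.** For $a\in\mathbb R^3$, $\hat a$ is the skew-symmetric matrix with $\hat a v=a\times v$, and $(\cdot)^\vee$ is the inverse of the hat map. Let $e_3=(0,0,1)^T$ and let $j\in\{1,2\}$. The constants $m_Q,m_r,L_r,L_c,g,\bar k,\bar c$ and the gains $k_{x_r},k_{v_r},k_{q_r},k_{\omega_r},k_{q_j},k_{\omega_j},k_R,k_\Omega,\epsilon_R$ are positive, and $J_Q$ is symmetric positive definite. The slow state is $x=(x_r,v_r,q_r,\omega_r,q_j,\omega_j,R_j,\Omega_j)$ with $q_r,q_j\in S^2$, $\omega_r\perp q_r$, $\omega_j\perp q_j$, $R_j\in SO(3)$. The fast state is $z=(y_j,z_j)$. Put $m_{\rm eff}=2m_Q+m_r$ and $I_{\rm eff}=(2m_Q+\frac23m_r)L_r$. *Elastic model.* Two quadrotors carry a rod by elastic cables with stiffness $\bar k/\epsilon^2$, damping $\bar c/\epsilon$, lengths $l_j=L_c+\epsilon^2y_j>0$, and $\dot l_j=\epsilon z_j$. With $\zeta_j=l_jq_j$ and $a_j=\dot v_r+(-1)^jL_r\ddot q_r+ge_3$ the equations are $$\dot x_r=v_r,\qquad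 m_{\rm eff}(\dot v_r+ge_3)=u_1+u_2+m_Q(\ddot\zeta_1+\ddot\zeta_2),$$ $$\dot q_r=\omega_r\times q_r,\qquad I_{\rm eff}\dot\omega_r=q_r\times[u_2-u_1+m_Q(\ddot\zeta_2-\ddot\zeta_1)],\qquad \dot q_j=\omega_j\times q_j,$$ $$m_Qq_j^T\ddot\zeta_j=m_Qq_j^Ta_j-q_j^Tu_j-\bar cz_j-\bar ky_j,\qquad q_j\times\ddot\zeta_j=q_j\times(a_j-\tfrac1{m_Q}u_j),$$ $$\dot R_j=R_j\hat\Omega_j,\qquad J_Q\dot\Omega_j=J_Q\Omega_j\times\Omega_j+M_j.$$ Solved for the derivatives they read $\dot x=f(t,x,z;\epsilon)$, $\epsilon\dot z=g(t,x,z;\epsilon)$ (the elastic singular perturbation problem). Let $z=h(t,x)$ be the unique solution of $g(t,x,z;0)=0$ (its components $z_j$ vanish). The reduced model is $\dot x=f(t,x,h(t,x);0)$. *Reference.* The desired $\tilde x_r(t)\in\mathbb R^3$, $\tilde q_r(t)\in S^2$ and the desired first body axes $b^1_j(t)\in S^2$ are $C^\infty$, and on $[t_0,\infty)$ all their derivatives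 of order $\ge1$ are bounded. Put $\tilde v_r=\dot{\tilde x}_r$ and $\tilde\omega_r=\tilde q_r\times\dot{\tilde q}_r$. *Controls.* Let $e_{x_r}=x_r-\tilde x_r$, $e_{v_r}=v_r-\tilde v_r$, and, for $i\in\{r,1,2\}$, $e_{q_i}=\tilde q_i\times q_i$, $e_{\omega_i}=\omega_i+\hat q_i^2\tilde\omega_i$. Define $\tilde\mu_1,\tilde\mu_2$ by $$\tilde\mu_1+\tilde\mu_2=m_r(\dot{\tilde v}_r+ge_3-k_{v_r}e_{v_r}-k_{x_r}e_{x_r}),$$ $$\tilde\mu_2-\tilde\mu_1=\tfrac23m_rL_r\big[-\hat q_r\dot{\tilde\omega}_r-(q_r^T\tilde\omega_r)\hat q_r^2\tilde\omega_r+(q_r^T\tilde\omega_r)e_{\omega_r}+k_{\omega_r}\hat q_re_{\omega_r}+k_{q_r}\hat q_re_{q_r}\big],$$ and $\mu_j=(I+\hat q_j^2)\tilde\mu_j$, $\tilde q_j=-\tilde\mu_j/\|\tilde\mu_j\|$. Write $A_r$, $B_r$ for the accelerations $\ddot x_r$, $\ddot q_r$ given, as functions of $(t,x)$, by $$m_r(\ddot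 x_r+ge_3)=\mu_1+\mu_2,\qquad \tfrac23m_rL_r\dot\omega_r=q_r\times(\mu_2-\mu_1),\qquad \ddot q_r=\dot\omega_r\times q_r-\|\omega_r\|^2q_r .$$ Let $\tilde\omega_j=\tilde q_j\times\dot{\tilde q}_j$. Here $\dot{\tilde q}_j$ and $\dot{\tilde\omega}_j$ are the total time derivatives of these functions of $(t,x)$ computed with $\dot x_r=v_r$, $\dot q_r=\omega_r\times q_r$, $\dot q_j=\omega_j\times q_j$ and these accelerations. With $\alpha_j=A_r+(-1)^jL_rB_r+ge_3$ the desired thrust vector is $$U_j=\mu_j+m_Q\big[(q_j^T\alpha_j)q_j+L_c\|\omega_j\|^2q_j\big]-m_Q\hat q_j^2\big[\alpha_j+L_c\hat q_j\dot{\tilde\omega}_j-L_c(q_j^T\tilde\omega_j)\omega_j\big]-m_QL_c\hat q_j[k_{q_j}e_{q_j}+k_{\omega_j}e_{\omega_j}].$$ Let $b^3_j=U_j/\|U_j\|$, and let $R_{j,d}$ be the matrix with the columns $-\frac{(\hat b^3_j)^2b^1_j}{\|(\hat b^3_j)^2b^1_j\|}$, $\frac{\hat b^3_jb^1_j}{\|\hat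 b^3_jb^1_j\|}$, $b^3_j$. The control inputs are $$u_j=(U_j\cdot R_je_3)R_je_3,$$ $$M_j=-\tfrac{k_R}{\epsilon_R^2}e_{R_j}-\tfrac{k_\Omega}{\epsilon_R}e_{\Omega_j}+\Omega_j\times J_Q\Omega_j-J_Q\big(\hat\Omega_jR_j^TR_{j,d}\Omega_{j,d}-R_j^TR_{j,d}\dot\Omega_{j,d}\big),$$ with $\Omega_{j,d}=(R_{j,d}^T\dot R_{j,d})^\vee$, $e_{R_j}=\frac12(R_{j,d}^TR_j-R_j^TR_{j,d})^\vee$, $e_{\Omega_j}=\Omega_j-R_j^TR_{j,d}\Omega_{j,d}$. Here $\dot R_{j,d}$ and $\dot\Omega_{j,d}$ are the total time derivatives along the reduced model. All controls are thus functions of $(t,x)$. They are *defined* at $(t,x)$ if $\tilde\mu_j$, $U_j$ and $b^3_j\times b^1_j$ do not vanish. **Proposition.** Let $x(t)$, $t\ge t_0$, be a trajectory of the reduced model along which $\|\tilde\mu_j\|$, $\|U_j\|$ and $\|b^3_j\times b^1_j\|$ are bounded below by a positive constant. Suppose that it converges exponentially to the desired trajectory, that is, the difference between $x(t)$ and $(\tilde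 x_r,\tilde v_r,\tilde q_r,\tilde\omega_r,\tilde q_j,\tilde\omega_j,R_{j,d},\Omega_{j,d})$, evaluated at $(t,x(t))$, is at most $Ke^{-\gamma(t-t_0)}$ in norm, for some $K$ and some $\gamma>0$. Let $r(\tau)$, $\tau\ge0$, be a trajectory of the boundary layer system $$\frac{dr}{d\tau}=g\big(t_0,x(t_0),r+h(t_0,x(t_0));0\big)$$ that converges exponentially to $0$. Let $\xi(\epsilon)$ (satisfying the constraints on slow states for small $\epsilon>0$) and $\eta(\epsilon)$ be initial values with $$\xi(\epsilon)-x(t_0)=O(\epsilon),\qquad \eta(\epsilon)-h(t_0,x(t_0))-r(0)=O(\epsilon)\qquad(\epsilon\to0^+).$$ Then there is $\epsilon^*>0$ such that for every $0<\epsilon<\epsilon^*$ the elastic singular perturbation problem has a unique solution $x(t,\epsilon),z(t,\epsilon)$ on $[t_0,\infty)$ with $x(t_0,\epsilon)=\xi(\epsilon)$, $z(t_0,\epsilon)=\eta(\epsilon)$ (a solution has $l_j>0$ and stays where the controls are defined), and $$x(t,\epsilon)-x(t)=O(\epsilon),\qquad z(t,\epsilon)-h(t,x(t))-r\big(\tfrac{t-t_0}{\epsilon}\big)=O(\epsilon)$$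 uniformly for $t\in[t_0,\infty)$ and $0<\epsilon<\epsilon^*$. Moreover, for every $t_1>t_0$ there is $0<\epsilon^{**}<\epsilon^*$ such that $z(t,\epsilon)-h(t,x(t))=O(\epsilon)$ uniformly for $t\in(t_1,\infty)$ and $0<\epsilon<\epsilon^{**}$. -/

import Mathlib

open Set Filter Topology Asymptotics
open scoped ContDiff

noncomputable section

namespace RodTransport

/-! ### Vectors and rotations -/

abbrev E3 := EuclideanSpace ℝ (Fin 3)

/-- Linear maps of `ℝ³`; the attitudes `R_j` live here. -/
abbrev L3 := E3 →L[ℝ] E3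

def cross (a b : E3) : E3 :=
  !₂[a 1 * b 2 - a 2 * b 1, a 2 * b 0 - a 0 * b 2, a 0 * b 1 - a 1 * b 0]

infixl:74 " ×ᵥ " => cross

/-- The standard basis of `ℝ³` (numbered `0, 1, 2`). -/
def e (i : Fin 3) : E3 := EuclideanSpace.single i 1

/-- The hat map `ℝ³ → so(3)`. -/
def hat (w : E3) : L3 :=
  Matrix.toEuclideanCLM (n := Fin 3) (𝕜 := ℝ) !![0, -w 2, w 1; w 2, 0, -w 0; -w 1, w 0, 0]

/-- The inverse of the hat map (on skew-symmetric maps). -/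
def vee (A : L3) : E3 := !₂[A (e 1) 2, A (e 2) 0, A (e 0) 1]

/-- The linear map whose matrix has the columns `c₁, c₂, c₃`. -/
def ofColumns (c₁ c₂ c₃ : E3) : L3 :=
  Matrix.toEuclideanCLM (n := Fin 3) (𝕜 := ℝ) !![c₁ 0, c₂ 0, c₃ 0; c₁ 1, c₂ 1, c₃ 1; c₁ 2, c₂ 2, c₃ 2]

def unitVec (v : E3) : E3 := ‖v‖⁻¹ • v

def SO3 : Set L3 := {R | ContinuousLinearMap.adjoint R ∘L R = 1 ∧ R.det = 1}

/-- The sign `(-1)^j` for the quadrotors `j = 1, 2`, which are numbered `0, 1` here. -/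
def sgn (j : Fin 2) : ℝ := if j = 0 then -1 else 1

/-! ### Parameters, reference, states -/

/-- Physical constants and control gains. -/
structure Params where
  mQ : ℝ
  mr : ℝ
  Lr : ℝ
  Lc : ℝ
  grav : ℝ
  /-- inertia tensor of a quadrotor -/
  JQ : Matrix (Fin 3) (Fin 3) ℝ
  /-- the stiffness is `kbar / ε ^ 2` -/
  kbar : ℝ
  /-- the damping is `cbar / ε` -/
  cbar : ℝ
  kx : ℝ
  kv : ℝ
  kq : ℝ
  kw : ℝ
  /-- gains of the two cables -/
  kqc : Fin 2 → ℝ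
  kwc : Fin 2 → ℝ
  kR : ℝ
  kO : ℝ
  /-- the constant by which the attitude gains are scaled -/
  epsA : ℝ
  mQ_pos : 0 < mQ
  mr_pos : 0 < mr
  Lr_pos : 0 < Lr
  Lc_pos : 0 < Lc
  grav_pos : 0 < grav
  JQ_posDef : JQ.PosDef
  kbar_pos : 0 < kbar
  cbar_pos : 0 < cbar
  kx_pos : 0 < kx
  kv_pos : 0 < kv
  kq_pos : 0 < kq
  kw_pos : 0 < kw
  kqc_pos : ∀ j, 0 < kqc j
  kwc_pos : ∀ j, 0 < kwc j
  kR_pos : 0 < kR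
  kO_pos : 0 < kO
  epsA_pos : 0 < epsA

/-- Desired position and attitude of the rod, and desired first body axes of the quadrotors. -/
structure Reference where
  xd : ℝ → E3
  qd : ℝ → E3
  b1 : Fin 2 → ℝ → E3

namespace Reference

/-- Desired angular velocity of the rod: `q̃' = ω̃ × q̃`, `ω̃ ⬝ q̃ = 0`. -/
def wd (ref : Reference) (t : ℝ) : E3 := ref.qd t ×ᵥ deriv ref.qd t

/-- Smooth, on the unit sphere where required, with bounded derivatives on `[t₀, ∞)`. -/
structure Admissible (ref : Reference) (t₀ : ℝ) : Prop where
  smooth_xd : ContDiff ℝ ∞ ref.xd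
  smooth_qd : ContDiff ℝ ∞ ref.qd
  smooth_b1 : ∀ j, ContDiff ℝ ∞ (ref.b1 j)
  norm_qd : ∀ t, ‖ref.qd t‖ = 1
  norm_b1 : ∀ j t, ‖ref.b1 j t‖ = 1
  bdd_xd : ∀ n : ℕ, 1 ≤ n → ∃ C, ∀ t, t₀ ≤ t → ‖iteratedDeriv n ref.xd t‖ ≤ C
  bdd_qd : ∀ n : ℕ, 1 ≤ n → ∃ C, ∀ t, t₀ ≤ t → ‖iteratedDeriv n ref.qd t‖ ≤ C
  bdd_b1 : ∀ j, ∀ n : ℕ, 1 ≤ n → ∃ C, ∀ t, t₀ ≤ t → ‖iteratedDeriv n (ref.b1 j) t‖ ≤ C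

end Reference

/-- `(x_r, v_r, q_r, ω_r)`. -/
abbrev Rod := E3 × E3 × E3 × E3

abbrev Rod.x (s : Rod) : E3 := s.1
abbrev Rod.v (s : Rod) : E3 := s.2.1
abbrev Rod.q (s : Rod) : E3 := s.2.2.1
abbrev Rod.w (s : Rod) : E3 := s.2.2.2

/-- Rod, cable directions `q_j`. -/
abbrev Conf := Rod × (Fin 2 → E3)

/-- Rod, cable directions `q_j`, angular velocities `ω_j` of the cables. -/
abbrev Mech := Conf × (Fin 2 → E3)

abbrev Mech.rod (s : Mech) : Rod := s.1.1
abbrev Mech.qc (s : Mech) : Fin 2 → E3 := s.1.2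
abbrev Mech.wc (s : Mech) : Fin 2 → E3 := s.2

/-- The slow state: `Mech`, the attitudes `R_j`, and the body angular velocities `Ω_j`. -/
abbrev Slow := (Mech × (Fin 2 → L3)) × (Fin 2 → E3)

abbrev Slow.mech (x : Slow) : Mech := x.1.1
abbrev Slow.att (x : Slow) : Fin 2 → L3 := x.1.2
abbrev Slow.om (x : Slow) : Fin 2 → E3 := x.2

/-- The fast state `(y_j, z_j)`: the cable lengths are `L_c + ε² y_j`, their rates `ε z_j`. -/
abbrev Fast := Fin 2 → ℝ × ℝ

/-- The constraints `q ∈ S²`, `ω ⬝ q = 0`, `R_j ∈ SO(3)`. -/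
def Slow.OnManifold (x : Slow) : Prop :=
  ‖x.mech.rod.q‖ = 1 ∧ inner ℝ x.mech.rod.w x.mech.rod.q = 0 ∧
    ∀ j, ‖x.mech.qc j‖ = 1 ∧ inner ℝ (x.mech.wc j) (x.mech.qc j) = 0 ∧ x.att j ∈ SO3

/-! ### The mechanics for given thrust vectors `u`

With the tensions `T_j = k (l_j - L_c) + c l_j' = kbar y_j + cbar z_j`, the controlled
Euler-Lagrange equations solved for the accelerations. -/

/-- `v_r'`, from `m_r (v_r' + g e₃) = - ∑ T_j q_j`. -/
def rodAcc (P : Params) (T : Fin 2 → ℝ) (s : Mech) : E3 :=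
  -(P.mr⁻¹ • ∑ i, T i • s.qc i) - P.grav • e 2

/-- `ω_r'`, from `(2/3) m_r L_r ω_r' = q_r × (T₁ q₁ - T₂ q₂)`. -/
def rodAngAcc (P : Params) (T : Fin 2 → ℝ) (s : Mech) : E3 :=
  -((2 / 3 * P.mr * P.Lr)⁻¹ • (s.rod.q ×ᵥ ∑ i, (sgn i * T i) • s.qc i))

/-- `q''` of a unit vector with `q' = ω × q`, `ω ⬝ q = 0`, `ω' = α`. -/
def dirAcc (q w α : E3) : E3 := α ×ᵥ q - ‖w‖ ^ 2 • q

/-- `v_r' + (-1)^j L_r q_r'' + g e₃`. -/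
def endAcc (P : Params) (T : Fin 2 → ℝ) (s : Mech) (j : Fin 2) : E3 :=
  rodAcc P T s + (sgn j * P.Lr) • dirAcc s.rod.q s.rod.w (rodAngAcc P T s) + P.grav • e 2

def tension (P : Params) (w : Fast) (j : Fin 2) : ℝ := P.kbar * (w j).1 + P.cbar * (w j).2

def cableLength (P : Params) (ε : ℝ) (w : Fast) (j : Fin 2) : ℝ := P.Lc + ε ^ 2 * (w j).1

/-- `ω_j'`, from the part orthogonal to `q_j` of the equation of quadrotor `j`:
`l_j ω_j' + 2 l_j' ω_j = q_j × (v_r' + (-1)^j L_r q_r'' + g e₃ - u_j / m_Q)`. -/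
def cableAngAcc (P : Params) (u : Fin 2 → E3) (ε : ℝ) (s : Mech) (w : Fast) (j : Fin 2) : E3 :=
  (cableLength P ε w j)⁻¹ •
    (s.qc j ×ᵥ (endAcc P (tension P w) s j - P.mQ⁻¹ • u j) - (2 * (ε * (w j).2)) • s.wc j)

/-- The time derivative of the rod and the cables. -/
def mechField (P : Params) (u : Fin 2 → E3) (ε : ℝ) (s : Mech) (w : Fast) : Mech :=
  (((s.rod.v, rodAcc P (tension P w) s, s.rod.w ×ᵥ s.rod.q, rodAngAcc P (tension P w) s),
      fun j => s.wc j ×ᵥ s.qc j),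
    fun j => cableAngAcc P u ε s w j)

/-- `ε` times the time derivative of `(y_j, z_j)`, from `ε y_j' = z_j` and the part along `q_j`
of the equation of quadrotor `j`. -/
def fastMech (P : Params) (u : Fin 2 → E3) (ε : ℝ) (s : Mech) (w : Fast) : Fast := fun j =>
  ((w j).2,
    cableLength P ε w j * ‖s.wc j‖ ^ 2
      + inner ℝ (s.qc j) (endAcc P (tension P w) s j - P.mQ⁻¹ • u j)
      - P.mQ⁻¹ * tension P w j)

/-- The matrix of the linear system for the tensions at `ε = 0`, `z_j = 0`. -/
def tensionMatrix (P : Params) (s : Mech) : Matrix (Fin 2) (Fin 2) ℝ := Matrix.of fun j i =>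
  (if j = i then P.mQ⁻¹ else 0) + P.mr⁻¹ * inner ℝ (s.qc j) (s.qc i)
    + (2 / 3 * P.mr)⁻¹ * (sgn j * sgn i) *
      inner ℝ (s.rod.q ×ᵥ s.qc j) (s.rod.q ×ᵥ s.qc i)

/-- The tensions of inelastic cables. -/
def inelasticTension (P : Params) (u : Fin 2 → E3) (s : Mech) : Fin 2 → ℝ :=
  (tensionMatrix P s)⁻¹.mulVec fun j =>
    P.Lc * ‖s.wc j‖ ^ 2 + inner ℝ (s.qc j) (endAcc P 0 s j - P.mQ⁻¹ • u j)

/-- The root of the fast equations at `ε = 0`. -/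
def rootMech (P : Params) (u : Fin 2 → E3) (s : Mech) : Fast := fun j =>
  (P.kbar⁻¹ * inelasticTension P u s j, 0)

/-! Consistency of these formulas with the equations of motion. -/

theorem inner_e3 (a b : E3) : inner ℝ a b = a 0 * b 0 + a 1 * b 1 + a 2 * b 2 := by
  simp [PiLp.inner_apply, Fin.sum_univ_three]; ring

theorem normsq_e3 (a : E3) : ‖a‖ ^ 2 = a 0 ^ 2 + a 1 ^ 2 + a 2 ^ 2 := by
  rw [EuclideanSpace.norm_sq_eq]; simp [Fin.sum_univ_three]

theorem ext3 {a b : E3} (h0 : a 0 = b 0) (h1 : a 1 = b 1) (h2 : a 2 = b 2) : a = b := by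
  ext i; fin_cases i <;> assumption

@[simp] theorem cross0 (a b : E3) : (a ×ᵥ b) 0 = a 1 * b 2 - a 2 * b 1 := rfl
@[simp] theorem cross1 (a b : E3) : (a ×ᵥ b) 1 = a 2 * b 0 - a 0 * b 2 := rfl
@[simp] theorem cross2 (a b : E3) : (a ×ᵥ b) 2 = a 0 * b 1 - a 1 * b 0 := rfl

/-- The acceleration `ζ_j''` of `ζ_j = l_j q_j`, where `l_j' = ε z_j`. -/
def zdd (P : Params) (u : Fin 2 → E3) (ε : ℝ) (s : Mech) (w : Fast) (j : Fin 2) : E3 :=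
  (fastMech P u ε s w j).2 • s.qc j + (2 * (ε * (w j).2)) • (s.wc j ×ᵥ s.qc j)
   + cableLength P ε w j • dirAcc (s.qc j) (s.wc j) (cableAngAcc P u ε s w j)

/-- The equations of quadrotor `j`, along and orthogonal to the cable, hold for `mechField` and
`fastMech`. -/
theorem zdd_eq (P : Params) (u : Fin 2 → E3) (ε : ℝ) (s : Mech) (w : Fast) (j : Fin 2)
   (hl : 0 < cableLength P ε w j) (hq : ‖s.qc j‖ = 1) :
   zdd P u ε s w j = endAcc P (tension P w) s j - P.mQ⁻¹ • u j
      - (P.mQ⁻¹ * tension P w j) • s.qc j := by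
  have h1 := normsq_e3 (s.qc j)
  rw [hq] at h1
  have hl' := hl.ne'
  simp only [zdd, fastMech, cableAngAcc, dirAcc]
  generalize endAcc P (tension P w) s j - P.mQ⁻¹ • u j = b
  generalize hll : cableLength P ε w j = l at *
  generalize s.qc j = q at *
  generalize s.wc j = om at *
  have e1 : ∀ v : E3, ((l⁻¹ • v) ×ᵥ q) = l⁻¹ • (v ×ᵥ q) := by
    intro v; apply ext3 <;> simp <;> ring
  rw [e1, smul_sub, smul_smul, mul_inv_cancel₀ hl', one_smul]
  apply ext3 <;> simp [inner_e3]
  · linear_combination (-b 0) * h1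
  · linear_combination (-b 1) * h1
  · linear_combination (-b 2) * h1

/-- The equation of the rod's position in terms of `ζ_j''`. -/
theorem balance_x (P : Params) (u : Fin 2 → E3) (ε : ℝ) (s : Mech) (w : Fast)
    (hl : ∀ j, 0 < cableLength P ε w j) (hq : ∀ j, ‖s.qc j‖ = 1) :
  (2 * P.mQ + P.mr) • (rodAcc P (tension P w) s + P.grav • e 2) = u 0 + u 1
    + P.mQ • (zdd P u ε s w 0 + zdd P u ε s w 1) := by
  have := P.mr_pos.ne'
  have := P.mQ_pos.ne'
  rw [zdd_eq _ _ _ _ _ _ (hl 0) (hq 0), zdd_eq _ _ _ _ _ _ (hl 1) (hq 1)]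
  simp only [endAcc, rodAcc, sgn, Fin.sum_univ_two]
  apply ext3 <;> simp <;> field_simp <;> ring

theorem rodAngAcc_eq (P : Params) (s : Mech) (T : Fin 2 → ℝ) : (2 / 3 * P.mr * P.Lr) • rodAngAcc P T s
    = s.rod.q ×ᵥ (T 0 • s.qc 0 - T 1 • s.qc 1) := by
  have := P.mr_pos.ne'
  have := P.Lr_pos.ne'
  simp only [rodAngAcc, sgn, Fin.sum_univ_two]
  apply ext3 <;> simp <;> field_simp <;> ring

/-- The equation of the rod's attitude in terms of `ζ_j''`. -/
theorem balance_q (P : Params) (u : Fin 2 → E3) (ε : ℝ) (s : Mech) (w : Fast)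
    (hl : ∀ j, 0 < cableLength P ε w j) (hq : ∀ j, ‖s.qc j‖ = 1)
   (hr : ‖s.rod.q‖ = 1) :
  ((2 * P.mQ + 2 / 3 * P.mr) * P.Lr) • rodAngAcc P (tension P w) s = s.rod.q ×ᵥ (u 1 - u 0
    + P.mQ • (zdd P u ε s w 1 - zdd P u ε s w 0)) := by
  have hm := P.mr_pos.ne'
  have hQ := P.mQ_pos.ne'
  rw [zdd_eq _ _ _ _ _ _ (hl 0) (hq 0), zdd_eq _ _ _ _ _ _ (hl 1) (hq 1)]
  have h1 := normsq_e3 s.rod.q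
  rw [hr] at h1
  have h2 := rodAngAcc_eq P s (tension P w)
  have h3 : inner ℝ (s.rod.q) (rodAngAcc P (tension P w) s) = 0 := by
    simp only [rodAngAcc, inner_e3]; simp; ring
  simp only [endAcc, dirAcc, sgn]
  simp only [inner_e3] at h3
  generalize rodAngAcc P (tension P w) s = al at *
  generalize s.rod.q = q at *
  have h20 := congrArg (fun v : E3 => v 0) h2
  have h21 := congrArg (fun v : E3 => v 1) h2
  have h22 := congrArg (fun v : E3 => v 2) h2
  simp at h20 h21 h22
  apply ext3 <;> simp <;> field_simp
  · linear_combination 3 * h20 + 6 * P.mQ * P.Lr * q 0 * h3 + 6 * P.mQ * P.Lr * al 0 * h1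
  · linear_combination 3 * h21 + 6 * P.mQ * P.Lr * q 1 * h3 + 6 * P.mQ * P.Lr * al 1 * h1
  · linear_combination 3 * h22 + 6 * P.mQ * P.Lr * q 2 * h3 + 6 * P.mQ * P.Lr * al 2 * h1

theorem residual_eq (P : Params) (s : Mech) (T : Fin 2 → ℝ) (j : Fin 2) (b : E3) :
   inner ℝ (s.qc j) (endAcc P T s j - b) - P.mQ⁻¹ * T j
    = inner ℝ (s.qc j) (endAcc P 0 s j - b) - (tensionMatrix P s).mulVec T j := by
  have hm := P.mr_pos.ne'
  have hL := P.Lr_pos.ne'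
  simp only [tensionMatrix, Matrix.mulVec, dotProduct, Matrix.of_apply, Fin.sum_univ_two, endAcc, dirAcc, rodAcc, rodAngAcc]
  generalize s.rod.q = q at *
  fin_cases j <;> simp [inner_e3, normsq_e3 (s.qc _), normsq_e3 (_ ×ᵥ _), sgn] <;> field_simp <;> ring

theorem tensionMatrix_posDef (P : Params) (s : Mech) : (tensionMatrix P s).PosDef := by
  have hm := P.mr_pos
  have hQ := P.mQ_pos
  refine Matrix.PosDef.of_dotProduct_mulVec_pos ?_ ?_
  · ext i j
    simp only [tensionMatrix, Matrix.conjTranspose_apply, Matrix.of_apply, star_trivial, real_inner_comm, eq_comm]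
    rw [real_inner_comm, mul_comm (sgn i)]
  · intro v hv
    have : star v ⬝ᵥ (tensionMatrix P s).mulVec v = P.mQ⁻¹ * (v 0 ^2 + v 1 ^2) + P.mr⁻¹ * ‖v 0 • s.qc 0 + v 1 • s.qc 1‖^2
      + (2/3 * P.mr)⁻¹ * ‖v 1 • (s.rod.q ×ᵥ s.qc 1) - v 0 • (s.rod.q ×ᵥ s.qc 0)‖^2 := by
      simp only [tensionMatrix, Matrix.mulVec, dotProduct, Matrix.of_apply, Fin.sum_univ_two, inner_e3, normsq_e3]
      simp [sgn]
      ring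
    rw [this]
    have h2 : 0 < v 0 ^ 2 + v 1 ^ 2 := by
      by_contra hc
      apply hv
      ext i
      fin_cases i <;> simp <;> nlinarith [sq_nonneg (v 0), sq_nonneg (v 1)]
    positivity

/-- At `ε = 0` the fast equations have exactly one root. -/
theorem fastMech_eq_zero_iff (P : Params) (u : Fin 2 → E3) (s : Mech) (w : Fast) :
    fastMech P u 0 s w = 0 ↔ w = rootMech P u s := by
  have hk := P.kbar_pos.ne'
  have hdet : IsUnit (tensionMatrix P s).det := (tensionMatrix_posDef P s).det_pos.ne'.isUnit
  have key : ∀ j, (fastMech P u 0 s w j).2 =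
     (P.Lc * ‖s.wc j‖ ^ 2 + inner ℝ (s.qc j) (endAcc P 0 s j - P.mQ⁻¹ • u j)) - (tensionMatrix P s).mulVec (tension P w) j := by
    intro j
    simp only [fastMech, cableLength]
    rw [add_sub_assoc, residual_eq P s]; ring
  constructor
  · intro H
    have h2 : ∀ j, (w j).2 = 0 := fun j => congrArg (fun z : Fast => (z j).1) H
    have h3 : (tensionMatrix P s).mulVec (tension P w) = fun j => P.Lc * ‖s.wc j‖ ^ 2 + inner ℝ (s.qc j) (endAcc P 0 s j - P.mQ⁻¹ • u j) := by
      ext j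
      have := key j
      rw [H] at this
      simp at this
      simp
      linarith
    have h4 : inelasticTension P u s = tension P w := by
      rw [inelasticTension, ← h3, Matrix.mulVec_mulVec, Matrix.nonsing_inv_mul _ hdet, Matrix.one_mulVec]
    ext j
    · simp [rootMech, h4, tension, h2]; field_simp
    · simp [rootMech, h2]
  · rintro rfl
    have h5 : tension P (rootMech P u s) = inelasticTension P u s := by
      ext j; simp [tension, rootMech]; field_simp
    ext j
    · simp [fastMech, rootMech]
    · rw [key j, h5, inelasticTension, Matrix.mulVec_mulVec, Matrix.mul_nonsing_inv _ hdet, Matrix.one_mulVec]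
      simp

/-! ### The thrust control designed for thrusts in any direction -/

/-- `e_q = q̃ × q` -/
def errQ (qd q : E3) : E3 := qd ×ᵥ q

/-- `e_ω = ω + q̂² ω̃` -/
def errW (wd q w : E3) : E3 := w + q ×ᵥ (q ×ᵥ wd)

def muSum (P : Params) (ref : Reference) (t : ℝ) (s : Rod) : E3 :=
  P.mr • (deriv (deriv ref.xd) t + P.grav • e 2
    - P.kv • (s.v - deriv ref.xd t) - P.kx • (s.x - ref.xd t))

def muDiff (P : Params) (ref : Reference) (t : ℝ) (s : Rod) : E3 :=
  (2 / 3 * P.mr * P.Lr) •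
    (-(s.q ×ᵥ deriv ref.wd t)
      - inner ℝ s.q (ref.wd t) • (s.q ×ᵥ (s.q ×ᵥ ref.wd t))
      + inner ℝ s.q (ref.wd t) • errW (ref.wd t) s.q s.w
      + P.kw • (s.q ×ᵥ errW (ref.wd t) s.q s.w)
      + P.kq • (s.q ×ᵥ errQ (ref.qd t) s.q))

/-- `μ̃_j`, from `μ̃₁ + μ̃₂ = muSum` and `μ̃₂ - μ̃₁ = muDiff`. -/
def muDes (P : Params) (ref : Reference) (j : Fin 2) (t : ℝ) (s : Rod) : E3 :=
  (1 / 2 : ℝ) • (muSum P ref t s + sgn j • muDiff P ref t s)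

/-- `μ_j = (I + q̂_j²) μ̃_j` -/
def mu (P : Params) (ref : Reference) (j : Fin 2) (t : ℝ) (c : Conf) : E3 :=
  muDes P ref j t c.1 + c.2 j ×ᵥ (c.2 j ×ᵥ muDes P ref j t c.1)

/-- `v_r'` of the controlled reduced model: `m_r (v_r' + g e₃) = μ₁ + μ₂`. -/
def nomAcc (P : Params) (ref : Reference) (t : ℝ) (c : Conf) : E3 :=
  P.mr⁻¹ • (mu P ref 0 t c + mu P ref 1 t c) - P.grav • e 2

/-- `ω_r'` of the controlled reduced model: `(2/3) m_r L_r ω_r' = q_r × (μ₂ - μ₁)`. -/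
def nomAngAcc (P : Params) (ref : Reference) (t : ℝ) (c : Conf) : E3 :=
  (2 / 3 * P.mr * P.Lr)⁻¹ • (c.1.q ×ᵥ (mu P ref 1 t c - mu P ref 0 t c))

def nomRodField (P : Params) (ref : Reference) (t : ℝ) (c : Conf) : Rod :=
  (c.1.v, nomAcc P ref t c, c.1.w ×ᵥ c.1.q, nomAngAcc P ref t c)

/-- The desired direction `q̃_j = - μ̃_j / ‖μ̃_j‖` of cable `j`. -/
def qDes (P : Params) (ref : Reference) (j : Fin 2) (p : ℝ × Rod) : E3 :=
  -unitVec (muDes P ref j p.1 p.2)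

/-- `ω̃_j = q̃_j × q̃_j'`, where `q̃_j'` is the total time derivative in the controlled reduced
model. -/
def wDes (P : Params) (ref : Reference) (j : Fin 2) (p : ℝ × Conf) : E3 :=
  qDes P ref j (p.1, p.2.1) ×ᵥ
    fderiv ℝ (qDes P ref j) (p.1, p.2.1) (1, nomRodField P ref p.1 p.2)

/-- `ω̃_j'`, the total time derivative in the controlled reduced model. -/
def wDesDot (P : Params) (ref : Reference) (j : Fin 2) (t : ℝ) (s : Mech) : E3 :=
  fderiv ℝ (wDes P ref j) (t, s.1)
    (1, (nomRodField P ref t s.1, fun i => s.wc i ×ᵥ s.qc i))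

/-- `x_r'' + (-1)^j L_r q_r''` in the controlled reduced model. -/
def nomEndAcc (P : Params) (ref : Reference) (j : Fin 2) (t : ℝ) (s : Mech) : E3 :=
  nomAcc P ref t s.1 + (sgn j * P.Lr) • dirAcc s.rod.q s.rod.w (nomAngAcc P ref t s.1)

/-- The component of the control along `q_j`. -/
def uPar (P : Params) (ref : Reference) (j : Fin 2) (t : ℝ) (s : Mech) : E3 :=
  mu P ref j t s.1 + P.mQ •
    (inner ℝ (s.qc j) (nomEndAcc P ref j t s + P.grav • e 2) • s.qc j
      + (P.Lc * ‖s.wc j‖ ^ 2) • s.qc j)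

/-- The component of the control orthogonal to `q_j`. -/
def uPerp (P : Params) (ref : Reference) (j : Fin 2) (t : ℝ) (s : Mech) : E3 :=
  -(P.mQ • (s.qc j ×ᵥ (s.qc j ×ᵥ
      (nomEndAcc P ref j t s + P.grav • e 2
        + P.Lc • (s.qc j ×ᵥ wDesDot P ref j t s)
        - (P.Lc * inner ℝ (s.qc j) (wDes P ref j (t, s.1))) • s.wc j))))
  - (P.mQ * P.Lc) • (s.qc j ×ᵥ
      (P.kqc j • errQ (qDes P ref j (t, s.rod)) (s.qc j)
        + P.kwc j • errW (wDes P ref j (t, s.1)) (s.qc j) (s.wc j)))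

/-- The desired thrust vector of quadrotor `j`. -/
def uDes (P : Params) (ref : Reference) (j : Fin 2) (t : ℝ) (s : Mech) : E3 :=
  uPar P ref j t s + uPerp P ref j t s

/-! ### The control inputs: thrusts along the third body axes, and moments -/

/-- `u_j = f_j R_j e₃` with `f_j = uDes ⬝ R_j e₃`. -/
def thrust (P : Params) (ref : Reference) (t : ℝ) (s : Mech) (R : Fin 2 → L3) (j : Fin 2) : E3 :=
  inner ℝ (uDes P ref j t s) (R j (e 2)) • R j (e 2)

/-- Desired third body axis. -/
def b3Des (P : Params) (ref : Reference) (j : Fin 2) (t : ℝ) (s : Mech) : E3 :=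
  unitVec (uDes P ref j t s)

/-- Desired attitude. -/
def RDes (P : Params) (ref : Reference) (j : Fin 2) (p : ℝ × Mech) : L3 :=
  ofColumns
    (-unitVec (b3Des P ref j p.1 p.2 ×ᵥ (b3Des P ref j p.1 p.2 ×ᵥ ref.b1 j p.1)))
    (unitVec (b3Des P ref j p.1 p.2 ×ᵥ ref.b1 j p.1))
    (b3Des P ref j p.1 p.2)

/-- The rod and cable part of the reduced model. -/
def redMechField (P : Params) (ref : Reference) (t : ℝ) (s : Mech) (R : Fin 2 → L3) : Mech :=
  mechField P (thrust P ref t s R) 0 s (rootMech P (thrust P ref t s R) s)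

/-- `Ω_{j,d} = (R_{j,d}ᵀ R_{j,d}')^∨`, with the total time derivative in the reduced model. -/
def OmDes (P : Params) (ref : Reference) (j : Fin 2) (p : ℝ × Mech × (Fin 2 → L3)) : E3 :=
  vee (ContinuousLinearMap.adjoint (RDes P ref j (p.1, p.2.1)) ∘L
    fderiv ℝ (RDes P ref j) (p.1, p.2.1) (1, redMechField P ref p.1 p.2.1 p.2.2))

/-- `Ω_{j,d}'`, the total time derivative in the reduced model. -/
def OmDesDot (P : Params) (ref : Reference) (j : Fin 2) (t : ℝ) (x : Slow) : E3 :=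
  fderiv ℝ (OmDes P ref j) (t, x.1)
    (1, (redMechField P ref t x.mech x.att, fun i => x.att i ∘L hat (x.om i)))

/-- `R_jᵀ R_{j,d}` -/
def relAtt (P : Params) (ref : Reference) (j : Fin 2) (t : ℝ) (x : Slow) : L3 :=
  ContinuousLinearMap.adjoint (x.att j) ∘L RDes P ref j (t, x.mech)

def errR (P : Params) (ref : Reference) (j : Fin 2) (t : ℝ) (x : Slow) : E3 :=
  (1 / 2 : ℝ) •
    vee (ContinuousLinearMap.adjoint (relAtt P ref j t x) - relAtt P ref j t x)

def errOm (P : Params) (ref : Reference) (j : Fin 2) (t : ℝ) (x : Slow) : E3 :=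
  x.om j - relAtt P ref j t x (OmDes P ref j (t, x.1))

def J (P : Params) : L3 := Matrix.toEuclideanCLM (n := Fin 3) (𝕜 := ℝ) P.JQ

def Jinv (P : Params) : L3 := Matrix.toEuclideanCLM (n := Fin 3) (𝕜 := ℝ) P.JQ⁻¹

/-- The moment `M_j`. -/
def moment (P : Params) (ref : Reference) (j : Fin 2) (t : ℝ) (x : Slow) : E3 :=
  -((P.kR / P.epsA ^ 2) • errR P ref j t x) - (P.kO / P.epsA) • errOm P ref j t x
    + x.om j ×ᵥ J P (x.om j)
    - J P (x.om j ×ᵥ relAtt P ref j t x (OmDes P ref j (t, x.1))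
        - relAtt P ref j t x (OmDesDot P ref j t x))

/-! ### The singular perturbation problem -/

/-- The right-hand side of `x' = f(t, x, z; ε)`. -/
def f (P : Params) (ref : Reference) (t : ℝ) (x : Slow) (z : Fast) (ε : ℝ) : Slow :=
  ((mechField P (thrust P ref t x.mech x.att) ε x.mech z,
      fun j => x.att j ∘L hat (x.om j)),
    fun j => Jinv P (J P (x.om j) ×ᵥ x.om j + moment P ref j t x))

/-- The right-hand side of `ε z' = g(t, x, z; ε)`. -/
def g (P : Params) (ref : Reference) (t : ℝ) (x : Slow) (z : Fast) (ε : ℝ) : Fast :=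
  fastMech P (thrust P ref t x.mech x.att) ε x.mech z

/-- The root `z = h(t, x)` of `g(t, x, z; 0) = 0`. -/
def h (P : Params) (ref : Reference) (t : ℝ) (x : Slow) : Fast :=
  rootMech P (thrust P ref t x.mech x.att) x.mech

/-- At `(t, x)` the desired cable directions and the desired attitudes are well defined, with
margin at least `c`. -/
def MarginAtLeast (P : Params) (ref : Reference) (c t : ℝ) (x : Slow) : Prop :=
  ∀ j, c ≤ ‖muDes P ref j t x.mech.rod‖ ∧ c ≤ ‖uDes P ref j t x.mech‖ ∧
    c ≤ ‖b3Des P ref j t x.mech ×ᵥ ref.b1 j t‖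

/-- The desired value of the state; the desired values of the cable and attitude variables
depend on the current state. -/
def desired (P : Params) (ref : Reference) (t : ℝ) (x : Slow) : Slow :=
  (((((ref.xd t, deriv ref.xd t, ref.qd t, ref.wd t), fun j => qDes P ref j (t, x.mech.rod)),
      fun j => wDes P ref j (t, x.mech.1)),
    fun j => RDes P ref j (t, x.mech)), fun j => OmDes P ref j (t, x.1))

/-- `x` is a trajectory on `[t₀, ∞)` of the reduced model `x' = f(t, x, h(t, x); 0)`, along which
the controls are defined with a uniform margin. -/
structure IsReducedTrajectory (P : Params) (ref : Reference) (t₀ : ℝ) (x : ℝ → Slow) : Prop where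
  onManifold : ∀ t, t₀ ≤ t → (x t).OnManifold
  margin : ∃ c, 0 < c ∧ ∀ t, t₀ ≤ t → MarginAtLeast P ref c t (x t)
  ode : ∀ t, t₀ ≤ t →
    HasDerivWithinAt x (f P ref t (x t) (h P ref t (x t)) 0) (Ici t₀) t

def ConvergesExponentially (P : Params) (ref : Reference) (t₀ : ℝ) (x : ℝ → Slow) : Prop :=
  ∃ K γ : ℝ, 0 < γ ∧ ∀ t, t₀ ≤ t →
    ‖x t - desired P ref t (x t)‖ ≤ K * Real.exp (-γ * (t - t₀))

/-- `r` is a trajectory on `[0, ∞)` of the boundary layer system with the parameters `(t₀, x₀)`. -/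
def IsBoundaryLayerTrajectory (P : Params) (ref : Reference) (t₀ : ℝ) (x₀ : Slow)
    (r : ℝ → Fast) : Prop :=
  ∀ τ, 0 ≤ τ → HasDerivWithinAt r (g P ref t₀ x₀ (r τ + h P ref t₀ x₀) 0) (Ici 0) τ

/-- `(x, z)` solves the singular perturbation problem with parameter `ε` on `[t₀, ∞)`, with
initial value `(ξ, η)`. -/
structure IsElasticSolution (P : Params) (ref : Reference) (t₀ ε : ℝ) (ξ : Slow) (η : Fast)
    (x : ℝ → Slow) (z : ℝ → Fast) : Prop where
  init_x : x t₀ = ξ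
  init_z : z t₀ = η
  onManifold : ∀ t, t₀ ≤ t → (x t).OnManifold
  length_pos : ∀ t, t₀ ≤ t → ∀ j, 0 < cableLength P ε (z t) j
  margin : ∀ t, t₀ ≤ t → ∃ c, 0 < c ∧ MarginAtLeast P ref c t (x t)
  ode_x : ∀ t, t₀ ≤ t → HasDerivWithinAt x (f P ref t (x t) (z t) ε) (Ici t₀) t
  ode_z : ∀ t, t₀ ≤ t → HasDerivWithinAt z (ε⁻¹ • g P ref t (x t) (z t) ε) (Ici t₀) t

end RodTransport

end

noncomputable section
namespace RodTransport

/-! ### Functions with uniformly bounded derivatives -/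

section BddSmooth

variable {E F G H : Type*} [NormedAddCommGroup E] [NormedSpace ℝ E] [NormedAddCommGroup F]
  [NormedSpace ℝ F] [NormedAddCommGroup G] [NormedSpace ℝ G] [NormedAddCommGroup H]
  [NormedSpace ℝ H]

/-- `φ` is smooth at the points of `S`, with bounded derivatives of all orders `≥ 1`. -/
structure BddDerivOn (φ : E → F) (S : Set E) : Prop where
  smooth : ∀ p ∈ S, ContDiffAt ℝ ∞ φ p
  bdd : ∀ n : ℕ, 1 ≤ n → ∃ C, ∀ p ∈ S, ‖iteratedFDeriv ℝ n φ p‖ ≤ C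

/-- `φ` is smooth at the points of `S`, and bounded with all its derivatives. -/
structure BddSmoothOn (φ : E → F) (S : Set E) : Prop extends BddDerivOn φ S where
  bdd_val : ∃ C, ∀ p ∈ S, ‖φ p‖ ≤ C

theorem iteratedFDeriv_sub_const_of_pos {φ : E → F} {p : E} (c : F) {n i : ℕ} (hi : 1 ≤ i)
    (hin : i ≤ n) (hφ : ContDiffAt ℝ n φ p) :
    iteratedFDeriv ℝ i (fun y => φ y - c) p = iteratedFDeriv ℝ i φ p := by
  have := iteratedFDeriv_sub_apply (𝕜 := ℝ) (i := i) (f := φ) (g := fun _ => c) (x := p)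
    (hφ.of_le (by exact_mod_cast hin)) contDiffAt_const
  rw [iteratedFDeriv_const_of_ne (by omega)] at this
  simpa [Pi.sub_def] using this

theorem norm_iteratedFDeriv_comp_le_at {g : F → G} {f : E → F} {x : E} {n : ℕ} (hn : 1 ≤ n)
    (hg : ContDiffAt ℝ n g (f x)) (hf : ContDiffAt ℝ n f x) {C D : ℝ} (hC0 : 0 ≤ C)
    (hC : ∀ i, 1 ≤ i → i ≤ n → ‖iteratedFDeriv ℝ i g (f x)‖ ≤ C)
    (hD : ∀ i, 1 ≤ i → i ≤ n → ‖iteratedFDeriv ℝ i f x‖ ≤ D ^ i) :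
    ‖iteratedFDeriv ℝ n (fun y => g (f y)) x‖ ≤ n.factorial * C * D ^ n := by
  obtain ⟨V, hVsub, hVo, hV⟩ := eventually_nhds_iff.1 (hg.eventually (by simp))
  obtain ⟨U, hUsub, hUo, hU⟩ := eventually_nhds_iff.1
    ((hf.eventually (by simp)).and (hf.continuousAt (hVo.mem_nhds hV)))
  have h1 : ContDiffOn ℝ n (fun y => g y - g (f x)) V := fun y hy =>
    ((hVsub y hy).sub contDiffAt_const).contDiffWithinAt
  have h2 : ContDiffOn ℝ n f U := fun y hy => (hUsub y hy).1.contDiffWithinAt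
  have key := norm_iteratedFDerivWithin_comp_le (n := n) (x := x) h1 h2 le_rfl hVo.uniqueDiffOn
    hUo.uniqueDiffOn (fun y hy => (hUsub y hy).2) hU (C := C) (D := D) (fun i hi => by
      rw [iteratedFDerivWithin_of_isOpen i hVo hV]
      rcases Nat.eq_zero_or_pos i with rfl | h0
      · simpa using hC0
      · rw [iteratedFDeriv_sub_const_of_pos _ h0 hi hg]
        exact hC i h0 hi)
    (fun i h0 hi => by
      rw [iteratedFDerivWithin_of_isOpen i hUo hU]
      exact hD i h0 hi)
  rw [iteratedFDerivWithin_of_isOpen n hUo hU] at key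
  have h3 : ((fun y => g y - g (f x)) ∘ f) = fun y => g (f y) - g (f x) := rfl
  rw [h3, iteratedFDeriv_sub_const_of_pos (φ := fun y => g (f y)) _ hn le_rfl (hg.comp x hf)] at key
  exact key

theorem exists_uniform_bound {P : ℕ → ℝ → Prop} (hP : ∀ i, ∃ C, P i C)
    (hmono : ∀ i C C', C ≤ C' → P i C → P i C') (n : ℕ) : ∃ C, 1 ≤ C ∧ ∀ i ≤ n, P i C := by
  induction n with
  | zero =>
    obtain ⟨C, hC⟩ := hP 0
    exact ⟨max C 1, le_max_right _ _, fun i hi => by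
      obtain rfl : i = 0 := by omega
      exact hmono _ _ _ (le_max_left _ _) hC⟩
  | succ n ih =>
    obtain ⟨C, h1, hC⟩ := ih
    obtain ⟨C', hC'⟩ := hP (n + 1)
    refine ⟨max C C', h1.trans (le_max_left _ _), fun i hi => ?_⟩
    rcases Nat.lt_or_ge i (n + 1) with h | h
    · exact hmono _ _ _ (le_max_left _ _) (hC i (by omega))
    · obtain rfl : i = n + 1 := by omega
      exact hmono _ _ _ (le_max_right _ _) hC'

theorem BddDerivOn.exists_bound {φ : E → F} {S : Set E} (h : BddDerivOn φ S) (n : ℕ) :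
    ∃ C, 1 ≤ C ∧ ∀ i, 1 ≤ i → i ≤ n → ∀ p ∈ S, ‖iteratedFDeriv ℝ i φ p‖ ≤ C := by
  obtain ⟨C, h1, hC⟩ := exists_uniform_bound
    (P := fun i C => 1 ≤ i → ∀ p ∈ S, ‖iteratedFDeriv ℝ i φ p‖ ≤ C) (fun i => by
      rcases Nat.eq_zero_or_pos i with rfl | h0
      · exact ⟨0, fun h => by omega⟩
      · obtain ⟨C, hC⟩ := h.bdd i h0
        exact ⟨C, fun _ => hC⟩)
    (fun i C C' hle hP h0 p hp => (hP h0 p hp).trans hle) n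
  exact ⟨C, h1, fun i h0 hi => hC i hi h0⟩

theorem BddDerivOn.comp {ψ : F → G} {φ : E → F} {S : Set E} {S' : Set F}
    (hψ : BddDerivOn ψ S') (hφ : BddDerivOn φ S) (hm : MapsTo φ S S') :
    BddDerivOn (fun p => ψ (φ p)) S := by
  refine ⟨fun p hp => (hψ.smooth _ (hm hp)).comp p (hφ.smooth p hp), fun n hn => ?_⟩
  obtain ⟨C, hC1, hC⟩ := hψ.exists_bound n
  obtain ⟨D, hD1, hD⟩ := hφ.exists_bound n
  refine ⟨n.factorial * C * D ^ n, fun p hp => ?_⟩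
  refine norm_iteratedFDeriv_comp_le_at hn ((hψ.smooth _ (hm hp)).of_le (by exact_mod_cast le_top))
    ((hφ.smooth p hp).of_le (by exact_mod_cast le_top)) (by linarith)
    (fun i h0 hi => hC i h0 hi _ (hm hp)) (fun i h0 hi => ?_)
  refine (hD i h0 hi p hp).trans ?_
  calc D = D ^ 1 := (pow_one D).symm
    _ ≤ D ^ i := pow_le_pow_right₀ hD1 h0

theorem BddSmoothOn.comp {ψ : F → G} {φ : E → F} {S : Set E} {S' : Set F}
    (hψ : BddSmoothOn ψ S') (hφ : BddDerivOn φ S) (hm : MapsTo φ S S') :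
    BddSmoothOn (fun p => ψ (φ p)) S :=
  ⟨hψ.toBddDerivOn.comp hφ hm, by
    obtain ⟨C, hC⟩ := hψ.bdd_val
    exact ⟨C, fun p hp => hC _ (hm hp)⟩⟩

theorem BddDerivOn.mono {φ : E → F} {S S' : Set E} (h : BddDerivOn φ S) (hs : S' ⊆ S) :
    BddDerivOn φ S' :=
  ⟨fun p hp => h.smooth p (hs hp), fun n hn => by
    obtain ⟨C, hC⟩ := h.bdd n hn
    exact ⟨C, fun p hp => hC p (hs hp)⟩⟩

theorem BddSmoothOn.mono {φ : E → F} {S S' : Set E} (h : BddSmoothOn φ S) (hs : S' ⊆ S) :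
    BddSmoothOn φ S' :=
  ⟨h.toBddDerivOn.mono hs, by
    obtain ⟨C, hC⟩ := h.bdd_val
    exact ⟨C, fun p hp => hC p (hs hp)⟩⟩

theorem BddSmoothOn.bdd_all {φ : E → F} {S : Set E} (h : BddSmoothOn φ S) (n : ℕ) :
    ∃ C, ∀ p ∈ S, ‖iteratedFDeriv ℝ n φ p‖ ≤ C := by
  rcases Nat.eq_zero_or_pos n with rfl | h0
  · simpa using h.bdd_val
  · exact h.bdd n h0

theorem BddSmoothOn.of_bdd_all {φ : E → F} {S : Set E} (h1 : ∀ p ∈ S, ContDiffAt ℝ ∞ φ p)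
    (h2 : ∀ n : ℕ, ∃ C, ∀ p ∈ S, ‖iteratedFDeriv ℝ n φ p‖ ≤ C) : BddSmoothOn φ S :=
  ⟨⟨h1, fun n _ => h2 n⟩, by simpa using h2 0⟩

theorem BddDerivOn.fderiv {φ : E → F} {S : Set E} (h : BddDerivOn φ S) :
    BddSmoothOn (fun p => fderiv ℝ φ p) S :=
  .of_bdd_all (fun p hp => (h.smooth p hp).fderiv_right (by simp)) fun n => by
    obtain ⟨C, hC⟩ := h.bdd (n + 1) (by omega)
    exact ⟨C, fun p hp => by
      have := hC p hp
      rwa [← norm_iteratedFDeriv_fderiv] at this⟩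

theorem bddSmoothOn_const (c : F) (S : Set E) : BddSmoothOn (fun _ : E => c) S :=
  ⟨⟨fun _ _ => contDiffAt_const, fun n hn => ⟨0, fun p _ => by
    rw [iteratedFDeriv_const_of_ne (by omega)]; simp⟩⟩, ⟨‖c‖, fun _ _ => le_rfl⟩⟩

theorem bddDerivOn_clm (A : E →L[ℝ] F) (S : Set E) : BddDerivOn (fun p => A p) S :=
  ⟨fun _ _ => A.contDiff.contDiffAt, fun n hn => by
    obtain ⟨m, rfl⟩ : ∃ m, n = m + 1 := ⟨n - 1, by omega⟩
    obtain ⟨C, hC⟩ := (bddSmoothOn_const A S).bdd_all m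
    refine ⟨C, fun p hp => ?_⟩
    rw [← norm_iteratedFDeriv_fderiv]
    have : (_root_.fderiv ℝ fun p => A p) = fun _ => A := funext fun p => A.fderiv
    rw [this]
    exact hC p hp⟩

theorem BddDerivOn.prodMk {φ : E → F} {ψ : E → G} {S : Set E} (hφ : BddDerivOn φ S)
    (hψ : BddDerivOn ψ S) : BddDerivOn (fun p => (φ p, ψ p)) S :=
  ⟨fun p hp => (hφ.smooth p hp).prodMk (hψ.smooth p hp), fun n hn => by
    obtain ⟨C, hC⟩ := hφ.bdd n hn
    obtain ⟨D, hD⟩ := hψ.bdd n hn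
    refine ⟨max C D, fun p hp => ?_⟩
    rw [iteratedFDeriv_prodMk (n := ∞) (hφ.smooth p hp) (hψ.smooth p hp)
      (by exact_mod_cast le_top), ContinuousMultilinearMap.opNorm_prod]
    exact max_le_max (hC p hp) (hD p hp)⟩

theorem BddSmoothOn.prodMk {φ : E → F} {ψ : E → G} {S : Set E} (hφ : BddSmoothOn φ S)
    (hψ : BddSmoothOn ψ S) : BddSmoothOn (fun p => (φ p, ψ p)) S :=
  ⟨hφ.toBddDerivOn.prodMk hψ.toBddDerivOn, by
    obtain ⟨C, hC⟩ := hφ.bdd_val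
    obtain ⟨D, hD⟩ := hψ.bdd_val
    exact ⟨max C D, fun p hp => max_le_max (hC p hp) (hD p hp)⟩⟩

theorem bddSmoothOn_of_isCompact {ψ : F → G} {K : Set F} (hK : IsCompact K)
    (h : ∀ p ∈ K, ContDiffAt ℝ ∞ ψ p) : BddSmoothOn ψ K :=
  .of_bdd_all h fun n => hK.exists_bound_of_continuousOn fun p hp =>
    ((h p hp).continuousAt_iteratedFDeriv (by exact_mod_cast le_top)).continuousWithinAt

theorem BddSmoothOn.comp_contDiff [FiniteDimensional ℝ F] {ψ : F → G} {φ : E → F} {S : Set E}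
    (hφ : BddSmoothOn φ S) (hψ : ContDiff ℝ ∞ ψ) : BddSmoothOn (fun p => ψ (φ p)) S := by
  have := FiniteDimensional.proper_real F
  obtain ⟨C, hC⟩ := hφ.bdd_val
  exact (bddSmoothOn_of_isCompact (isCompact_closedBall (0 : F) C)
    fun p _ => hψ.contDiffAt).comp hφ.toBddDerivOn fun p hp => by simpa using hC p hp

theorem BddSmoothOn.comp_contDiffAt [FiniteDimensional ℝ F] {ψ : F → G} {φ : E → F} {S : Set E}
    (hφ : BddSmoothOn φ S) {K : Set F} (hK : IsClosed K) (hψ : ∀ p ∈ K, ContDiffAt ℝ ∞ ψ p)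
    (hm : MapsTo φ S K) : BddSmoothOn (fun p => ψ (φ p)) S := by
  have := FiniteDimensional.proper_real F
  obtain ⟨C, hC⟩ := hφ.bdd_val
  exact (bddSmoothOn_of_isCompact ((isCompact_closedBall (0 : F) C).inter_right hK)
    fun p hp => hψ p hp.2).comp hφ.toBddDerivOn fun p hp => ⟨by simpa using hC p hp, hm hp⟩

theorem BddDerivOn.clm_comp {φ : E → F} {S : Set E} (A : F →L[ℝ] G) (hφ : BddDerivOn φ S) :
    BddDerivOn (fun p => A (φ p)) S :=
  (bddDerivOn_clm A univ).comp hφ (mapsTo_univ _ _)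

theorem BddSmoothOn.clm_comp {φ : E → F} {S : Set E} (A : F →L[ℝ] G) (hφ : BddSmoothOn φ S) :
    BddSmoothOn (fun p => A (φ p)) S :=
  ⟨hφ.toBddDerivOn.clm_comp A, by
    obtain ⟨C, hC⟩ := hφ.bdd_val
    exact ⟨‖A‖ * C, fun p hp => (A.le_opNorm _).trans
      (mul_le_mul_of_nonneg_left (hC p hp) (norm_nonneg _))⟩⟩

theorem BddDerivOn.sub {φ ψ : E → F} {S : Set E} (hφ : BddDerivOn φ S) (hψ : BddDerivOn ψ S) :
    BddDerivOn (fun p => φ p - ψ p) S :=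
  (hφ.prodMk hψ).clm_comp (ContinuousLinearMap.fst ℝ F F - ContinuousLinearMap.snd ℝ F F)

theorem BddSmoothOn.add {φ ψ : E → F} {S : Set E} (hφ : BddSmoothOn φ S)
    (hψ : BddSmoothOn ψ S) : BddSmoothOn (fun p => φ p + ψ p) S :=
  (hφ.prodMk hψ).clm_comp (ContinuousLinearMap.fst ℝ F F + ContinuousLinearMap.snd ℝ F F)

theorem BddSmoothOn.sub {φ ψ : E → F} {S : Set E} (hφ : BddSmoothOn φ S)
    (hψ : BddSmoothOn ψ S) : BddSmoothOn (fun p => φ p - ψ p) S :=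
  (hφ.prodMk hψ).clm_comp (ContinuousLinearMap.fst ℝ F F - ContinuousLinearMap.snd ℝ F F)

theorem BddSmoothOn.neg {φ : E → F} {S : Set E} (hφ : BddSmoothOn φ S) :
    BddSmoothOn (fun p => -φ p) S :=
  hφ.clm_comp (-ContinuousLinearMap.id ℝ F)

theorem BddSmoothOn.const_smul {φ : E → F} {S : Set E} (c : ℝ) (hφ : BddSmoothOn φ S) :
    BddSmoothOn (fun p => c • φ p) S :=
  hφ.clm_comp (c • ContinuousLinearMap.id ℝ F)

theorem BddSmoothOn.const_mul {φ : E → ℝ} {S : Set E} (c : ℝ) (hφ : BddSmoothOn φ S) :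
    BddSmoothOn (fun p => c * φ p) S :=
  hφ.const_smul c

theorem BddSmoothOn.bilin [FiniteDimensional ℝ F] [FiniteDimensional ℝ G] {φ : E → F} {ψ : E → G}
    {S : Set E} {B : F × G → H} (hB : IsBoundedBilinearMap ℝ B) (hφ : BddSmoothOn φ S)
    (hψ : BddSmoothOn ψ S) : BddSmoothOn (fun p => B (φ p, ψ p)) S :=
  (hφ.prodMk hψ).comp_contDiff hB.contDiff

theorem BddSmoothOn.smul [FiniteDimensional ℝ F] {s : E → ℝ} {φ : E → F} {S : Set E}
    (hs : BddSmoothOn s S) (hφ : BddSmoothOn φ S) : BddSmoothOn (fun p => s p • φ p) S :=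
  hs.bilin isBoundedBilinearMap_smul hφ

theorem BddSmoothOn.mul {s φ : E → ℝ} {S : Set E}
    (hs : BddSmoothOn s S) (hφ : BddSmoothOn φ S) : BddSmoothOn (fun p => s p * φ p) S :=
  hs.smul hφ

theorem BddSmoothOn.clm_apply [FiniteDimensional ℝ F] [FiniteDimensional ℝ G]
    {A : E → F →L[ℝ] G} {φ : E → F} {S : Set E} (hA : BddSmoothOn A S) (hφ : BddSmoothOn φ S) :
    BddSmoothOn (fun p => A p (φ p)) S :=
  hA.bilin isBoundedBilinearMap_apply hφ

theorem BddSmoothOn.fst {φ : E → F × G} {S : Set E} (h : BddSmoothOn φ S) :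
    BddSmoothOn (fun p => (φ p).1) S := h.clm_comp (ContinuousLinearMap.fst ℝ F G)

theorem BddSmoothOn.snd {φ : E → F × G} {S : Set E} (h : BddSmoothOn φ S) :
    BddSmoothOn (fun p => (φ p).2) S := h.clm_comp (ContinuousLinearMap.snd ℝ F G)

theorem BddSmoothOn.apply {ι : Type*} [Fintype ι] {φ : E → ι → F} {S : Set E}
    (h : BddSmoothOn φ S) (i : ι) :
    BddSmoothOn (fun p => φ p i) S :=
  h.clm_comp (ContinuousLinearMap.proj (R := ℝ) (φ := fun _ : ι => F) i)

theorem bddSmoothOn_pi2 {φ : E → Fin 2 → F} {S : Set E}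
    (h : ∀ i, BddSmoothOn (fun p => φ p i) S) : BddSmoothOn φ S := by
  have := ((h 0).clm_comp (ContinuousLinearMap.single ℝ (fun _ : Fin 2 => F) 0)).add
    ((h 1).clm_comp (ContinuousLinearMap.single ℝ (fun _ : Fin 2 => F) 1))
  convert this using 2 with p
  ext i
  fin_cases i <;> simp

theorem BddSmoothOn.inv {s : E → ℝ} {S : Set E} (h : BddSmoothOn s S) {c : ℝ} (hc : 0 < c)
    (hs : ∀ p ∈ S, c ≤ s p) : BddSmoothOn (fun p => (s p)⁻¹) S :=
  h.comp_contDiffAt (K := Ici c) isClosed_Ici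
    (fun _ hp => contDiffAt_inv ℝ (hc.trans_le hp).ne') hs

theorem contDiffAt_unitVec {v : E3} (hv : v ≠ 0) : ContDiffAt ℝ ∞ unitVec v :=
  ((contDiffAt_norm ℝ hv).inv (norm_ne_zero_iff.2 hv)).smul contDiffAt_id

theorem BddSmoothOn.unitVec {φ : E → E3} {S : Set E} (h : BddSmoothOn φ S) {c : ℝ} (hc : 0 < c)
    (hs : ∀ p ∈ S, c ≤ ‖φ p‖) : BddSmoothOn (fun p => unitVec (φ p)) S :=
  h.comp_contDiffAt (K := {v | c ≤ ‖v‖}) (isClosed_le continuous_const continuous_norm)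
    (fun _ hv => contDiffAt_unitVec (norm_pos_iff.1 (hc.trans_le hv))) hs

theorem BddSmoothOn.inner {φ ψ : E → E3} {S : Set E} (hφ : BddSmoothOn φ S)
    (hψ : BddSmoothOn ψ S) : BddSmoothOn (fun p => inner ℝ (φ p) (ψ p)) S :=
  (hφ.prodMk hψ).comp_contDiff contDiff_inner

/-! ### Tubes -/

/-- The tube of radius `ρ` around the curve `c`, for times `≥ t₀`. -/
def tube (t₀ : ℝ) (c : ℝ → E) (ρ : ℝ) : Set (ℝ × E) := {p | t₀ ≤ p.1 ∧ ‖p.2 - c p.1‖ ≤ ρ}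

theorem tube_mono {t₀ : ℝ} {c : ℝ → E} {ρ ρ' : ℝ} (h : ρ ≤ ρ') : tube t₀ c ρ ⊆ tube t₀ c ρ' :=
  fun _ hp => ⟨hp.1, hp.2.trans h⟩

theorem center_mem_tube {t₀ : ℝ} {c : ℝ → E} {ρ : ℝ} (hρ : 0 ≤ ρ) {t : ℝ} (ht : t₀ ≤ t) :
    (t, c t) ∈ tube t₀ c ρ := ⟨ht, by simpa using hρ⟩

theorem BddDerivOn.exists_lipschitz {φ : E → F} {S : Set E} (h : BddDerivOn φ S) :
    ∃ L, 0 ≤ L ∧ ∀ p q, segment ℝ p q ⊆ S → ‖φ p - φ q‖ ≤ L * ‖p - q‖ := by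
  obtain ⟨C, hC⟩ := h.fderiv.bdd_val
  refine ⟨max C 0, le_max_right _ _, fun p q hpq => ?_⟩
  exact (convex_segment p q).norm_image_sub_le_of_norm_fderiv_le (𝕜 := ℝ)
    (fun x hx => (h.smooth x (hpq hx)).differentiableAt (by simp))
    (fun x hx => (hC x (hpq hx)).trans (le_max_left _ _)) (right_mem_segment _ _ _)
    (left_mem_segment _ _ _)

theorem segment_subset_tube {t₀ : ℝ} {c : ℝ → E} {ρ t : ℝ} {x y : E} (hx : (t, x) ∈ tube t₀ c ρ)
    (hy : (t, y) ∈ tube t₀ c ρ) : segment ℝ (t, x) (t, y) ⊆ tube t₀ c ρ := by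
  rintro ⟨s, z⟩ ⟨a, b, ha, hb, hab, h⟩
  simp only [Prod.smul_mk, Prod.mk_add_mk, Prod.mk.injEq, smul_eq_mul] at h
  obtain ⟨h1, rfl⟩ := h
  have hs : s = t := by rw [← h1, ← add_mul, hab, one_mul]
  subst hs
  refine ⟨hx.1, ?_⟩
  have := (convex_closedBall (c s) ρ) (mem_closedBall_iff_norm.2 hx.2)
    (mem_closedBall_iff_norm.2 hy.2) ha hb hab
  exact mem_closedBall_iff_norm.1 this

theorem BddDerivOn.exists_lipschitz_tube {φ : ℝ × E → F} {t₀ : ℝ} {c : ℝ → E} {ρ : ℝ}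
    (h : BddDerivOn φ (tube t₀ c ρ)) :
    ∃ L, 0 ≤ L ∧ ∀ t x y, (t, x) ∈ tube t₀ c ρ → (t, y) ∈ tube t₀ c ρ →
      ‖φ (t, x) - φ (t, y)‖ ≤ L * ‖x - y‖ := by
  obtain ⟨L, hL, h1⟩ := h.exists_lipschitz
  refine ⟨L, hL, fun t x y hx hy => (h1 _ _ (segment_subset_tube hx hy)).trans (le_of_eq ?_)⟩
  rw [Prod.mk_sub_mk, sub_self, Prod.norm_mk, norm_zero, max_eq_right (norm_nonneg _)]

/-- `φ` is bounded with all derivatives on all sufficiently thin tubes. -/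
def TubeSmooth (t₀ : ℝ) (c : ℝ → E) (φ : ℝ × E → F) : Prop :=
  ∀ᶠ ρ in 𝓝[>] (0 : ℝ), BddSmoothOn φ (tube t₀ c ρ)

theorem tubeSmooth_of {t₀ : ℝ} {c : ℝ → E} {φ : ℝ × E → F} {ρ : ℝ} (hρ : 0 < ρ)
    (h : BddSmoothOn φ (tube t₀ c ρ)) : TubeSmooth t₀ c φ := by
  filter_upwards [Ioc_mem_nhdsGT hρ] with r hr
  exact h.mono (tube_mono hr.2)

theorem TubeSmooth.lower_bound {t₀ : ℝ} {c : ℝ → E} {φ : ℝ × E → F} (h : TubeSmooth t₀ c φ)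
    {m : ℝ} (hm : 0 < m) (hc : ∀ t, t₀ ≤ t → m ≤ ‖φ (t, c t)‖) :
    ∀ᶠ ρ in 𝓝[>] (0 : ℝ), ∀ p ∈ tube t₀ c ρ, m / 2 ≤ ‖φ p‖ := by
  obtain ⟨ρ, hρs, hρ⟩ := (h.and self_mem_nhdsWithin).exists
  obtain ⟨L, hL, h1⟩ := hρs.toBddDerivOn.exists_lipschitz_tube
  have hρ' : 0 < ρ := hρ
  have h2 : 0 < min ρ (m / (2 * (L + 1))) := lt_min hρ' (by positivity)
  filter_upwards [Ioc_mem_nhdsGT h2] with r hr p hp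
  have h3 := h1 p.1 p.2 (c p.1) (tube_mono (hr.2.trans (min_le_left _ _)) hp)
    (center_mem_tube hρ'.le hp.1)
  have h4 : L * ‖p.2 - c p.1‖ ≤ m / 2 := by
    have : ‖p.2 - c p.1‖ ≤ m / (2 * (L + 1)) := hp.2.trans (hr.2.trans (min_le_right _ _))
    calc L * ‖p.2 - c p.1‖ ≤ (L + 1) * (m / (2 * (L + 1))) := by gcongr; linarith
      _ = m / 2 := by field_simp
  have h5 := hc p.1 hp.1
  have h6 := norm_sub_norm_le (φ (p.1, c p.1)) (φ p)
  rw [norm_sub_rev] at h6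
  have h7 : ‖φ p - φ (p.1, c p.1)‖ ≤ m / 2 := h3.trans h4
  linarith

theorem TubeSmooth.pull {t₀ : ℝ} {c : ℝ → E} {φ : ℝ × F → G} (A : E →L[ℝ] F)
    (hA : ∀ v, ‖A v‖ ≤ ‖v‖)
    (h : TubeSmooth t₀ (fun t => A (c t)) φ) : TubeSmooth t₀ c (fun p => φ (p.1, A p.2)) := by
  filter_upwards [h] with ρ hρ
  refine hρ.comp (φ := fun p : ℝ × E => (p.1, A p.2))
    ((bddDerivOn_clm (ContinuousLinearMap.fst ℝ ℝ E) _).prodMk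
      (bddDerivOn_clm (A ∘L ContinuousLinearMap.snd ℝ ℝ E) _)) fun p hp => ⟨hp.1, ?_⟩
  simp only [← map_sub]
  exact (hA _).trans hp.2

theorem tubeSmooth_clm {t₀ : ℝ} {c : ℝ → E} (A : E →L[ℝ] F) {C : ℝ}
    (h : ∀ t, t₀ ≤ t → ‖A (c t)‖ ≤ C) : TubeSmooth t₀ c (fun p => A p.2) := by
  refine tubeSmooth_of one_pos ⟨bddDerivOn_clm (A ∘L ContinuousLinearMap.snd ℝ ℝ E) _,
    ⟨C + ‖A‖, fun p hp => ?_⟩⟩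
  have h1 : A p.2 = A (c p.1) + A (p.2 - c p.1) := by rw [← map_add]; congr 1; abel
  rw [h1]
  refine (norm_add_le _ _).trans (add_le_add (h _ hp.1) ((A.le_opNorm _).trans ?_))
  calc ‖A‖ * ‖p.2 - c p.1‖ ≤ ‖A‖ * 1 := mul_le_mul_of_nonneg_left hp.2 (norm_nonneg _)
    _ = ‖A‖ := mul_one _

theorem tubeSmooth_time {t₀ : ℝ} {c : ℝ → E} {φ : ℝ → F} (h : BddSmoothOn φ (Ici t₀)) :
    TubeSmooth t₀ c (fun p => φ p.1) :=
  tubeSmooth_of one_pos (h.comp (bddDerivOn_clm (ContinuousLinearMap.fst ℝ ℝ E) _)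
    fun _ hp => hp.1)

theorem BddSmoothOn.deriv {φ : ℝ → F} {S : Set ℝ} (h : BddDerivOn φ S) :
    BddSmoothOn (fun t => deriv φ t) S := by
  have := h.fderiv.clm_comp (ContinuousLinearMap.apply ℝ F (1 : ℝ))
  simpa using this

end BddSmooth

end RodTransport
end

noncomputable section
namespace RodTransport

/-! ### The linear maps of the model as continuous (bi)linear maps -/

def crossL : E3 →L[ℝ] E3 →L[ℝ] E3 :=
  LinearMap.toContinuousLinearMap
    ((LinearMap.toContinuousLinearMap : (E3 →ₗ[ℝ] E3) ≃ₗ[ℝ] (E3 →L[ℝ] E3)).toLinearMap ∘ₗ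
      LinearMap.mk₂ ℝ cross
        (by intros; apply ext3 <;> simp <;> ring) (by intros; apply ext3 <;> simp <;> ring)
        (by intros; apply ext3 <;> simp <;> ring) (by intros; apply ext3 <;> simp <;> ring))
@[simp] theorem crossL_apply (a b : E3) : crossL a b = a ×ᵥ b := rfl

theorem cross_add (a b c : E3) : a ×ᵥ (b + c) = a ×ᵥ b + a ×ᵥ c := (crossL a).map_add b c
theorem cross_sub (a b c : E3) : a ×ᵥ (b - c) = a ×ᵥ b - a ×ᵥ c := (crossL a).map_sub b c
theorem cross_smul (r : ℝ) (a b : E3) : a ×ᵥ (r • b) = r • (a ×ᵥ b) := (crossL a).map_smul r b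
theorem cross_neg (a b : E3) : a ×ᵥ (-b) = -(a ×ᵥ b) := (crossL a).map_neg b
theorem add_cross (a b c : E3) : (a + b) ×ᵥ c = a ×ᵥ c + b ×ᵥ c := by
  simp only [← crossL_apply, map_add, add_apply]
theorem sub_cross (a b c : E3) : (a - b) ×ᵥ c = a ×ᵥ c - b ×ᵥ c := by
  simp only [← crossL_apply, map_sub, sub_apply]
theorem smul_cross (r : ℝ) (a b : E3) : (r • a) ×ᵥ b = r • (a ×ᵥ b) := by
  simp only [← crossL_apply, map_smul, smul_apply]
theorem neg_cross (a b : E3) : (-a) ×ᵥ b = -(a ×ᵥ b) := by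
  simp only [← crossL_apply, map_neg, neg_apply]
@[simp] theorem cross_self (a : E3) : a ×ᵥ a = 0 := by
  apply ext3 <;> simp <;> ring

theorem isBoundedBilinearMap_cross :
    IsBoundedBilinearMap ℝ (fun p : E3 × E3 => p.1 ×ᵥ p.2) :=
  crossL.isBoundedBilinearMap

theorem hat_apply (w v : E3) : hat w v = w ×ᵥ v := by
  apply ext3 <;>
    simp [hat, Matrix.ofLp_toEuclideanCLM, Matrix.mulVec, dotProduct,
      Fin.sum_univ_three] <;> ring

theorem hat_eq (w : E3) : hat w = crossL w := by
  ext1 v; exact hat_apply w v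

theorem ofColumns_apply (a b c v : E3) : ofColumns a b c v = v 0 • a + v 1 • b + v 2 • c := by
  apply ext3 <;>
    simp [ofColumns, Matrix.ofLp_toEuclideanCLM, Matrix.mulVec, dotProduct,
      Fin.sum_univ_three] <;> ring

theorem ext_e {A B : L3} (h : ∀ i, A (e i) = B (e i)) : A = B := by
  have h1 : ∀ v : E3, v = v 0 • e 0 + v 1 • e 1 + v 2 • e 2 := by
    intro v; apply ext3 <;> simp [e]
  ext1 v
  rw [h1 v]
  simp only [map_add, map_smul, h]

def ofColumnsL : (E3 × E3 × E3) →L[ℝ] L3 :=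
  LinearMap.toContinuousLinearMap
    { toFun := fun p => ofColumns p.1 p.2.1 p.2.2
      map_add' := fun p q => by
        ext1 v
        simp only [ofColumns_apply, add_apply]
        apply ext3 <;> simp <;> ring
      map_smul' := fun r p => by
        ext1 v
        simp only [ofColumns_apply, smul_apply]
        apply ext3 <;> simp <;> ring }

def veeL : L3 →L[ℝ] E3 :=
  LinearMap.toContinuousLinearMap
    { toFun := vee
      map_add' := fun p q => by apply ext3 <;> simp [vee]
      map_smul' := fun r p => by apply ext3 <;> simp [vee] }

def adjL : L3 →L[ℝ] L3 :=
  LinearMap.toContinuousLinearMap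
    { toFun := fun A => ContinuousLinearMap.adjoint A
      map_add' := fun p q => map_add _ p q
      map_smul' := fun r p => by simp }

theorem adjL_apply (A : L3) : adjL A = ContinuousLinearMap.adjoint A := rfl
theorem veeL_apply (A : L3) : veeL A = vee A := rfl

section

variable {E : Type*} [NormedAddCommGroup E] [NormedSpace ℝ E] {S : Set E}

theorem BddSmoothOn.cross {φ ψ : E → E3} (hφ : BddSmoothOn φ S) (hψ : BddSmoothOn ψ S) :
    BddSmoothOn (fun p => φ p ×ᵥ ψ p) S := hφ.bilin isBoundedBilinearMap_cross hψ

theorem BddSmoothOn.clm_mul {A B : E → L3} (hA : BddSmoothOn A S) (hB : BddSmoothOn B S) :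
    BddSmoothOn (fun p => A p ∘L B p) S := hA.bilin isBoundedBilinearMap_comp hB

theorem BddSmoothOn.adjoint {A : E → L3} (hA : BddSmoothOn A S) :
    BddSmoothOn (fun p => ContinuousLinearMap.adjoint (A p)) S := hA.clm_comp adjL

theorem BddSmoothOn.vee {A : E → L3} (hA : BddSmoothOn A S) :
    BddSmoothOn (fun p => vee (A p)) S := hA.clm_comp veeL

theorem BddSmoothOn.hat {w : E → E3} (hw : BddSmoothOn w S) :
    BddSmoothOn (fun p => hat (w p)) S := by
  simp only [hat_eq]
  exact hw.clm_comp crossL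

theorem BddSmoothOn.ofColumns {a b c : E → E3} (ha : BddSmoothOn a S) (hb : BddSmoothOn b S)
    (hc : BddSmoothOn c S) : BddSmoothOn (fun p => ofColumns (a p) (b p) (c p)) S :=
  (ha.prodMk (hb.prodMk hc)).clm_comp ofColumnsL

theorem BddSmoothOn.normSq {w : E → E3} (hw : BddSmoothOn w S) :
    BddSmoothOn (fun p => ‖w p‖ ^ 2) S := hw.comp_contDiff (contDiff_norm_sq ℝ)

/-! ### Smoothness of the mechanics -/

/-- The velocities and directions of a family of states of the rod and the cables are bounded
with all derivatives. -/
structure MechSmooth (s : E → Mech) (S : Set E) : Prop where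
  v : BddSmoothOn (fun p => (s p).rod.v) S
  q : BddSmoothOn (fun p => (s p).rod.q) S
  w : BddSmoothOn (fun p => (s p).rod.w) S
  qc : ∀ j, BddSmoothOn (fun p => (s p).qc j) S
  wc : ∀ j, BddSmoothOn (fun p => (s p).wc j) S

variable {s : E → Mech} {T : E → Fin 2 → ℝ} {u : E → Fin 2 → E3}

theorem MechSmooth.rodAcc (P : Params) (hs : MechSmooth s S)
    (hT : ∀ j, BddSmoothOn (fun p => T p j) S) :
    BddSmoothOn (fun p => rodAcc P (T p) (s p)) S := by
  simp only [RodTransport.rodAcc, Fin.sum_univ_two]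
  exact ((((hT 0).smul (hs.qc 0)).add ((hT 1).smul (hs.qc 1))).const_smul _).neg.sub
    (bddSmoothOn_const _ _)

theorem MechSmooth.rodAngAcc (P : Params) (hs : MechSmooth s S)
    (hT : ∀ j, BddSmoothOn (fun p => T p j) S) :
    BddSmoothOn (fun p => rodAngAcc P (T p) (s p)) S := by
  simp only [RodTransport.rodAngAcc, Fin.sum_univ_two]
  exact ((hs.q.cross ((((hT 0).const_mul _).smul (hs.qc 0)).add
    (((hT 1).const_mul _).smul (hs.qc 1)))).const_smul _).neg

theorem BddSmoothOn.dirAcc {q w α : E → E3} (hq : BddSmoothOn q S) (hw : BddSmoothOn w S)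
    (hα : BddSmoothOn α S) : BddSmoothOn (fun p => dirAcc (q p) (w p) (α p)) S :=
  (hα.cross hq).sub (hw.normSq.smul hq)

theorem MechSmooth.endAcc (P : Params) (hs : MechSmooth s S)
    (hT : ∀ j, BddSmoothOn (fun p => T p j) S) (j : Fin 2) :
    BddSmoothOn (fun p => endAcc P (T p) (s p) j) S :=
  ((hs.rodAcc P hT).add ((hs.q.dirAcc hs.w (hs.rodAngAcc P hT)).const_smul _)).add
    (bddSmoothOn_const _ _)

theorem det_tensionMatrix_ge (P : Params) (s : Mech) :
    P.mQ⁻¹ ^ 2 ≤ (tensionMatrix P s).det := by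
  have hm := P.mr_pos
  have hQ := P.mQ_pos
  have key : ∀ a b c d x y z : ℝ, 0 < a → 0 ≤ x → 0 ≤ z → (y ^ 2 ≤ x * z) →
      a ^ 2 ≤ (a + x) * (a + z) - y * y := by
    intro a b c d x y z ha hx hz hxy
    nlinarith [mul_nonneg ha.le hx, mul_nonneg ha.le hz]
  rw [Matrix.det_fin_two]
  have h := key P.mQ⁻¹ 0 0 0
    (P.mr⁻¹ * ‖s.qc 0‖ ^ 2 + (2 / 3 * P.mr)⁻¹ * ‖s.rod.q ×ᵥ s.qc 0‖ ^ 2)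
    (P.mr⁻¹ * inner ℝ (s.qc 0) (s.qc 1)
      - (2 / 3 * P.mr)⁻¹ * inner ℝ (s.rod.q ×ᵥ s.qc 0) (s.rod.q ×ᵥ s.qc 1))
    (P.mr⁻¹ * ‖s.qc 1‖ ^ 2 + (2 / 3 * P.mr)⁻¹ * ‖s.rod.q ×ᵥ s.qc 1‖ ^ 2)
    (by positivity) (by positivity) (by positivity) (by
      have h1 := abs_le.1 (abs_real_inner_le_norm (s.qc 0) (s.qc 1))
      have h2 := abs_le.1 (abs_real_inner_le_norm (s.rod.q ×ᵥ s.qc 0) (s.rod.q ×ᵥ s.qc 1))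
      set i1 := inner ℝ (s.qc 0) (s.qc 1)
      set i2 := inner ℝ (s.rod.q ×ᵥ s.qc 0) (s.rod.q ×ᵥ s.qc 1)
      generalize ‖s.qc 0‖ = a at *
      generalize ‖s.qc 1‖ = b at *
      generalize ‖s.rod.q ×ᵥ s.qc 0‖ = c at *
      generalize ‖s.rod.q ×ᵥ s.qc 1‖ = d at *
      have hA : 0 < P.mr⁻¹ := by positivity
      have hB : 0 < (2 / 3 * P.mr)⁻¹ := by positivity
      generalize P.mr⁻¹ = A at *
      generalize (2 / 3 * P.mr)⁻¹ = B at *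
      have h3 : |A * i1 - B * i2| ≤ A * (a * b) + B * (c * d) := by
        rw [abs_le]; constructor <;> nlinarith
      calc (A * i1 - B * i2) ^ 2 ≤ (A * (a * b) + B * (c * d)) ^ 2 := by
            rw [← sq_abs]; exact pow_le_pow_left₀ (abs_nonneg _) h3 2
        _ ≤ (A * a ^ 2 + B * c ^ 2) * (A * b ^ 2 + B * d ^ 2) := by
            nlinarith [mul_nonneg (mul_nonneg hA.le hB.le) (sq_nonneg (a * d - b * c))])
  refine h.trans (le_of_eq ?_)
  simp [tensionMatrix, sgn,
    real_inner_comm (s.qc 0) (s.qc 1), real_inner_comm (s.rod.q ×ᵥ s.qc 0) (s.rod.q ×ᵥ s.qc 1)]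
  ring

theorem MechSmooth.tensionMatrix (P : Params) (hs : MechSmooth s S) (i j : Fin 2) :
    BddSmoothOn (fun p => tensionMatrix P (s p) i j) S := by
  simp only [RodTransport.tensionMatrix, Matrix.of_apply]
  exact ((bddSmoothOn_const _ _).add (((hs.qc i).inner (hs.qc j)).const_mul _)).add
    (((hs.q.cross (hs.qc i)).inner (hs.q.cross (hs.qc j))).const_mul _)

theorem inv_mulVec_fin_two (M : Matrix (Fin 2) (Fin 2) ℝ) (b : Fin 2 → ℝ) :
    M⁻¹.mulVec b = fun j => M.det⁻¹ *
      (if j = 0 then M 1 1 * b 0 - M 0 1 * b 1 else M 0 0 * b 1 - M 1 0 * b 0) := by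
  rw [Matrix.inv_def, Matrix.adjugate_fin_two, Ring.inverse_eq_inv]
  ext j
  fin_cases j <;> simp [Matrix.mulVec, dotProduct, Fin.sum_univ_two] <;> ring

theorem MechSmooth.invMulVec (P : Params) (hs : MechSmooth s S) {b : E → Fin 2 → ℝ}
    (hb : ∀ j, BddSmoothOn (fun p => b p j) S) (j : Fin 2) :
    BddSmoothOn (fun p => ((RodTransport.tensionMatrix P (s p))⁻¹.mulVec (b p)) j) S := by
  have hM := hs.tensionMatrix P
  have hdet : BddSmoothOn (fun p => (RodTransport.tensionMatrix P (s p)).det) S := by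
    simp only [Matrix.det_fin_two]
    exact ((hM 0 0).mul (hM 1 1)).sub ((hM 0 1).mul (hM 1 0))
  have hinv := hdet.inv (c := P.mQ⁻¹ ^ 2) (by have := P.mQ_pos; positivity)
    (fun p _ => det_tensionMatrix_ge P (s p))
  simp only [inv_mulVec_fin_two]
  fin_cases j
  · exact hinv.mul (((hM 1 1).mul (hb 0)).sub ((hM 0 1).mul (hb 1)))
  · exact hinv.mul (((hM 0 0).mul (hb 1)).sub ((hM 1 0).mul (hb 0)))

theorem MechSmooth.inelasticTension (P : Params) (hs : MechSmooth s S)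
    (hu : ∀ j, BddSmoothOn (fun p => u p j) S) (j : Fin 2) :
    BddSmoothOn (fun p => inelasticTension P (u p) (s p) j) S := by
  refine hs.invMulVec P (fun j => ?_) j
  exact ((hs.wc j).normSq.const_mul _).add ((hs.qc j).inner
    ((hs.endAcc P (T := fun _ => 0) (fun _ => bddSmoothOn_const _ _) j).sub
      ((hu j).const_smul _)))

theorem MechSmooth.rootMech (P : Params) (hs : MechSmooth s S)
    (hu : ∀ j, BddSmoothOn (fun p => u p j) S) :
    BddSmoothOn (fun p => rootMech P (u p) (s p)) S :=
  bddSmoothOn_pi2 fun j => ((hs.inelasticTension P hu j).const_mul _).prodMk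
    (bddSmoothOn_const _ _)

variable {ε : E → ℝ} {w : E → Fast}

theorem BddSmoothOn.tension (P : Params) (hw : BddSmoothOn w S) (j : Fin 2) :
    BddSmoothOn (fun p => tension P (w p) j) S :=
  ((hw.apply j).fst.const_mul _).add ((hw.apply j).snd.const_mul _)

theorem BddSmoothOn.cableLength (P : Params) (hε : BddSmoothOn ε S) (hw : BddSmoothOn w S)
    (j : Fin 2) : BddSmoothOn (fun p => cableLength P (ε p) (w p) j) S := by
  simp only [RodTransport.cableLength, pow_two]
  exact (bddSmoothOn_const _ _).add ((hε.mul hε).mul (hw.apply j).fst)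

theorem MechSmooth.mechField (P : Params) (hs : MechSmooth s S)
    (hu : ∀ j, BddSmoothOn (fun p => u p j) S) (hε : BddSmoothOn ε S) (hw : BddSmoothOn w S)
    {c : ℝ} (hc : 0 < c) (hl : ∀ j, ∀ p ∈ S, c ≤ RodTransport.cableLength P (ε p) (w p) j) :
    BddSmoothOn (fun p => mechField P (u p) (ε p) (s p) (w p)) S := by
  refine ((hs.v.prodMk ((hs.rodAcc P (hw.tension P)).prodMk ((hs.w.cross hs.q).prodMk
    (hs.rodAngAcc P (hw.tension P))))).prodMk (bddSmoothOn_pi2 fun j =>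
      (hs.wc j).cross (hs.qc j))).prodMk (bddSmoothOn_pi2 fun j => ?_)
  exact ((hε.cableLength P hw j).inv hc (hl j)).smul
    (((hs.qc j).cross ((hs.endAcc P (hw.tension P) j).sub ((hu j).const_smul _))).sub
      (((hε.mul (hw.apply j).snd).const_mul _).smul (hs.wc j)))

theorem MechSmooth.fastMech (P : Params) (hs : MechSmooth s S)
    (hu : ∀ j, BddSmoothOn (fun p => u p j) S) (hε : BddSmoothOn ε S) (hw : BddSmoothOn w S) :
    BddSmoothOn (fun p => fastMech P (u p) (ε p) (s p) (w p)) S :=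
  bddSmoothOn_pi2 fun j => (hw.apply j).snd.prodMk
    ((((hε.cableLength P hw j).mul (hs.wc j).normSq).add ((hs.qc j).inner
      ((hs.endAcc P (hw.tension P) j).sub ((hu j).const_smul _)))).sub
      ((hw.tension P j).const_mul _))

end

end RodTransport
end

noncomputable section
namespace RodTransport

/-! ### Smoothness of the controls on thin tubes around a trajectory -/

section

variable {E F G : Type*} [NormedAddCommGroup E] [NormedSpace ℝ E] [NormedAddCommGroup F]
  [NormedSpace ℝ F] [NormedAddCommGroup G] [NormedSpace ℝ G]

theorem TubeSmooth.fst_pull {t₀ : ℝ} {c : ℝ → E × F} {φ : ℝ × E → G}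
    (h : TubeSmooth t₀ (fun t => (c t).1) φ) : TubeSmooth t₀ c (fun p => φ (p.1, p.2.1)) :=
  TubeSmooth.pull (ContinuousLinearMap.fst ℝ E F) (fun v => norm_fst_le v) h

theorem TubeSmooth.exists_bound {t₀ : ℝ} {c : ℝ → E} {φ : ℝ × E → F} (h : TubeSmooth t₀ c φ) :
    ∃ C, ∀ t, t₀ ≤ t → ‖φ (t, c t)‖ ≤ C := by
  obtain ⟨ρ, hρs, hρ⟩ := (h.and self_mem_nhdsWithin).exists
  obtain ⟨C, hC⟩ := hρs.bdd_val
  exact ⟨C, fun t ht => hC _ (center_mem_tube (le_of_lt hρ) ht)⟩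

theorem TubeSmooth.fderiv {t₀ : ℝ} {c : ℝ → E} {φ : ℝ × E → F} (h : TubeSmooth t₀ c φ) :
    TubeSmooth t₀ c (fun p => fderiv ℝ φ p) := by
  filter_upwards [h] with ρ h using h.toBddDerivOn.fderiv

theorem TubeSmooth.unitVec {t₀ : ℝ} {c : ℝ → E} {φ : ℝ → E → E3}
    (h : TubeSmooth t₀ c (fun p => φ p.1 p.2)) {m : ℝ} (hm : 0 < m)
    (hc : ∀ t, t₀ ≤ t → m ≤ ‖φ t (c t)‖) :
    TubeSmooth t₀ c (fun p => unitVec (φ p.1 p.2)) := by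
  filter_upwards [h, h.lower_bound hm hc] with ρ h h' using h.unitVec (half_pos hm) h'

end

theorem norm_unitVec {v : E3} (hv : v ≠ 0) : ‖unitVec v‖ = 1 := by
  rw [unitVec, norm_smul, norm_inv, norm_norm, inv_mul_cancel₀ (norm_ne_zero_iff.2 hv)]

theorem normsq_cross (a b : E3) : ‖a ×ᵥ b‖ ^ 2 = ‖a‖ ^ 2 * ‖b‖ ^ 2 - (inner ℝ a b) ^ 2 := by
  simp only [normsq_e3, inner_e3, cross0, cross1, cross2]; ring

theorem inner_cross_self_left (a b : E3) : inner ℝ a (a ×ᵥ b) = 0 := by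
  simp only [inner_e3, cross0, cross1, cross2]; ring

theorem norm_cross_of_orth {a b : E3} (ha : ‖a‖ = 1) (h : inner ℝ a b = 0) :
    ‖a ×ᵥ b‖ = ‖b‖ := by
  have := normsq_cross a b
  rw [ha, h] at this
  have h2 : ‖a ×ᵥ b‖ ^ 2 = ‖b‖ ^ 2 := by rw [this]; ring
  exact (pow_left_inj₀ (norm_nonneg _) (norm_nonneg _) two_ne_zero).1 h2

theorem norm_apply_of_mem_SO3 {R : L3} (hR : R ∈ SO3) (v : E3) : ‖R v‖ = ‖v‖ := by
  have h1 : inner ℝ (R v) (R v) = inner ℝ v v := by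
    rw [← ContinuousLinearMap.adjoint_inner_right, ← ContinuousLinearMap.comp_apply, hR.1]
    rfl
  rw [real_inner_self_eq_norm_sq, real_inner_self_eq_norm_sq] at h1
  exact (pow_left_inj₀ (norm_nonneg _) (norm_nonneg _) two_ne_zero).1 h1

theorem norm_le_one_of_mem_SO3 {R : L3} (hR : R ∈ SO3) : ‖R‖ ≤ 1 :=
  R.opNorm_le_bound zero_le_one fun v => by rw [norm_apply_of_mem_SO3 hR, one_mul]

namespace Reference.Admissible

variable {ref : Reference} {t₀ : ℝ} (h : ref.Admissible t₀)
include h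

theorem bddDerivOn_xd : BddDerivOn ref.xd (Ici t₀) :=
  ⟨fun _ _ => h.smooth_xd.contDiffAt, fun n hn => by
    obtain ⟨C, hC⟩ := h.bdd_xd n hn
    exact ⟨C, fun t ht => by rw [norm_iteratedFDeriv_eq_norm_iteratedDeriv]; exact hC t ht⟩⟩

theorem bddSmoothOn_qd : BddSmoothOn ref.qd (Ici t₀) :=
  ⟨⟨fun _ _ => h.smooth_qd.contDiffAt, fun n hn => by
    obtain ⟨C, hC⟩ := h.bdd_qd n hn
    exact ⟨C, fun t ht => by rw [norm_iteratedFDeriv_eq_norm_iteratedDeriv]; exact hC t ht⟩⟩,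
    ⟨1, fun t _ => (h.norm_qd t).le⟩⟩

theorem bddSmoothOn_b1 (j : Fin 2) : BddSmoothOn (ref.b1 j) (Ici t₀) :=
  ⟨⟨fun _ _ => (h.smooth_b1 j).contDiffAt, fun n hn => by
    obtain ⟨C, hC⟩ := h.bdd_b1 j n hn
    exact ⟨C, fun t ht => by rw [norm_iteratedFDeriv_eq_norm_iteratedDeriv]; exact hC t ht⟩⟩,
    ⟨1, fun t _ => (h.norm_b1 j t).le⟩⟩

theorem bddSmoothOn_wd : BddSmoothOn ref.wd (Ici t₀) :=
  h.bddSmoothOn_qd.cross (BddSmoothOn.deriv h.bddSmoothOn_qd.toBddDerivOn)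

end Reference.Admissible

def Rod.vL : Rod →L[ℝ] E3 := ContinuousLinearMap.fst ℝ E3 (E3 × E3) ∘L
  ContinuousLinearMap.snd ℝ E3 (E3 × E3 × E3)
def Rod.qL : Rod →L[ℝ] E3 := ContinuousLinearMap.fst ℝ E3 E3 ∘L
  ContinuousLinearMap.snd ℝ E3 (E3 × E3) ∘L ContinuousLinearMap.snd ℝ E3 (E3 × E3 × E3)
def Rod.wL : Rod →L[ℝ] E3 := ContinuousLinearMap.snd ℝ E3 E3 ∘L
  ContinuousLinearMap.snd ℝ E3 (E3 × E3) ∘L ContinuousLinearMap.snd ℝ E3 (E3 × E3 × E3)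
def sndApplyL {E F : Type*} [NormedAddCommGroup E] [NormedSpace ℝ E] [NormedAddCommGroup F]
    [NormedSpace ℝ F] (j : Fin 2) : (E × (Fin 2 → F)) →L[ℝ] F :=
  ContinuousLinearMap.proj (R := ℝ) (φ := fun _ : Fin 2 => F) j ∘L
    ContinuousLinearMap.snd ℝ E (Fin 2 → F)

theorem norm_rod_x_le (d : Slow) : ‖d.mech.rod.x‖ ≤ ‖d‖ :=
  (norm_fst_le d.mech.rod).trans ((norm_fst_le d.mech.1).trans ((norm_fst_le d.mech).trans
    ((norm_fst_le d.1).trans (norm_fst_le d))))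
theorem norm_rod_v_le (d : Slow) : ‖d.mech.rod.v‖ ≤ ‖d‖ :=
  (norm_fst_le d.mech.rod.2).trans ((norm_snd_le d.mech.rod).trans ((norm_fst_le d.mech.1).trans
    ((norm_fst_le d.mech).trans ((norm_fst_le d.1).trans (norm_fst_le d)))))
theorem norm_rod_q_le (d : Slow) : ‖d.mech.rod.q‖ ≤ ‖d‖ :=
  (norm_fst_le d.mech.rod.2.2).trans ((norm_snd_le d.mech.rod.2).trans
    ((norm_snd_le d.mech.rod).trans ((norm_fst_le d.mech.1).trans
      ((norm_fst_le d.mech).trans ((norm_fst_le d.1).trans (norm_fst_le d))))))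
theorem norm_rod_w_le (d : Slow) : ‖d.mech.rod.w‖ ≤ ‖d‖ :=
  (norm_snd_le d.mech.rod.2.2).trans ((norm_snd_le d.mech.rod.2).trans
    ((norm_snd_le d.mech.rod).trans ((norm_fst_le d.mech.1).trans
      ((norm_fst_le d.mech).trans ((norm_fst_le d.1).trans (norm_fst_le d))))))
theorem norm_qc_le (d : Slow) (j : Fin 2) : ‖d.mech.qc j‖ ≤ ‖d‖ :=
  (norm_le_pi_norm d.mech.qc j).trans ((norm_snd_le d.mech.1).trans ((norm_fst_le d.mech).trans
    ((norm_fst_le d.1).trans (norm_fst_le d))))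
theorem norm_wc_le (d : Slow) (j : Fin 2) : ‖d.mech.wc j‖ ≤ ‖d‖ :=
  (norm_le_pi_norm d.mech.wc j).trans ((norm_snd_le d.mech).trans
    ((norm_fst_le d.1).trans (norm_fst_le d)))
theorem norm_att_le (d : Slow) (j : Fin 2) : ‖d.att j‖ ≤ ‖d‖ :=
  (norm_le_pi_norm d.att j).trans ((norm_snd_le d.1).trans (norm_fst_le d))
theorem norm_om_le (d : Slow) (j : Fin 2) : ‖d.om j‖ ≤ ‖d‖ :=
  (norm_le_pi_norm d.om j).trans (norm_snd_le d)

/-- A curve of slow states along which the controls are defined with a uniform margin and which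
stays at a bounded distance from the desired state. -/
structure GoodCurve (P : Params) (ref : Reference) (t₀ : ℝ) (x : ℝ → Slow) : Prop where
  href : ref.Admissible t₀
  onManifold : ∀ t, t₀ ≤ t → (x t).OnManifold
  margin : ∃ c, 0 < c ∧ ∀ t, t₀ ≤ t → MarginAtLeast P ref c t (x t)
  bdd : ∃ K, ∀ t, t₀ ≤ t → ‖x t - desired P ref t (x t)‖ ≤ K

namespace GoodCurve

variable {P : Params} {ref : Reference} {t₀ : ℝ} {x : ℝ → Slow} (h : GoodCurve P ref t₀ x)
include h

/-! #### Rod -/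

theorem rod_pos : TubeSmooth t₀ (fun t => (x t).mech.rod)
    (fun p : ℝ × Rod => p.2.x - ref.xd p.1) := by
  obtain ⟨K, hK⟩ := h.bdd
  refine tubeSmooth_of one_pos ⟨(bddDerivOn_clm (ContinuousLinearMap.fst ℝ E3 (E3 × E3 × E3) ∘L
    ContinuousLinearMap.snd ℝ ℝ Rod) _).sub (h.href.bddDerivOn_xd.comp
      (bddDerivOn_clm (ContinuousLinearMap.fst ℝ ℝ Rod) _) fun _ hp => hp.1),
      ⟨1 + K, fun p hp => ?_⟩⟩
  have h1 : p.2.x - ref.xd p.1 = (p.2.x - (x p.1).mech.rod.x) + ((x p.1).mech.rod.x - ref.xd p.1) := by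
    abel
  rw [h1]
  refine (norm_add_le _ _).trans (add_le_add ((norm_fst_le (p.2 - (x p.1).mech.rod : Rod)).trans hp.2) ?_)
  exact (norm_rod_x_le (x p.1 - RodTransport.desired P ref p.1 (x p.1))).trans (hK _ hp.1)

theorem rod_v : TubeSmooth t₀ (fun t => (x t).mech.rod) (fun p : ℝ × Rod => p.2.v) := by
  obtain ⟨K, hK⟩ := h.bdd
  obtain ⟨C, hC⟩ := (BddSmoothOn.deriv h.href.bddDerivOn_xd).bdd_val
  refine tubeSmooth_clm Rod.vL (C := K + C) fun t ht => ?_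
  have h1 : ‖(x t).mech.rod.v - deriv ref.xd t‖ ≤ K :=
    (norm_rod_v_le (x t - RodTransport.desired P ref t (x t))).trans (hK t ht)
  have h2 := norm_add_le ((x t).mech.rod.v - deriv ref.xd t) (deriv ref.xd t)
  rw [sub_add_cancel] at h2
  exact h2.trans (add_le_add h1 (hC t ht))

theorem rod_q : TubeSmooth t₀ (fun t => (x t).mech.rod) (fun p : ℝ × Rod => p.2.q) :=
  tubeSmooth_clm Rod.qL (C := 1) fun t ht => (h.onManifold t ht).1.le

theorem rod_w : TubeSmooth t₀ (fun t => (x t).mech.rod) (fun p : ℝ × Rod => p.2.w) := by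
  obtain ⟨K, hK⟩ := h.bdd
  obtain ⟨C, hC⟩ := h.href.bddSmoothOn_wd.bdd_val
  refine tubeSmooth_clm Rod.wL (C := K + C) fun t ht => ?_
  have h1 : ‖(x t).mech.rod.w - ref.wd t‖ ≤ K :=
    (norm_rod_w_le (x t - RodTransport.desired P ref t (x t))).trans (hK t ht)
  have h2 := norm_add_le ((x t).mech.rod.w - ref.wd t) (ref.wd t)
  rw [sub_add_cancel] at h2
  exact h2.trans (add_le_add h1 (hC t ht))

theorem time {φ : ℝ → E3} (hφ : BddSmoothOn φ (Ici t₀)) :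
    TubeSmooth t₀ (fun t => (x t).mech.rod) (fun p : ℝ × Rod => φ p.1) :=
  have := h
  tubeSmooth_time hφ

theorem muDes (j : Fin 2) : TubeSmooth t₀ (fun t => (x t).mech.rod)
    (fun p : ℝ × Rod => muDes P ref j p.1 p.2) := by
  have hxd := BddSmoothOn.deriv h.href.bddDerivOn_xd
  filter_upwards [h.rod_pos, h.rod_v, h.rod_q, h.rod_w, h.time hxd,
    h.time (BddSmoothOn.deriv hxd.toBddDerivOn), h.time h.href.bddSmoothOn_qd,
    h.time h.href.bddSmoothOn_wd,
    h.time (BddSmoothOn.deriv h.href.bddSmoothOn_wd.toBddDerivOn)]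
    with ρ hp hv hq hw hxd hxdd hqd hwd hwdd
  have hs : BddSmoothOn (fun p : ℝ × Rod => muSum P ref p.1 p.2) (tube t₀ _ ρ) :=
    (((hxdd.add (bddSmoothOn_const _ _)).sub ((hv.sub hxd).const_smul _)).sub
      (hp.const_smul _)).const_smul _
  have he : BddSmoothOn (fun p : ℝ × Rod => errW (ref.wd p.1) p.2.q p.2.w) (tube t₀ _ ρ) :=
    hw.add (hq.cross (hq.cross hwd))
  have hd : BddSmoothOn (fun p : ℝ × Rod => muDiff P ref p.1 p.2) (tube t₀ _ ρ) :=
    (((((hq.cross hwdd).neg.sub ((hq.inner hwd).smul (hq.cross (hq.cross hwd)))).add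
      ((hq.inner hwd).smul he)).add ((hq.cross he).const_smul _)).add
      ((hq.cross (hqd.cross hq)).const_smul _)).const_smul _
  exact (hs.add (hd.const_smul _)).const_smul _

theorem qDes (j : Fin 2) : TubeSmooth t₀ (fun t => (x t).mech.rod) (qDes P ref j) := by
  obtain ⟨c, hc, hm⟩ := h.margin
  filter_upwards [(h.muDes j).unitVec hc fun t ht => (hm t ht j).1] with ρ h using h.neg

/-! #### Configurations -/

theorem conf_qc (j : Fin 2) : TubeSmooth t₀ (fun t => (x t).mech.1) (fun p : ℝ × Conf => p.2.2 j) :=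
  tubeSmooth_clm (sndApplyL (E := Rod) (F := E3) j) fun t ht => ((h.onManifold t ht).2.2 j).1.le

theorem mu (j : Fin 2) : TubeSmooth t₀ (fun t => (x t).mech.1)
    (fun p : ℝ × Conf => mu P ref j p.1 p.2) := by
  filter_upwards [(h.muDes j).fst_pull, h.conf_qc j] with ρ h1 h2
  exact h1.add (h2.cross (h2.cross h1))

theorem nomAcc : TubeSmooth t₀ (fun t => (x t).mech.1)
    (fun p : ℝ × Conf => nomAcc P ref p.1 p.2) := by
  filter_upwards [h.mu 0, h.mu 1] with ρ h1 h2
  exact ((h1.add h2).const_smul _).sub (bddSmoothOn_const _ _)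

theorem nomAngAcc : TubeSmooth t₀ (fun t => (x t).mech.1)
    (fun p : ℝ × Conf => nomAngAcc P ref p.1 p.2) := by
  filter_upwards [h.mu 0, h.mu 1, h.rod_q.fst_pull] with ρ h1 h2 h3
  exact (h3.cross (h2.sub h1)).const_smul _

theorem nomRodField : TubeSmooth t₀ (fun t => (x t).mech.1)
    (fun p : ℝ × Conf => nomRodField P ref p.1 p.2) := by
  filter_upwards [h.nomAcc, h.nomAngAcc, h.rod_q.fst_pull, h.rod_v.fst_pull, h.rod_w.fst_pull]
    with ρ h1 h2 h3 h4 h5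
  exact h4.prodMk (h1.prodMk ((h5.cross h3).prodMk h2))

theorem wDes (j : Fin 2) : TubeSmooth t₀ (fun t => (x t).mech.1) (wDes P ref j) := by
  filter_upwards [(h.qDes j).fst_pull, (h.qDes j).fderiv.fst_pull, h.nomRodField] with ρ h1 h2 h3
  exact h1.cross (h2.clm_apply ((bddSmoothOn_const _ _).prodMk h3))

/-! #### Rod and cables -/

theorem mech_wc (j : Fin 2) : TubeSmooth t₀ (fun t => (x t).mech) (fun p : ℝ × Mech => p.2.wc j) := by
  obtain ⟨K, hK⟩ := h.bdd
  obtain ⟨C, hC⟩ := (h.wDes j).exists_bound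
  refine tubeSmooth_clm (sndApplyL (E := Conf) (F := E3) j) (C := K + C) fun t ht => ?_
  have h1 : ‖(x t).mech.wc j - RodTransport.wDes P ref j (t, (x t).mech.1)‖ ≤ K :=
    (norm_wc_le (x t - RodTransport.desired P ref t (x t)) j).trans (hK t ht)
  have h2 := norm_add_le ((x t).mech.wc j - RodTransport.wDes P ref j (t, (x t).mech.1))
    (RodTransport.wDes P ref j (t, (x t).mech.1))
  rw [sub_add_cancel] at h2
  exact h2.trans (add_le_add h1 (hC t ht))

theorem mechSmooth : ∀ᶠ ρ in 𝓝[>] (0 : ℝ), MechSmooth (fun p : ℝ × Mech => p.2)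
    (tube t₀ (fun t => (x t).mech) ρ) := by
  filter_upwards [h.rod_v.fst_pull.fst_pull, h.rod_q.fst_pull.fst_pull, h.rod_w.fst_pull.fst_pull,
    eventually_all.2 fun j => (h.conf_qc j).fst_pull, eventually_all.2 h.mech_wc]
    with ρ h1 h2 h3 h4 h5
  exact ⟨h1, h2, h3, h4, h5⟩

theorem wDesDot (j : Fin 2) : TubeSmooth t₀ (fun t => (x t).mech)
    (fun p : ℝ × Mech => wDesDot P ref j p.1 p.2) := by
  filter_upwards [(h.wDes j).fderiv.fst_pull, h.nomRodField.fst_pull, h.mechSmooth] with ρ h1 h2 h3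
  exact h1.clm_apply ((bddSmoothOn_const _ _).prodMk (h2.prodMk
    (bddSmoothOn_pi2 fun i => (h3.wc i).cross (h3.qc i))))

theorem nomEndAcc (j : Fin 2) : TubeSmooth t₀ (fun t => (x t).mech)
    (fun p : ℝ × Mech => nomEndAcc P ref j p.1 p.2) := by
  filter_upwards [h.nomAcc.fst_pull, h.nomAngAcc.fst_pull, h.mechSmooth] with ρ h1 h2 h3
  have h4 : BddSmoothOn (fun p : ℝ × Mech => dirAcc p.2.rod.q p.2.rod.w
      (RodTransport.nomAngAcc P ref p.1 p.2.1)) (tube t₀ _ ρ) := h3.q.dirAcc h3.w h2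
  have h5 : BddSmoothOn (fun p : ℝ × Mech => (sgn j * P.Lr) • dirAcc p.2.rod.q p.2.rod.w
      (RodTransport.nomAngAcc P ref p.1 p.2.1)) (tube t₀ _ ρ) := h4.const_smul _
  have h6 : BddSmoothOn (fun p : ℝ × Mech => RodTransport.nomAcc P ref p.1 p.2.1) (tube t₀ _ ρ) := h1
  have h7 := h6.add h5
  unfold RodTransport.nomEndAcc
  exact h7

theorem uDes (j : Fin 2) : TubeSmooth t₀ (fun t => (x t).mech)
    (fun p : ℝ × Mech => uDes P ref j p.1 p.2) := by
  filter_upwards [(h.mu j).fst_pull, h.nomEndAcc j, h.mechSmooth, h.wDesDot j, (h.wDes j).fst_pull,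
    (h.qDes j).fst_pull.fst_pull] with ρ h1 h2 h3 h4 h5 h6
  have h7 := h2.add (bddSmoothOn_const (P.grav • e 2) _)
  have hq := h3.qc j
  have hw := h3.wc j
  have h0 : BddSmoothOn (fun p : ℝ × Mech => RodTransport.mu P ref j p.1 p.2.1) (tube t₀ (fun t => (x t).mech) ρ) := h1
  have h8 : BddSmoothOn (fun p : ℝ × Mech => uPar P ref j p.1 p.2)
      (tube t₀ (fun t => (x t).mech) ρ) := by
    unfold uPar
    exact .add h0 (.const_smul _ (.add (.smul (.inner hq h7) hq)
      (.smul (.const_mul _ (.normSq hw)) hq)))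
  have h9 : BddSmoothOn (fun p : ℝ × Mech => uPerp P ref j p.1 p.2)
      (tube t₀ (fun t => (x t).mech) ρ) := by
    unfold uPerp errQ errW
    exact .sub (.neg (.const_smul _ (.cross hq (.cross hq (.sub (.add h7 (.const_smul _
      (.cross hq h4))) (.smul (.const_mul _ (.inner hq h5)) hw))))))
      (.const_smul _ (.cross hq (.add (.const_smul _ (.cross h6 hq))
        (.const_smul _ (.add hw (.cross hq (.cross hq h5)))))))
  unfold RodTransport.uDes
  exact h8.add h9

theorem b3Des (j : Fin 2) : TubeSmooth t₀ (fun t => (x t).mech)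
    (fun p : ℝ × Mech => b3Des P ref j p.1 p.2) := by
  obtain ⟨c, hc, hm⟩ := h.margin
  have h1 : ∀ t, t₀ ≤ t → c ≤ ‖RodTransport.uDes P ref j t (x t).mech‖ :=
    fun t ht => (hm t ht j).2.1
  have h2 := (h.uDes j).unitVec hc h1
  exact h2

theorem RDes (j : Fin 2) : TubeSmooth t₀ (fun t => (x t).mech) (RDes P ref j) := by
  obtain ⟨c, hc, hm⟩ := h.margin
  have hb1 : TubeSmooth t₀ (fun t => (x t).mech) (fun p : ℝ × Mech => ref.b1 j p.1) :=
    tubeSmooth_time (h.href.bddSmoothOn_b1 j)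
  have h1 : TubeSmooth t₀ (fun t => (x t).mech)
      (fun p : ℝ × Mech => RodTransport.b3Des P ref j p.1 p.2 ×ᵥ ref.b1 j p.1) := by
    filter_upwards [h.b3Des j, hb1] with ρ a b using a.cross b
  have h2 : TubeSmooth t₀ (fun t => (x t).mech) (fun p : ℝ × Mech =>
      RodTransport.b3Des P ref j p.1 p.2 ×ᵥ (RodTransport.b3Des P ref j p.1 p.2 ×ᵥ ref.b1 j p.1)) := by
    filter_upwards [h.b3Des j, h1] with ρ a b using a.cross b
  have m1 : ∀ t, t₀ ≤ t → c ≤ ‖RodTransport.b3Des P ref j t (x t).mech ×ᵥ ref.b1 j t‖ :=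
    fun t ht => (hm t ht j).2.2
  have m2 : ∀ t, t₀ ≤ t → c ≤ ‖RodTransport.b3Des P ref j t (x t).mech ×ᵥ
      (RodTransport.b3Des P ref j t (x t).mech ×ᵥ ref.b1 j t)‖ := fun t ht => by
    have : ‖RodTransport.b3Des P ref j t (x t).mech‖ = 1 :=
      norm_unitVec (norm_pos_iff.1 (hc.trans_le (hm t ht j).2.1))
    rw [norm_cross_of_orth this (inner_cross_self_left _ _)]
    exact m1 t ht
  filter_upwards [TubeSmooth.unitVec (φ := fun t s =>
    RodTransport.b3Des P ref j t s ×ᵥ ref.b1 j t) h1 hc m1, h.b3Des j, TubeSmooth.unitVec (φ := fun t s =>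
    RodTransport.b3Des P ref j t s ×ᵥ (RodTransport.b3Des P ref j t s ×ᵥ ref.b1 j t)) h2 hc m2] with ρ h3 h4 h5
  unfold RodTransport.RDes
  exact h5.neg.ofColumns h3 h4

/-! #### Rod, cables and attitudes -/

theorem att (j : Fin 2) : TubeSmooth t₀ (fun t => (x t).1)
    (fun p : ℝ × (Mech × (Fin 2 → L3)) => p.2.2 j) :=
  tubeSmooth_clm (sndApplyL (E := Mech) (F := L3) j) fun t ht => norm_le_one_of_mem_SO3 ((h.onManifold t ht).2.2 j).2.2

theorem thrust (j : Fin 2) : TubeSmooth t₀ (fun t => (x t).1)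
    (fun p : ℝ × (Mech × (Fin 2 → L3)) => thrust P ref p.1 p.2.1 p.2.2 j) := by
  filter_upwards [(h.uDes j).fst_pull, h.att j] with ρ h1 h2
  have h3 := h2.clm_apply (bddSmoothOn_const (e 2) _)
  exact (h1.inner h3).smul h3

theorem mechSmooth' : ∀ᶠ ρ in 𝓝[>] (0 : ℝ),
    MechSmooth (fun p : ℝ × (Mech × (Fin 2 → L3)) => p.2.1) (tube t₀ (fun t => (x t).1) ρ) := by
  filter_upwards [h.rod_v.fst_pull.fst_pull.fst_pull, h.rod_q.fst_pull.fst_pull.fst_pull,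
    h.rod_w.fst_pull.fst_pull.fst_pull, eventually_all.2 fun j => (h.conf_qc j).fst_pull.fst_pull,
    eventually_all.2 fun j => (h.mech_wc j).fst_pull] with ρ h1 h2 h3 h4 h5
  exact ⟨h1, h2, h3, h4, h5⟩

theorem redMechField : TubeSmooth t₀ (fun t => (x t).1)
    (fun p : ℝ × (Mech × (Fin 2 → L3)) => redMechField P ref p.1 p.2.1 p.2.2) := by
  filter_upwards [eventually_all.2 h.thrust, h.mechSmooth'] with ρ h1 h2
  exact h2.mechField P (ε := fun _ => 0) h1 (bddSmoothOn_const _ _) (h2.rootMech P h1) P.Lc_pos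
    fun j p _ => by simp [cableLength]

theorem OmDes (j : Fin 2) : TubeSmooth t₀ (fun t => (x t).1) (OmDes P ref j) := by
  filter_upwards [(h.RDes j).fst_pull, (h.RDes j).fderiv.fst_pull, h.redMechField] with ρ h1 h2 h3
  exact (h1.adjoint.clm_mul (h2.clm_apply ((bddSmoothOn_const _ _).prodMk h3))).vee

/-! #### Slow states -/

theorem om (j : Fin 2) : TubeSmooth t₀ x (fun p : ℝ × Slow => p.2.om j) := by
  obtain ⟨K, hK⟩ := h.bdd
  obtain ⟨C, hC⟩ := (h.OmDes j).exists_bound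
  refine tubeSmooth_clm (sndApplyL (E := (Mech × (Fin 2 → L3))) (F := E3) j) (C := K + C) fun t ht => ?_
  have h1 : ‖(x t).om j - RodTransport.OmDes P ref j (t, (x t).1)‖ ≤ K :=
    (norm_om_le (x t - RodTransport.desired P ref t (x t)) j).trans (hK t ht)
  have h2 := norm_add_le ((x t).om j - RodTransport.OmDes P ref j (t, (x t).1))
    (RodTransport.OmDes P ref j (t, (x t).1))
  rw [sub_add_cancel] at h2
  exact h2.trans (add_le_add h1 (hC t ht))

theorem OmDesDot (j : Fin 2) : TubeSmooth t₀ x (fun p : ℝ × Slow => OmDesDot P ref j p.1 p.2) := by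
  filter_upwards [(h.OmDes j).fderiv.fst_pull, h.redMechField.fst_pull,
    eventually_all.2 fun j => (h.att j).fst_pull, eventually_all.2 h.om] with ρ h1 h2 h3 h4
  exact h1.clm_apply ((bddSmoothOn_const _ _).prodMk (h2.prodMk (bddSmoothOn_pi2 fun i =>
    (h3 i).clm_mul (h4 i).hat)))

theorem relAtt (j : Fin 2) : TubeSmooth t₀ x (fun p : ℝ × Slow => relAtt P ref j p.1 p.2) := by
  filter_upwards [(h.att j).fst_pull, (h.RDes j).fst_pull.fst_pull] with ρ h1 h2
  exact h1.adjoint.clm_mul h2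

theorem errR (j : Fin 2) : TubeSmooth t₀ x (fun p : ℝ × Slow => errR P ref j p.1 p.2) := by
  filter_upwards [h.relAtt j] with ρ h1
  exact (h1.adjoint.sub h1).vee.const_smul _

theorem errOm (j : Fin 2) : TubeSmooth t₀ x (fun p : ℝ × Slow => errOm P ref j p.1 p.2) := by
  filter_upwards [h.relAtt j, h.om j, (h.OmDes j).fst_pull] with ρ h1 h2 h3
  exact h2.sub (h1.clm_apply h3)

theorem moment (j : Fin 2) : TubeSmooth t₀ x (fun p : ℝ × Slow => moment P ref j p.1 p.2) := by
  filter_upwards [h.relAtt j, h.om j, (h.OmDes j).fst_pull, h.errR j, h.errOm j, h.OmDesDot j]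
    with ρ h1 h2 h3 h4 h5 h6
  exact ((((h4.const_smul _).neg.sub (h5.const_smul _)).add (h2.cross (h2.clm_comp (J P))))).sub
    (((h2.cross (h1.clm_apply h3)).sub (h1.clm_apply h6)).clm_comp (J P))

theorem root : TubeSmooth t₀ x (fun p : ℝ × Slow => RodTransport.h P ref p.1 p.2) := by
  have h0 : TubeSmooth t₀ (fun t => (x t).1) (fun p : ℝ × (Mech × (Fin 2 → L3)) =>
      rootMech P (RodTransport.thrust P ref p.1 p.2.1 p.2.2) p.2.1) := by
    filter_upwards [eventually_all.2 h.thrust, h.mechSmooth'] with ρ h1 h2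
    exact h2.rootMech P h1
  exact h0.fst_pull

theorem desired : TubeSmooth t₀ x (fun p : ℝ × Slow => p.2 - desired P ref p.1 p.2) := by
  have hxd := BddSmoothOn.deriv h.href.bddDerivOn_xd
  filter_upwards [h.rod_pos.fst_pull.fst_pull.fst_pull.fst_pull,
    h.rod_v.fst_pull.fst_pull.fst_pull.fst_pull, h.rod_q.fst_pull.fst_pull.fst_pull.fst_pull,
    h.rod_w.fst_pull.fst_pull.fst_pull.fst_pull, (h.time hxd).fst_pull.fst_pull.fst_pull.fst_pull,
    (h.time h.href.bddSmoothOn_qd).fst_pull.fst_pull.fst_pull.fst_pull,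
    (h.time h.href.bddSmoothOn_wd).fst_pull.fst_pull.fst_pull.fst_pull,
    eventually_all.2 fun j => (h.conf_qc j).fst_pull.fst_pull.fst_pull,
    eventually_all.2 fun j => (h.qDes j).fst_pull.fst_pull.fst_pull.fst_pull,
    eventually_all.2 fun j => (h.mech_wc j).fst_pull.fst_pull,
    eventually_all.2 fun j => (h.wDes j).fst_pull.fst_pull.fst_pull,
    (eventually_all.2 fun j => (h.att j).fst_pull).and
    ((eventually_all.2 fun j => (h.RDes j).fst_pull.fst_pull).and
    ((eventually_all.2 h.om).and
    (eventually_all.2 fun j => (h.OmDes j).fst_pull)))]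
    with ρ a1 a2 a3 a4 b2 b3 b4 c1 c2 d1 d2 ⟨e1, e2, f1, f2⟩
  have key : (fun p : ℝ × Slow => p.2 - RodTransport.desired P ref p.1 p.2) = fun p =>
      (((((p.2.mech.rod.x - ref.xd p.1, p.2.mech.rod.v - deriv ref.xd p.1,
        p.2.mech.rod.q - ref.qd p.1, p.2.mech.rod.w - ref.wd p.1),
        fun j => p.2.mech.qc j - RodTransport.qDes P ref j (p.1, p.2.mech.rod)),
        fun j => p.2.mech.wc j - RodTransport.wDes P ref j (p.1, p.2.mech.1)),
        fun j => p.2.att j - RodTransport.RDes P ref j (p.1, p.2.mech)),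
        fun j => p.2.om j - RodTransport.OmDes P ref j (p.1, p.2.1)) := rfl
  rw [key]
  exact .prodMk (.prodMk (.prodMk (.prodMk (.prodMk a1 (.prodMk (.sub a2 b2)
    (.prodMk (.sub a3 b3) (.sub a4 b4)))) (bddSmoothOn_pi2 fun j => .sub (c1 j) (c2 j)))
    (bddSmoothOn_pi2 fun j => .sub (d1 j) (d2 j))) (bddSmoothOn_pi2 fun j => .sub (e1 j) (e2 j)))
    (bddSmoothOn_pi2 fun j => .sub (f1 j) (f2 j))

end GoodCurve

end RodTransport
end

noncomputable section
namespace RodTransport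

/-! ### Rotations -/

theorem inner_cross_self_right (a b : E3) : inner ℝ b (a ×ᵥ b) = 0 := by
  simp only [inner_e3, cross0, cross1, cross2]; ring

theorem cross_comm (a b : E3) : a ×ᵥ b = -(b ×ᵥ a) := by
  apply ext3 <;> simp <;> ring

theorem cross_cross (a b c : E3) : a ×ᵥ (b ×ᵥ c) = inner ℝ a c • b - inner ℝ a b • c := by
  apply ext3 <;> simp [inner_e3] <;> ring

/-- Isometries of `ℝ³` which preserve the cross product. -/
structure IsRot (R : L3) : Prop where
  orth : ContinuousLinearMap.adjoint R ∘L R = 1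
  map_cross : ∀ a b, R (a ×ᵥ b) = R a ×ᵥ R b

theorem eq_sum_e (v : E3) : v = v 0 • e 0 + v 1 • e 1 + v 2 • e 2 := by
  apply ext3 <;> simp [e]

theorem comp_eq_one_comm {A B : L3} (h : A ∘L B = 1) : B ∘L A = 1 := by
  have h1 : (A : E3 →ₗ[ℝ] E3) * (B : E3 →ₗ[ℝ] E3) = 1 := by
    ext1 v
    exact congrArg (fun C : L3 => C v) h
  have h2 := mul_eq_one_comm.1 h1
  ext1 v
  exact congrArg (fun C : E3 →ₗ[ℝ] E3 => C v) h2

theorem orth_comm {R : L3} (h : ContinuousLinearMap.adjoint R ∘L R = 1) :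
    R ∘L ContinuousLinearMap.adjoint R = 1 := comp_eq_one_comm h

theorem det_e3 (R : L3) : R.det = R (e 0) 0 * R (e 1) 1 * R (e 2) 2
    - R (e 0) 0 * R (e 2) 1 * R (e 1) 2 - R (e 1) 0 * R (e 0) 1 * R (e 2) 2
    + R (e 1) 0 * R (e 2) 1 * R (e 0) 2 + R (e 2) 0 * R (e 0) 1 * R (e 1) 2
    - R (e 2) 0 * R (e 1) 1 * R (e 0) 2 := by
  rw [ContinuousLinearMap.det,
    ← LinearMap.det_toMatrix (EuclideanSpace.basisFun (Fin 3) ℝ).toBasis, Matrix.det_fin_three]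
  simp [LinearMap.toMatrix_apply, e]

theorem inner_map_cross (R : L3) (a b c : E3) :
    inner ℝ (R a ×ᵥ R b) (R c) = R.det * inner ℝ (a ×ᵥ b) c := by
  rw [det_e3, eq_sum_e a, eq_sum_e b, eq_sum_e c]
  simp only [map_add, map_smul]
  generalize R (e 0) = u
  generalize R (e 1) = v
  generalize R (e 2) = w
  simp [inner_e3, e]
  ring

theorem isRot_of_mem_SO3 {R : L3} (hR : R ∈ SO3) : IsRot R := by
  refine ⟨hR.1, fun a b => ?_⟩
  have h1 : R ∘L ContinuousLinearMap.adjoint R = 1 := orth_comm hR.1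
  refine ext_inner_right ℝ fun v => ?_
  have hv : R (ContinuousLinearMap.adjoint R v) = v := congrArg (fun C : L3 => C v) h1
  rw [← hv, inner_map_cross, hR.2, one_mul, ← ContinuousLinearMap.adjoint_inner_right]
  exact congrArg _ (congrArg (fun C : L3 => C (ContinuousLinearMap.adjoint R v)) hR.1)

theorem orth_of_inner {R : L3} (h : ∀ v w, inner ℝ (R v) (R w) = inner ℝ v w) :
    ContinuousLinearMap.adjoint R ∘L R = 1 := by
  ext1 v
  refine ext_inner_left ℝ fun w => ?_
  rw [ContinuousLinearMap.comp_apply, ContinuousLinearMap.adjoint_inner_right, h]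
  rfl

theorem isRot_ofColumns {b c : E3} (hb : ‖b‖ = 1) (hc : ‖c‖ = 1) (hbc : inner ℝ b c = 0) :
    IsRot (ofColumns (b ×ᵥ c) b c) := by
  have h1 := normsq_e3 b
  have h2 := normsq_e3 c
  rw [hb] at h1
  rw [hc] at h2
  rw [inner_e3] at hbc
  constructor
  · refine orth_of_inner fun v w => ?_
    simp only [ofColumns_apply, inner_add_left, inner_add_right, inner_smul_left, inner_smul_right]
    have e1 : inner ℝ (b ×ᵥ c) (b ×ᵥ c) = (1 : ℝ) := by
      rw [real_inner_self_eq_norm_sq, normsq_cross, hb, hc, inner_e3, hbc]; norm_num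
    have e2 : inner ℝ b (b ×ᵥ c) = (0 : ℝ) := inner_cross_self_left _ _
    have e3 : inner ℝ c (b ×ᵥ c) = (0 : ℝ) := inner_cross_self_right _ _
    have e4 : inner ℝ b c = (0 : ℝ) := by rw [inner_e3]; exact hbc
    rw [e1, real_inner_comm b (b ×ᵥ c), real_inner_comm c (b ×ᵥ c), real_inner_comm b c, e2, e3, e4,
      real_inner_self_eq_norm_sq, real_inner_self_eq_norm_sq, hb, hc, inner_e3]
    simp
    ring
  · intro v w
    simp only [ofColumns_apply]
    have e1 : c ×ᵥ (b ×ᵥ c) = b := by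
      rw [cross_cross, real_inner_self_eq_norm_sq, hc, real_inner_comm, inner_e3, hbc]; simp
    have e2 : b ×ᵥ (b ×ᵥ c) = -c := by
      rw [cross_cross, real_inner_self_eq_norm_sq, hb, inner_e3, hbc]; simp
    have e3 : (b ×ᵥ c) ×ᵥ b = c := by rw [cross_comm, e2, neg_neg]
    have e4 : (b ×ᵥ c) ×ᵥ c = -b := by rw [cross_comm, e1]
    simp only [cross_add, add_cross, cross_smul, smul_cross, e1, e2, e3, e4, cross_self,
      cross_comm c b]
    generalize b ×ᵥ c = a
    apply ext3 <;> simp <;> ring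

theorem IsRot.norm_apply {R : L3} (hR : IsRot R) (v : E3) : ‖R v‖ = ‖v‖ := by
  have h1 : inner ℝ (R v) (R v) = inner ℝ v v := by
    rw [← ContinuousLinearMap.adjoint_inner_right, ← ContinuousLinearMap.comp_apply, hR.orth]
    rfl
  rw [real_inner_self_eq_norm_sq, real_inner_self_eq_norm_sq] at h1
  exact (pow_left_inj₀ (norm_nonneg _) (norm_nonneg _) two_ne_zero).1 h1

theorem IsRot.apply_adjoint {R : L3} (hR : IsRot R) (v : E3) :
    R (ContinuousLinearMap.adjoint R v) = v :=
  congrArg (fun C : L3 => C v) (orth_comm hR.orth)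

theorem IsRot.adjoint_apply {R : L3} (hR : IsRot R) (v : E3) :
    ContinuousLinearMap.adjoint R (R v) = v :=
  congrArg (fun C : L3 => C v) hR.orth

theorem IsRot.adjoint {R : L3} (hR : IsRot R) : IsRot (ContinuousLinearMap.adjoint R) := by
  refine ⟨by rw [ContinuousLinearMap.adjoint_adjoint]; exact orth_comm hR.orth, fun a b => ?_⟩
  conv_lhs => rw [← hR.apply_adjoint a, ← hR.apply_adjoint b, ← hR.map_cross]
  exact hR.adjoint_apply _

theorem IsRot.comp {R Q : L3} (hR : IsRot R) (hQ : IsRot Q) : IsRot (R ∘L Q) := by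
  refine ⟨?_, fun a b => by simp [hQ.map_cross, hR.map_cross]⟩
  ext1 v
  rw [ContinuousLinearMap.adjoint_comp]
  simp only [ContinuousLinearMap.comp_apply, hR.adjoint_apply, hQ.adjoint_apply]
  rfl

theorem IsRot.comp_hat {R : L3} (hR : IsRot R) (w : E3) : R ∘L hat w = hat (R w) ∘L R := by
  ext1 v
  simp only [ContinuousLinearMap.comp_apply, hat_apply, hR.map_cross]

theorem inner_e (v : E3) (i : Fin 3) : inner ℝ (e i) v = v i := by
  simp [e, EuclideanSpace.inner_single_left]

theorem adjoint_hat (w : E3) : ContinuousLinearMap.adjoint (hat w) = -hat w := by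
  ext1 v
  refine ext_inner_left ℝ fun u => ?_
  rw [ContinuousLinearMap.adjoint_inner_right, neg_apply, hat_apply, hat_apply]
  simp [inner_e3]
  ring

theorem vee_hat (w : E3) : vee (hat w) = w := by
  apply ext3 <;> simp [vee, hat_apply, e]

theorem hat_vee_sub (A : L3) :
    hat (vee (A - ContinuousLinearMap.adjoint A)) = A - ContinuousLinearMap.adjoint A := by
  have h : ∀ i j, (A - ContinuousLinearMap.adjoint A) (e i) j = A (e i) j - A (e j) i := by
    intro i j
    rw [sub_apply, PiLp.sub_apply, ← inner_e (ContinuousLinearMap.adjoint A (e i)) j,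
      ContinuousLinearMap.adjoint_inner_right, real_inner_comm, inner_e]
  refine ext_e fun i => ext3 ?_ ?_ ?_ <;> fin_cases i <;>
    simp only [hat_apply, cross0, cross1, cross2, vee, h] <;> simp [e]

theorem hat_vee_of_skew {A : L3} (hA : A + ContinuousLinearMap.adjoint A = 0) :
    hat (vee A) = A := by
  have h1 : ContinuousLinearMap.adjoint A = -A := by
    rw [eq_neg_iff_add_eq_zero, add_comm]; exact hA
  have h2 := hat_vee_sub A
  have h3 : A - ContinuousLinearMap.adjoint A = (2 : ℝ) • A := by rw [h1, two_smul ℝ A]; abel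
  rw [h3, ← veeL_apply, map_smul, hat_eq, map_smul, ← hat_eq, veeL_apply] at h2
  exact smul_right_injective L3 (two_ne_zero (α := ℝ)) h2

theorem smul_unitVec (v : E3) : ‖v‖ • unitVec v = v := by
  rcases eq_or_ne v 0 with rfl | hv
  · simp
  · rw [unitVec, smul_smul, mul_inv_cancel₀ (norm_ne_zero_iff.2 hv), one_smul]

theorem isRot_frame {b3 b1 : E3} (h3 : ‖b3‖ = 1) (h : b3 ×ᵥ b1 ≠ 0) :
    IsRot (ofColumns (-unitVec (b3 ×ᵥ (b3 ×ᵥ b1))) (unitVec (b3 ×ᵥ b1)) b3) := by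
  have h4 : ‖b3 ×ᵥ (b3 ×ᵥ b1)‖ = ‖b3 ×ᵥ b1‖ := norm_cross_of_orth h3 (inner_cross_self_left _ _)
  have h5 : -unitVec (b3 ×ᵥ (b3 ×ᵥ b1)) = unitVec (b3 ×ᵥ b1) ×ᵥ b3 := by
    rw [unitVec, unitVec, h4, smul_cross, ← smul_neg, ← cross_comm]
  rw [h5]
  refine isRot_ofColumns (norm_unitVec h) h3 ?_
  rw [unitVec, real_inner_comm, inner_smul_right, inner_cross_self_left, mul_zero]

theorem isRot_RDes {P : Params} {ref : Reference} {j : Fin 2} {p : ℝ × Mech}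
    (h1 : uDes P ref j p.1 p.2 ≠ 0) (h2 : b3Des P ref j p.1 p.2 ×ᵥ ref.b1 j p.1 ≠ 0) :
    IsRot (RDes P ref j p) := isRot_frame (norm_unitVec h1) h2

theorem RDes_apply_e2 (P : Params) (ref : Reference) (j : Fin 2) (p : ℝ × Mech) :
    RDes P ref j p (e 2) = b3Des P ref j p.1 p.2 := by
  rw [RDes, ofColumns_apply]
  simp [e]

theorem cross_cross_of_norm_one {q v : E3} (hq : ‖q‖ = 1) :
    q ×ᵥ (q ×ᵥ v) = inner ℝ q v • q - v := by
  rw [cross_cross, real_inner_self_eq_norm_sq, hq]; simp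

/-! ### The nominal closed loop -/

section Nominal

variable {P : Params} {ref : Reference} {t : ℝ} {s : Mech}

theorem mu_eq (j : Fin 2) (hq : ‖s.qc j‖ = 1) :
    mu P ref j t s.1 = inner ℝ (s.qc j) (muDes P ref j t s.rod) • s.qc j := by
  rw [mu, cross_cross_of_norm_one hq]
  abel

/-- The tensions for the thrusts `uDes`. -/
def nomTension (P : Params) (ref : Reference) (t : ℝ) (s : Mech) (j : Fin 2) : ℝ :=
  -inner ℝ (s.qc j) (muDes P ref j t s.rod)

theorem rodAcc_nomTension (hq : ∀ j, ‖s.qc j‖ = 1) :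
    rodAcc P (nomTension P ref t s) s = nomAcc P ref t s.1 := by
  rw [nomAcc, mu_eq 0 (hq 0), mu_eq 1 (hq 1), rodAcc]
  simp [nomTension, Fin.sum_univ_two, neg_smul]

theorem rodAngAcc_nomTension (hq : ∀ j, ‖s.qc j‖ = 1) :
    rodAngAcc P (nomTension P ref t s) s = nomAngAcc P ref t s.1 := by
  rw [nomAngAcc, mu_eq 0 (hq 0), mu_eq 1 (hq 1), rodAngAcc, ← smul_neg, ← cross_neg]
  simp only [nomTension, Fin.sum_univ_two, sgn]
  congr 2
  simp
  module

theorem endAcc_nomTension (hq : ∀ j, ‖s.qc j‖ = 1) (j : Fin 2) :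
    endAcc P (nomTension P ref t s) s j = nomEndAcc P ref j t s + P.grav • e 2 := by
  rw [endAcc, rodAcc_nomTension hq, rodAngAcc_nomTension hq, nomEndAcc]

theorem isUnit_det_tensionMatrix (P : Params) (s : Mech) : IsUnit (tensionMatrix P s).det :=
  (tensionMatrix_posDef P s).det_pos.ne'.isUnit

theorem inelasticTension_eq {u : Fin 2 → E3} {T : Fin 2 → ℝ}
    (h : ∀ j, P.Lc * ‖s.wc j‖ ^ 2 + inner ℝ (s.qc j) (endAcc P T s j - P.mQ⁻¹ • u j)
      - P.mQ⁻¹ * T j = 0) : inelasticTension P u s = T := by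
  have h1 : (fun j => P.Lc * ‖s.wc j‖ ^ 2 + inner ℝ (s.qc j) (endAcc P 0 s j - P.mQ⁻¹ • u j))
      = (tensionMatrix P s).mulVec T := by
    ext j
    have h2 := residual_eq P s T j (P.mQ⁻¹ • u j)
    have h3 := h j
    linarith
  rw [inelasticTension, h1, Matrix.mulVec_mulVec,
    Matrix.nonsing_inv_mul _ (isUnit_det_tensionMatrix P s), Matrix.one_mulVec]

theorem inelasticTension_uDes (hq : ∀ j, ‖s.qc j‖ = 1) :
    inelasticTension P (fun j => uDes P ref j t s) s = nomTension P ref t s := by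
  refine inelasticTension_eq fun j => ?_
  have hm := P.mQ_pos.ne'
  rw [endAcc_nomTension hq, inner_sub_right, inner_smul_right]
  have h1 : inner ℝ (s.qc j) (uPerp P ref j t s) = 0 := by
    rw [uPerp, inner_sub_right, inner_neg_right, inner_smul_right, inner_smul_right,
      inner_cross_self_left, inner_cross_self_left]
    simp
  have h2 : inner ℝ (s.qc j) (s.qc j) = (1 : ℝ) := by
    rw [real_inner_self_eq_norm_sq, hq]; norm_num
  rw [uDes, inner_add_right (s.qc j) (uPar P ref j t s), h1, uPar,
    inner_add_right (s.qc j) (mu P ref j t s.1), mu_eq j (hq j), inner_smul_right,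
    inner_smul_right, inner_add_right (s.qc j) (inner ℝ _ _ • _), inner_smul_right,
    inner_smul_right, h2, nomTension]
  field_simp
  ring

theorem mulVec_inv_sub (u u' : Fin 2 → E3) (j : Fin 2) :
    inelasticTension P u s j - inelasticTension P u' s j =
      -P.mQ⁻¹ * ∑ i, (tensionMatrix P s)⁻¹ j i * inner ℝ (s.qc i) (u i - u' i) := by
  simp only [inelasticTension, Matrix.mulVec, dotProduct, Fin.sum_univ_two, inner_sub_right,
    inner_smul_right]
  ring

theorem one_apply_e3 (v : E3) : (1 : L3) v = v := rfl

theorem thrust_sub_uDes {R : Fin 2 → L3} {j : Fin 2} (hR : IsRot (R j))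
    (hRd : IsRot (RDes P ref j (t, s))) :
    thrust P ref t s R j - uDes P ref j t s = ‖uDes P ref j t s‖ • (R j (e 2) ×ᵥ
      R j (e 2 ×ᵥ ((ContinuousLinearMap.adjoint (R j) ∘L RDes P ref j (t, s) - 1) (e 2)))) := by
  have h1 : ‖R j (e 2)‖ = 1 := by rw [hR.norm_apply]; simp [e]
  have h2 : thrust P ref t s R j - uDes P ref j t s
      = R j (e 2) ×ᵥ (R j (e 2) ×ᵥ uDes P ref j t s) := by
    rw [cross_cross_of_norm_one h1, thrust, real_inner_comm]
  have h3 : R j (e 2) ×ᵥ RDes P ref j (t, s) (e 2) = R j (e 2 ×ᵥ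
      ((ContinuousLinearMap.adjoint (R j) ∘L RDes P ref j (t, s) - 1) (e 2))) := by
    rw [sub_apply, cross_sub, one_apply_e3, cross_self, sub_zero, hR.map_cross,
      ContinuousLinearMap.comp_apply, hR.apply_adjoint]
  rw [h2, ← h3, RDes_apply_e2, b3Des, ← cross_smul, ← cross_smul, smul_unitVec]

theorem nominal_cableAngAcc (j : Fin 2) (hq : ‖s.qc j‖ = 1) (hw : inner ℝ (s.wc j) (s.qc j) = 0) :
    P.Lc⁻¹ • (s.qc j ×ᵥ (nomEndAcc P ref j t s + P.grav • e 2 - P.mQ⁻¹ • uDes P ref j t s)) =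
      -(s.qc j ×ᵥ (s.qc j ×ᵥ wDesDot P ref j t s))
      + inner ℝ (s.qc j) (wDes P ref j (t, s.1)) • (s.qc j ×ᵥ s.wc j)
      - P.kqc j • errQ (qDes P ref j (t, s.rod)) (s.qc j)
      - P.kwc j • errW (wDes P ref j (t, s.1)) (s.qc j) (s.wc j) := by
  have hm := P.mQ_pos.ne'
  have hL := P.Lc_pos.ne'
  have hx : ∀ v, s.qc j ×ᵥ (s.qc j ×ᵥ (s.qc j ×ᵥ v)) = -(s.qc j ×ᵥ v) := fun v => by
    rw [cross_cross_of_norm_one hq, inner_cross_self_left]; simp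
  have h1 : s.qc j ×ᵥ uPar P ref j t s = 0 := by
    rw [uPar, mu_eq j hq]
    simp [cross_add, cross_smul]
  have h2 : ∀ v, inner ℝ (s.qc j) v = 0 → s.qc j ×ᵥ (s.qc j ×ᵥ v) = -v := fun v hv => by
    rw [cross_cross_of_norm_one hq, hv]; simp
  have e1 : inner ℝ (s.qc j) (errQ (qDes P ref j (t, s.rod)) (s.qc j)) = (0 : ℝ) :=
    inner_cross_self_right _ _
  have e2 : inner ℝ (s.qc j) (errW (wDes P ref j (t, s.1)) (s.qc j) (s.wc j)) = (0 : ℝ) := by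
    rw [errW, inner_add_right, inner_cross_self_left, real_inner_comm, hw, add_zero]
  have h3 : s.qc j ×ᵥ uPerp P ref j t s = P.mQ • (s.qc j ×ᵥ (nomEndAcc P ref j t s + P.grav • e 2
        + P.Lc • (s.qc j ×ᵥ wDesDot P ref j t s)
        - (P.Lc * inner ℝ (s.qc j) (wDes P ref j (t, s.1))) • s.wc j))
      + (P.mQ * P.Lc) • (P.kqc j • errQ (qDes P ref j (t, s.rod)) (s.qc j)
        + P.kwc j • errW (wDes P ref j (t, s.1)) (s.qc j) (s.wc j)) := by
    rw [uPerp, cross_sub, cross_neg, cross_smul, cross_smul, hx,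
      h2 _ (by rw [inner_add_right, inner_smul_right, inner_smul_right, e1, e2]; simp)]
    simp only [smul_neg, neg_neg, sub_neg_eq_add]
  rw [cross_sub, cross_smul, uDes, cross_add _ (uPar P ref j t s), h1, h3]
  simp only [cross_sub, cross_add, cross_smul, smul_sub, smul_add, smul_smul, zero_add]
  have a1 : P.mQ⁻¹ * P.mQ = 1 := inv_mul_cancel₀ hm
  have a2 : P.Lc⁻¹ * (P.mQ⁻¹ * P.mQ) = P.Lc⁻¹ := by rw [a1, mul_one]
  match_scalars <;> field_simp <;> ring

end Nominal

end RodTransport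
end

noncomputable section
namespace RodTransport

/-! ### Functions controlled by an error, in terms of pairs of points -/

section Coupled

variable {E F G H : Type*} [NormedAddCommGroup E] [NormedAddCommGroup F]
  [NormedSpace ℝ F] [NormedAddCommGroup G] [NormedSpace ℝ G] [NormedAddCommGroup H]
  [NormedSpace ℝ H] {S : Set (ℝ × E)} {err : ℝ × E → ℝ} {N N' : ℝ → E → E → ℝ}

/-- Bounded, and Lipschitz in the state. -/
structure BddLip (S : Set (ℝ × E)) (φ : ℝ × E → F) : Prop where
  bdd : ∃ C, 0 ≤ C ∧ ∀ p ∈ S, ‖φ p‖ ≤ C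
  lip : ∃ L, 0 ≤ L ∧ ∀ t X Y, (t, X) ∈ S → (t, Y) ∈ S → ‖φ (t, X) - φ (t, Y)‖ ≤ L * ‖X - Y‖

/-- Bounded by a multiple of the error. -/
def Small (S : Set (ℝ × E)) (err : ℝ × E → ℝ) (φ : ℝ × E → F) : Prop :=
  ∃ C, 0 ≤ C ∧ ∀ p ∈ S, ‖φ p‖ ≤ C * err p

/-- Bounded by a multiple of the error, and with increments in the state that are controlled by
`N` up to a small multiple of the distance. -/
structure Coupled (S : Set (ℝ × E)) (err : ℝ × E → ℝ) (N : ℝ → E → E → ℝ)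
    (φ : ℝ × E → F) : Prop where
  small : Small S err φ
  diff : ∃ C, 0 ≤ C ∧ ∀ t X Y, (t, X) ∈ S → (t, Y) ∈ S →
    ‖φ (t, X) - φ (t, Y)‖ ≤ C * (N t X Y + (err (t, X) + err (t, Y)) * ‖X - Y‖)

theorem Small.congr {φ ψ : ℝ × E → F} (h : Small S err φ) (he : ∀ p ∈ S, φ p = ψ p) :
    Small S err ψ := by
  obtain ⟨C, hC, h⟩ := h
  exact ⟨C, hC, fun p hp => he p hp ▸ h p hp⟩

theorem Coupled.congr {φ ψ : ℝ × E → F} (h : Coupled S err N φ) (he : ∀ p ∈ S, φ p = ψ p) :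
    Coupled S err N ψ := by
  obtain ⟨C, hC, hd⟩ := h.diff
  exact ⟨h.small.congr he, C, hC, fun t X Y hX hY => by
    rw [← he _ hX, ← he _ hY]; exact hd t X Y hX hY⟩

theorem Coupled.mono {φ : ℝ × E → F} (h : Coupled S err N φ)
    (hN : ∀ t X Y, N t X Y ≤ N' t X Y) : Coupled S err N' φ := by
  obtain ⟨C, hC, hd⟩ := h.diff
  exact ⟨h.small, C, hC, fun t X Y hX hY => (hd t X Y hX hY).trans
    (mul_le_mul_of_nonneg_left (by have := hN t X Y; linarith) hC)⟩

theorem Small.bilin {φ : ℝ × E → F} {ψ : ℝ × E → G} {B : F × G → H}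
    (hB : IsBoundedBilinearMap ℝ B) (hφ : BddLip S φ) (hψ : Small S err ψ) :
    Small S err (fun p => B (φ p, ψ p)) := by
  obtain ⟨K, hK, hKb⟩ := hB.bound
  obtain ⟨C, hC, h1⟩ := hφ.bdd
  obtain ⟨D, hD, h2⟩ := hψ
  refine ⟨K * C * D, by positivity, fun p hp => (hKb _ _).trans ?_⟩
  calc K * ‖φ p‖ * ‖ψ p‖ ≤ K * C * (D * err p) := by
        gcongr
        · exact h1 p hp
        · exact h2 p hp
    _ = K * C * D * err p := by ring

theorem Coupled.bilin {φ : ℝ × E → F} {ψ : ℝ × E → G} {B : F × G → H}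
    (hB : IsBoundedBilinearMap ℝ B) (herr : ∀ p, 0 ≤ err p) (hN : ∀ t X Y, 0 ≤ N t X Y)
    (hφ : BddLip S φ) (hψ : Coupled S err N ψ) :
    Coupled S err N (fun p => B (φ p, ψ p)) := by
  refine ⟨hψ.small.bilin hB hφ, ?_⟩
  obtain ⟨K, hK, hKb⟩ := hB.bound
  obtain ⟨C, hC, h1⟩ := hφ.bdd
  obtain ⟨L, hL, h1'⟩ := hφ.lip
  obtain ⟨D, hD, h2⟩ := hψ.small
  obtain ⟨D', hD', h2'⟩ := hψ.diff
  refine ⟨K * C * D' + K * L * D, by positivity, fun t X Y hX hY => ?_⟩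
  have e1 : B (φ (t, X), ψ (t, X)) - B (φ (t, Y), ψ (t, Y)) =
      B (φ (t, X), ψ (t, X) - ψ (t, Y)) + B (φ (t, X) - φ (t, Y), ψ (t, Y)) := by
    rw [hB.map_sub_right, hB.map_sub_left]; abel
  have hx := herr (t, X)
  have hy := herr (t, Y)
  have hn := hN t X Y
  rw [e1]
  refine (norm_add_le _ _).trans ((add_le_add (hKb _ _) (hKb _ _)).trans ?_)
  calc K * ‖φ (t, X)‖ * ‖ψ (t, X) - ψ (t, Y)‖ + K * ‖φ (t, X) - φ (t, Y)‖ * ‖ψ (t, Y)‖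
      ≤ K * C * (D' * (N t X Y + (err (t, X) + err (t, Y)) * ‖X - Y‖))
        + K * (L * ‖X - Y‖) * (D * (N t X Y * 0 + err (t, Y))) := by
        gcongr
        · exact h1 _ hX
        · exact h2' t X Y hX hY
        · exact h1' t X Y hX hY
        · rw [mul_zero, zero_add]; exact h2 _ hY
    _ ≤ (K * C * D' + K * L * D) * (N t X Y + (err (t, X) + err (t, Y)) * ‖X - Y‖) := by
        have : 0 ≤ K * L * D * (N t X Y + err (t, X) * ‖X - Y‖) := by positivity
        nlinarith

theorem BddLip.coupled_mul {φ : ℝ × E → F} {ψ : ℝ × E → G} {B : F × G → H}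
    (hB : IsBoundedBilinearMap ℝ B) (herr : ∀ p, 0 ≤ err p) (hφ : BddLip S φ) (hψ : BddLip S ψ)
    (sφ : Small S err φ) (sψ : Small S err ψ) :
    Coupled S err (fun _ _ _ => 0) (fun p => B (φ p, ψ p)) := by
  refine ⟨sψ.bilin hB hφ, ?_⟩
  obtain ⟨K, hK, hKb⟩ := hB.bound
  obtain ⟨L, hL, h1⟩ := hφ.lip
  obtain ⟨L', hL', h2⟩ := hψ.lip
  obtain ⟨C, hC, h3⟩ := sφ
  obtain ⟨C', hC', h4⟩ := sψ
  refine ⟨K * C * L' + K * L * C', by positivity, fun t X Y hX hY => ?_⟩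
  have e1 : B (φ (t, X), ψ (t, X)) - B (φ (t, Y), ψ (t, Y)) =
      B (φ (t, X), ψ (t, X) - ψ (t, Y)) + B (φ (t, X) - φ (t, Y), ψ (t, Y)) := by
    rw [hB.map_sub_right, hB.map_sub_left]; abel
  have hx := herr (t, X)
  have hy := herr (t, Y)
  rw [e1]
  refine (norm_add_le _ _).trans ((add_le_add (hKb _ _) (hKb _ _)).trans ?_)
  calc K * ‖φ (t, X)‖ * ‖ψ (t, X) - ψ (t, Y)‖ + K * ‖φ (t, X) - φ (t, Y)‖ * ‖ψ (t, Y)‖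
      ≤ K * (C * err (t, X)) * (L' * ‖X - Y‖) + K * (L * ‖X - Y‖) * (C' * err (t, Y)) := by
        gcongr
        · exact h3 _ hX
        · exact h2 t X Y hX hY
        · exact h1 t X Y hX hY
        · exact h4 _ hY
    _ ≤ (K * C * L' + K * L * C') * (0 + (err (t, X) + err (t, Y)) * ‖X - Y‖) := by
        have a1 : 0 ≤ K * C * L' * err (t, Y) * ‖X - Y‖ := by positivity
        have a2 : 0 ≤ K * L * C' * err (t, X) * ‖X - Y‖ := by positivity
        nlinarith

theorem Coupled.of_small {φ : ℝ × E → F} (h : BddLip S φ) (hs : Small S err φ)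
    (herr : ∀ p, 0 ≤ err p) : Coupled S err (fun t X Y => ‖φ (t, X) - φ (t, Y)‖) φ :=
  ⟨hs, 1, zero_le_one, fun t X Y _ _ => by
    have hx := herr (t, X)
    have hy := herr (t, Y)
    rw [one_mul]
    have : 0 ≤ (err (t, X) + err (t, Y)) * ‖X - Y‖ := by positivity
    linarith⟩

theorem Small.clm {φ : ℝ × E → F} (A : F →L[ℝ] G) (h : Small S err φ) :
    Small S err (fun p => A (φ p)) := by
  obtain ⟨C, hC, h⟩ := h
  refine ⟨‖A‖ * C, by positivity, fun p hp => (A.le_opNorm _).trans ?_⟩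
  rw [mul_assoc]
  exact mul_le_mul_of_nonneg_left (h p hp) (norm_nonneg _)

theorem Coupled.clm {φ : ℝ × E → F} (A : F →L[ℝ] G) (h : Coupled S err N φ) :
    Coupled S err N (fun p => A (φ p)) := by
  obtain ⟨C, hC, hd⟩ := h.diff
  refine ⟨h.small.clm A, ‖A‖ * C, by positivity, fun t X Y hX hY => ?_⟩
  rw [← map_sub, mul_assoc]
  exact (A.le_opNorm _).trans (mul_le_mul_of_nonneg_left (hd t X Y hX hY) (norm_nonneg _))

theorem Small.prodMk {φ : ℝ × E → F} {ψ : ℝ × E → G} (h : Small S err φ) (h' : Small S err ψ)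
    (herr : ∀ p, 0 ≤ err p) : Small S err (fun p => (φ p, ψ p)) := by
  obtain ⟨C, hC, h⟩ := h
  obtain ⟨C', hC', h'⟩ := h'
  refine ⟨C + C', by positivity, fun p hp => ?_⟩
  have := herr p
  rw [Prod.norm_mk, add_mul]
  exact max_le ((h p hp).trans (le_add_of_nonneg_right (by positivity)))
    ((h' p hp).trans (le_add_of_nonneg_left (by positivity)))

theorem Coupled.prodMk {φ : ℝ × E → F} {ψ : ℝ × E → G} (h : Coupled S err N φ)
    (h' : Coupled S err N ψ) (herr : ∀ p, 0 ≤ err p) (hN : ∀ t X Y, 0 ≤ N t X Y) :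
    Coupled S err N (fun p => (φ p, ψ p)) := by
  refine ⟨h.small.prodMk h'.small herr, ?_⟩
  obtain ⟨C, hC, h⟩ := h.diff
  obtain ⟨C', hC', h'⟩ := h'.diff
  refine ⟨C + C', by positivity, fun t X Y hX hY => ?_⟩
  have hx := herr (t, X)
  have hy := herr (t, Y)
  have hn := hN t X Y
  rw [Prod.mk_sub_mk, Prod.norm_mk, add_mul]
  exact max_le ((h t X Y hX hY).trans (le_add_of_nonneg_right (by positivity)))
    ((h' t X Y hX hY).trans (le_add_of_nonneg_left (by positivity)))

theorem Coupled.add {φ ψ : ℝ × E → F} (h : Coupled S err N φ)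
    (h' : Coupled S err N ψ) (herr : ∀ p, 0 ≤ err p) (hN : ∀ t X Y, 0 ≤ N t X Y) :
    Coupled S err N (fun p => φ p + ψ p) :=
  (h.prodMk h' herr hN).clm (ContinuousLinearMap.fst ℝ F F + ContinuousLinearMap.snd ℝ F F)

theorem Small.add {φ ψ : ℝ × E → F} (h : Small S err φ)
    (h' : Small S err ψ) (herr : ∀ p, 0 ≤ err p) : Small S err (fun p => φ p + ψ p) :=
  (h.prodMk h' herr).clm (ContinuousLinearMap.fst ℝ F F + ContinuousLinearMap.snd ℝ F F)

theorem Small.sub {φ ψ : ℝ × E → F} (h : Small S err φ)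
    (h' : Small S err ψ) (herr : ∀ p, 0 ≤ err p) : Small S err (fun p => φ p - ψ p) :=
  (h.prodMk h' herr).clm (ContinuousLinearMap.fst ℝ F F - ContinuousLinearMap.snd ℝ F F)

end Coupled

theorem BddSmoothOn.bddLip {E F : Type*} [NormedAddCommGroup E] [NormedSpace ℝ E]
    [NormedAddCommGroup F] [NormedSpace ℝ F] {φ : ℝ × E → F} {t₀ : ℝ} {c : ℝ → E} {ρ : ℝ}
    (h : BddSmoothOn φ (tube t₀ c ρ)) {S : Set (ℝ × E)} (hS : S ⊆ tube t₀ c ρ) : BddLip S φ := by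
  constructor
  · obtain ⟨C, hC⟩ := h.bdd_val
    exact ⟨max C 0, le_max_right _ _, fun p hp => (hC p (hS hp)).trans (le_max_left _ _)⟩
  · obtain ⟨L, hL, h⟩ := h.toBddDerivOn.exists_lipschitz_tube
    exact ⟨L, hL, fun t X Y hX hY => h t X Y (hS hX) (hS hY)⟩

attribute [local irreducible] muDes uDes b3Des RDes OmDes qDes wDes thrust relAtt errR errOm moment
  OmDesDot wDesDot desired RodTransport.h

/-! ### Tubes on which all the controls are smooth -/

/-- All the functions that make up the controls are smooth, with bounded derivatives, on the tube
of radius `ρ` around `x`, and the controls are defined there with a margin. -/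
structure GoodTube (P : Params) (ref : Reference) (t₀ : ℝ) (x : ℝ → Slow) (ρ : ℝ) : Prop where
  href : ref.Admissible t₀
  pos : 0 < ρ
  margin : ∃ c, 0 < c ∧ ∀ p ∈ tube t₀ x ρ, MarginAtLeast P ref c p.1 p.2
  qDes₀ : ∀ j, BddSmoothOn (qDes P ref j) (tube t₀ (fun t => (x t).mech.rod) ρ)
  wDes₀ : ∀ j, BddSmoothOn (wDes P ref j) (tube t₀ (fun t => (x t).mech.1) ρ)
  RDes₀ : ∀ j, BddSmoothOn (RDes P ref j) (tube t₀ (fun t => (x t).mech) ρ)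
  OmDes₀ : ∀ j, BddSmoothOn (OmDes P ref j) (tube t₀ (fun t => (x t).1) ρ)
  uDes₀ : ∀ j, BddSmoothOn (fun p : ℝ × Mech => uDes P ref j p.1 p.2)
    (tube t₀ (fun t => (x t).mech) ρ)
  muDes₀ : ∀ j, BddSmoothOn (fun p : ℝ × Rod => muDes P ref j p.1 p.2)
    (tube t₀ (fun t => (x t).mech.rod) ρ)
  thrust₀ : ∀ j, BddSmoothOn (fun p : ℝ × (Mech × (Fin 2 → L3)) => thrust P ref p.1 p.2.1 p.2.2 j)
    (tube t₀ (fun t => (x t).1) ρ)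
  rod_pos₀ : BddSmoothOn (fun p : ℝ × Rod => p.2.x - ref.xd p.1)
    (tube t₀ (fun t => (x t).mech.rod) ρ)
  rod_v₀ : BddSmoothOn (fun p : ℝ × Rod => p.2.v) (tube t₀ (fun t => (x t).mech.rod) ρ)
  rod_q₀ : BddSmoothOn (fun p : ℝ × Rod => p.2.q) (tube t₀ (fun t => (x t).mech.rod) ρ)
  rod_w₀ : BddSmoothOn (fun p : ℝ × Rod => p.2.w) (tube t₀ (fun t => (x t).mech.rod) ρ)
  qc₀ : ∀ j, BddSmoothOn (fun p : ℝ × Conf => p.2.2 j) (tube t₀ (fun t => (x t).mech.1) ρ)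
  wc₀ : ∀ j, BddSmoothOn (fun p : ℝ × Mech => p.2.wc j) (tube t₀ (fun t => (x t).mech) ρ)
  att₀ : ∀ j, BddSmoothOn (fun p : ℝ × (Mech × (Fin 2 → L3)) => p.2.2 j)
    (tube t₀ (fun t => (x t).1) ρ)
  om : ∀ j, BddSmoothOn (fun p : ℝ × Slow => p.2.om j) (tube t₀ x ρ)
  relAtt : ∀ j, BddSmoothOn (fun p : ℝ × Slow => relAtt P ref j p.1 p.2) (tube t₀ x ρ)
  errR : ∀ j, BddSmoothOn (fun p : ℝ × Slow => errR P ref j p.1 p.2) (tube t₀ x ρ)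
  errOm : ∀ j, BddSmoothOn (fun p : ℝ × Slow => errOm P ref j p.1 p.2) (tube t₀ x ρ)
  moment : ∀ j, BddSmoothOn (fun p : ℝ × Slow => moment P ref j p.1 p.2) (tube t₀ x ρ)
  root : BddSmoothOn (fun p : ℝ × Slow => RodTransport.h P ref p.1 p.2) (tube t₀ x ρ)
  desired : BddSmoothOn (fun p : ℝ × Slow => p.2 - desired P ref p.1 p.2) (tube t₀ x ρ)

section

variable {E F G : Type*} [NormedAddCommGroup E] [NormedSpace ℝ E] [NormedAddCommGroup F]
  [NormedSpace ℝ F] [NormedAddCommGroup G] [NormedSpace ℝ G]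

end

theorem att_mem_tube {t₀ : ℝ} {x : ℝ → Slow} {ρ t : ℝ} {X : Slow} (hp : (t, X) ∈ tube t₀ x ρ) :
    (t, X.1) ∈ tube t₀ (fun t => (x t).1) ρ :=
  ⟨hp.1, (norm_fst_le (X - x t)).trans hp.2⟩

theorem mech_mem_tube {t₀ : ℝ} {x : ℝ → Slow} {ρ t : ℝ} {X : Slow} (hp : (t, X) ∈ tube t₀ x ρ) :
    (t, X.mech) ∈ tube t₀ (fun t => (x t).mech) ρ :=
  ⟨hp.1, (norm_fst_le (X.1 - (x t).1)).trans (att_mem_tube hp).2⟩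

theorem conf_mem_tube {t₀ : ℝ} {x : ℝ → Slow} {ρ t : ℝ} {X : Slow} (hp : (t, X) ∈ tube t₀ x ρ) :
    (t, X.mech.1) ∈ tube t₀ (fun t => (x t).mech.1) ρ :=
  ⟨hp.1, (norm_fst_le (X.mech - (x t).mech)).trans (mech_mem_tube hp).2⟩

theorem rod_mem_tube {t₀ : ℝ} {x : ℝ → Slow} {ρ t : ℝ} {X : Slow} (hp : (t, X) ∈ tube t₀ x ρ) :
    (t, X.mech.rod) ∈ tube t₀ (fun t => (x t).mech.rod) ρ :=
  ⟨hp.1, (norm_fst_le (X.mech.1 - (x t).mech.1)).trans (conf_mem_tube hp).2⟩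

theorem TubeSmooth.eventually_le_norm {E F : Type*} [NormedAddCommGroup E] [NormedSpace ℝ E]
    [NormedAddCommGroup F] [NormedSpace ℝ F] {t₀ : ℝ} {x : ℝ → E} {c : ℝ} (hc : 0 < c)
    {φ : Fin 2 → ℝ → E → F} (h : ∀ j, TubeSmooth t₀ x (fun p : ℝ × E => φ j p.1 p.2))
    (hm : ∀ j t, t₀ ≤ t → c ≤ ‖φ j t (x t)‖) :
    ∀ᶠ ρ in 𝓝[>] (0 : ℝ), ∀ p ∈ tube t₀ x ρ, ∀ j, c / 2 ≤ ‖φ j p.1 p.2‖ := by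
  filter_upwards [eventually_all.2 fun j =>
    TubeSmooth.lower_bound (φ := fun p : ℝ × E => φ j p.1 p.2) (h j) hc (hm j)] with ρ h p hp j
    using h j p hp

theorem GoodCurve.norm_ge {P : Params} {ref : Reference} {t₀ : ℝ} {x : ℝ → Slow}
    (h : GoodCurve P ref t₀ x) : ∃ c, 0 < c ∧
      (∀ j t, t₀ ≤ t → c ≤ ‖RodTransport.muDes P ref j t (x t).mech.rod‖) ∧
      (∀ j t, t₀ ≤ t → c ≤ ‖RodTransport.uDes P ref j t (x t).mech‖) ∧
      ∀ j t, t₀ ≤ t → c ≤ ‖RodTransport.b3Des P ref j t (x t).mech ×ᵥ ref.b1 j t‖ := by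
  obtain ⟨c, hc, hm⟩ := h.margin
  exact ⟨c, hc, fun j t ht => (hm t ht j).1, fun j t ht => (hm t ht j).2.1,
    fun j t ht => (hm t ht j).2.2⟩

theorem GoodCurve.b3Des_cross {P : Params} {ref : Reference} {t₀ : ℝ} {x : ℝ → Slow}
    (h : GoodCurve P ref t₀ x) (j : Fin 2) :
    TubeSmooth t₀ (fun t => (x t).mech)
      (fun p : ℝ × Mech => RodTransport.b3Des P ref j p.1 p.2 ×ᵥ ref.b1 j p.1) := by
  have h1 : TubeSmooth t₀ (fun t => (x t).mech) (fun p : ℝ × Mech => ref.b1 j p.1) :=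
    tubeSmooth_time (h.href.bddSmoothOn_b1 j)
  filter_upwards [h.b3Des j, h1] with ρ h2 h3 using h2.cross h3

theorem eventually_marginAtLeast {P : Params} {ref : Reference} {t₀ : ℝ} {x : ℝ → Slow}
    (h : GoodCurve P ref t₀ x) : ∃ c, 0 < c ∧ ∀ᶠ ρ in 𝓝[>] (0 : ℝ), ∀ p ∈ tube t₀ x ρ,
      MarginAtLeast P ref c p.1 p.2 := by
  obtain ⟨c, hc, m1, m2, m3⟩ := h.norm_ge
  refine ⟨c / 2, by positivity, ?_⟩
  have h1 := TubeSmooth.eventually_le_norm hc h.muDes m1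
  have h2 := TubeSmooth.eventually_le_norm hc h.uDes m2
  have h3 := TubeSmooth.eventually_le_norm
    (φ := fun j t s => b3Des P ref j t s ×ᵥ ref.b1 j t) hc h.b3Des_cross m3
  refine (h1.and (h2.and h3)).mono fun ρ hρ => ?_
  obtain ⟨m1, m2, m3⟩ := hρ
  rintro ⟨t, X⟩ hp j
  exact ⟨m1 (t, X.mech.rod) (rod_mem_tube hp) j, m2 (t, X.mech) (mech_mem_tube hp) j,
    m3 (t, X.mech) (mech_mem_tube hp) j⟩

theorem eventually_goodTube {P : Params} {ref : Reference} {t₀ : ℝ} {x : ℝ → Slow}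
    (h : GoodCurve P ref t₀ x) : ∀ᶠ ρ in 𝓝[>] (0 : ℝ), GoodTube P ref t₀ x ρ := by
  obtain ⟨c, hc, hm⟩ := eventually_marginAtLeast h
  filter_upwards [self_mem_nhdsWithin, hm, eventually_all.2 h.qDes, eventually_all.2 h.wDes,
    eventually_all.2 h.RDes, eventually_all.2 h.OmDes, eventually_all.2 h.uDes,
    eventually_all.2 h.muDes, eventually_all.2 h.thrust, h.rod_pos, h.rod_v, h.rod_q, h.rod_w,
    eventually_all.2 h.conf_qc, eventually_all.2 h.mech_wc, eventually_all.2 h.att,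
    eventually_all.2 h.om, eventually_all.2 h.relAtt, eventually_all.2 h.errR,
    eventually_all.2 h.errOm, eventually_all.2 h.moment, h.root, h.desired] with ρ hρ hm
    h1 h2 h3 h4 h5 h6 h7 h8 h9 h10 h11 h12 h13 h14 h15 h16 h17 h18 h19 h20 h21
  exact ⟨h.href, hρ, ⟨c, hc, hm⟩, h1, h2, h3, h4, h5, h6, h7,
    h8, h9, h10, h11, h12, h13, h14, h15, h16, h17, h18, h19, h20, h21⟩

end RodTransport
end

noncomputable section
namespace RodTransport

section BddLip

variable {E F G H : Type*} [NormedAddCommGroup E] [NormedAddCommGroup F]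
  [NormedSpace ℝ F] [NormedAddCommGroup G] [NormedSpace ℝ G] [NormedAddCommGroup H]
  [NormedSpace ℝ H] {S : Set (ℝ × E)} {err : ℝ × E → ℝ} {N : ℝ → E → E → ℝ}

theorem BddLip.clm {φ : ℝ × E → F} (A : F →L[ℝ] G) (h : BddLip S φ) :
    BddLip S (fun p => A (φ p)) := by
  obtain ⟨C, hC, hb⟩ := h.bdd
  obtain ⟨L, hL, hl⟩ := h.lip
  refine ⟨⟨‖A‖ * C, by positivity, fun p hp => A.le_opNorm_of_le (hb p hp)⟩, ‖A‖ * L,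
    by positivity, fun t X Y hX hY => ?_⟩
  rw [← map_sub, mul_assoc]
  exact A.le_opNorm_of_le (hl t X Y hX hY)

theorem BddLip.prodMk {φ : ℝ × E → F} {ψ : ℝ × E → G} (h : BddLip S φ) (h' : BddLip S ψ) :
    BddLip S (fun p => (φ p, ψ p)) := by
  obtain ⟨C, hC, hb⟩ := h.bdd
  obtain ⟨L, hL, hl⟩ := h.lip
  obtain ⟨C', hC', hb'⟩ := h'.bdd
  obtain ⟨L', hL', hl'⟩ := h'.lip
  refine ⟨⟨C + C', by positivity, fun p hp => ?_⟩, L + L', by positivity, fun t X Y hX hY => ?_⟩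
  · exact max_le ((hb p hp).trans (by linarith)) ((hb' p hp).trans (by linarith))
  · rw [Prod.mk_sub_mk, Prod.norm_mk, add_mul]
    exact max_le ((hl t X Y hX hY).trans (le_add_of_nonneg_right (by positivity)))
      ((hl' t X Y hX hY).trans (le_add_of_nonneg_left (by positivity)))

theorem BddLip.add {φ ψ : ℝ × E → F} (h : BddLip S φ) (h' : BddLip S ψ) :
    BddLip S (fun p => φ p + ψ p) :=
  (h.prodMk h').clm (ContinuousLinearMap.fst ℝ F F + ContinuousLinearMap.snd ℝ F F)

theorem BddLip.sub {φ ψ : ℝ × E → F} (h : BddLip S φ) (h' : BddLip S ψ) :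
    BddLip S (fun p => φ p - ψ p) :=
  (h.prodMk h').clm (ContinuousLinearMap.fst ℝ F F - ContinuousLinearMap.snd ℝ F F)

theorem BddLip.bilin {φ : ℝ × E → F} {ψ : ℝ × E → G} {B : F × G → H}
    (hB : IsBoundedBilinearMap ℝ B) (hφ : BddLip S φ) (hψ : BddLip S ψ) :
    BddLip S (fun p => B (φ p, ψ p)) := by
  obtain ⟨K, hK, hKb⟩ := hB.bound
  obtain ⟨C, hC, hb⟩ := hφ.bdd
  obtain ⟨L, hL, hl⟩ := hφ.lip
  obtain ⟨C', hC', hb'⟩ := hψ.bdd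
  obtain ⟨L', hL', hl'⟩ := hψ.lip
  refine ⟨⟨K * C * C', by positivity, fun p hp => (hKb _ _).trans ?_⟩, K * C * L' + K * L * C',
    by positivity, fun t X Y hX hY => ?_⟩
  · have := hb p hp
    have := hb' p hp
    gcongr
  · have e1 : B (φ (t, X), ψ (t, X)) - B (φ (t, Y), ψ (t, Y)) =
        B (φ (t, X), ψ (t, X) - ψ (t, Y)) + B (φ (t, X) - φ (t, Y), ψ (t, Y)) := by
      rw [hB.map_sub_right, hB.map_sub_left]; abel
    rw [e1]
    refine (norm_add_le _ _).trans ((add_le_add (hKb _ _) (hKb _ _)).trans ?_)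
    have h1 := hb _ hX
    have h2 := hb' _ hY
    have h3 := hl t X Y hX hY
    have h4 := hl' t X Y hX hY
    calc _ ≤ K * C * (L' * ‖X - Y‖) + K * (L * ‖X - Y‖) * C' := by gcongr
      _ = _ := by ring

theorem BddLip.congr {φ ψ : ℝ × E → F} (h : BddLip S φ) (he : ∀ p ∈ S, φ p = ψ p) :
    BddLip S ψ := by
  obtain ⟨C, hC, hb⟩ := h.bdd
  obtain ⟨L, hL, hl⟩ := h.lip
  exact ⟨⟨C, hC, fun p hp => he p hp ▸ hb p hp⟩, L, hL, fun t X Y hX hY => by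
    rw [← he _ hX, ← he _ hY]; exact hl t X Y hX hY⟩

theorem Coupled.zero (herr : ∀ p, 0 ≤ err p) (hN : ∀ t X Y, 0 ≤ N t X Y) :
    Coupled S err N (fun _ => (0 : F)) :=
  ⟨⟨0, le_rfl, fun p _ => by simp⟩, 0, le_rfl, fun t X Y _ _ => by simp⟩

theorem Coupled.of_mul {φ : ℝ × E → F} {ψ : ℝ × E → G} {B : F × G → H}
    (hB : IsBoundedBilinearMap ℝ B) (herr : ∀ p, 0 ≤ err p) (hN : ∀ t X Y, 0 ≤ N t X Y)
    (hφ : BddLip S φ) (hψ : BddLip S ψ)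
    (sφ : Small S err φ) (sψ : Small S err ψ) :
    Coupled S err N (fun p => B (φ p, ψ p)) :=
  (hφ.coupled_mul hB herr hψ sφ sψ).mono hN

theorem Coupled.sub {φ ψ : ℝ × E → F} (h : Coupled S err N φ)
    (h' : Coupled S err N ψ) (herr : ∀ p, 0 ≤ err p) (hN : ∀ t X Y, 0 ≤ N t X Y) :
    Coupled S err N (fun p => φ p - ψ p) :=
  (h.prodMk h' herr hN).clm (ContinuousLinearMap.fst ℝ F F - ContinuousLinearMap.snd ℝ F F)

/-- If `c` is orthogonal to `n`, then increments of `c` are nearly orthogonal to `n`. -/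
theorem inner_sub_smul_sub_le {c n : ℝ × E → E3} {α : ℝ × E → ℝ} (herr : ∀ p, 0 ≤ err p)
    (hc : BddLip S c)
    (hn : BddLip S n) (hα : BddLip S α) (sc : Small S err c) (sα : Small S err α)
    (h : ∀ p ∈ S, inner ℝ (c p) (n p) = 0) :
    ∃ C, 0 ≤ C ∧ ∀ t X Y, (t, X) ∈ S → (t, Y) ∈ S →
      |inner ℝ (c (t, X) - c (t, Y)) (α (t, X) • n (t, X) - α (t, Y) • n (t, Y))| ≤
        C * ((err (t, X) + err (t, Y)) * ‖X - Y‖ ^ 2) := by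
  obtain ⟨Lc, hLc, lc⟩ := hc.lip
  obtain ⟨Ln, hLn, ln⟩ := hn.lip
  obtain ⟨La, hLa, la⟩ := hα.lip
  obtain ⟨Cc, hCc, bc⟩ := sc
  obtain ⟨Ca, hCa, ba⟩ := sα
  refine ⟨Lc * Ca * Ln + La * Cc * Ln, by positivity, fun t X Y hX hY => ?_⟩
  have e1 : inner ℝ (c (t, X) - c (t, Y)) (α (t, X) • n (t, X) - α (t, Y) • n (t, Y)) =
      α (t, X) * inner ℝ (c (t, X) - c (t, Y)) (n (t, X) - n (t, Y))
      - (α (t, X) - α (t, Y)) * inner ℝ (c (t, X)) (n (t, X) - n (t, Y)) := by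
    have h1 := h _ hX
    have h2 := h _ hY
    simp only [inner_sub_left, inner_sub_right, inner_smul_right]
    rw [h1, h2]; ring
  have hx := herr (t, X)
  have hy := herr (t, Y)
  rw [e1]
  refine (abs_sub _ _).trans ?_
  rw [abs_mul, abs_mul]
  have a1 := ba _ hX
  rw [Real.norm_eq_abs] at a1
  have a2 := la t X Y hX hY
  rw [Real.norm_eq_abs] at a2
  calc |α (t, X)| * |inner ℝ (c (t, X) - c (t, Y)) (n (t, X) - n (t, Y))|
        + |α (t, X) - α (t, Y)| * |inner ℝ (c (t, X)) (n (t, X) - n (t, Y))|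
      ≤ |α (t, X)| * (‖c (t, X) - c (t, Y)‖ * ‖n (t, X) - n (t, Y)‖)
        + |α (t, X) - α (t, Y)| * (‖c (t, X)‖ * ‖n (t, X) - n (t, Y)‖) := by
        gcongr <;> exact abs_real_inner_le_norm _ _
    _ ≤ (Ca * err (t, X)) * ((Lc * ‖X - Y‖) * (Ln * ‖X - Y‖))
        + (La * ‖X - Y‖) * ((Cc * err (t, X)) * (Ln * ‖X - Y‖)) := by
        have b1 := lc t X Y hX hY
        have b2 := ln t X Y hX hY
        have b3 := bc _ hX
        gcongr
    _ ≤ _ := by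
        have : 0 ≤ (Lc * Ca * Ln + La * Cc * Ln) * (err (t, Y) * ‖X - Y‖ ^ 2) := by positivity
        nlinarith

end BddLip

/-! ### Oscillators -/

section Osc

variable {E : Type*} [NormedAddCommGroup E] [NormedSpace ℝ E] {S : Set (ℝ × E)} {F : ℝ × E → E}
  {err : ℝ × E → ℝ} {N : ℝ → E → E → ℝ}

/-- `a₁` is the derivative of `a` along the vector field `F`, and the derivative of `a` is
bounded. -/
def HasFlowDeriv (S : Set (ℝ × E)) (F : ℝ × E → E) (a a₁ : ℝ × E → E3) : Prop :=
  ∃ C, 0 ≤ C ∧ ∀ p ∈ S, ∃ L : ℝ × E →L[ℝ] E3, HasFDerivAt a L p ∧ L (1, F p) = a₁ p ∧ ‖L‖ ≤ C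

/-- A pair of errors `a`, `b` with `a' = b + α n + …`, `J b' = -k₁ a - k₂ b + β n + …`, where
`a`, `b`, `J b` are orthogonal to `n`. -/
structure IsOsc (S : Set (ℝ × E)) (err : ℝ × E → ℝ) (N : ℝ → E → E → ℝ) (J : L3) (k₁ k₂ : ℝ)
    (a b a₁ b₁ : ℝ × E → E3) : Prop where
  bl_a : BddLip S a
  bl_b : BddLip S b
  sm_a : Small S err a
  sm_b : Small S err b
  eqn : ∃ (α β : ℝ × E → ℝ) (n : ℝ × E → E3), BddLip S α ∧ BddLip S β ∧ BddLip S n ∧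
    Small S err α ∧ Small S err β ∧ (∀ p ∈ S, inner ℝ (a p) (n p) = 0) ∧
    (∀ p ∈ S, inner ℝ (b p) (n p) = 0) ∧ (∀ p ∈ S, inner ℝ (J (b p)) (n p) = 0) ∧
    Coupled S err N (fun p => a₁ p - b p - α p • n p) ∧
    Coupled S err N (fun p => J (b₁ p) + k₁ • a p + k₂ • b p - β p • n p)

/-- `W` is continuous along curves in `S`. -/
def ContinuousAlong (S : Set (ℝ × E)) (W : ℝ → E → E → ℝ) : Prop :=
  ∀ (X Y : ℝ → E) (I : Set ℝ), ContinuousOn X I → ContinuousOn Y I → (∀ s ∈ I, (s, X s) ∈ S) →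
    (∀ s ∈ I, (s, Y s) ∈ S) → ContinuousOn (fun s => W s (X s) (Y s)) I

/-- The function `W` of pairs of states is comparable to, and dissipates, `q`, up to the
coupling `Q` and errors. -/
def Dissipates (S : Set (ℝ × E)) (F : ℝ × E → E) (err : ℝ × E → ℝ) (W q Q : ℝ → E → E → ℝ) :
    Prop :=
  ContinuousAlong S W ∧ ∃ m C : ℝ, 0 < m ∧ 0 ≤ C ∧
    (∀ t X Y, (t, X) ∈ S → (t, Y) ∈ S →
      m * q t X Y ≤ W t X Y ∧ W t X Y ≤ C * ‖X - Y‖ ^ 2) ∧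
    ∀ (X Y : ℝ → E) (t : ℝ) (v : E), (t, X t) ∈ S → (t, Y t) ∈ S →
      HasDerivWithinAt X (F (t, X t) + v) (Ici t) t →
      HasDerivWithinAt Y (F (t, Y t)) (Ici t) t →
      ∃ w, HasDerivWithinAt (fun s => W s (X s) (Y s)) w (Ici t) t ∧
        w ≤ -m * q t (X t) (Y t) + C * (Q t (X t) (Y t)
          + (err (t, X t) + err (t, Y t)) * ‖X t - Y t‖ ^ 2 + ‖X t - Y t‖ * ‖v‖)

theorem HasFlowDeriv.hasDerivWithinAt {a a₁ : ℝ × E → E3} (h : HasFlowDeriv S F a a₁) :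
    ∃ C, 0 ≤ C ∧ ∀ (X : ℝ → E) (t : ℝ) (v : E), (t, X t) ∈ S →
      HasDerivWithinAt X (F (t, X t) + v) (Ici t) t →
      ∃ d, ‖d‖ ≤ C * ‖v‖ ∧
        HasDerivWithinAt (fun s => a (s, X s)) (a₁ (t, X t) + d) (Ici t) t := by
  obtain ⟨C, hC, h⟩ := h
  refine ⟨C, hC, fun X t v hX hd => ?_⟩
  obtain ⟨L, hL, hLa, hLC⟩ := h _ hX
  refine ⟨L (0, v), ?_, ?_⟩
  · refine (L.le_of_opNorm_le hLC _).trans ?_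
    rw [Prod.norm_mk, norm_zero, max_eq_right (norm_nonneg _)]
  · have h1 : HasDerivWithinAt (fun s => (s, X s)) ((1 : ℝ), F (t, X t) + v) (Ici t) t :=
      (hasDerivWithinAt_id t _).prodMk hd
    have h2 := hL.comp_hasDerivWithinAt t h1
    rw [← hLa, ← map_add, Prod.mk_add_mk, add_zero]
    exact h2

theorem HasFlowDeriv.continuousOn {a a₁ : ℝ × E → E3} (h : HasFlowDeriv S F a a₁) {X : ℝ → E}
    {I : Set ℝ} (hX : ContinuousOn X I) (hS : ∀ s ∈ I, (s, X s) ∈ S) :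
    ContinuousOn (fun s => a (s, X s)) I := by
  obtain ⟨C, hC, h⟩ := h
  intro s hs
  obtain ⟨L, hL, -⟩ := h _ (hS s hs)
  exact hL.continuousAt.comp_continuousWithinAt (f := fun s => (s, X s))
    (continuousWithinAt_id.prodMk (hX s hs))

theorem inner_J_comm {J : L3} (hJ : ContinuousLinearMap.adjoint J = J) (u v : E3) :
    inner ℝ (J u) v = inner ℝ u (J v) := by
  rw [← ContinuousLinearMap.adjoint_inner_right, hJ]

end Osc

end RodTransport
end

noncomputable section
namespace RodTransport

theorem osc_le {J : L3} {k₁ k₂ c j : ℝ} (hk₁ : 0 < k₁) (hc : 0 < c)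
    (hj : ∀ v : E3, ‖J v‖ ≤ j * ‖v‖) (hcj : c * (j + k₂ ^ 2 / (2 * k₁)) ≤ k₂ / 2)
    {x y u v ru rv : E3} (hu : u = y + ru) (hv : J v = -(k₁ • x) - k₂ • y + rv) :
    k₁ * inner ℝ x u + inner ℝ y (J v) + c * (inner ℝ u (J y) + inner ℝ x (J v)) ≤
      -(c * k₁ / 2) * ‖x‖ ^ 2 - k₂ / 2 * ‖y‖ ^ 2
      + (k₁ * inner ℝ x ru + inner ℝ y rv + c * inner ℝ ru (J y) + c * inner ℝ x rv) := by
  have h1 : inner ℝ y (J y) ≤ j * ‖y‖ ^ 2 := by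
    refine (real_inner_le_norm _ _).trans ?_
    nlinarith [hj y, norm_nonneg y]
  have h2 : inner ℝ x y = inner ℝ y x := real_inner_comm _ _
  have h3 : -(k₂ * inner ℝ x y) ≤ k₁ / 2 * ‖x‖ ^ 2 + k₂ ^ 2 / (2 * k₁) * ‖y‖ ^ 2 := by
    have h4 : 0 ≤ ‖k₁ • x + k₂ • y‖ ^ 2 := by positivity
    rw [norm_add_sq_real, norm_smul, norm_smul, inner_smul_left, inner_smul_right] at h4
    simp only [Real.norm_eq_abs, mul_pow, sq_abs, conj_trivial] at h4
    have h5 : k₁ / 2 * ‖x‖ ^ 2 + k₂ ^ 2 / (2 * k₁) * ‖y‖ ^ 2 + k₂ * inner ℝ x y =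
      (k₁ ^ 2 * ‖x‖ ^ 2 + 2 * (k₁ * (k₂ * inner ℝ x y)) + k₂ ^ 2 * ‖y‖ ^ 2) / (2 * k₁) := by
      field_simp
      ring
    have h6 : 0 ≤ (k₁ ^ 2 * ‖x‖ ^ 2 + 2 * (k₁ * (k₂ * inner ℝ x y)) + k₂ ^ 2 * ‖y‖ ^ 2)
      / (2 * k₁) := by positivity
    linarith
  rw [hv, hu]
  simp only [inner_add_right, inner_add_left, inner_sub_right, inner_neg_right, inner_smul_right,
    real_inner_self_eq_norm_sq]
  have h7 : c * (j * ‖y‖ ^ 2) + c * (k₂ ^ 2 / (2 * k₁) * ‖y‖ ^ 2) ≤ k₂ / 2 * ‖y‖ ^ 2 := by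
    have := mul_le_mul_of_nonneg_right hcj (sq_nonneg ‖y‖)
    linarith
  have h8 := mul_le_mul_of_nonneg_left h1 hc.le
  have h9 := mul_le_mul_of_nonneg_left h3 hc.le
  rw [← h2]
  nlinarith

theorem exists_mixing_coefficient {k₁ k₂ l j : ℝ} (hk₁ : 0 < k₁) (hk₂ : 0 < k₂) (hl : 0 < l)
    (hj : 0 ≤ j) : ∃ c, 0 < c ∧ c * (j + k₂ ^ 2 / (2 * k₁)) ≤ k₂ / 2 ∧ (c * j) ^ 2 ≤ k₁ * l / 4 := by
  have h1 : Tendsto (fun c : ℝ => c * (j + k₂ ^ 2 / (2 * k₁))) (𝓝[>] 0) (𝓝 0) := by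
    refine Tendsto.mono_left ?_ nhdsWithin_le_nhds
    have : Continuous fun c : ℝ => c * (j + k₂ ^ 2 / (2 * k₁)) := by fun_prop
    simpa using this.tendsto 0
  have h2 : Tendsto (fun c : ℝ => (c * j) ^ 2) (𝓝[>] 0) (𝓝 0) := by
    refine Tendsto.mono_left ?_ nhdsWithin_le_nhds
    have : Continuous fun c : ℝ => (c * j) ^ 2 := by fun_prop
    simpa using this.tendsto 0
  have h0 : ∀ᶠ c : ℝ in 𝓝[>] 0, 0 < c := self_mem_nhdsWithin
  obtain ⟨c, hc, h3, h4⟩ := (h0.and ((h1.eventually_le_const (half_pos hk₂)).and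
    (h2.eventually_le_const (by positivity : 0 < k₁ * l / 4)))).exists
  exact ⟨c, hc, h3, h4⟩

theorem inner_add_add_le {x ρ A p : E3} {C K G ν M : ℝ} (hC : 0 ≤ C) (hK : 0 ≤ K) (hG : 0 ≤ G)
    (hν : 0 ≤ ν) (hρ : ‖ρ‖ ≤ C * G) (hp : ‖p‖ ≤ K * ν) (hA : inner ℝ x A ≤ M) :
    inner ℝ x (ρ + A + p) ≤ ‖x‖ * ((C + K) * (G + ν)) + M := by
  have h1 : inner ℝ x ρ ≤ ‖x‖ * (C * G) := (real_inner_le_norm _ _).trans (by gcongr)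
  have h2 : inner ℝ x p ≤ ‖x‖ * (K * ν) := (real_inner_le_norm _ _).trans (by gcongr)
  have h3 : 0 ≤ ‖x‖ * (K * G + C * ν) := by positivity
  rw [inner_add_right, inner_add_right]
  linarith

theorem young_le {m D s N : ℝ} (hm : 0 < m) :
    D * s * N ≤ m * s ^ 2 + D ^ 2 / m / 2 * N ^ 2 := by
  have h1 : m * (D * s * N) ≤ m * (m * s ^ 2 + D ^ 2 / m / 2 * N ^ 2) := by
    have h2 : m * (m * s ^ 2 + D ^ 2 / m / 2 * N ^ 2) = m ^ 2 * s ^ 2 + D ^ 2 * N ^ 2 / 2 := by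
      field_simp
    rw [h2]
    nlinarith [sq_nonneg (m * s - D * N / 2), sq_nonneg (D * N)]
  exact le_of_mul_le_mul_left h1 hm

theorem osc_perturbed_le {k₁ k₂ c D K m N η δ ν La Lb s r V : ℝ} (hm : 0 < m)
    (hD : 0 ≤ D) (hK : 0 ≤ K) (hη : 0 ≤ η) (hδ : 0 ≤ δ) (hν : 0 ≤ ν) (hLa : 0 ≤ La) (hLb : 0 ≤ Lb)
    (hs : 0 ≤ s) (hr : 0 ≤ r) (m1 : m ≤ c * k₁ / 4) (m2 : m ≤ k₂ / 4) (hsδ : s ≤ La * δ)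
    (hrδ : r ≤ Lb * δ)
    (hV : V ≤ -(c * k₁ / 2) * s ^ 2 - k₂ / 2 * r ^ 2
      + (D * (s + r) * (N + η * δ + ν) + K * (η * δ ^ 2))) :
    V ≤ -m * (s ^ 2 + r ^ 2)
      + (D ^ 2 / m + D * (La + Lb) + K) * (N ^ 2 + η * δ ^ 2 + δ * ν) := by
  have f1 : m * s ^ 2 ≤ c * k₁ / 4 * s ^ 2 := by gcongr
  have f2 : m * r ^ 2 ≤ k₂ / 4 * r ^ 2 := by gcongr
  have y1 := young_le (D := D) (s := s) (N := N) hm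
  have y2 := young_le (D := D) (s := r) (N := N) hm
  have f3 : D * (s + r) * (η * δ + ν) ≤ D * (La + Lb) * (η * δ ^ 2 + δ * ν) := by
    calc _ ≤ D * (La * δ + Lb * δ) * (η * δ + ν) := by gcongr
      _ = _ := by ring
  have R0 : 0 ≤ K * (δ * ν) := by positivity
  have R1 : 0 ≤ (D * (La + Lb) + K) * N ^ 2 := by positivity
  have R2 : 0 ≤ D ^ 2 / m * (η * δ ^ 2 + δ * ν) := by positivity
  linarith

section

variable {E : Type*} [NormedAddCommGroup E] [NormedSpace ℝ E] {S : Set (ℝ × E)} {F : ℝ × E → E}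
  {err : ℝ × E → ℝ} {N : ℝ → E → E → ℝ}

set_option maxHeartbeats 1600000 in
theorem IsOsc.dissipates {J : L3} {k₁ k₂ l : ℝ} {a b a₁ b₁ : ℝ × E → E3} (hk₁ : 0 < k₁)
    (hk₂ : 0 < k₂) (hl : 0 < l) (hJ : ContinuousLinearMap.adjoint J = J)
    (hJl : ∀ v, l * ‖v‖ ^ 2 ≤ inner ℝ v (J v)) (herr : ∀ p, 0 ≤ err p)
    (hN : ∀ t X Y, 0 ≤ N t X Y) (h : IsOsc S err N J k₁ k₂ a b a₁ b₁)
    (ha : HasFlowDeriv S F a a₁) (hb : HasFlowDeriv S F b b₁) :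
    ∃ W, Dissipates S F err W
      (fun t X Y => ‖a (t, X) - a (t, Y)‖ ^ 2 + ‖b (t, X) - b (t, Y)‖ ^ 2)
      (fun t X Y => N t X Y ^ 2) := by
  obtain ⟨c, hc, hc1, hc2⟩ := exists_mixing_coefficient hk₁ hk₂ hl (norm_nonneg J)
  have hj : ∀ v : E3, ‖J v‖ ≤ ‖J‖ * ‖v‖ := J.le_opNorm
  obtain ⟨α, β, n, bα, bβ, bn, sα, sβ, na, nb, nJb, ca, cb⟩ := h.eqn
  obtain ⟨La, hLa, la⟩ := h.bl_a.lip
  obtain ⟨Lb, hLb, lb⟩ := h.bl_b.lip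
  obtain ⟨Ka, hKa, da⟩ := ha.hasDerivWithinAt
  obtain ⟨Kb, hKb, db⟩ := hb.hasDerivWithinAt
  obtain ⟨Ca, hCa, ca⟩ := ca.diff
  obtain ⟨Cb, hCb, cb⟩ := cb.diff
  obtain ⟨C1, hC1, i1⟩ := inner_sub_smul_sub_le herr h.bl_a bn bα h.sm_a sα na
  obtain ⟨C2, hC2, i2⟩ := inner_sub_smul_sub_le herr h.bl_b bn bβ h.sm_b sβ nb
  obtain ⟨C3, hC3, i3⟩ := inner_sub_smul_sub_le herr (h.bl_b.clm J) bn bα (h.sm_b.clm J) sα nJb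
  obtain ⟨C4, hC4, i4⟩ := inner_sub_smul_sub_le herr h.bl_a bn bβ h.sm_a sβ na
  set j := ‖J‖ with hjdef
  have hj0 : 0 ≤ j := norm_nonneg J
  -- all coupling terms are bounded by `(‖x‖ + ‖y‖) * (D * (N + η δ + ‖v‖)) + D η δ²`
  set D := (k₁ + c * j) * (Ca + Ka) + (1 + c) * (Cb + j * Kb) with hD
  have hD0 : 0 ≤ D := by positivity
  set m := min (min (c * k₁ / 4) (k₂ / 4)) (min (k₁ / 4) (l / 4)) with hm
  have hm0 : 0 < m := by positivity
  refine ⟨fun t X Y => k₁ / 2 * ‖a (t, X) - a (t, Y)‖ ^ 2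
    + 1 / 2 * inner ℝ (b (t, X) - b (t, Y)) (J (b (t, X) - b (t, Y)))
    + c * inner ℝ (a (t, X) - a (t, Y)) (J (b (t, X) - b (t, Y))),
    fun X Y I hX hY hXS hYS => ?_, m,
    (k₁ / 2 * La ^ 2 + 1 / 2 * (Lb * (j * Lb)) + c * (La * (j * Lb))) +
    (D ^ 2 / m + D * (La + Lb) + (k₁ * C1 + C2 + c * C3 + c * C4)), hm0, by positivity, ?_, ?_⟩
  · have c1 := (ha.continuousOn hX hXS).sub (ha.continuousOn hY hYS)
    have c2 := (hb.continuousOn hX hXS).sub (hb.continuousOn hY hYS)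
    have c3 := J.continuous.comp_continuousOn c2
    exact (((c1.norm.pow 2).const_mul _).add ((ContinuousOn.inner (𝕜 := ℝ) c2 c3).const_mul _)).add
      ((ContinuousOn.inner (𝕜 := ℝ) c1 c3).const_mul _)
  · intro t X Y hX hY
    have ha' := la t X Y hX hY
    have hb' := lb t X Y hX hY
    beta_reduce
    generalize a (t, X) - a (t, Y) = x at *
    generalize b (t, X) - b (t, Y) = y at *
    have e1 : |inner ℝ x (J y)| ≤ ‖x‖ * (j * ‖y‖) :=
      (abs_real_inner_le_norm _ _).trans (by gcongr; exact hj y)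
    have e2 : |inner ℝ y (J y)| ≤ ‖y‖ * (j * ‖y‖) :=
      (abs_real_inner_le_norm _ _).trans (by gcongr; exact hj y)
    constructor
    · have e3 : c * inner ℝ x (J y) ≥ -(k₁ / 4 * ‖x‖ ^ 2 + l / 4 * ‖y‖ ^ 2) := by
        have h1 : c * |inner ℝ x (J y)| ≤ ‖x‖ * ((c * j) * ‖y‖) := by
          calc _ ≤ c * (‖x‖ * (j * ‖y‖)) := by gcongr
            _ = _ := by ring
        have h2 : ‖x‖ * ((c * j) * ‖y‖) ≤ k₁ / 4 * ‖x‖ ^ 2 + l / 4 * ‖y‖ ^ 2 := by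
          have h3 : 0 ≤ (k₁ / 2 * ‖x‖ - (c * j) * ‖y‖) ^ 2 := sq_nonneg _
          have h4 : (c * j) ^ 2 * ‖y‖ ^ 2 ≤ k₁ * l / 4 * ‖y‖ ^ 2 := by gcongr
          have h5 : k₁ * (‖x‖ * ((c * j) * ‖y‖)) ≤
            k₁ * (k₁ / 4 * ‖x‖ ^ 2 + l / 4 * ‖y‖ ^ 2) := by nlinarith
          exact le_of_mul_le_mul_left h5 hk₁
        have := neg_abs_le (inner ℝ x (J y))
        nlinarith
      have e4 := hJl y
      have m1 : m * ‖x‖ ^ 2 ≤ k₁ / 4 * ‖x‖ ^ 2 := by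
        gcongr; exact (min_le_right _ _).trans (min_le_left _ _)
      have m2 : m * ‖y‖ ^ 2 ≤ l / 4 * ‖y‖ ^ 2 := by
        gcongr; exact (min_le_right _ _).trans (min_le_right _ _)
      linarith
    · have e3 : ‖x‖ * (j * ‖y‖) ≤ (La * ‖X - Y‖) * (j * (Lb * ‖X - Y‖)) := by gcongr
      have e4 : ‖y‖ * (j * ‖y‖) ≤ (Lb * ‖X - Y‖) * (j * (Lb * ‖X - Y‖)) := by gcongr
      have e5 : ‖x‖ ^ 2 ≤ (La * ‖X - Y‖) ^ 2 := by gcongr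
      calc _ ≤ k₁ / 2 * (La * ‖X - Y‖) ^ 2
            + 1 / 2 * ((Lb * ‖X - Y‖) * (j * (Lb * ‖X - Y‖)))
            + c * ((La * ‖X - Y‖) * (j * (Lb * ‖X - Y‖))) := by
            gcongr
            · exact (le_abs_self _).trans (e2.trans e4)
            · exact (le_abs_self _).trans (e1.trans e3)
        _ = (k₁ / 2 * La ^ 2 + 1 / 2 * (Lb * (j * Lb)) + c * (La * (j * Lb))) * ‖X - Y‖ ^ 2 := by
            ring
        _ ≤ _ := mul_le_mul_of_nonneg_right (le_add_of_nonneg_right (by positivity))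
            (by positivity)
  · intro X Y t v hX hY hXd hYd
    obtain ⟨pa, hpa, dXa⟩ := da X t v hX hXd
    obtain ⟨pb, hpb, dXb⟩ := db X t v hX hXd
    obtain ⟨_, h0a, dYa⟩ := da Y t 0 hY (by simpa using hYd)
    obtain ⟨_, h0b, dYb⟩ := db Y t 0 hY (by simpa using hYd)
    rw [norm_zero, mul_zero, norm_le_zero_iff] at h0a h0b
    subst h0a h0b
    have dx := dXa.sub dYa
    have dy := dXb.sub dYb
    have dJy := (J.hasFDerivAt.comp_hasDerivWithinAt t dy)
    refine ⟨_, ((((dx.norm_sq).const_mul (k₁ / 2)).add ((dy.inner ℝ dJy).const_mul (1 / 2))).add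
      ((dx.inner ℝ dJy).const_mul c)), ?_⟩
    have ca' := ca t (X t) (Y t) hX hY
    have cb' := cb t (X t) (Y t) hX hY
    have i1 := (abs_le.1 (i1 t (X t) (Y t) hX hY)).2
    have i2 := (abs_le.1 (i2 t (X t) (Y t) hX hY)).2
    have i3 := (abs_le.1 (i3 t (X t) (Y t) hX hY)).2
    have i4 := (abs_le.1 (i4 t (X t) (Y t) hX hY)).2
    have la' := la t (X t) (Y t) hX hY
    have lb' := lb t (X t) (Y t) hX hY
    have e0 : 0 ≤ err (t, X t) + err (t, Y t) := add_nonneg (herr _) (herr _)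
    have N0 := hN t (X t) (Y t)
    rw [← map_sub] at i3
    set x := a (t, X t) - a (t, Y t) with hx
    set y := b (t, X t) - b (t, Y t) with hy
    set A := α (t, X t) • n (t, X t) - α (t, Y t) • n (t, Y t) with hA
    set B := β (t, X t) • n (t, X t) - β (t, Y t) • n (t, Y t) with hB
    set ρa := a₁ (t, X t) - b (t, X t) - α (t, X t) • n (t, X t)
      - (a₁ (t, Y t) - b (t, Y t) - α (t, Y t) • n (t, Y t)) with hρa
    set ρb := J (b₁ (t, X t)) + k₁ • a (t, X t) + k₂ • b (t, X t) - β (t, X t) • n (t, X t)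
      - (J (b₁ (t, Y t)) + k₁ • a (t, Y t) + k₂ • b (t, Y t) - β (t, Y t) • n (t, Y t)) with hρb
    have hu : a₁ (t, X t) + pa - (a₁ (t, Y t) + 0) = y + (ρa + A + pa) := by
      rw [hy, hρa, hA]; abel
    have hv : J (b₁ (t, X t) + pb - (b₁ (t, Y t) + 0)) =
        -(k₁ • x) - k₂ • y + (ρb + B + J pb) := by
      rw [hx, hy, hρb, hB, map_sub, map_add, add_zero]; module
    have key := osc_le hk₁ hc hj hc1 hu hv
    rw [hu] at key ⊢
    have hsymm : inner ℝ (b₁ (t, X t) + pb - (b₁ (t, Y t) + 0)) (J y) =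
        inner ℝ y (J (b₁ (t, X t) + pb - (b₁ (t, Y t) + 0))) := by
      rw [← inner_J_comm hJ, real_inner_comm]
    have e1 : ‖J y‖ ≤ j * ‖y‖ := hj y
    have e2 : ‖J pb‖ ≤ j * (Kb * ‖v‖) := (hj pb).trans (by gcongr)
    have i3' : inner ℝ (J y) A ≤ _ := i3
    generalize J (b₁ (t, X t) + pb - (b₁ (t, Y t) + 0)) = Jv at *
    generalize b₁ (t, X t) + pb - (b₁ (t, Y t) + 0) = w at *
    have G0 : 0 ≤ N t (X t) (Y t) + (err (t, X t) + err (t, Y t)) * ‖X t - Y t‖ := by positivity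
    have v0 := norm_nonneg v
    have b1 := inner_add_add_le hCa hKa G0 v0 ca' hpa i1
    have b2 := inner_add_add_le (K := j * Kb) hCb (by positivity) G0 v0 cb' (by linarith) i2
    have b3 := inner_add_add_le hCa hKa G0 v0 ca' hpa i3
    have b4 := inner_add_add_le (K := j * Kb) hCb (by positivity) G0 v0 cb' (by linarith) i4
    have b3' : inner ℝ (ρa + A + pa) (J y) ≤ j * ‖y‖ * ((Ca + Ka)
        * (N t (X t) (Y t) + (err (t, X t) + err (t, Y t)) * ‖X t - Y t‖ + ‖v‖))
        + C3 * ((err (t, X t) + err (t, Y t)) * ‖X t - Y t‖ ^ 2) := by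
      rw [real_inner_comm]
      exact b3.trans (by gcongr)
    have b5 : k₁ * inner ℝ x (ρa + A + pa) + inner ℝ y (ρb + B + J pb)
        + c * inner ℝ (ρa + A + pa) (J y) + c * inner ℝ x (ρb + B + J pb) ≤
        D * (‖x‖ + ‖y‖)
          * (N t (X t) (Y t) + (err (t, X t) + err (t, Y t)) * ‖X t - Y t‖ + ‖v‖)
        + (k₁ * C1 + C2 + c * C3 + c * C4)
          * ((err (t, X t) + err (t, Y t)) * ‖X t - Y t‖ ^ 2) := by
      have h1 := mul_le_mul_of_nonneg_left b1 hk₁.le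
      have h3 := mul_le_mul_of_nonneg_left b3' hc.le
      have h4 := mul_le_mul_of_nonneg_left b4 hc.le
      have hG : 0 ≤ N t (X t) (Y t) + (err (t, X t) + err (t, Y t)) * ‖X t - Y t‖ + ‖v‖ := by
        positivity
      generalize N t (X t) (Y t) + (err (t, X t) + err (t, Y t)) * ‖X t - Y t‖ + ‖v‖ = G at *
      generalize (err (t, X t) + err (t, Y t)) * ‖X t - Y t‖ ^ 2 = M at *
      have h5 : 0 ≤ (c * j * (Ca + Ka) + (Cb + j * Kb)) * (‖x‖ * G)
        + (k₁ * (Ca + Ka) + c * (Cb + j * Kb)) * (‖y‖ * G) := by positivity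
      rw [hD]
      clear_value x y A B ρa ρb m D j
      clear ha hb h ca cb da db la lb hj hJl i1 i2 i3 i4 na nb nJb
      linarith
    refine (osc_perturbed_le (k₁ := k₁) (k₂ := k₂) (c := c) (K := k₁ * C1 + C2 + c * C3 + c * C4)
      hm0 hD0 (by positivity) e0
      (norm_nonneg _) v0 hLa hLb
      (norm_nonneg x) (norm_nonneg y) ((min_le_left _ _).trans (min_le_left _ _))
      ((min_le_left _ _).trans (min_le_right _ _)) la' lb' (le_trans (le_of_eq ?_)
        (key.trans (add_le_add_right b5 _)))).trans ?_
    · change k₁ / 2 * (2 * inner ℝ x (y + (ρa + A + pa))) + 1 / 2 * (inner ℝ y Jv + inner ℝ w (J y))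
        + c * (inner ℝ x Jv + inner ℝ (y + (ρa + A + pa)) (J y)) = _
      rw [hsymm]; ring
    · have V0 : 0 ≤ k₁ / 2 * La ^ 2 + 1 / 2 * (Lb * (j * Lb)) + c * (La * (j * Lb)) := by
        positivity
      exact add_le_add_right (mul_le_mul_of_nonneg_right (le_add_of_nonneg_left V0)
        (by positivity)) _

theorem Dissipates.add {W q Q W' q' Q' : ℝ → E → E → ℝ} (h : Dissipates S F err W q Q)
    (h' : Dissipates S F err W' q' Q') (herr : ∀ p, 0 ≤ err p) (hq : ∀ t X Y, 0 ≤ q t X Y)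
    (hq' : ∀ t X Y, 0 ≤ q' t X Y) (hQ : ∀ t X Y, 0 ≤ Q t X Y) (hQ' : ∀ t X Y, 0 ≤ Q' t X Y) :
    Dissipates S F err (fun t X Y => W t X Y + W' t X Y) (fun t X Y => q t X Y + q' t X Y)
      (fun t X Y => Q t X Y + Q' t X Y) := by
  obtain ⟨hc, m, C, hm, hC, h1, h2⟩ := h
  obtain ⟨hc', m', C', hm', hC', h1', h2'⟩ := h'
  refine ⟨fun X Y I hX hY hXS hYS => (hc X Y I hX hY hXS hYS).add (hc' X Y I hX hY hXS hYS),
    min m m', C + C', by positivity, by positivity, fun t X Y hX hY => ?_,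
    fun X Y t v hX hY hXd hYd => ?_⟩
  · have a1 := h1 t X Y hX hY
    have a2 := h1' t X Y hX hY
    have a3 : min m m' * q t X Y ≤ m * q t X Y :=
      mul_le_mul_of_nonneg_right (min_le_left _ _) (hq _ _ _)
    have a4 : min m m' * q' t X Y ≤ m' * q' t X Y :=
      mul_le_mul_of_nonneg_right (min_le_right _ _) (hq' _ _ _)
    constructor <;> linarith
  · obtain ⟨w, hw, hw1⟩ := h2 X Y t v hX hY hXd hYd
    obtain ⟨w', hw', hw1'⟩ := h2' X Y t v hX hY hXd hYd
    refine ⟨w + w', hw.add hw', ?_⟩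
    have a3 : min m m' * q t (X t) (Y t) ≤ m * q t (X t) (Y t) :=
      mul_le_mul_of_nonneg_right (min_le_left _ _) (hq _ _ _)
    have a4 : min m m' * q' t (X t) (Y t) ≤ m' * q' t (X t) (Y t) :=
      mul_le_mul_of_nonneg_right (min_le_right _ _) (hq' _ _ _)
    have e0 : 0 ≤ err (t, X t) + err (t, Y t) := add_nonneg (herr _) (herr _)
    have e1 : 0 ≤ (err (t, X t) + err (t, Y t)) * ‖X t - Y t‖ ^ 2 + ‖X t - Y t‖ * ‖v‖ := by
      positivity
    have c1 := mul_nonneg hC (hQ' t (X t) (Y t))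
    have c2 := mul_nonneg hC' (hQ t (X t) (Y t))
    nlinarith

/-- A coupling that is controlled by a dissipated quantity can be compensated. -/
theorem Dissipates.cascade {W q W' q' Q' : ℝ → E → E → ℝ} {Q : ℝ → E → E → ℝ}
    (h : Dissipates S F err W q Q)
    (h' : Dissipates S F err W' q' Q') (herr : ∀ p, 0 ≤ err p) (hq : ∀ t X Y, 0 ≤ q t X Y)
    (hQ : ∀ t X Y, 0 ≤ Q t X Y)
    {K : ℝ} (hK : 0 ≤ K) (hQ' : ∀ t X Y, (t, X) ∈ S → (t, Y) ∈ S →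
      Q' t X Y ≤ K * (q t X Y + Q t X Y + (err (t, X) + err (t, Y)) * ‖X - Y‖ ^ 2)) :
    ∃ W'', Dissipates S F err W'' (fun t X Y => q t X Y + q' t X Y) Q := by
  obtain ⟨hc, m, C, hm, hC, h1, h2⟩ := h
  obtain ⟨hc', m', C', hm', hC', h1', h2'⟩ := h'
  set M := (C' * K + m') / m with hM
  have hMm : M * m = C' * K + m' := by rw [hM]; field_simp
  have hM0 : 0 ≤ M := by positivity
  refine ⟨fun t X Y => M * W t X Y + W' t X Y, fun X Y I hX hY hXS hYS =>
    ((hc X Y I hX hY hXS hYS).const_mul M).add (hc' X Y I hX hY hXS hYS), m', M * C + C' + C' * K, hm', by positivity,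
    fun t X Y hX hY => ?_, fun X Y t v hX hY hXd hYd => ?_⟩
  · have a1 := h1 t X Y hX hY
    have a2 := h1' t X Y hX hY
    have a3 := mul_le_mul_of_nonneg_left a1.1 hM0
    have a4 := mul_le_mul_of_nonneg_left a1.2 hM0
    have a5 : m' * q t X Y ≤ M * m * q t X Y := by
      rw [hMm]; exact mul_le_mul_of_nonneg_right (le_add_of_nonneg_left (by positivity)) (hq _ _ _)
    have a6 : 0 ≤ C' * K * ‖X - Y‖ ^ 2 := by positivity
    constructor <;> linarith
  · obtain ⟨w, hw, hw1⟩ := h2 X Y t v hX hY hXd hYd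
    obtain ⟨w', hw', hw1'⟩ := h2' X Y t v hX hY hXd hYd
    refine ⟨_, (hw.const_mul M).add hw', ?_⟩
    have b1 := mul_le_mul_of_nonneg_left hw1 hM0
    have b2 := mul_le_mul_of_nonneg_left (hQ' t (X t) (Y t) hX hY) hC'
    have e0 : 0 ≤ err (t, X t) + err (t, Y t) := add_nonneg (herr _) (herr _)
    have e1 : 0 ≤ (err (t, X t) + err (t, Y t)) * ‖X t - Y t‖ ^ 2 := by positivity
    have e2 : 0 ≤ ‖X t - Y t‖ * ‖v‖ := by positivity
    have e3 := hQ t (X t) (Y t)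
    have e4 := hq t (X t) (Y t)
    have b3 : M * (-m * q t (X t) (Y t)) = -(C' * K) * q t (X t) (Y t) - m' * q t (X t) (Y t) := by
      linear_combination (-q t (X t) (Y t)) * hMm
    have c1 : 0 ≤ C' * Q t (X t) (Y t) := by positivity
    have c2 : 0 ≤ C' * K * (‖X t - Y t‖ * ‖v‖) := by positivity
    linarith

end

end RodTransport
end

noncomputable section
namespace RodTransport

/-! ### The errors of a direction -/

theorem errW_eq {q wd w : E3} (hq : ‖q‖ = 1) : errW wd q w = w + inner ℝ q wd • q - wd := by
  rw [errW, cross_cross_of_norm_one hq]; abel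

theorem inner_errW {q wd w : E3} (hq : ‖q‖ = 1) (hw : inner ℝ w q = 0) :
    inner ℝ (errW wd q w) q = 0 := by
  rw [errW_eq hq, inner_sub_left, inner_add_left, inner_smul_left, hw,
    real_inner_self_eq_norm_sq, hq, real_inner_comm]
  simp

theorem deriv_errQ_eq {q w qd wd κ : E3} (hq : ‖q‖ = 1) (hw : inner ℝ w q = 0)
    (hwd : inner ℝ qd wd = 0) :
    (wd ×ᵥ qd + κ) ×ᵥ q + qd ×ᵥ (w ×ᵥ q) - errW wd q w - inner ℝ (q - qd) wd • q =
      inner ℝ q (qd - q) • errW wd q w - inner ℝ (qd - q) (errW wd q w) • q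
        + inner ℝ (q - qd) wd • (qd - q) + κ ×ᵥ q := by
  have h1 : inner ℝ (qd - q) (errW wd q w) = inner ℝ qd (errW wd q w) := by
    rw [inner_sub_left, real_inner_comm _ q, inner_errW hq hw, sub_zero]
  have h2 : inner ℝ q (qd - q) = inner ℝ q qd - 1 := by
    rw [inner_sub_right, real_inner_self_eq_norm_sq, hq]; norm_num
  have h3 : inner ℝ (q - qd) wd = inner ℝ q wd := by rw [inner_sub_left, hwd, sub_zero]
  have h4 : (wd ×ᵥ qd) ×ᵥ q = -(inner ℝ q qd • wd - inner ℝ q wd • qd) := by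
    rw [cross_comm, cross_cross]
  rw [h1, h2, h3, add_cross, h4, cross_cross, errW_eq hq, inner_sub_right, inner_add_right,
    inner_smul_right, real_inner_comm q qd, hwd, sub_zero]
  module

theorem deriv_errW_eq {q w wd wdn κ₁ κ₂ eq : E3} {k k' : ℝ} (hq : ‖q‖ = 1)
    (hw : inner ℝ w q = 0) :
    -(q ×ᵥ (q ×ᵥ wdn)) + inner ℝ q wd • (q ×ᵥ w) - k • eq - k' • errW wd q w + κ₁
      + ((w ×ᵥ q) ×ᵥ (q ×ᵥ wd) + q ×ᵥ ((w ×ᵥ q) ×ᵥ wd + q ×ᵥ (wdn + κ₂)))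
      + k • eq + k' • errW wd q w - inner ℝ (errW wd q w) (q ×ᵥ wd) • q =
      κ₁ + q ×ᵥ (q ×ᵥ κ₂) := by
  have h1 : (w ×ᵥ q) ×ᵥ (q ×ᵥ wd) = inner ℝ (w ×ᵥ q) wd • q := by
    rw [cross_cross, real_inner_comm q (w ×ᵥ q), inner_cross_self_right, zero_smul, sub_zero]
  have h2 : (w ×ᵥ q) ×ᵥ wd = -(inner ℝ q wd • w - inner ℝ w wd • q) := by
    rw [cross_comm, cross_cross, real_inner_comm wd q, real_inner_comm wd w]
  have h3 : inner ℝ (errW wd q w) (q ×ᵥ wd) = inner ℝ (w ×ᵥ q) wd := by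
    rw [errW_eq hq, inner_sub_left, inner_add_left, inner_smul_left, inner_cross_self_left,
      inner_cross_self_right]
    simp [inner_e3]; ring
  rw [h1, h2, h3, cross_add, cross_add q wdn, cross_add q (q ×ᵥ wdn), cross_neg, cross_sub,
    cross_smul, cross_smul, cross_self, smul_zero]
  module

section

variable {E : Type*} [NormedAddCommGroup E] [NormedSpace ℝ E] {S : Set (ℝ × E)} {F : ℝ × E → E}
  {err : ℝ × E → ℝ} {N : ℝ → E → E → ℝ}

theorem BddLip.cross {φ ψ : ℝ × E → E3} (h : BddLip S φ) (h' : BddLip S ψ) :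
    BddLip S (fun p => φ p ×ᵥ ψ p) := h.bilin isBoundedBilinearMap_cross h'

theorem BddLip.inner {φ ψ : ℝ × E → E3} (h : BddLip S φ) (h' : BddLip S ψ) :
    BddLip S (fun p => Inner.inner ℝ (φ p) (ψ p)) :=
  h.bilin (B := fun p : E3 × E3 => Inner.inner ℝ p.1 p.2) isBoundedBilinearMap_inner h'

theorem _root_.IsBoundedBilinearMap.swap {X Y Z : Type*} [NormedAddCommGroup X] [NormedSpace ℝ X]
    [NormedAddCommGroup Y] [NormedSpace ℝ Y] [NormedAddCommGroup Z] [NormedSpace ℝ Z]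
    {B : X × Y → Z} (hB : IsBoundedBilinearMap ℝ B) :
    IsBoundedBilinearMap ℝ (fun p : Y × X => B (p.2, p.1)) where
  add_left x₁ x₂ y := hB.add_right y x₁ x₂
  smul_left c x y := hB.smul_right c y x
  add_right x y₁ y₂ := hB.add_left y₁ y₂ x
  smul_right c x y := hB.smul_left c y x
  bound := by
    obtain ⟨C, hC, h⟩ := hB.bound
    exact ⟨C, hC, fun x y => (h y x).trans_eq (by ring)⟩

theorem Small.cross {φ ψ : ℝ × E → E3} (h : BddLip S φ) (h' : Small S err ψ) :
    Small S err (fun p => φ p ×ᵥ ψ p) := h'.bilin isBoundedBilinearMap_cross h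

theorem Small.inner {φ ψ : ℝ × E → E3} (h : BddLip S φ) (h' : Small S err ψ) :
    Small S err (fun p => Inner.inner ℝ (φ p) (ψ p)) :=
  h'.bilin (B := fun p : E3 × E3 => Inner.inner ℝ p.1 p.2) isBoundedBilinearMap_inner h

theorem Small.inner_left {φ ψ : ℝ × E → E3} (h : Small S err φ) (h' : BddLip S ψ) :
    Small S err (fun p => Inner.inner ℝ (φ p) (ψ p)) :=
  (Small.inner h' h).congr fun _ _ => real_inner_comm _ _

theorem Small.smul_left {φ : ℝ × E → ℝ} {ψ : ℝ × E → E3} (h : Small S err φ) (h' : BddLip S ψ) :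
    Small S err (fun p => φ p • ψ p) := h.bilin isBoundedBilinearMap_smul.swap h'

theorem Coupled.cross {φ ψ : ℝ × E → E3} (h : BddLip S φ) (h' : Coupled S err N ψ)
    (herr : ∀ p, 0 ≤ err p) (hN : ∀ t X Y, 0 ≤ N t X Y) :
    Coupled S err N (fun p => φ p ×ᵥ ψ p) := h'.bilin isBoundedBilinearMap_cross herr hN h

theorem Coupled.cross_left {φ ψ : ℝ × E → E3} (h : Coupled S err N φ) (h' : BddLip S ψ)
    (herr : ∀ p, 0 ≤ err p) (hN : ∀ t X Y, 0 ≤ N t X Y) :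
    Coupled S err N (fun p => φ p ×ᵥ ψ p) :=
  h.bilin (B := fun p : E3 × E3 => p.2 ×ᵥ p.1) isBoundedBilinearMap_cross.swap herr hN h'

theorem isOsc_direction {q w qd wd wdn κ₀ κ₁ κ₂ a₁ b₁ : ℝ × E → E3} {k k' : ℝ}
    (herr : ∀ p, 0 ≤ err p) (hN : ∀ t X Y, 0 ≤ N t X Y)
    (bq : BddLip S q) (bw : BddLip S w) (bqd : BddLip S qd) (bwd : BddLip S wd)
    (sq : Small S err (fun p => q p - qd p)) (sw : Small S err (fun p => w p - wd p))
    (hq : ∀ p ∈ S, ‖q p‖ = 1) (hw : ∀ p ∈ S, inner ℝ (w p) (q p) = 0)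
    (hwd : ∀ p ∈ S, inner ℝ (qd p) (wd p) = 0)
    (c₀ : Coupled S err N κ₀) (c₁ : Coupled S err N κ₁) (c₂ : Coupled S err N κ₂)
    (ha : ∀ p ∈ S, a₁ p = (wd p ×ᵥ qd p + κ₀ p) ×ᵥ q p + qd p ×ᵥ (w p ×ᵥ q p))
    (hb : ∀ p ∈ S, b₁ p = -(q p ×ᵥ (q p ×ᵥ wdn p)) + inner ℝ (q p) (wd p) • (q p ×ᵥ w p)
      - k • errQ (qd p) (q p) - k' • errW (wd p) (q p) (w p) + κ₁ p
      + ((w p ×ᵥ q p) ×ᵥ (q p ×ᵥ wd p)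
        + q p ×ᵥ ((w p ×ᵥ q p) ×ᵥ wd p + q p ×ᵥ (wdn p + κ₂ p)))) :
    IsOsc S err N 1 k k' (fun p => errQ (qd p) (q p)) (fun p => errW (wd p) (q p) (w p)) a₁ b₁ := by
  have sq' : Small S err (fun p => qd p - q p) :=
    (sq.clm (-ContinuousLinearMap.id ℝ E3)).congr fun p _ => by simp
  have bsq : BddLip S (fun p => q p - qd p) := bq.sub bqd
  have bsq' : BddLip S (fun p => qd p - q p) := bqd.sub bq
  have ba : BddLip S (fun p => errQ (qd p) (q p)) := bqd.cross bq
  have bb : BddLip S (fun p => errW (wd p) (q p) (w p)) := bw.add (bq.cross (bq.cross bwd))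
  have sα : Small S err (fun p => inner ℝ (q p - qd p) (wd p)) :=
    sq.inner_left bwd
  have bα : BddLip S (fun p => inner ℝ (q p - qd p) (wd p)) := bsq.inner bwd
  have sa : Small S err (fun p => errQ (qd p) (q p)) := by
    have h1 : Small S err (fun p => qd p ×ᵥ (q p - qd p)) :=
      sq.bilin isBoundedBilinearMap_cross bqd
    refine h1.congr fun p _ => ?_
    rw [cross_sub, cross_self, sub_zero, errQ]
  have sb : Small S err (fun p => errW (wd p) (q p) (w p)) := by
    refine (sw.add (sα.smul_left bq) herr).congr fun p hp => ?_
    rw [errW_eq (hq p hp), inner_sub_left, hwd p hp]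
    module
  have bβ : BddLip S (fun p => inner ℝ (errW (wd p) (q p) (w p)) (q p ×ᵥ wd p)) :=
    bb.inner (bq.cross bwd)
  have sβ : Small S err (fun p => inner ℝ (errW (wd p) (q p) (w p)) (q p ×ᵥ wd p)) :=
    sb.inner_left (bq.cross bwd)
  refine ⟨ba, bb, sa, sb, _, _, q, bα, bβ, bq, sα, sβ,
    fun p _ => (real_inner_comm _ _).trans (inner_cross_self_right _ _),
    fun p hp => inner_errW (hq p hp) (hw p hp), fun p hp => inner_errW (hq p hp) (hw p hp), ?_, ?_⟩
  · have t1 : Coupled S err N (fun p => inner ℝ (q p) (qd p - q p) • errW (wd p) (q p) (w p)) :=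
      Coupled.of_mul isBoundedBilinearMap_smul herr hN (bq.inner bsq') bb (Small.inner bq sq') sb
    have t2 : Coupled S err N (fun p => inner ℝ (qd p - q p) (errW (wd p) (q p) (w p)) • q p) :=
      Coupled.bilin isBoundedBilinearMap_smul.swap herr hN bq
        (Coupled.of_mul (B := fun p : E3 × E3 => Inner.inner ℝ p.1 p.2) isBoundedBilinearMap_inner
          herr hN bsq' bb sq' sb)
    have t3 : Coupled S err N (fun p => inner ℝ (q p - qd p) (wd p) • (qd p - q p)) :=
      Coupled.of_mul isBoundedBilinearMap_smul herr hN bα bsq' sα sq'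
    refine ((((t1.sub t2 herr hN).add t3 herr hN).add (c₀.cross_left bq herr hN)) herr hN).congr
      fun p hp => ?_
    rw [ha p hp, deriv_errQ_eq (hq p hp) (hw p hp) (hwd p hp)]
  · refine ((c₁.add (Coupled.cross bq (Coupled.cross bq c₂ herr hN) herr hN) herr hN)).congr
      fun p hp => ?_
    rw [hb p hp, one_apply_e3]
    exact (deriv_errW_eq (hq p hp) (hw p hp)).symm

end

end RodTransport
end

noncomputable section
namespace RodTransport

/-- The right-hand side of the reduced model. -/
def redField (P : Params) (ref : Reference) (p : ℝ × Slow) : Slow :=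
  f P ref p.1 p.2 (h P ref p.1 p.2) 0

/-- The distance of a state to its desired value. -/
def slowErr (P : Params) (ref : Reference) (p : ℝ × Slow) : ℝ := ‖p.2 - desired P ref p.1 p.2‖

/-- The points of the tube that satisfy the constraints. -/
def manifoldTube (t₀ : ℝ) (x : ℝ → Slow) (ρ : ℝ) : Set (ℝ × Slow) :=
  {p | p ∈ tube t₀ x ρ ∧ p.2.OnManifold}

theorem slowErr_nonneg (P : Params) (ref : Reference) (p : ℝ × Slow) : 0 ≤ slowErr P ref p :=
  norm_nonneg _

section lines

variable {E F G : Type*} [NormedAddCommGroup E] [NormedSpace ℝ E] [NormedAddCommGroup F]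
  [NormedSpace ℝ F] [NormedAddCommGroup G] [NormedSpace ℝ G]

theorem hasDerivAt_line {ψ : F → G} (A : E →L[ℝ] F) {p v : E} (h : DifferentiableAt ℝ ψ (A p)) :
    HasDerivAt (fun s : ℝ => ψ (A (p + s • v))) (fderiv ℝ ψ (A p) (A v)) 0 := by
  have h1 : HasDerivAt (fun s : ℝ => A (p + s • v)) (A v) 0 := by
    have h2 : HasDerivAt (fun s : ℝ => p + s • v) v 0 := by
      simpa using ((hasDerivAt_id (0 : ℝ)).smul_const v).const_add p
    exact A.hasFDerivAt.comp_hasDerivAt (0 : ℝ) h2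
  have h3 : HasFDerivAt ψ (fderiv ℝ ψ (A p)) (A (p + (0 : ℝ) • v)) := by
    simpa using h.hasFDerivAt
  exact h3.comp_hasDerivAt (0 : ℝ) h1

theorem hasDerivAt_line_clm (A : E →L[ℝ] F) (p v : E) :
    HasDerivAt (fun s : ℝ => A (p + s • v)) (A v) 0 := by
  have h2 : HasDerivAt (fun s : ℝ => p + s • v) v 0 := by
    simpa using ((hasDerivAt_id (0 : ℝ)).smul_const v).const_add p
  exact A.hasFDerivAt.comp_hasDerivAt (0 : ℝ) h2

theorem fderiv_eq_of_line {ψ : E → G} {p v : E} {d : G} (h : DifferentiableAt ℝ ψ p)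
    (hd : HasDerivAt (fun s : ℝ => ψ (p + s • v)) d 0) : fderiv ℝ ψ p v = d :=
  (hasDerivAt_line (ContinuousLinearMap.id ℝ E) h).unique hd

theorem hasDerivAt_cross {a b : ℝ → E3} {a' b' : E3} {s : ℝ} (ha : HasDerivAt a a' s)
    (hb : HasDerivAt b b' s) :
    HasDerivAt (fun s => a s ×ᵥ b s) (a' ×ᵥ b s + a s ×ᵥ b') s := by
  have h := (isBoundedBilinearMap_cross.hasFDerivAt (a s, b s)).comp_hasDerivAt s (ha.prodMk hb)
  rw [add_comm]
  exact h

theorem BddDerivOn.differentiableAt {φ : E → G} {S : Set E} (h : BddDerivOn φ S) {p : E}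
    (hp : p ∈ S) : DifferentiableAt ℝ φ p := (h.smooth p hp).differentiableAt (by simp)

/-- Projection to the first component of the state. -/
def prFst (E F : Type*) [NormedAddCommGroup E] [NormedSpace ℝ E] [NormedAddCommGroup F]
    [NormedSpace ℝ F] : (ℝ × (E × F)) →L[ℝ] ℝ × E :=
  (ContinuousLinearMap.fst ℝ ℝ (E × F)).prod
    (ContinuousLinearMap.fst ℝ E F ∘L ContinuousLinearMap.snd ℝ ℝ (E × F))

theorem BddSmoothOn.time {φ : ℝ → G} {t₀ ρ : ℝ} {c : ℝ → E} (h : BddSmoothOn φ (Ici t₀)) :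
    BddSmoothOn (fun p : ℝ × E => φ p.1) (tube t₀ c ρ) :=
  h.comp (bddDerivOn_clm (ContinuousLinearMap.fst ℝ ℝ E) _) fun _ hp => hp.1

theorem BddSmoothOn.hasFlowDeriv {a : ℝ × E → E3} {t₀ ρ : ℝ} {c : ℝ → E}
    (h : BddSmoothOn a (tube t₀ c ρ)) {S : Set (ℝ × E)} (hS : S ⊆ tube t₀ c ρ) (F : ℝ × E → E) :
    HasFlowDeriv S F a (fun p => fderiv ℝ a p (1, F p)) := by
  obtain ⟨C, hC⟩ := h.toBddDerivOn.fderiv.bdd_val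
  exact ⟨max C 0, le_max_right _ _, fun p hp => ⟨_, (h.differentiableAt (hS hp)).hasFDerivAt, rfl,
    (hC p (hS hp)).trans (le_max_left _ _)⟩⟩

end lines

def attPr : ℝ × Slow →L[ℝ] ℝ × (Mech × (Fin 2 → L3)) := prFst (Mech × (Fin 2 → L3)) (Fin 2 → E3)
def mechPr : ℝ × Slow →L[ℝ] ℝ × Mech := prFst Mech (Fin 2 → L3) ∘L attPr
def confPr : ℝ × Slow →L[ℝ] ℝ × Conf := prFst Conf (Fin 2 → E3) ∘L mechPr
def rodPr : ℝ × Slow →L[ℝ] ℝ × Rod := prFst Rod (Fin 2 → E3) ∘L confPr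

theorem attPr_apply (p : ℝ × Slow) : attPr p = (p.1, p.2.1) := rfl
theorem mechPr_apply (p : ℝ × Slow) : mechPr p = (p.1, p.2.mech) := rfl
theorem confPr_apply (p : ℝ × Slow) : confPr p = (p.1, p.2.mech.1) := rfl
theorem rodPr_apply (p : ℝ × Slow) : rodPr p = (p.1, p.2.mech.rod) := rfl

section pull

variable {G : Type*} [NormedAddCommGroup G] [NormedSpace ℝ G] {t₀ ρ : ℝ} {x : ℝ → Slow}

theorem BddSmoothOn.att_pull {φ : ℝ × (Mech × (Fin 2 → L3)) → G}
    (h : BddSmoothOn φ (tube t₀ (fun t => (x t).1) ρ)) :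
    BddSmoothOn (fun p : ℝ × Slow => φ (p.1, p.2.1)) (tube t₀ x ρ) :=
  h.comp (bddDerivOn_clm attPr _) fun p hp => att_mem_tube (t := p.1) (X := p.2) hp

theorem BddSmoothOn.mech_pull {φ : ℝ × Mech → G}
    (h : BddSmoothOn φ (tube t₀ (fun t => (x t).mech) ρ)) :
    BddSmoothOn (fun p : ℝ × Slow => φ (p.1, p.2.mech)) (tube t₀ x ρ) :=
  h.comp (bddDerivOn_clm mechPr _) fun p hp => mech_mem_tube (t := p.1) (X := p.2) hp

theorem BddSmoothOn.conf_pull {φ : ℝ × Conf → G}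
    (h : BddSmoothOn φ (tube t₀ (fun t => (x t).mech.1) ρ)) :
    BddSmoothOn (fun p : ℝ × Slow => φ (p.1, p.2.mech.1)) (tube t₀ x ρ) :=
  h.comp (bddDerivOn_clm confPr _) fun p hp => conf_mem_tube (t := p.1) (X := p.2) hp

theorem BddSmoothOn.rod_pull {φ : ℝ × Rod → G}
    (h : BddSmoothOn φ (tube t₀ (fun t => (x t).mech.rod) ρ)) :
    BddSmoothOn (fun p : ℝ × Slow => φ (p.1, p.2.mech.rod)) (tube t₀ x ρ) :=
  h.comp (bddDerivOn_clm rodPr _) fun p hp => rod_mem_tube (t := p.1) (X := p.2) hp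

end pull

namespace GoodTube

variable {P : Params} {ref : Reference} {t₀ ρ : ℝ} {x : ℝ → Slow} (hG : GoodTube P ref t₀ x ρ)
include hG

theorem rod_v : BddSmoothOn (fun p : ℝ × Slow => p.2.mech.rod.v) (tube t₀ x ρ) :=
  hG.rod_v₀.rod_pull

theorem rod_q : BddSmoothOn (fun p : ℝ × Slow => p.2.mech.rod.q) (tube t₀ x ρ) :=
  hG.rod_q₀.rod_pull

theorem rod_w : BddSmoothOn (fun p : ℝ × Slow => p.2.mech.rod.w) (tube t₀ x ρ) :=
  hG.rod_w₀.rod_pull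

theorem qc (j : Fin 2) : BddSmoothOn (fun p : ℝ × Slow => p.2.mech.qc j) (tube t₀ x ρ) :=
  (hG.qc₀ j).conf_pull

theorem wc (j : Fin 2) : BddSmoothOn (fun p : ℝ × Slow => p.2.mech.wc j) (tube t₀ x ρ) :=
  (hG.wc₀ j).mech_pull

theorem att (j : Fin 2) : BddSmoothOn (fun p : ℝ × Slow => p.2.att j) (tube t₀ x ρ) :=
  (hG.att₀ j).att_pull

theorem qd : BddSmoothOn (fun p : ℝ × Slow => ref.qd p.1) (tube t₀ x ρ) :=
  hG.href.bddSmoothOn_qd.time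

theorem wd : BddSmoothOn (fun p : ℝ × Slow => ref.wd p.1) (tube t₀ x ρ) :=
  hG.href.bddSmoothOn_wd.time

theorem vd : BddSmoothOn (fun p : ℝ × Slow => deriv ref.xd p.1) (tube t₀ x ρ) :=
  (BddSmoothOn.deriv hG.href.bddDerivOn_xd).time

theorem rod_pos : BddSmoothOn (fun p : ℝ × Slow => p.2.mech.rod.x - ref.xd p.1) (tube t₀ x ρ) :=
  hG.rod_pos₀.rod_pull

theorem muDes (j : Fin 2) :
    BddSmoothOn (fun p : ℝ × Slow => muDes P ref j p.1 p.2.mech.rod) (tube t₀ x ρ) :=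
  (hG.muDes₀ j).rod_pull

theorem qDes (j : Fin 2) :
    BddSmoothOn (fun p : ℝ × Slow => qDes P ref j (p.1, p.2.mech.rod)) (tube t₀ x ρ) :=
  (hG.qDes₀ j).rod_pull

theorem wDes (j : Fin 2) :
    BddSmoothOn (fun p : ℝ × Slow => wDes P ref j (p.1, p.2.mech.1)) (tube t₀ x ρ) :=
  (hG.wDes₀ j).conf_pull

theorem uDes (j : Fin 2) :
    BddSmoothOn (fun p : ℝ × Slow => uDes P ref j p.1 p.2.mech) (tube t₀ x ρ) :=
  (hG.uDes₀ j).mech_pull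

theorem OmDes (j : Fin 2) :
    BddSmoothOn (fun p : ℝ × Slow => OmDes P ref j (p.1, p.2.1)) (tube t₀ x ρ) :=
  (hG.OmDes₀ j).att_pull

theorem thrust (j : Fin 2) :
    BddSmoothOn (fun p : ℝ × Slow => thrust P ref p.1 p.2.mech p.2.att j) (tube t₀ x ρ) :=
  (hG.thrust₀ j).att_pull

theorem mechSmooth : MechSmooth (fun p : ℝ × Slow => p.2.mech) (tube t₀ x ρ) :=
  ⟨hG.rod_v, hG.rod_q, hG.rod_w, hG.qc, hG.wc⟩

end GoodTube

end RodTransport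
end

noncomputable section
namespace RodTransport

/-- Increments of the relative attitudes. -/
def attInc (P : Params) (ref : Reference) (t : ℝ) (X Y : Slow) : ℝ :=
  ∑ j, ‖relAtt P ref j t X - relAtt P ref j t Y‖

/-- Increments of the relative attitudes and of the errors of the cable directions. -/
def dirInc (P : Params) (ref : Reference) (t : ℝ) (X Y : Slow) : ℝ :=
  attInc P ref t X Y + ∑ j, ‖errQ (qDes P ref j (t, X.mech.rod)) (X.mech.qc j)
    - errQ (qDes P ref j (t, Y.mech.rod)) (Y.mech.qc j)‖

theorem attInc_nonneg (P : Params) (ref : Reference) (t : ℝ) (X Y : Slow) :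
    0 ≤ attInc P ref t X Y := Finset.sum_nonneg fun _ _ => norm_nonneg _

theorem attInc_le_dirInc (P : Params) (ref : Reference) (t : ℝ) (X Y : Slow) :
    attInc P ref t X Y ≤ dirInc P ref t X Y :=
  le_add_of_nonneg_right (Finset.sum_nonneg fun _ _ => norm_nonneg _)

theorem dirInc_nonneg (P : Params) (ref : Reference) (t : ℝ) (X Y : Slow) :
    0 ≤ dirInc P ref t X Y := (attInc_nonneg ..).trans (attInc_le_dirInc ..)

theorem tension_rootMech (P : Params) (u : Fin 2 → E3) (s : Mech) :
    tension P (rootMech P u s) = inelasticTension P u s := by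
  have := P.kbar_pos.ne'
  ext j; simp [tension, rootMech]; field_simp

theorem BddLip.norm {E : Type*} [NormedAddCommGroup E] {S : Set (ℝ × E)} {φ : ℝ × E → E3}
    (h : BddLip S φ) : BddLip S (fun p => ‖φ p‖) := by
  obtain ⟨C, hC, hb⟩ := h.bdd
  obtain ⟨L, hL, hl⟩ := h.lip
  exact ⟨⟨C, hC, fun p hp => by rw [norm_norm]; exact hb p hp⟩, L, hL,
    fun t X Y hX hY => (abs_norm_sub_norm_le _ _).trans (hl t X Y hX hY)⟩

section small

variable (P : Params) (ref : Reference) (S : Set (ℝ × Slow))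

theorem small_rod_x : Small S (slowErr P ref) (fun p => p.2.mech.rod.x - ref.xd p.1) :=
  ⟨1, zero_le_one, fun p _ => by
    rw [one_mul]; exact norm_rod_x_le (p.2 - desired P ref p.1 p.2)⟩

theorem small_rod_v : Small S (slowErr P ref) (fun p => p.2.mech.rod.v - deriv ref.xd p.1) :=
  ⟨1, zero_le_one, fun p _ => by
    rw [one_mul]; exact norm_rod_v_le (p.2 - desired P ref p.1 p.2)⟩

theorem small_rod_q : Small S (slowErr P ref) (fun p => p.2.mech.rod.q - ref.qd p.1) :=
  ⟨1, zero_le_one, fun p _ => by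
    rw [one_mul]; exact norm_rod_q_le (p.2 - desired P ref p.1 p.2)⟩

theorem small_rod_w : Small S (slowErr P ref) (fun p => p.2.mech.rod.w - ref.wd p.1) :=
  ⟨1, zero_le_one, fun p _ => by
    rw [one_mul]; exact norm_rod_w_le (p.2 - desired P ref p.1 p.2)⟩

theorem small_qc (j : Fin 2) : Small S (slowErr P ref)
    (fun p => p.2.mech.qc j - qDes P ref j (p.1, p.2.mech.rod)) :=
  ⟨1, zero_le_one, fun p _ => by
    rw [one_mul]; exact norm_qc_le (p.2 - desired P ref p.1 p.2) j⟩

theorem small_wc (j : Fin 2) : Small S (slowErr P ref)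
    (fun p => p.2.mech.wc j - wDes P ref j (p.1, p.2.mech.1)) :=
  ⟨1, zero_le_one, fun p _ => by
    rw [one_mul]; exact norm_wc_le (p.2 - desired P ref p.1 p.2) j⟩

theorem small_att (j : Fin 2) : Small S (slowErr P ref)
    (fun p => p.2.att j - RDes P ref j (p.1, p.2.mech)) :=
  ⟨1, zero_le_one, fun p _ => by
    rw [one_mul]; exact norm_att_le (p.2 - desired P ref p.1 p.2) j⟩

theorem small_om (j : Fin 2) : Small S (slowErr P ref)
    (fun p => p.2.om j - OmDes P ref j (p.1, p.2.1)) :=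
  ⟨1, zero_le_one, fun p _ => by
    rw [one_mul]; exact norm_om_le (p.2 - desired P ref p.1 p.2) j⟩

end small

attribute [local irreducible] muDes uDes b3Des RDes OmDes qDes wDes thrust errR errOm moment
  OmDesDot wDesDot desired nomTension inelasticTension

namespace GoodTube

variable {P : Params} {ref : Reference} {t₀ ρ : ℝ} {x : ℝ → Slow} (hG : GoodTube P ref t₀ x ρ)
include hG

theorem bddLip {F : Type*} [NormedAddCommGroup F] [NormedSpace ℝ F] {φ : ℝ × Slow → F}
    (h : BddSmoothOn φ (tube t₀ x ρ)) : BddLip (manifoldTube t₀ x ρ) φ :=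
  h.bddLip fun _ hp => hp.1

omit hG in
theorem isRot_att {p : ℝ × Slow} (hp : p ∈ manifoldTube t₀ x ρ) (j : Fin 2) :
    IsRot (p.2.att j) := isRot_of_mem_SO3 (hp.2.2.2 j).2.2

theorem isRot_RDes {p : ℝ × Slow} (hp : p ∈ tube t₀ x ρ) (j : Fin 2) :
    IsRot (RodTransport.RDes P ref j (p.1, p.2.mech)) := by
  obtain ⟨c, hc, h⟩ := hG.margin
  exact RodTransport.isRot_RDes (norm_pos_iff.1 (hc.trans_le (h p hp j).2.1))
    (norm_pos_iff.1 (hc.trans_le (h p hp j).2.2))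

theorem muDes_ne {p : ℝ × Slow} (hp : p ∈ tube t₀ x ρ) (j : Fin 2) :
    RodTransport.muDes P ref j p.1 p.2.mech.rod ≠ 0 := by
  obtain ⟨c, hc, h⟩ := hG.margin
  exact norm_pos_iff.1 (hc.trans_le (h p hp j).1)

theorem relAtt_sub_one_small (j : Fin 2) : Small (manifoldTube t₀ x ρ) (slowErr P ref)
    (fun p => RodTransport.relAtt P ref j p.1 p.2 - 1) := by
  have h1 : Small (manifoldTube t₀ x ρ) (slowErr P ref) (fun p =>
      ContinuousLinearMap.adjoint (p.2.att j) ∘L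
        (p.2.att j - RodTransport.RDes P ref j (p.1, p.2.mech))) :=
    (small_att P ref _ j).bilin isBoundedBilinearMap_comp (hG.bddLip (hG.att j).adjoint)
  refine (h1.clm (-ContinuousLinearMap.id ℝ L3)).congr fun p hp => ?_
  rw [ContinuousLinearMap.comp_sub, (isRot_att hp j).orth, RodTransport.relAtt]
  simp

theorem relAtt_coupled (j : Fin 2) : Coupled (manifoldTube t₀ x ρ) (slowErr P ref) (attInc P ref)
    (fun p => RodTransport.relAtt P ref j p.1 p.2 - 1) := by
  refine (Coupled.of_small (hG.bddLip ((hG.relAtt j).sub (bddSmoothOn_const 1 _)))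
    (hG.relAtt_sub_one_small j) (slowErr_nonneg P ref)).mono fun t X Y => ?_
  rw [sub_sub_sub_cancel_right]
  exact Finset.single_le_sum (f := fun j => ‖RodTransport.relAtt P ref j t X
    - RodTransport.relAtt P ref j t Y‖) (fun _ _ => norm_nonneg _) (Finset.mem_univ j)

theorem thrust_coupled (j : Fin 2) : Coupled (manifoldTube t₀ x ρ) (slowErr P ref) (attInc P ref)
    (fun p => RodTransport.thrust P ref p.1 p.2.mech p.2.att j
      - RodTransport.uDes P ref j p.1 p.2.mech) := by
  have e0 := slowErr_nonneg P ref
  have n0 := attInc_nonneg P ref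
  have h1 := (hG.relAtt_coupled j).clm (crossL (e 2) ∘L ContinuousLinearMap.apply ℝ E3 (e 2))
  have h2 : Coupled (manifoldTube t₀ x ρ) (slowErr P ref) (attInc P ref)
      (fun p => p.2.att j (e 2 ×ᵥ ((RodTransport.relAtt P ref j p.1 p.2 - 1) (e 2)))) :=
    h1.bilin isBoundedBilinearMap_apply e0 n0 (hG.bddLip (hG.att j))
  have h3 := Coupled.cross (hG.bddLip ((hG.att j).clm_apply (bddSmoothOn_const (e 2) _))) h2 e0 n0
  have h4 := h3.bilin isBoundedBilinearMap_smul e0 n0 (hG.bddLip (hG.uDes j)).norm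
  refine h4.congr fun p hp => ?_
  exact (thrust_sub_uDes (isRot_att hp j) (hG.isRot_RDes hp.1 j)).symm

theorem tension_coupled (j : Fin 2) : Coupled (manifoldTube t₀ x ρ) (slowErr P ref)
    (attInc P ref) (fun p => tension P (RodTransport.h P ref p.1 p.2) j
      - nomTension P ref p.1 p.2.mech j) := by
  have e0 := slowErr_nonneg P ref
  have n0 := attInc_nonneg P ref
  have h1 : ∀ i, BddLip (manifoldTube t₀ x ρ)
      (fun p => (tensionMatrix P p.2.mech)⁻¹ j i) := fun i => by
    have h2 := hG.mechSmooth.invMulVec P (b := fun _ => Pi.single i 1)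
      (fun k => bddSmoothOn_const _ _) j
    refine (hG.bddLip h2).congr fun p _ => ?_
    simp
  have h2 : ∀ i, Coupled (manifoldTube t₀ x ρ) (slowErr P ref) (attInc P ref)
      (fun p => (tensionMatrix P p.2.mech)⁻¹ j i * inner ℝ (p.2.mech.qc i)
        (RodTransport.thrust P ref p.1 p.2.mech p.2.att i
          - RodTransport.uDes P ref i p.1 p.2.mech)) := fun i =>
    ((hG.thrust_coupled i).bilin (B := fun p : E3 × E3 => inner ℝ p.1 p.2)
      isBoundedBilinearMap_inner e0 n0 (hG.bddLip (hG.qc i))).bilin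
      (B := fun p : ℝ × ℝ => p.1 * p.2) isBoundedBilinearMap_mul e0 n0 (h1 i)
  refine ((((h2 0).add (h2 1) e0 n0).clm (-P.mQ⁻¹ • ContinuousLinearMap.id ℝ ℝ))).congr
    fun p hp => ?_
  have hq : ∀ j, ‖p.2.mech.qc j‖ = 1 := fun j => (hp.2.2.2 j).1
  rw [RodTransport.h, tension_rootMech, ← inelasticTension_uDes hq, mulVec_inv_sub,
    Fin.sum_univ_two]
  rfl

omit hG in
theorem _root_.RodTransport.rodAcc_sub (T T' : Fin 2 → ℝ) (s : Mech) :
    rodAcc P T s - rodAcc P T' s =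
      -(P.mr⁻¹ • ((T 0 - T' 0) • s.qc 0 + (T 1 - T' 1) • s.qc 1)) := by
  simp only [rodAcc, Fin.sum_univ_two]; module

omit hG in
theorem _root_.RodTransport.rodAngAcc_sub (T T' : Fin 2 → ℝ) (s : Mech) :
    rodAngAcc P T s - rodAngAcc P T' s =
      -((2 / 3 * P.mr * P.Lr)⁻¹ •
        (s.rod.q ×ᵥ ((T 1 - T' 1) • s.qc 1 - (T 0 - T' 0) • s.qc 0))) := by
  simp only [rodAngAcc, Fin.sum_univ_two, cross_add, cross_sub, cross_smul, sgn]; simp; module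

omit hG in
theorem _root_.RodTransport.endAcc_sub (T T' : Fin 2 → ℝ) (s : Mech) (j : Fin 2) :
    endAcc P T s j - endAcc P T' s j = (rodAcc P T s - rodAcc P T' s)
      + (sgn j * P.Lr) • ((rodAngAcc P T s - rodAngAcc P T' s) ×ᵥ s.rod.q) := by
  simp only [endAcc, dirAcc, sub_cross]; module

theorem rodAcc_coupled : Coupled (manifoldTube t₀ x ρ) (slowErr P ref) (attInc P ref)
    (fun p => (redField P ref p).mech.rod.v - nomAcc P ref p.1 p.2.mech.1) := by
  have e0 := slowErr_nonneg P ref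
  have n0 := attInc_nonneg P ref
  have h1 := fun j => (hG.tension_coupled j).bilin (isBoundedBilinearMap_smul
    (𝕜 := ℝ) (E := E3)).swap e0 n0 (hG.bddLip (hG.qc j))
  refine (((h1 0).add (h1 1) e0 n0).clm (-P.mr⁻¹ • ContinuousLinearMap.id ℝ E3)).congr
    fun p hp => ?_
  rw [← rodAcc_nomTension fun j => (hp.2.2.2 j).1]
  refine Eq.trans ?_ (RodTransport.rodAcc_sub (tension P (RodTransport.h P ref p.1 p.2)) _ _).symm
  simp; abel

theorem rodAngAcc_coupled : Coupled (manifoldTube t₀ x ρ) (slowErr P ref) (attInc P ref)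
    (fun p => (redField P ref p).mech.rod.w - nomAngAcc P ref p.1 p.2.mech.1) := by
  have e0 := slowErr_nonneg P ref
  have n0 := attInc_nonneg P ref
  have h1 := fun j => (hG.tension_coupled j).bilin (isBoundedBilinearMap_smul
    (𝕜 := ℝ) (E := E3)).swap e0 n0 (hG.bddLip (hG.qc j))
  refine ((Coupled.cross (hG.bddLip hG.rod_q) ((h1 1).sub (h1 0) e0 n0) e0 n0).clm
    (-(2 / 3 * P.mr * P.Lr)⁻¹ • ContinuousLinearMap.id ℝ E3)).congr fun p hp => ?_
  rw [← rodAngAcc_nomTension fun j => (hp.2.2.2 j).1]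
  refine Eq.trans ?_
    (RodTransport.rodAngAcc_sub (tension P (RodTransport.h P ref p.1 p.2)) _ _).symm
  simp

theorem endAcc_coupled (j : Fin 2) : Coupled (manifoldTube t₀ x ρ) (slowErr P ref) (attInc P ref)
    (fun p => endAcc P (tension P (RodTransport.h P ref p.1 p.2)) p.2.mech j
      - (nomEndAcc P ref j p.1 p.2.mech + P.grav • e 2)) := by
  have e0 := slowErr_nonneg P ref
  have n0 := attInc_nonneg P ref
  refine (hG.rodAcc_coupled.add ((hG.rodAngAcc_coupled.cross_left (hG.bddLip hG.rod_q) e0 n0).clm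
    ((sgn j * P.Lr) • ContinuousLinearMap.id ℝ E3)) e0 n0).congr fun p hp => ?_
  have hq : ∀ j, ‖p.2.mech.qc j‖ = 1 := fun j => (hp.2.2.2 j).1
  rw [← rodAcc_nomTension hq, ← rodAngAcc_nomTension hq, ← endAcc_nomTension hq j,
    RodTransport.endAcc_sub]
  rfl

end GoodTube

end RodTransport
end

noncomputable section
namespace RodTransport

/-- The line through `p` in the direction `v`. -/
def lineMap {E : Type*} [NormedAddCommGroup E] [NormedSpace ℝ E] (p v : E) (s : ℝ) : E :=
  p + s • v

theorem lineMap_zero {E : Type*} [NormedAddCommGroup E] [NormedSpace ℝ E] (p v : E) :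
    lineMap p v 0 = p := by rw [lineMap, zero_smul, add_zero]

/-- The line through `p` in the direction of the reduced model. -/
def flowLine (P : Params) (ref : Reference) (p : ℝ × Slow) (s : ℝ) : ℝ × Slow :=
  lineMap p ((1 : ℝ), redField P ref p) s

theorem flowLine_zero (P : Params) (ref : Reference) (p : ℝ × Slow) : flowLine P ref p 0 = p :=
  lineMap_zero _ _

section

variable {G : Type*} [NormedAddCommGroup G] [NormedSpace ℝ G] {F : Type*} [NormedAddCommGroup F]
  [NormedSpace ℝ F] {P : Params} {ref : Reference} {p : ℝ × Slow}

theorem hasDerivAt_flowLine_clm (A : ℝ × Slow →L[ℝ] G) :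
    HasDerivAt (fun s => A (flowLine P ref p s)) (A (1, redField P ref p)) 0 :=
  hasDerivAt_line_clm A p _

theorem hasDerivAt_flowLine {ψ : F → G} (A : ℝ × Slow →L[ℝ] F) (h : DifferentiableAt ℝ ψ (A p)) :
    HasDerivAt (fun s => ψ (A (flowLine P ref p s)))
      (fderiv ℝ ψ (A p) (A (1, redField P ref p))) 0 :=
  hasDerivAt_line A h

theorem fderiv_eq_of_flowLine {ψ : ℝ × Slow → G} {d : G} (h : DifferentiableAt ℝ ψ p)
    (hd : HasDerivAt (fun s => ψ (flowLine P ref p s)) d 0) :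
    fderiv ℝ ψ p (1, redField P ref p) = d := fderiv_eq_of_line h hd

end

section

variable {P : Params} {ref : Reference}

theorem line_rod_q (p : ℝ × Slow) : HasDerivAt (fun s => (flowLine P ref p s).2.mech.rod.q)
    (p.2.mech.rod.w ×ᵥ p.2.mech.rod.q) 0 :=
  hasDerivAt_flowLine_clm (Rod.qL ∘L ContinuousLinearMap.snd ℝ ℝ Rod ∘L rodPr)

theorem line_rod_w (p : ℝ × Slow) : HasDerivAt (fun s => (flowLine P ref p s).2.mech.rod.w)
    (redField P ref p).mech.rod.w 0 :=
  hasDerivAt_flowLine_clm (Rod.wL ∘L ContinuousLinearMap.snd ℝ ℝ Rod ∘L rodPr)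

theorem line_rod_v (p : ℝ × Slow) : HasDerivAt (fun s => (flowLine P ref p s).2.mech.rod.v)
    (redField P ref p).mech.rod.v 0 :=
  hasDerivAt_flowLine_clm (Rod.vL ∘L ContinuousLinearMap.snd ℝ ℝ Rod ∘L rodPr)

theorem line_rod_x (p : ℝ × Slow) : HasDerivAt (fun s => (flowLine P ref p s).2.mech.rod.x)
    p.2.mech.rod.v 0 :=
  hasDerivAt_flowLine_clm (ContinuousLinearMap.fst ℝ E3 (E3 × E3 × E3) ∘L
    ContinuousLinearMap.snd ℝ ℝ Rod ∘L rodPr)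

theorem line_qc (p : ℝ × Slow) (j : Fin 2) :
    HasDerivAt (fun s => (flowLine P ref p s).2.mech.qc j)
      (p.2.mech.wc j ×ᵥ p.2.mech.qc j) 0 :=
  hasDerivAt_flowLine_clm (sndApplyL j ∘L ContinuousLinearMap.snd ℝ ℝ Conf ∘L confPr)

theorem line_wc (p : ℝ × Slow) (j : Fin 2) :
    HasDerivAt (fun s => (flowLine P ref p s).2.mech.wc j) ((redField P ref p).mech.wc j) 0 :=
  hasDerivAt_flowLine_clm (sndApplyL j ∘L ContinuousLinearMap.snd ℝ ℝ Mech ∘L mechPr)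

theorem line_time {φ : ℝ → E3} {p : ℝ × Slow} (h : DifferentiableAt ℝ φ p.1) :
    HasDerivAt (fun s => φ (flowLine P ref p s).1) (deriv φ p.1) 0 :=
  hasDerivAt_flowLine (ContinuousLinearMap.fst ℝ ℝ Slow) h

end

attribute [local irreducible] redField flowLine

theorem adjoint_one : ContinuousLinearMap.adjoint (1 : L3) = 1 :=
  ContinuousLinearMap.adjoint_id

theorem sq_le_inner_one (v : E3) : 1 * ‖v‖ ^ 2 ≤ inner ℝ v ((1 : L3) v) := by
  rw [one_apply_e3, real_inner_self_eq_norm_sq, one_mul]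

theorem dissipates_direction {P : Params} {ref : Reference} {t₀ ρ : ℝ} {x : ℝ → Slow}
    {N : ℝ → Slow → Slow → ℝ} (hN : ∀ t X Y, 0 ≤ N t X Y)
    {q w qd wd wdn κ₀ κ₁ κ₂ : ℝ × Slow → E3} {k k' : ℝ} (hk : 0 < k) (hk' : 0 < k')
    (bq : BddSmoothOn q (tube t₀ x ρ)) (bw : BddSmoothOn w (tube t₀ x ρ))
    (bqd : BddSmoothOn qd (tube t₀ x ρ)) (bwd : BddSmoothOn wd (tube t₀ x ρ))
    (sq : Small (manifoldTube t₀ x ρ) (slowErr P ref) (fun p => q p - qd p))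
    (sw : Small (manifoldTube t₀ x ρ) (slowErr P ref) (fun p => w p - wd p))
    (hq : ∀ p ∈ manifoldTube t₀ x ρ, ‖q p‖ = 1)
    (hw : ∀ p ∈ manifoldTube t₀ x ρ, inner ℝ (w p) (q p) = 0)
    (hwd : ∀ p ∈ manifoldTube t₀ x ρ, inner ℝ (qd p) (wd p) = 0)
    (c₀ : Coupled (manifoldTube t₀ x ρ) (slowErr P ref) N κ₀)
    (c₁ : Coupled (manifoldTube t₀ x ρ) (slowErr P ref) N κ₁)
    (c₂ : Coupled (manifoldTube t₀ x ρ) (slowErr P ref) N κ₂)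
    (lq : ∀ p ∈ manifoldTube t₀ x ρ,
      HasDerivAt (fun s => q (flowLine P ref p s)) (w p ×ᵥ q p) 0)
    (lqd : ∀ p ∈ manifoldTube t₀ x ρ,
      HasDerivAt (fun s => qd (flowLine P ref p s)) (wd p ×ᵥ qd p + κ₀ p) 0)
    (lw : ∀ p ∈ manifoldTube t₀ x ρ, HasDerivAt (fun s => w (flowLine P ref p s))
      (-(q p ×ᵥ (q p ×ᵥ wdn p)) + inner ℝ (q p) (wd p) • (q p ×ᵥ w p)
        - k • errQ (qd p) (q p) - k' • errW (wd p) (q p) (w p) + κ₁ p) 0)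
    (lwd : ∀ p ∈ manifoldTube t₀ x ρ,
      HasDerivAt (fun s => wd (flowLine P ref p s)) (wdn p + κ₂ p) 0) :
    ∃ W, Dissipates (manifoldTube t₀ x ρ) (redField P ref) (slowErr P ref) W
      (fun t X Y => ‖errQ (qd (t, X)) (q (t, X)) - errQ (qd (t, Y)) (q (t, Y))‖ ^ 2
        + ‖errW (wd (t, X)) (q (t, X)) (w (t, X)) - errW (wd (t, Y)) (q (t, Y)) (w (t, Y))‖ ^ 2)
      (fun t X Y => N t X Y ^ 2) := by
  have hS : manifoldTube t₀ x ρ ⊆ tube t₀ x ρ := fun _ hp => hp.1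
  have ba : BddSmoothOn (fun p => errQ (qd p) (q p)) (tube t₀ x ρ) := bqd.cross bq
  have bb : BddSmoothOn (fun p => errW (wd p) (q p) (w p)) (tube t₀ x ρ) :=
    bw.add (bq.cross (bq.cross bwd))
  have h := isOsc_direction (slowErr_nonneg P ref) hN (bq.bddLip hS) (bw.bddLip hS)
    (bqd.bddLip hS) (bwd.bddLip hS) sq sw hq hw hwd c₀ c₁ c₂ (k := k) (k' := k') (wdn := wdn)
    (a₁ := fun p => fderiv ℝ (fun p => errQ (qd p) (q p)) p (1, redField P ref p))
    (b₁ := fun p => fderiv ℝ (fun p => errW (wd p) (q p) (w p)) p (1, redField P ref p))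
    (fun p hp => ?_) (fun p hp => ?_)
  · have h' := h.dissipates hk hk' one_pos adjoint_one sq_le_inner_one (slowErr_nonneg P ref) hN
      (ba.hasFlowDeriv hS _) (bb.hasFlowDeriv hS _)
    exact h'
  · refine fderiv_eq_of_flowLine (ba.differentiableAt (hS hp)) ?_
    have h1 := hasDerivAt_cross (lqd p hp) (lq p hp)
    rw [flowLine_zero] at h1
    exact h1
  · refine fderiv_eq_of_flowLine (bb.differentiableAt (hS hp)) ?_
    have h1 := (lw p hp).add (hasDerivAt_cross (lq p hp) (hasDerivAt_cross (lq p hp) (lwd p hp)))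
    simp only [flowLine_zero] at h1
    exact h1

attribute [local irreducible] muDes uDes b3Des RDes OmDes qDes wDes thrust errR errOm moment
  OmDesDot wDesDot desired nomTension inelasticTension

namespace GoodTube

variable {P : Params} {ref : Reference} {t₀ ρ : ℝ} {x : ℝ → Slow} (hG : GoodTube P ref t₀ x ρ)
include hG

theorem errQ_small (j : Fin 2) : Small (manifoldTube t₀ x ρ) (slowErr P ref)
    (fun p => errQ (RodTransport.qDes P ref j (p.1, p.2.mech.rod)) (p.2.mech.qc j)) := by
  refine (Small.cross (hG.bddLip (hG.qDes j)) (small_qc P ref _ j)).congr fun p _ => ?_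
  rw [cross_sub, cross_self, sub_zero, errQ]

theorem errQ_coupled (j : Fin 2) : Coupled (manifoldTube t₀ x ρ) (slowErr P ref) (dirInc P ref)
    (fun p => errQ (RodTransport.qDes P ref j (p.1, p.2.mech.rod)) (p.2.mech.qc j)) := by
  refine (Coupled.of_small (hG.bddLip ((hG.qDes j).cross (hG.qc j))) (hG.errQ_small j)
    (slowErr_nonneg P ref)).mono fun t X Y => ?_
  refine (Finset.single_le_sum (f := fun j =>
    ‖errQ (RodTransport.qDes P ref j (t, X.mech.rod)) (X.mech.qc j)
    - errQ (RodTransport.qDes P ref j (t, Y.mech.rod)) (Y.mech.qc j)‖)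
    (fun _ _ => norm_nonneg _) (Finset.mem_univ j)).trans
    (le_add_of_nonneg_left (attInc_nonneg P ref t X Y))

theorem mu_coupled (j : Fin 2) : Coupled (manifoldTube t₀ x ρ) (slowErr P ref) (dirInc P ref)
    (fun p => mu P ref j p.1 p.2.mech.1 - RodTransport.muDes P ref j p.1 p.2.mech.rod) := by
  have e0 := slowErr_nonneg P ref
  have n0 := dirInc_nonneg P ref
  refine (Coupled.cross (hG.bddLip (hG.qc j)) ((hG.errQ_coupled j).bilin
    isBoundedBilinearMap_smul e0 n0 (hG.bddLip (hG.muDes j)).norm) e0 n0).congr fun p hp => ?_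
  have h1 : ‖RodTransport.muDes P ref j p.1 p.2.mech.rod‖ •
      errQ (RodTransport.qDes P ref j (p.1, p.2.mech.rod)) (p.2.mech.qc j) =
      p.2.mech.qc j ×ᵥ RodTransport.muDes P ref j p.1 p.2.mech.rod := by
    rw [errQ, RodTransport.qDes, neg_cross, cross_comm, neg_neg, ← cross_smul, smul_unitVec]
  change p.2.mech.qc j ×ᵥ (‖RodTransport.muDes P ref j p.1 p.2.mech.rod‖ •
      errQ (RodTransport.qDes P ref j (p.1, p.2.mech.rod)) (p.2.mech.qc j)) = _
  rw [h1, mu, add_sub_cancel_left]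

theorem dissipates_position : ∃ W, Dissipates (manifoldTube t₀ x ρ) (redField P ref)
    (slowErr P ref) W
    (fun t X Y => ‖(X.mech.rod.x - ref.xd t) - (Y.mech.rod.x - ref.xd t)‖ ^ 2
      + ‖(X.mech.rod.v - deriv ref.xd t) - (Y.mech.rod.v - deriv ref.xd t)‖ ^ 2)
    (fun t X Y => dirInc P ref t X Y ^ 2) := by
  have e0 := slowErr_nonneg P ref
  have n0 := dirInc_nonneg P ref
  have hS : manifoldTube t₀ x ρ ⊆ tube t₀ x ρ := fun _ hp => hp.1
  have bb := hG.rod_v.sub hG.vd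
  have h : IsOsc (manifoldTube t₀ x ρ) (slowErr P ref) (dirInc P ref) 1 P.kx P.kv
      (fun p => p.2.mech.rod.x - ref.xd p.1) (fun p => p.2.mech.rod.v - deriv ref.xd p.1)
      (fun p => fderiv ℝ (fun p : ℝ × Slow => p.2.mech.rod.x - ref.xd p.1) p (1, redField P ref p))
      (fun p => fderiv ℝ (fun p : ℝ × Slow => p.2.mech.rod.v - deriv ref.xd p.1) p
        (1, redField P ref p)) := by
    have b0 : BddLip (manifoldTube t₀ x ρ) (fun _ => (0 : ℝ)) :=
      hG.bddLip (bddSmoothOn_const _ _)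
    have z0 : Small (manifoldTube t₀ x ρ) (slowErr P ref) (fun _ => (0 : ℝ)) :=
      ⟨0, le_rfl, fun p _ => by simp⟩
    refine ⟨hG.bddLip hG.rod_pos, hG.bddLip bb, small_rod_x P ref _, small_rod_v P ref _,
      fun _ => 0, fun _ => 0, fun _ => 0, b0, b0, hG.bddLip (bddSmoothOn_const _ _), z0, z0,
      fun _ _ => inner_zero_right _, fun _ _ => inner_zero_right _, fun _ _ => inner_zero_right _,
      ?_, ?_⟩
    · refine (Coupled.zero e0 n0).congr fun p hp => ?_
      have h1 : fderiv ℝ (fun p : ℝ × Slow => p.2.mech.rod.x - ref.xd p.1) p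
          (1, redField P ref p) = p.2.mech.rod.v - deriv ref.xd p.1 :=
        fderiv_eq_of_flowLine (hG.rod_pos.differentiableAt (hS hp)) ((line_rod_x p).sub
          (line_time (hG.href.smooth_xd.differentiable (by simp) _)))
      rw [h1]; simp
    · refine ((hG.rodAcc_coupled.mono (attInc_le_dirInc P ref)).add
        (((hG.mu_coupled 0).add (hG.mu_coupled 1) e0 n0).clm
          (P.mr⁻¹ • ContinuousLinearMap.id ℝ E3)) e0 n0).congr fun p hp => ?_
      have h1 : fderiv ℝ (fun p : ℝ × Slow => p.2.mech.rod.v - deriv ref.xd p.1) p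
          (1, redField P ref p) = (redField P ref p).mech.rod.v - deriv (deriv ref.xd) p.1 :=
        fderiv_eq_of_flowLine (bb.differentiableAt (hS hp)) ((line_rod_v p).sub
          (line_time (((contDiff_infty_iff_deriv.1 hG.href.smooth_xd).2).differentiable
            (by simp) _)))
      have hm := P.mr_pos.ne'
      have h2 : RodTransport.muDes P ref 0 p.1 p.2.mech.rod
          + RodTransport.muDes P ref 1 p.1 p.2.mech.rod = muSum P ref p.1 p.2.mech.rod := by
        simp only [RodTransport.muDes, sgn]; simp; module
      have h3 : P.mr⁻¹ • muSum P ref p.1 p.2.mech.rod = deriv (deriv ref.xd) p.1 + P.grav • e 2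
          - P.kv • (p.2.mech.rod.v - deriv ref.xd p.1)
          - P.kx • (p.2.mech.rod.x - ref.xd p.1) := by
        rw [muSum, smul_smul, inv_mul_cancel₀ hm, one_smul]
      rw [h1, one_apply_e3, nomAcc]
      simp only [smul_apply, ContinuousLinearMap.id_apply]
      rw [eq_comm, ← sub_eq_zero]
      have h4 : P.mr⁻¹ • (mu P ref 0 p.1 p.2.mech.1
          - RodTransport.muDes P ref 0 p.1 p.2.mech.rod
          + (mu P ref 1 p.1 p.2.mech.1 - RodTransport.muDes P ref 1 p.1 p.2.mech.rod)) =
          P.mr⁻¹ • (mu P ref 0 p.1 p.2.mech.1 + mu P ref 1 p.1 p.2.mech.1)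
          - P.mr⁻¹ • muSum P ref p.1 p.2.mech.rod := by rw [← h2]; module
      rw [h4, h3]
      module
  have h' := h.dissipates P.kx_pos P.kv_pos one_pos adjoint_one sq_le_inner_one e0 n0
      (hG.rod_pos.hasFlowDeriv hS _) (bb.hasFlowDeriv hS _)
  exact h'

end GoodTube

end RodTransport
end

noncomputable section
namespace RodTransport

theorem inner_deriv_eq_zero {c : ℝ → E3} {c' : E3} {s : ℝ} (hc : HasDerivAt c c' s)
    (h : ∀ᶠ u in 𝓝 s, ‖c u‖ = 1) : inner ℝ (c s) c' = 0 := by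
  have h1 := hc.norm_sq
  have h2 : HasDerivAt (fun u => ‖c u‖ ^ 2) 0 s :=
    (hasDerivAt_const s (1 : ℝ)).congr_of_eventuallyEq (h.mono fun u hu => by
      change ‖c u‖ ^ 2 = 1
      rw [hu, one_pow])
  have h3 := h1.unique h2
  linarith

theorem cross_deriv_cross {q q' : E3} (hq : ‖q‖ = 1) (h : inner ℝ q q' = 0) :
    (q ×ᵥ q') ×ᵥ q = q' := by
  rw [cross_comm, cross_cross, h, real_inner_self_eq_norm_sq, hq]; simp

theorem cross_muDiff {P : Params} {ref : Reference} {t : ℝ} {s : Rod} (hq : ‖s.q‖ = 1)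
    (hw : inner ℝ s.w s.q = 0) :
    (2 / 3 * P.mr * P.Lr)⁻¹ • (s.q ×ᵥ muDiff P ref t s) =
      -(s.q ×ᵥ (s.q ×ᵥ deriv ref.wd t)) + inner ℝ s.q (ref.wd t) • (s.q ×ᵥ s.w)
      - P.kq • errQ (ref.qd t) s.q - P.kw • errW (ref.wd t) s.q s.w := by
  have hm := P.mr_pos
  have hL := P.Lr_pos
  have hx : s.q ×ᵥ (s.q ×ᵥ (s.q ×ᵥ ref.wd t)) = -(s.q ×ᵥ ref.wd t) := by
    rw [cross_cross_of_norm_one hq, inner_cross_self_left]; simp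
  have h1 : s.q ×ᵥ (s.q ×ᵥ errW (ref.wd t) s.q s.w) = -errW (ref.wd t) s.q s.w := by
    rw [cross_cross_of_norm_one hq, real_inner_comm, inner_errW hq hw]; simp
  have h2 : s.q ×ᵥ (s.q ×ᵥ errQ (ref.qd t) s.q) = -errQ (ref.qd t) s.q := by
    rw [cross_cross_of_norm_one hq, errQ, inner_cross_self_right]; simp
  have h3 : s.q ×ᵥ errW (ref.wd t) s.q s.w = s.q ×ᵥ s.w - s.q ×ᵥ ref.wd t := by
    rw [errW_eq hq, cross_sub, cross_add, cross_smul, cross_self]; simp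
  rw [muDiff, cross_smul, smul_smul, inv_mul_cancel₀ (by positivity), one_smul, cross_add,
    cross_add, cross_add, cross_sub, cross_neg, cross_smul, cross_smul, cross_smul, cross_smul, hx,
    h1, h2, h3]
  module

theorem redField_rod (P : Params) (ref : Reference) (p : ℝ × Slow) :
    (redField P ref p).mech.rod = (p.2.mech.rod.v, (redField P ref p).mech.rod.v,
      p.2.mech.rod.w ×ᵥ p.2.mech.rod.q, (redField P ref p).mech.rod.w) := rfl

theorem redField_qc (P : Params) (ref : Reference) (p : ℝ × Slow) :
    (redField P ref p).mech.qc = fun j => p.2.mech.wc j ×ᵥ p.2.mech.qc j := rfl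

theorem redField_wc (P : Params) (ref : Reference) (p : ℝ × Slow) (j : Fin 2) :
    (redField P ref p).mech.wc j = P.Lc⁻¹ • (p.2.mech.qc j ×ᵥ
      (endAcc P (tension P (h P ref p.1 p.2)) p.2.mech j
        - P.mQ⁻¹ • thrust P ref p.1 p.2.mech p.2.att j)) := by
  change cableAngAcc P (thrust P ref p.1 p.2.mech p.2.att) 0 p.2.mech (h P ref p.1 p.2) j = _
  rw [cableAngAcc, cableLength]
  simp

theorem redField_rod_sub (P : Params) (ref : Reference) (p : ℝ × Slow) :
    (redField P ref p).mech.rod - nomRodField P ref p.1 p.2.mech.1 =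
      (0, (redField P ref p).mech.rod.v - nomAcc P ref p.1 p.2.mech.1,
        0, (redField P ref p).mech.rod.w - nomAngAcc P ref p.1 p.2.mech.1) := by
  rw [redField_rod, nomRodField, Prod.mk_sub_mk, Prod.mk_sub_mk, Prod.mk_sub_mk, sub_self, sub_self]

theorem rodPr_redField (P : Params) (ref : Reference) (p : ℝ × Slow) :
    rodPr (1, redField P ref p) = (1, nomRodField P ref p.1 p.2.mech.1)
      + (0, (redField P ref p).mech.rod - nomRodField P ref p.1 p.2.mech.1) := by
  rw [rodPr_apply, Prod.mk_add_mk, add_zero, add_sub_cancel]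

theorem confPr_redField (P : Params) (ref : Reference) (p : ℝ × Slow) :
    confPr (1, redField P ref p) =
      (1, (nomRodField P ref p.1 p.2.mech.1, fun j => p.2.mech.wc j ×ᵥ p.2.mech.qc j))
      + (0, ((redField P ref p).mech.rod - nomRodField P ref p.1 p.2.mech.1, 0)) := by
  rw [confPr_apply, Prod.mk_add_mk, add_zero, Prod.mk_add_mk, add_zero, add_sub_cancel,
    ← redField_qc P ref]

attribute [local irreducible] redField flowLine muDes uDes b3Des RDes OmDes thrust errR errOm moment
  OmDesDot wDesDot desired nomTension inelasticTension

theorem norm_qDes {P : Params} {ref : Reference} {j : Fin 2} {p : ℝ × Rod}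
    (h : muDes P ref j p.1 p.2 ≠ 0) : ‖qDes P ref j p‖ = 1 := by
  rw [qDes, norm_neg, norm_unitVec h]

attribute [local irreducible] qDes wDes

namespace GoodTube

variable {P : Params} {ref : Reference} {t₀ ρ : ℝ} {x : ℝ → Slow} (hG : GoodTube P ref t₀ x ρ)
include hG

theorem wd_cross_qd (t : ℝ) : ref.wd t ×ᵥ ref.qd t = deriv ref.qd t :=
  cross_deriv_cross (hG.href.norm_qd t) (inner_deriv_eq_zero
    (hG.href.smooth_qd.differentiable (by simp) t).hasDerivAt
    (Eventually.of_forall hG.href.norm_qd))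

omit hG in
theorem _root_.RodTransport.inner_qd_wd (ref : Reference) (t : ℝ) :
    inner ℝ (ref.qd t) (ref.wd t) = 0 :=
  inner_cross_self_left _ _

theorem smooth_wd : ContDiff ℝ ∞ ref.wd := by
  have h1 : ContDiff ℝ ∞ (deriv ref.qd) := (contDiff_infty_iff_deriv.1 hG.href.smooth_qd).2
  exact isBoundedBilinearMap_cross.contDiff.comp (hG.href.smooth_qd.prodMk h1)

theorem dissipates_rod : ∃ W, Dissipates (manifoldTube t₀ x ρ) (redField P ref)
    (slowErr P ref) W
    (fun t X Y => ‖errQ (ref.qd t) X.mech.rod.q - errQ (ref.qd t) Y.mech.rod.q‖ ^ 2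
      + ‖errW (ref.wd t) X.mech.rod.q X.mech.rod.w - errW (ref.wd t) Y.mech.rod.q Y.mech.rod.w‖ ^ 2)
    (fun t X Y => dirInc P ref t X Y ^ 2) := by
  have e0 := slowErr_nonneg P ref
  have n0 := dirInc_nonneg P ref
  have c1 := (hG.rodAngAcc_coupled.mono (attInc_le_dirInc P ref)).add
    ((Coupled.cross (hG.bddLip hG.rod_q) ((hG.mu_coupled 1).sub (hG.mu_coupled 0) e0 n0) e0 n0).clm
      ((2 / 3 * P.mr * P.Lr)⁻¹ • ContinuousLinearMap.id ℝ E3)) e0 n0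
  have h := dissipates_direction n0 P.kq_pos P.kw_pos hG.rod_q hG.rod_w hG.qd hG.wd
    (small_rod_q P ref _) (small_rod_w P ref _) (fun p hp => hp.2.1) (fun p hp => hp.2.2.1)
    (fun p _ => inner_qd_wd ref p.1) (Coupled.zero e0 n0) c1 (Coupled.zero e0 n0)
    (wdn := fun p => deriv ref.wd p.1)
    (fun p _ => line_rod_q p) (fun p _ => ?_) (fun p hp => ?_) (fun p _ => ?_)
  · exact h
  · rw [add_zero, hG.wd_cross_qd]
    exact line_time (hG.href.smooth_qd.differentiable (by simp) _)
  · have h2 : muDiff P ref p.1 p.2.mech.rod = RodTransport.muDes P ref 1 p.1 p.2.mech.rod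
        - RodTransport.muDes P ref 0 p.1 p.2.mech.rod := by
      simp only [RodTransport.muDes, sgn]; simp; module
    have h3 := cross_muDiff (P := P) (ref := ref) (t := p.1) hp.2.1 hp.2.2.1
    rw [← h3, h2]
    have h4 := line_rod_w (P := P) (ref := ref) p
    convert h4 using 1
    rw [nomAngAcc]
    simp only [smul_apply, ContinuousLinearMap.id_apply, cross_sub]
    module
  · rw [add_zero]
    exact line_time (hG.smooth_wd.differentiable (by simp) _)

theorem inner_qDes_deriv {p : ℝ × Slow} (hp : p ∈ tube t₀ x ρ) (j : Fin 2) (v : ℝ × Rod) :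
    inner ℝ (RodTransport.qDes P ref j (p.1, p.2.mech.rod))
      (fderiv ℝ (RodTransport.qDes P ref j) (p.1, p.2.mech.rod) v) = 0 := by
  have hp' := rod_mem_tube (t := p.1) (X := p.2) hp
  have h1 := hasDerivAt_line (ContinuousLinearMap.id ℝ (ℝ × Rod)) (v := v)
    ((hG.qDes₀ j).differentiableAt hp')
  have h2 := inner_deriv_eq_zero h1 ?_
  · simpa using h2
  · have h3 : ContinuousAt (fun q : ℝ × Rod => RodTransport.muDes P ref j q.1 q.2)
      (p.1, p.2.mech.rod) := ((hG.muDes₀ j).differentiableAt hp').continuousAt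
    have h4 := h3.eventually_ne (hG.muDes_ne hp j)
    have h5 : Tendsto (fun u : ℝ => (ContinuousLinearMap.id ℝ (ℝ × Rod))
        ((p.1, p.2.mech.rod) + u • v)) (𝓝 0) (𝓝 (p.1, p.2.mech.rod)) := by
      have h6 : Continuous (fun u : ℝ => (ContinuousLinearMap.id ℝ (ℝ × Rod))
        ((p.1, p.2.mech.rod) + u • v)) := by fun_prop
      simpa using h6.tendsto 0
    exact (h5.eventually h4).mono fun u hu => norm_qDes hu

theorem wDes_cross_qDes {p : ℝ × Slow} (hp : p ∈ tube t₀ x ρ) (j : Fin 2) :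
    RodTransport.wDes P ref j (p.1, p.2.mech.1) ×ᵥ RodTransport.qDes P ref j (p.1, p.2.mech.rod) =
      fderiv ℝ (RodTransport.qDes P ref j) (p.1, p.2.mech.rod)
        (1, nomRodField P ref p.1 p.2.mech.1) := by
  unfold RodTransport.wDes
  exact cross_deriv_cross (norm_qDes (hG.muDes_ne hp j)) (hG.inner_qDes_deriv hp j _)

theorem rodField_coupled : Coupled (manifoldTube t₀ x ρ) (slowErr P ref) (attInc P ref)
    (fun p => (redField P ref p).mech.rod - nomRodField P ref p.1 p.2.mech.1) := by
  have e0 := slowErr_nonneg P ref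
  have n0 := attInc_nonneg P ref
  have z : Coupled (manifoldTube t₀ x ρ) (slowErr P ref) (attInc P ref) (fun _ => (0 : E3)) :=
    Coupled.zero e0 n0
  refine (z.prodMk (hG.rodAcc_coupled.prodMk (z.prodMk hG.rodAngAcc_coupled e0 n0) e0 n0)
    e0 n0).congr fun p _ => ?_
  rw [redField_rod_sub]

theorem dissipates_cable (j : Fin 2) : ∃ W, Dissipates (manifoldTube t₀ x ρ) (redField P ref)
    (slowErr P ref) W
    (fun t X Y => ‖errQ (RodTransport.qDes P ref j (t, X.mech.rod)) (X.mech.qc j)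
        - errQ (RodTransport.qDes P ref j (t, Y.mech.rod)) (Y.mech.qc j)‖ ^ 2
      + ‖errW (RodTransport.wDes P ref j (t, X.mech.1)) (X.mech.qc j) (X.mech.wc j)
        - errW (RodTransport.wDes P ref j (t, Y.mech.1)) (Y.mech.qc j) (Y.mech.wc j)‖ ^ 2)
    (fun t X Y => attInc P ref t X Y ^ 2) := by
  have e0 := slowErr_nonneg P ref
  have n0 := attInc_nonneg P ref
  have c0 : Coupled (manifoldTube t₀ x ρ) (slowErr P ref) (attInc P ref) (fun p =>
      fderiv ℝ (RodTransport.qDes P ref j) (p.1, p.2.mech.rod)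
        (0, (redField P ref p).mech.rod - nomRodField P ref p.1 p.2.mech.1)) :=
    (hG.rodField_coupled.clm (ContinuousLinearMap.inr ℝ ℝ Rod)).bilin isBoundedBilinearMap_apply
      e0 n0 (hG.bddLip (hG.qDes₀ j).fderiv.rod_pull)
  have c2 : Coupled (manifoldTube t₀ x ρ) (slowErr P ref) (attInc P ref) (fun p =>
      fderiv ℝ (RodTransport.wDes P ref j) (p.1, p.2.mech.1)
        (0, ((redField P ref p).mech.rod - nomRodField P ref p.1 p.2.mech.1, 0))) :=
    (hG.rodField_coupled.clm (ContinuousLinearMap.inr ℝ ℝ Conf ∘L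
      ContinuousLinearMap.inl ℝ Rod (Fin 2 → E3))).bilin isBoundedBilinearMap_apply
      e0 n0 (hG.bddLip (hG.wDes₀ j).fderiv.conf_pull)
  have c1 := (Coupled.cross (hG.bddLip (hG.qc j)) ((hG.endAcc_coupled j).sub
    ((hG.thrust_coupled j).clm (P.mQ⁻¹ • ContinuousLinearMap.id ℝ E3)) e0 n0) e0 n0).clm
    (P.Lc⁻¹ • ContinuousLinearMap.id ℝ E3)
  have h := dissipates_direction n0 (P.kqc_pos j) (P.kwc_pos j) (hG.qc j) (hG.wc j) (hG.qDes j)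
    (hG.wDes j) (small_qc P ref _ j) (small_wc P ref _ j) (fun p hp => (hp.2.2.2 j).1)
    (fun p hp => (hp.2.2.2 j).2.1)
    (fun p _ => by
      unfold RodTransport.wDes; exact inner_cross_self_left _ _) c0 c1 c2
    (wdn := fun p => RodTransport.wDesDot P ref j p.1 p.2.mech)
    (fun p _ => line_qc p j) (fun p hp => ?_) (fun p hp => ?_) (fun p hp => ?_)
  · exact h
  · have h1 := hasDerivAt_flowLine (P := P) (ref := ref) (p := p) rodPr
      ((hG.qDes₀ j).differentiableAt (rod_mem_tube (t := p.1) (X := p.2) hp.1))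
    rw [rodPr_redField, map_add] at h1
    rw [hG.wDes_cross_qDes hp.1 j]
    exact h1
  · have h1 := nominal_cableAngAcc (P := P) (ref := ref) (t := p.1) j (hp.2.2.2 j).1
      (hp.2.2.2 j).2.1
    have h2 := line_wc (P := P) (ref := ref) p j
    rw [redField_wc] at h2
    rw [← h1]
    convert h2 using 1
    simp only [smul_apply, ContinuousLinearMap.id_apply]
    rw [← smul_add, ← cross_add]
    congr 2
    module
  · have h1 := hasDerivAt_flowLine (P := P) (ref := ref) (p := p) confPr
      ((hG.wDes₀ j).differentiableAt (conf_mem_tube (t := p.1) (X := p.2) hp.1))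
    rw [confPr_redField, map_add] at h1
    unfold RodTransport.wDesDot
    exact h1

end GoodTube

end RodTransport
end

noncomputable section
namespace RodTransport

theorem J_comp_Jinv (P : Params) (v : E3) : J P (Jinv P v) = v := by
  have h1 : P.JQ * P.JQ⁻¹ = 1 :=
    Matrix.mul_nonsing_inv _ P.JQ_posDef.det_pos.ne'.isUnit
  have h2 : J P * Jinv P = 1 := by rw [J, Jinv, ← map_mul, h1, map_one]
  exact congrArg (fun A : L3 => A v) h2

theorem Jinv_comp_J (P : Params) (v : E3) : Jinv P (J P v) = v := by
  have h1 : P.JQ⁻¹ * P.JQ = 1 :=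
    Matrix.nonsing_inv_mul _ P.JQ_posDef.det_pos.ne'.isUnit
  have h2 : Jinv P * J P = 1 := by rw [J, Jinv, ← map_mul, h1, map_one]
  exact congrArg (fun A : L3 => A v) h2

theorem adjoint_J (P : Params) : ContinuousLinearMap.adjoint (J P) = J P := by
  rw [← ContinuousLinearMap.star_eq_adjoint, J, ← map_star, Matrix.star_eq_conjTranspose,
    P.JQ_posDef.isHermitian.eq]

theorem inner_J_pos (P : Params) {v : E3} (hv : v ≠ 0) : 0 < inner ℝ v (J P v) := by
  have h1 := P.JQ_posDef.dotProduct_mulVec_pos (x := v.ofLp) fun h => hv (by ext i; simp [h])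
  have h2 : inner ℝ v (J P v) = star v.ofLp ⬝ᵥ P.JQ.mulVec v.ofLp := by
    rw [J, PiLp.inner_apply]
    simp [dotProduct, Matrix.ofLp_toEuclideanCLM, mul_comm]
  rw [h2]; exact h1

theorem exists_le_inner_J (P : Params) : ∃ l, 0 < l ∧ ∀ v, l * ‖v‖ ^ 2 ≤ inner ℝ v (J P v) := by
  obtain ⟨u, hu, hmin⟩ := (isCompact_sphere (0 : E3) 1).exists_isMinOn
    ⟨e 0, by simp [e]⟩ (f := fun v => inner ℝ v (J P v)) (by fun_prop)
  have hu0 : u ≠ 0 := by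
    rintro rfl
    simp at hu
  refine ⟨_, inner_J_pos P hu0, fun v => ?_⟩
  rcases eq_or_ne v 0 with rfl | hv
  · simp
  · have h1 : inner ℝ u (J P u) ≤ inner ℝ (unitVec v) (J P (unitVec v)) :=
      hmin (by simp [norm_unitVec hv])
    have h2 : inner ℝ v (J P v) = ‖v‖ ^ 2 * inner ℝ (unitVec v) (J P (unitVec v)) := by
      conv_lhs => rw [← smul_unitVec v]
      rw [map_smul, inner_smul_left, inner_smul_right]
      simp; ring
    rw [h2, mul_comm]
    gcongr

theorem hasDerivAt_comp {A B : ℝ → L3} {A' B' : L3} {s : ℝ} (hA : HasDerivAt A A' s)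
    (hB : HasDerivAt B B' s) :
    HasDerivAt (fun s => A s ∘L B s) (A' ∘L B s + A s ∘L B') s := by
  have h := ((isBoundedBilinearMap_comp (𝕜 := ℝ) (E := E3) (F := E3) (G := E3)).hasFDerivAt
    (A s, B s)).comp_hasDerivAt s (hA.prodMk hB)
  rw [add_comm]
  exact h

theorem hasDerivAt_adjoint {A : ℝ → L3} {A' : L3} {s : ℝ} (hA : HasDerivAt A A' s) :
    HasDerivAt (fun s => ContinuousLinearMap.adjoint (A s)) (ContinuousLinearMap.adjoint A') s :=
  adjL.hasFDerivAt.comp_hasDerivAt s hA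

theorem adjoint_comp_deriv {R : ℝ → L3} {D : L3} {s : ℝ} (hR : HasDerivAt R D s)
    (h : ∀ᶠ u in 𝓝 s, IsRot (R u)) :
    ContinuousLinearMap.adjoint (R s) ∘L D
      + ContinuousLinearMap.adjoint (ContinuousLinearMap.adjoint (R s) ∘L D) = 0 := by
  have h1 := hasDerivAt_comp (hasDerivAt_adjoint hR) hR
  have h2 : HasDerivAt (fun u => ContinuousLinearMap.adjoint (R u) ∘L R u) (0 : L3) s :=
    (hasDerivAt_const s (1 : L3)).congr_of_eventuallyEq (h.mono fun u hu => hu.orth)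
  rw [ContinuousLinearMap.adjoint_comp, ContinuousLinearMap.adjoint_adjoint, add_comm]
  exact h1.unique h2

/-- The derivative of `Rᵀ Rd` along `R' = R ω̂`, `Rd' = Rd ω̂d`. -/
theorem deriv_relAtt_eq {R Rd : L3} {w wd : E3} (hR : IsRot R) (hRd : IsRot Rd) :
    ContinuousLinearMap.adjoint (R ∘L hat w) ∘L Rd
      + ContinuousLinearMap.adjoint R ∘L (Rd ∘L hat wd) =
    -(hat (w - (ContinuousLinearMap.adjoint R ∘L Rd) wd)
      ∘L (ContinuousLinearMap.adjoint R ∘L Rd)) := by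
  have h1 : ContinuousLinearMap.adjoint R ∘L (Rd ∘L hat wd) =
      hat ((ContinuousLinearMap.adjoint R ∘L Rd) wd) ∘L (ContinuousLinearMap.adjoint R ∘L Rd) :=
    (hR.adjoint.comp hRd).comp_hat wd
  have h2 : ContinuousLinearMap.adjoint (R ∘L hat w) ∘L Rd
      = -(hat w ∘L (ContinuousLinearMap.adjoint R ∘L Rd)) := by
    rw [ContinuousLinearMap.adjoint_comp, adjoint_hat]; rfl
  rw [h1, h2, hat_eq (w - _), map_sub, ← hat_eq, ← hat_eq, ContinuousLinearMap.sub_comp]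
  abel

theorem deriv_errR_eq (Q : L3) (w : E3) :
    (1 / 2 : ℝ) • vee (ContinuousLinearMap.adjoint (-(hat w ∘L Q)) - -(hat w ∘L Q)) =
      w + (1 / 2 : ℝ) • vee (ContinuousLinearMap.adjoint (Q - 1) ∘L hat w + hat w ∘L (Q - 1)) := by
  have h1 : ContinuousLinearMap.adjoint (-(hat w ∘L Q)) - -(hat w ∘L Q) =
      (2 : ℝ) • hat w
        + (ContinuousLinearMap.adjoint (Q - 1) ∘L hat w + hat w ∘L (Q - 1)) := by
    rw [map_neg, ContinuousLinearMap.adjoint_comp, adjoint_hat, map_sub, adjoint_one]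
    ext1 v
    simp [two_smul]
    abel
  rw [h1, ← veeL_apply, ← veeL_apply, map_add, map_smul, veeL_apply, vee_hat]
  module

theorem relAtt_sub_one_eq {Q : L3} (h : ContinuousLinearMap.adjoint Q ∘L Q = 1) :
    Q - 1 = -hat ((1 / 2 : ℝ) • vee (ContinuousLinearMap.adjoint Q - Q))
      - (1 / 2 : ℝ) • (ContinuousLinearMap.adjoint (Q - 1) ∘L (Q - 1)) := by
  have h1 := hat_vee_sub (ContinuousLinearMap.adjoint Q)
  rw [ContinuousLinearMap.adjoint_adjoint] at h1
  have h2 : ContinuousLinearMap.adjoint (Q - 1) ∘L (Q - 1) =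
      (2 : ℝ) • (1 : L3) - ContinuousLinearMap.adjoint Q - Q := by
    rw [map_sub, adjoint_one, ContinuousLinearMap.comp_sub, ContinuousLinearMap.sub_comp,
      ContinuousLinearMap.sub_comp, h]
    ext1 v
    simp [two_smul]
    abel
  rw [hat_eq, map_smul, ← hat_eq, h1, h2]
  module

theorem redField_att (P : Params) (ref : Reference) (p : ℝ × Slow) (j : Fin 2) :
    (redField P ref p).att j = p.2.att j ∘L hat (p.2.om j) := rfl

theorem redField_om (P : Params) (ref : Reference) (p : ℝ × Slow) (j : Fin 2) :
    (redField P ref p).om j =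
      Jinv P (J P (p.2.om j) ×ᵥ p.2.om j + moment P ref j p.1 p.2) := rfl

theorem mechPr_redField (P : Params) (ref : Reference) (p : ℝ × Slow) :
    mechPr (1, redField P ref p) = (1, redMechField P ref p.1 p.2.mech p.2.att) := rfl

theorem attPr_redField (P : Params) (ref : Reference) (p : ℝ × Slow) :
    attPr (1, redField P ref p) =
      (1, (redMechField P ref p.1 p.2.mech p.2.att, fun i => p.2.att i ∘L hat (p.2.om i))) := rfl

attribute [local irreducible] redField flowLine muDes uDes b3Des RDes OmDes thrust errR errOm moment
  OmDesDot wDesDot desired nomTension inelasticTension qDes wDes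

section

variable {P : Params} {ref : Reference}

theorem line_att (p : ℝ × Slow) (j : Fin 2) :
    HasDerivAt (fun s => (flowLine P ref p s).2.att j) (p.2.att j ∘L hat (p.2.om j)) 0 := by
  have h := hasDerivAt_flowLine_clm (P := P) (ref := ref) (p := p) (sndApplyL j ∘L
    ContinuousLinearMap.snd ℝ ℝ (Mech × (Fin 2 → L3)) ∘L attPr)
  have h1 := redField_att P ref p j
  rw [← h1]
  exact h

theorem line_om (p : ℝ × Slow) (j : Fin 2) :
    HasDerivAt (fun s => (flowLine P ref p s).2.om j)
      (Jinv P (J P (p.2.om j) ×ᵥ p.2.om j + moment P ref j p.1 p.2)) 0 := by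
  have h := hasDerivAt_flowLine_clm (P := P) (ref := ref) (p := p) (sndApplyL j ∘L
    ContinuousLinearMap.snd ℝ ℝ Slow)
  have h1 := redField_om P ref p j
  rw [← h1]
  exact h

end

theorem Jinv_moment (P : Params) (ref : Reference) (j : Fin 2) (t : ℝ) (x : Slow) :
    Jinv P (J P (x.om j) ×ᵥ x.om j + moment P ref j t x) =
      Jinv P (-((P.kR / P.epsA ^ 2) • errR P ref j t x) - (P.kO / P.epsA) • errOm P ref j t x)
      - (errOm P ref j t x ×ᵥ relAtt P ref j t x (OmDes P ref j (t, x.1))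
        - relAtt P ref j t x (OmDesDot P ref j t x)) := by
  have h1 : errOm P ref j t x ×ᵥ relAtt P ref j t x (OmDes P ref j (t, x.1)) =
      x.om j ×ᵥ relAtt P ref j t x (OmDes P ref j (t, x.1)) := by
    unfold errOm; rw [sub_cross, cross_self, sub_zero]
  rw [h1]
  conv_rhs => rw [← Jinv_comp_J P (x.om j ×ᵥ relAtt P ref j t x (OmDes P ref j (t, x.1))
        - relAtt P ref j t x (OmDesDot P ref j t x)), ← map_sub]
  unfold moment
  rw [cross_comm (J P (x.om j))]
  congr 1
  abel

namespace GoodTube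

variable {P : Params} {ref : Reference} {t₀ ρ : ℝ} {x : ℝ → Slow} (hG : GoodTube P ref t₀ x ρ)
include hG

theorem eventually_isRot_RDes {p : ℝ × Slow} (hp : p ∈ tube t₀ x ρ) (j : Fin 2) :
    ∀ᶠ s in 𝓝 (0 : ℝ), IsRot (RodTransport.RDes P ref j (mechPr (flowLine P ref p s))) := by
  obtain ⟨c, hc, h⟩ := hG.margin
  have hp' := mech_mem_tube (t := p.1) (X := p.2) hp
  have h1 : ContinuousAt (fun s => RodTransport.uDes P ref j (mechPr (flowLine P ref p s)).1
      (mechPr (flowLine P ref p s)).2) 0 :=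
    (hasDerivAt_flowLine (P := P) (ref := ref) (p := p) mechPr
      ((hG.uDes₀ j).differentiableAt hp')).continuousAt
  have h2 : ContinuousAt (fun s => RodTransport.RDes P ref j (mechPr (flowLine P ref p s))) 0 :=
    (hasDerivAt_flowLine (P := P) (ref := ref) (p := p) mechPr
      ((hG.RDes₀ j).differentiableAt hp')).continuousAt
  have h3 : ContinuousAt (fun s => ref.b1 j (flowLine P ref p s).1) 0 :=
    (line_time (P := P) (ref := ref)
      ((hG.href.smooth_b1 j).differentiable (by simp) p.1)).continuousAt
  have h4 : ContinuousAt (fun s => RodTransport.RDes P ref j (mechPr (flowLine P ref p s)) (e 2)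
      ×ᵥ ref.b1 j (flowLine P ref p s).1) 0 :=
    isBoundedBilinearMap_cross.continuous.continuousAt.comp
      ((h2.clm_apply continuousAt_const).prodMk h3)
  have a1 := h1.eventually_ne (y := 0) (by
    rw [flowLine_zero]
    exact norm_pos_iff.1 (hc.trans_le (h p hp j).2.1))
  have a2 := h4.eventually_ne (y := 0) (by
    rw [flowLine_zero, RDes_apply_e2]
    exact norm_pos_iff.1 (hc.trans_le (h p hp j).2.2))
  filter_upwards [a1, a2] with s b1 b2
  rw [RDes_apply_e2] at b2
  exact RodTransport.isRot_RDes b1 b2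

theorem line_RDes {p : ℝ × Slow} (hp : p ∈ tube t₀ x ρ) (j : Fin 2) :
    HasDerivAt (fun s => RodTransport.RDes P ref j (mechPr (flowLine P ref p s)))
      (RodTransport.RDes P ref j (p.1, p.2.mech)
        ∘L hat (RodTransport.OmDes P ref j (p.1, p.2.1))) 0 := by
  have hp' := mech_mem_tube (t := p.1) (X := p.2) hp
  have h1 := hasDerivAt_flowLine (P := P) (ref := ref) (p := p) mechPr
      ((hG.RDes₀ j).differentiableAt hp')
  have h2 := adjoint_comp_deriv h1 (hG.eventually_isRot_RDes hp j)
  rw [flowLine_zero] at h2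
  have h3 := hat_vee_of_skew h2
  rw [mechPr_redField] at h1 h3
  rw [mechPr_apply] at h1 h3
  have h4 : hat (RodTransport.OmDes P ref j (p.1, p.2.1)) =
      ContinuousLinearMap.adjoint (RodTransport.RDes P ref j (p.1, p.2.mech)) ∘L
        fderiv ℝ (RodTransport.RDes P ref j) (p.1, p.2.mech)
          (1, redMechField P ref p.1 p.2.mech p.2.att) := by
    unfold RodTransport.OmDes
    exact h3
  have h5 := orth_comm (hG.isRot_RDes hp j).orth
  rw [h4, ← ContinuousLinearMap.comp_assoc, h5]
  exact h1

theorem line_relAtt {p : ℝ × Slow} (hp : p ∈ manifoldTube t₀ x ρ) (j : Fin 2) :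
    HasDerivAt (fun s => RodTransport.relAtt P ref j (flowLine P ref p s).1
        (flowLine P ref p s).2)
      (-(hat (RodTransport.errOm P ref j p.1 p.2) ∘L RodTransport.relAtt P ref j p.1 p.2)) 0 := by
  have h1 := hasDerivAt_comp (hasDerivAt_adjoint (line_att (P := P) (ref := ref) p j))
    (hG.line_RDes hp.1 j)
  rw [flowLine_zero, mechPr_apply, deriv_relAtt_eq (isRot_att hp j) (hG.isRot_RDes hp.1 j)] at h1
  unfold RodTransport.errOm RodTransport.relAtt
  exact h1

theorem line_errR {p : ℝ × Slow} (hp : p ∈ manifoldTube t₀ x ρ) (j : Fin 2) :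
    HasDerivAt (fun s => RodTransport.errR P ref j (flowLine P ref p s).1 (flowLine P ref p s).2)
      (RodTransport.errOm P ref j p.1 p.2 + (1 / 2 : ℝ) • vee
        (ContinuousLinearMap.adjoint (RodTransport.relAtt P ref j p.1 p.2 - 1)
            ∘L hat (RodTransport.errOm P ref j p.1 p.2)
          + hat (RodTransport.errOm P ref j p.1 p.2)
            ∘L (RodTransport.relAtt P ref j p.1 p.2 - 1))) 0 := by
  have h1 := hG.line_relAtt hp j
  have h2 := (veeL.hasFDerivAt.comp_hasDerivAt (0 : ℝ)
    ((hasDerivAt_adjoint h1).sub h1)).const_smul (1 / 2 : ℝ)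
  rw [veeL_apply, deriv_errR_eq] at h2
  unfold RodTransport.errR
  exact h2

theorem line_errOm {p : ℝ × Slow} (hp : p ∈ manifoldTube t₀ x ρ) (j : Fin 2) :
    HasDerivAt (fun s => RodTransport.errOm P ref j (flowLine P ref p s).1 (flowLine P ref p s).2)
      (Jinv P (-((P.kR / P.epsA ^ 2) • RodTransport.errR P ref j p.1 p.2)
        - (P.kO / P.epsA) • RodTransport.errOm P ref j p.1 p.2)) 0 := by
  have h1 := hasDerivAt_flowLine (P := P) (ref := ref) (p := p) attPr
    ((hG.OmDes₀ j).differentiableAt (att_mem_tube (t := p.1) (X := p.2) hp.1))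
  have h2 := (hG.line_relAtt hp j).clm_apply h1
  have h3 := (line_om (P := P) (ref := ref) p j).sub h2
  rw [Jinv_moment, flowLine_zero, attPr_redField, attPr_apply] at h3
  have h4 : fderiv ℝ (RodTransport.OmDes P ref j) (p.1, p.2.1)
      (1, (redMechField P ref p.1 p.2.mech p.2.att, fun i => p.2.att i ∘L hat (p.2.om i))) =
      OmDesDot P ref j p.1 p.2 := by unfold OmDesDot; rfl
  rw [h4, neg_apply, ContinuousLinearMap.comp_apply, hat_apply] at h3
  have h5 : ∀ a b c : E3, a - (b - c) - (-b + c) = a := fun a b c => by abel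
  rw [h5] at h3
  unfold RodTransport.errOm at h3 ⊢
  exact h3

theorem errR_small (j : Fin 2) : Small (manifoldTube t₀ x ρ) (slowErr P ref)
    (fun p => RodTransport.errR P ref j p.1 p.2) := by
  have h1 := hG.relAtt_sub_one_small j
  have h2 := (((h1.clm adjL).sub h1 (slowErr_nonneg P ref)).clm
    ((1 / 2 : ℝ) • veeL))
  refine h2.congr fun p _ => ?_
  unfold RodTransport.errR
  rw [smul_apply, veeL_apply, map_sub]
  congr 2
  change ContinuousLinearMap.adjoint (RodTransport.relAtt P ref j p.1 p.2)
    - ContinuousLinearMap.adjoint (1 : L3) - _ = _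
  rw [adjoint_one]
  abel

theorem errOm_small (j : Fin 2) : Small (manifoldTube t₀ x ρ) (slowErr P ref)
    (fun p => RodTransport.errOm P ref j p.1 p.2) := by
  have h1 : Small (manifoldTube t₀ x ρ) (slowErr P ref) (fun p =>
      (RodTransport.relAtt P ref j p.1 p.2 - 1) (RodTransport.OmDes P ref j (p.1, p.2.1))) :=
    (hG.relAtt_sub_one_small j).bilin
      (isBoundedBilinearMap_apply (𝕜 := ℝ) (E := E3) (F := E3)).swap (hG.bddLip (hG.OmDes j))
  refine ((small_om P ref _ j).sub h1 (slowErr_nonneg P ref)).congr fun p _ => ?_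
  unfold RodTransport.errOm
  rw [sub_apply, one_apply_e3]
  abel

end GoodTube

attribute [local irreducible] relAtt

namespace GoodTube

variable {P : Params} {ref : Reference} {t₀ ρ : ℝ} {x : ℝ → Slow} (hG : GoodTube P ref t₀ x ρ)
include hG

/-- The attitude errors control the relative attitude. -/
theorem relAtt_coupled_errR (j : Fin 2) : Coupled (manifoldTube t₀ x ρ) (slowErr P ref)
    (fun t X Y => ‖RodTransport.errR P ref j t X - RodTransport.errR P ref j t Y‖)
    (fun p => RodTransport.relAtt P ref j p.1 p.2 - 1) := by
  have e0 := slowErr_nonneg P ref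
  have n0 : ∀ t (X Y : Slow),
      0 ≤ ‖RodTransport.errR P ref j t X - RodTransport.errR P ref j t Y‖ :=
    fun _ _ _ => norm_nonneg _
  have h1 : Coupled (manifoldTube t₀ x ρ) (slowErr P ref)
    (fun t X Y => ‖RodTransport.errR P ref j t X - RodTransport.errR P ref j t Y‖)
    (fun p => RodTransport.errR P ref j p.1 p.2) := by
    have b0 := hG.bddLip (hG.errR j)
    have s0 := hG.errR_small j
    have h0 := Coupled.of_small b0 s0 e0
    exact h0
  have b := hG.bddLip ((hG.relAtt j).sub (bddSmoothOn_const 1 _))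
  have s := hG.relAtt_sub_one_small j
  have h2 : Coupled (manifoldTube t₀ x ρ) (slowErr P ref)
    (fun t X Y => ‖RodTransport.errR P ref j t X - RodTransport.errR P ref j t Y‖)
    (fun p => ContinuousLinearMap.adjoint (RodTransport.relAtt P ref j p.1 p.2 - 1) ∘L
      (RodTransport.relAtt P ref j p.1 p.2 - 1)) :=
    Coupled.of_mul isBoundedBilinearMap_comp e0 n0 (b.clm adjL) b (s.clm adjL) s
  have h5 : Coupled (manifoldTube t₀ x ρ) (slowErr P ref)
    (fun t X Y => ‖RodTransport.errR P ref j t X - RodTransport.errR P ref j t Y‖)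
    (fun p => -crossL (RodTransport.errR P ref j p.1 p.2)) := h1.clm (-crossL)
  have h6 : Coupled (manifoldTube t₀ x ρ) (slowErr P ref)
    (fun t X Y => ‖RodTransport.errR P ref j t X - RodTransport.errR P ref j t Y‖)
    (fun p => (1 / 2 : ℝ) • (ContinuousLinearMap.adjoint (RodTransport.relAtt P ref j p.1 p.2 - 1) ∘L
      (RodTransport.relAtt P ref j p.1 p.2 - 1))) :=
    h2.clm ((1 / 2 : ℝ) • ContinuousLinearMap.id ℝ L3)
  have h7 := h5.sub h6 e0 n0
  refine h7.congr fun p hp => ?_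
  have h3 := relAtt_sub_one_eq (Q := RodTransport.relAtt P ref j p.1 p.2)
    (by unfold RodTransport.relAtt; exact ((isRot_att hp j).adjoint.comp (hG.isRot_RDes hp.1 j)).orth)
  have h4 : RodTransport.errR P ref j p.1 p.2 = (1 / 2 : ℝ) • vee (ContinuousLinearMap.adjoint
      (RodTransport.relAtt P ref j p.1 p.2) - RodTransport.relAtt P ref j p.1 p.2) := by
    unfold RodTransport.errR; rfl
  rw [← h4, hat_eq] at h3
  exact h3.symm

theorem dissipates_att (j : Fin 2) : ∃ W, Dissipates (manifoldTube t₀ x ρ) (redField P ref)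
    (slowErr P ref) W
    (fun t X Y => ‖RodTransport.errR P ref j t X - RodTransport.errR P ref j t Y‖ ^ 2
      + ‖RodTransport.errOm P ref j t X - RodTransport.errOm P ref j t Y‖ ^ 2)
    (fun _ _ _ => (0 : ℝ) ^ 2) := by
  have e0 := slowErr_nonneg P ref
  have n0 : ∀ (t : ℝ) (X Y : Slow), (0 : ℝ) ≤ 0 := fun _ _ _ => le_rfl
  have hS : manifoldTube t₀ x ρ ⊆ tube t₀ x ρ := fun _ hp => hp.1
  obtain ⟨l, hl, hJl⟩ := exists_le_inner_J P
  have hk₁ : 0 < P.kR / P.epsA ^ 2 := div_pos P.kR_pos (pow_pos P.epsA_pos 2)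
  have hk₂ : 0 < P.kO / P.epsA := div_pos P.kO_pos P.epsA_pos
  have b := hG.bddLip ((hG.relAtt j).sub (bddSmoothOn_const 1 _))
  have s := hG.relAtt_sub_one_small j
  have bo := hG.bddLip (hG.errOm j)
  have so := hG.errOm_small j
  have c1 : Coupled (manifoldTube t₀ x ρ) (slowErr P ref) (fun _ _ _ => 0)
      (fun p => ContinuousLinearMap.adjoint (RodTransport.relAtt P ref j p.1 p.2 - 1)
            ∘L crossL (RodTransport.errOm P ref j p.1 p.2)) :=
    Coupled.of_mul isBoundedBilinearMap_comp e0 n0 (b.clm adjL) (bo.clm crossL) (s.clm adjL)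
      (so.clm crossL)
  have c2 : Coupled (manifoldTube t₀ x ρ) (slowErr P ref) (fun _ _ _ => 0)
      (fun p => crossL (RodTransport.errOm P ref j p.1 p.2)
            ∘L (RodTransport.relAtt P ref j p.1 p.2 - 1)) :=
    Coupled.of_mul isBoundedBilinearMap_comp e0 n0 (bo.clm crossL) b (so.clm crossL) s
  have h : IsOsc (manifoldTube t₀ x ρ) (slowErr P ref) (fun _ _ _ => 0) (J P)
      (P.kR / P.epsA ^ 2) (P.kO / P.epsA)
      (fun p => RodTransport.errR P ref j p.1 p.2) (fun p => RodTransport.errOm P ref j p.1 p.2)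
      (fun p => fderiv ℝ (fun p : ℝ × Slow => RodTransport.errR P ref j p.1 p.2) p
        (1, redField P ref p))
      (fun p => fderiv ℝ (fun p : ℝ × Slow => RodTransport.errOm P ref j p.1 p.2) p
        (1, redField P ref p)) := by
    have b0 : BddLip (manifoldTube t₀ x ρ) (fun _ => (0 : ℝ)) :=
      hG.bddLip (bddSmoothOn_const _ _)
    have z0 : Small (manifoldTube t₀ x ρ) (slowErr P ref) (fun _ => (0 : ℝ)) :=
      ⟨0, le_rfl, fun p _ => by simp⟩
    refine ⟨hG.bddLip (hG.errR j), bo, hG.errR_small j, so,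
      fun _ => 0, fun _ => 0, fun _ => 0, b0, b0, hG.bddLip (bddSmoothOn_const _ _), z0, z0,
      fun _ _ => inner_zero_right _, fun _ _ => inner_zero_right _, fun _ _ => inner_zero_right _,
      ?_, ?_⟩
    · refine ((c1.add c2 e0 n0).clm ((1 / 2 : ℝ) • veeL)).congr fun p hp => ?_
      have h1 := fderiv_eq_of_flowLine ((hG.errR j).differentiableAt (hS hp)) (hG.line_errR hp j)
      rw [h1, hat_eq]
      simp only [smul_zero, sub_zero, add_sub_cancel_left]
      rfl
    · refine (Coupled.zero e0 n0).congr fun p hp => ?_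
      have h1 := fderiv_eq_of_flowLine ((hG.errOm j).differentiableAt (hS hp))
        (hG.line_errOm hp j)
      rw [h1, J_comp_Jinv]
      simp only [smul_zero, sub_zero]
      abel
  have h' := h.dissipates hk₁ hk₂ hl (adjoint_J P) hJl e0 n0 ((hG.errR j).hasFlowDeriv hS _)
    ((hG.errOm j).hasFlowDeriv hS _)
  exact h'

end GoodTube

end RodTransport
end

noncomputable section
namespace RodTransport

section Incr

variable {E F G : Type*} [NormedAddCommGroup E] [NormedAddCommGroup F]
  [NormedSpace ℝ F] [NormedAddCommGroup G] [NormedSpace ℝ G] {S : Set (ℝ × E)} {err : ℝ × E → ℝ}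
  {N N' : ℝ → E → E → ℝ}

/-- The increments are controlled by `N` up to a small multiple of the distance. -/
def Incr (S : Set (ℝ × E)) (err : ℝ × E → ℝ) (N : ℝ → E → E → ℝ) (φ : ℝ × E → F) : Prop :=
  ∃ C, 0 ≤ C ∧ ∀ t X Y, (t, X) ∈ S → (t, Y) ∈ S →
    ‖φ (t, X) - φ (t, Y)‖ ≤ C * (N t X Y + (err (t, X) + err (t, Y)) * ‖X - Y‖)

theorem Incr.congr {φ ψ : ℝ × E → F} (h : Incr S err N φ)
    (he : ∀ t X Y, (t, X) ∈ S → (t, Y) ∈ S → φ (t, X) - φ (t, Y) = ψ (t, X) - ψ (t, Y)) :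
    Incr S err N ψ := by
  obtain ⟨C, hC, h⟩ := h
  exact ⟨C, hC, fun t X Y hX hY => he t X Y hX hY ▸ h t X Y hX hY⟩

theorem Incr.prodMk {φ : ℝ × E → F} {ψ : ℝ × E → G} (h : Incr S err N φ)
    (h' : Incr S err N ψ) (herr : ∀ p, 0 ≤ err p) (hN : ∀ t X Y, 0 ≤ N t X Y) :
    Incr S err N (fun p => (φ p, ψ p)) := by
  obtain ⟨C, hC, h⟩ := h
  obtain ⟨C', hC', h'⟩ := h'
  refine ⟨C + C', by positivity, fun t X Y hX hY => ?_⟩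
  have hx := herr (t, X)
  have hy := herr (t, Y)
  have hn := hN t X Y
  rw [Prod.mk_sub_mk, Prod.norm_mk, add_mul]
  exact max_le ((h t X Y hX hY).trans (le_add_of_nonneg_right (by positivity)))
    ((h' t X Y hX hY).trans (le_add_of_nonneg_left (by positivity)))

theorem Incr.add {φ ψ : ℝ × E → F} (h : Incr S err N φ)
    (h' : Incr S err N ψ) (herr : ∀ p, 0 ≤ err p) (hN : ∀ t X Y, 0 ≤ N t X Y) :
    Incr S err N (fun p => φ p + ψ p) := by
  obtain ⟨C, hC, h⟩ := h
  obtain ⟨C', hC', h'⟩ := h'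
  refine ⟨C + C', by positivity, fun t X Y hX hY => ?_⟩
  rw [add_sub_add_comm, add_mul]
  exact norm_add_le_of_le (h t X Y hX hY) (h' t X Y hX hY)

theorem Incr.pi2 {φ : Fin 2 → ℝ × E → F} (h : ∀ j, Incr S err N (φ j))
    (herr : ∀ p, 0 ≤ err p) (hN : ∀ t X Y, 0 ≤ N t X Y) :
    Incr S err N (fun p j => φ j p) := by
  choose C hC h using h
  refine ⟨C 0 + C 1, add_nonneg (hC 0) (hC 1), fun t X Y hX hY => ?_⟩
  have hx := herr (t, X)
  have hy := herr (t, Y)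
  have hn := hN t X Y
  have h0 := hC 0
  have h1 := hC 1
  rw [pi_norm_le_iff_of_nonneg (by positivity)]
  intro j
  refine (h j t X Y hX hY).trans (mul_le_mul_of_nonneg_right ?_ (by positivity))
  fin_cases j <;> simp <;> assumption

/-- A Lipschitz function of a function with controlled increments. -/
theorem Incr.lip {φ : ℝ × F → G} {ψ : ℝ × E → F} (h : Incr S err N ψ) {T : Set (ℝ × F)}
    (hT : ∀ t X, (t, X) ∈ S → (t, ψ (t, X)) ∈ T)
    (hφ : BddLip T φ) : Incr S err N (fun p => φ (p.1, ψ p)) := by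
  obtain ⟨L, hL, hφ⟩ := hφ.lip
  obtain ⟨C, hC, h⟩ := h
  refine ⟨L * C, by positivity, fun t X Y hX hY => (hφ t _ _ (hT t X hX) (hT t Y hY)).trans ?_⟩
  rw [mul_assoc]
  exact mul_le_mul_of_nonneg_left (h t X Y hX hY) hL

theorem Incr.sq_le {φ : ℝ × E → F} (h : Incr S err N φ) (herr : ∀ p, 0 ≤ err p)
    (hN : ∀ t X Y, 0 ≤ N t X Y) {M : ℝ} (hM : ∀ p ∈ S, err p ≤ M) :
    ∃ K, 0 ≤ K ∧ ∀ t X Y, (t, X) ∈ S → (t, Y) ∈ S →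
      ‖φ (t, X) - φ (t, Y)‖ ^ 2 ≤
        K * (N t X Y ^ 2 + (err (t, X) + err (t, Y)) * ‖X - Y‖ ^ 2) := by
  obtain ⟨C, hC, h⟩ := h
  refine ⟨2 * C ^ 2 * (1 + 2 * |M|), by positivity, fun t X Y hX hY => ?_⟩
  have hx := herr (t, X)
  have hy := herr (t, Y)
  have hn := hN t X Y
  have h1 := h t X Y hX hY
  have hxM := (hM _ hX).trans (le_abs_self M)
  have hyM := (hM _ hY).trans (le_abs_self M)
  have hη : err (t, X) + err (t, Y) ≤ 2 * |M| := by linarith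
  calc ‖φ (t, X) - φ (t, Y)‖ ^ 2
      ≤ (C * (N t X Y + (err (t, X) + err (t, Y)) * ‖X - Y‖)) ^ 2 := by gcongr
    _ ≤ 2 * C ^ 2 * (N t X Y ^ 2 + ((err (t, X) + err (t, Y)) * ‖X - Y‖) ^ 2) := by
        rw [mul_pow, mul_comm (2 : ℝ), mul_assoc]
        gcongr
        exact add_sq_le
    _ = 2 * C ^ 2 * (N t X Y ^ 2 + (err (t, X) + err (t, Y))
          * ((err (t, X) + err (t, Y)) * ‖X - Y‖ ^ 2)) := by ring
    _ ≤ 2 * C ^ 2 * ((1 + 2 * |M|) * N t X Y ^ 2 + (1 + 2 * |M|)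
          * ((err (t, X) + err (t, Y)) * ‖X - Y‖ ^ 2)) := by
        refine mul_le_mul_of_nonneg_left (add_le_add ?_ (mul_le_mul_of_nonneg_right ?_
          (by positivity))) (by positivity)
        · have : 0 ≤ 2 * |M| * N t X Y ^ 2 := by positivity
          linarith
        · linarith
    _ = _ := by ring

end Incr

attribute [local irreducible] redField flowLine muDes uDes b3Des RDes OmDes thrust errR errOm moment
  OmDesDot wDesDot desired nomTension inelasticTension qDes wDes relAtt

/-- Squared increments of the attitude errors. -/
def attSq (P : Params) (ref : Reference) (j : Fin 2) (t : ℝ) (X Y : Slow) : ℝ :=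
  ‖errR P ref j t X - errR P ref j t Y‖ ^ 2 + ‖errOm P ref j t X - errOm P ref j t Y‖ ^ 2

/-- Squared increments of the cable errors. -/
def cableSq (P : Params) (ref : Reference) (j : Fin 2) (t : ℝ) (X Y : Slow) : ℝ :=
  ‖errQ (qDes P ref j (t, X.mech.rod)) (X.mech.qc j)
      - errQ (qDes P ref j (t, Y.mech.rod)) (Y.mech.qc j)‖ ^ 2
    + ‖errW (wDes P ref j (t, X.mech.1)) (X.mech.qc j) (X.mech.wc j)
      - errW (wDes P ref j (t, Y.mech.1)) (Y.mech.qc j) (Y.mech.wc j)‖ ^ 2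

/-- Squared increments of the errors of the rod's direction. -/
def rodSq (ref : Reference) (t : ℝ) (X Y : Slow) : ℝ :=
  ‖errQ (ref.qd t) X.mech.rod.q - errQ (ref.qd t) Y.mech.rod.q‖ ^ 2
    + ‖errW (ref.wd t) X.mech.rod.q X.mech.rod.w - errW (ref.wd t) Y.mech.rod.q Y.mech.rod.w‖ ^ 2

/-- Squared increments of the errors of the rod's position. -/
def posSq (ref : Reference) (t : ℝ) (X Y : Slow) : ℝ :=
  ‖(X.mech.rod.x - ref.xd t) - (Y.mech.rod.x - ref.xd t)‖ ^ 2
    + ‖(X.mech.rod.v - deriv ref.xd t) - (Y.mech.rod.v - deriv ref.xd t)‖ ^ 2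

/-- Squared increments of all the errors. -/
def errSq (P : Params) (ref : Reference) (t : ℝ) (X Y : Slow) : ℝ :=
  ((attSq P ref 0 t X Y + attSq P ref 1 t X Y) + (cableSq P ref 0 t X Y + cableSq P ref 1 t X Y))
    + (rodSq ref t X Y + posSq ref t X Y)

section

variable (P : Params) (ref : Reference) (t : ℝ) (X Y : Slow)

theorem attSq_nonneg (j : Fin 2) : 0 ≤ attSq P ref j t X Y := by unfold attSq; positivity
theorem cableSq_nonneg (j : Fin 2) : 0 ≤ cableSq P ref j t X Y := by unfold cableSq; positivity
theorem rodSq_nonneg : 0 ≤ rodSq ref t X Y := by unfold rodSq; positivity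
theorem posSq_nonneg : 0 ≤ posSq ref t X Y := by unfold posSq; positivity

theorem attSq_le (j : Fin 2) : attSq P ref j t X Y ≤ attSq P ref 0 t X Y + attSq P ref 1 t X Y := by
  have h0 := attSq_nonneg P ref t X Y 0
  have h1 := attSq_nonneg P ref t X Y 1
  fin_cases j <;> simp <;> assumption

theorem attSum_le : attSq P ref 0 t X Y + attSq P ref 1 t X Y ≤ errSq P ref t X Y := by
  have h0 := cableSq_nonneg P ref t X Y 0
  have h1 := cableSq_nonneg P ref t X Y 1
  have h2 := rodSq_nonneg ref t X Y
  have h3 := posSq_nonneg ref t X Y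
  unfold errSq; linarith

theorem cableSq_le (j : Fin 2) : cableSq P ref j t X Y ≤ errSq P ref t X Y := by
  have h0 := cableSq_nonneg P ref t X Y 0
  have h1 := cableSq_nonneg P ref t X Y 1
  have h2 := rodSq_nonneg ref t X Y
  have h3 := posSq_nonneg ref t X Y
  have h4 := attSq_nonneg P ref t X Y 0
  have h5 := attSq_nonneg P ref t X Y 1
  have h6 : cableSq P ref j t X Y ≤ cableSq P ref 0 t X Y + cableSq P ref 1 t X Y := by
    fin_cases j <;> simp <;> assumption
  unfold errSq; linarith

theorem rodSq_le : rodSq ref t X Y ≤ errSq P ref t X Y := by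
  have h0 := cableSq_nonneg P ref t X Y 0
  have h1 := cableSq_nonneg P ref t X Y 1
  have h3 := posSq_nonneg ref t X Y
  have h4 := attSq_nonneg P ref t X Y 0
  have h5 := attSq_nonneg P ref t X Y 1
  unfold errSq; linarith

theorem posSq_le : posSq ref t X Y ≤ errSq P ref t X Y := by
  have h0 := cableSq_nonneg P ref t X Y 0
  have h1 := cableSq_nonneg P ref t X Y 1
  have h2 := rodSq_nonneg ref t X Y
  have h4 := attSq_nonneg P ref t X Y 0
  have h5 := attSq_nonneg P ref t X Y 1
  unfold errSq; linarith

theorem attInc_sq_le : attInc P ref t X Y ^ 2 ≤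
    2 * (‖relAtt P ref 0 t X - relAtt P ref 0 t Y‖ ^ 2
      + ‖relAtt P ref 1 t X - relAtt P ref 1 t Y‖ ^ 2) := by
  rw [attInc, Fin.sum_univ_two]
  exact add_sq_le

theorem dirInc_sq_le : dirInc P ref t X Y ^ 2 ≤ 2 * attInc P ref t X Y ^ 2
    + 4 * (cableSq P ref 0 t X Y + cableSq P ref 1 t X Y) := by
  rw [dirInc, Fin.sum_univ_two]
  unfold cableSq
  refine add_sq_le.trans ?_
  have h1 := add_sq_le (a := ‖errQ (qDes P ref 0 (t, X.mech.rod)) (X.mech.qc 0)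
      - errQ (qDes P ref 0 (t, Y.mech.rod)) (Y.mech.qc 0)‖)
    (b := ‖errQ (qDes P ref 1 (t, X.mech.rod)) (X.mech.qc 1)
      - errQ (qDes P ref 1 (t, Y.mech.rod)) (Y.mech.qc 1)‖)
  have h2 := sq_nonneg ‖errW (wDes P ref 0 (t, X.mech.1)) (X.mech.qc 0) (X.mech.wc 0)
      - errW (wDes P ref 0 (t, Y.mech.1)) (Y.mech.qc 0) (Y.mech.wc 0)‖
  have h3 := sq_nonneg ‖errW (wDes P ref 1 (t, X.mech.1)) (X.mech.qc 1) (X.mech.wc 1)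
      - errW (wDes P ref 1 (t, Y.mech.1)) (Y.mech.qc 1) (Y.mech.wc 1)‖
  linarith

end

namespace GoodTube

variable {P : Params} {ref : Reference} {t₀ ρ : ℝ} {x : ℝ → Slow} (hG : GoodTube P ref t₀ x ρ)
include hG

theorem slowErr_bdd : ∃ M, ∀ p ∈ manifoldTube t₀ x ρ, slowErr P ref p ≤ M := by
  obtain ⟨C, -, h⟩ := (hG.bddLip hG.desired).bdd
  exact ⟨C, h⟩

theorem attInc_sq_le_attSq : ∃ K, 0 ≤ K ∧ ∀ t X Y, (t, X) ∈ manifoldTube t₀ x ρ →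
    (t, Y) ∈ manifoldTube t₀ x ρ → attInc P ref t X Y ^ 2 ≤
      K * ((attSq P ref 0 t X Y + attSq P ref 1 t X Y)
        + (slowErr P ref (t, X) + slowErr P ref (t, Y)) * ‖X - Y‖ ^ 2) := by
  have e0 := slowErr_nonneg P ref
  obtain ⟨M, hM⟩ := hG.slowErr_bdd
  have h1 : ∀ j, ∃ K, 0 ≤ K ∧ ∀ t X Y, (t, X) ∈ manifoldTube t₀ x ρ →
      (t, Y) ∈ manifoldTube t₀ x ρ →
      ‖RodTransport.relAtt P ref j t X - RodTransport.relAtt P ref j t Y‖ ^ 2 ≤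
        K * ((attSq P ref 0 t X Y + attSq P ref 1 t X Y)
          + (slowErr P ref (t, X) + slowErr P ref (t, Y)) * ‖X - Y‖ ^ 2) := fun j => by
    have h2 : Incr (manifoldTube t₀ x ρ) (slowErr P ref)
      (fun t X Y => ‖RodTransport.errR P ref j t X - RodTransport.errR P ref j t Y‖)
      (fun p => RodTransport.relAtt P ref j p.1 p.2 - 1) := (hG.relAtt_coupled_errR j).diff
    obtain ⟨K, hK, h3⟩ := h2.sq_le e0 (fun _ _ _ => norm_nonneg _) hM
    refine ⟨K, hK, fun t X Y hX hY => ?_⟩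
    have h4 := h3 t X Y hX hY
    simp only [sub_sub_sub_cancel_right] at h4
    refine h4.trans (mul_le_mul_of_nonneg_left (add_le_add_left ?_ _) hK)
    refine le_trans ?_ (attSq_le P ref t X Y j)
    unfold attSq
    exact le_add_of_nonneg_right (sq_nonneg _)
  obtain ⟨K₀, hK₀, h₀⟩ := h1 0
  obtain ⟨K₁, hK₁, h₁⟩ := h1 1
  refine ⟨2 * (K₀ + K₁), by positivity, fun t X Y hX hY => (attInc_sq_le P ref t X Y).trans ?_⟩
  have h2 := h₀ t X Y hX hY
  have h3 := h₁ t X Y hX hY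
  rw [mul_assoc, add_mul]
  linarith

theorem dissipates_all : ∃ W, Dissipates (manifoldTube t₀ x ρ) (redField P ref)
    (slowErr P ref) W (errSq P ref) (fun _ _ _ => 0) := by
  have e0 := slowErr_nonneg P ref
  obtain ⟨Wa, ha⟩ := hG.dissipates_att 0
  obtain ⟨Wb, hb⟩ := hG.dissipates_att 1
  obtain ⟨Wc, hc⟩ := hG.dissipates_cable 0
  obtain ⟨Wd, hd⟩ := hG.dissipates_cable 1
  obtain ⟨Wr, hr⟩ := hG.dissipates_rod
  obtain ⟨Wp, hp⟩ := hG.dissipates_position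
  change Dissipates _ _ _ _ (attSq P ref 0) _ at ha
  change Dissipates _ _ _ _ (attSq P ref 1) _ at hb
  change Dissipates _ _ _ _ (cableSq P ref 0) _ at hc
  change Dissipates _ _ _ _ (cableSq P ref 1) _ at hd
  change Dissipates _ _ _ _ (rodSq ref) _ at hr
  change Dissipates _ _ _ _ (posSq ref) _ at hp
  have z0 : ∀ (t : ℝ) (X Y : Slow), (0 : ℝ) ≤ (0 : ℝ) ^ 2 := fun _ _ _ => by norm_num
  have A := ha.add hb e0 (attSq_nonneg P ref · · · 0) (attSq_nonneg P ref · · · 1) z0 z0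
  have B := hc.add hd e0 (cableSq_nonneg P ref · · · 0) (cableSq_nonneg P ref · · · 1)
    (fun _ _ _ => sq_nonneg _) (fun _ _ _ => sq_nonneg _)
  have R := hr.add hp e0 (rodSq_nonneg ref) (posSq_nonneg ref)
    (fun _ _ _ => sq_nonneg _) (fun _ _ _ => sq_nonneg _)
  obtain ⟨K, hK, hKle⟩ := hG.attInc_sq_le_attSq
  have qa : ∀ t X Y, 0 ≤ attSq P ref 0 t X Y + attSq P ref 1 t X Y := fun t X Y =>
    add_nonneg (attSq_nonneg ..) (attSq_nonneg ..)
  have qc : ∀ t X Y, 0 ≤ cableSq P ref 0 t X Y + cableSq P ref 1 t X Y := fun t X Y =>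
    add_nonneg (cableSq_nonneg ..) (cableSq_nonneg ..)
  have z1 : ∀ (t : ℝ) (X Y : Slow), (0 : ℝ) ≤ (0 : ℝ) ^ 2 + (0 : ℝ) ^ 2 := fun _ _ _ => by
    norm_num
  obtain ⟨W₁, h₁⟩ := A.cascade B e0 qa z1 (K := 2 * K) (by positivity)
    (fun t X Y hX hY => by
      have := hKle t X Y hX hY
      rw [mul_assoc]
      linarith)
  obtain ⟨W₂, h₂⟩ := h₁.cascade R e0 (fun t X Y => add_nonneg (qa t X Y) (qc t X Y)) z1
    (K := 4 * K + 8) (by positivity) (fun t X Y hX hY => by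
      have h3 := hKle t X Y hX hY
      have h4 := dirInc_sq_le P ref t X Y
      have h5 := qa t X Y
      have h6 := mul_nonneg hK (qc t X Y)
      have h7 : 0 ≤ (slowErr P ref (t, X) + slowErr P ref (t, Y)) * ‖X - Y‖ ^ 2 :=
        mul_nonneg (add_nonneg (e0 _) (e0 _)) (sq_nonneg _)
      nlinarith)
  refine ⟨W₂, ?_⟩
  have z2 : (fun (_ : ℝ) (_ _ : Slow) => (0 : ℝ) ^ 2 + (0 : ℝ) ^ 2) = fun _ _ _ => 0 := by
    funext _ _ _; norm_num
  rw [z2] at h₂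
  exact h₂

end GoodTube

end RodTransport
end

noncomputable section
namespace RodTransport

section

variable {E : Type*} [NormedAddCommGroup E] [NormedSpace ℝ E] {S : Set (ℝ × E)}
  {err : ℝ × E → ℝ} {N : ℝ → E → E → ℝ}

/-- The errors of a direction control the direction and its angular velocity. -/
theorem direction_coupled {q w qd wd : ℝ × E → E3}
    (herr : ∀ p, 0 ≤ err p) (hN : ∀ t X Y, 0 ≤ N t X Y)
    (bq : BddLip S q) (bw : BddLip S w) (bqd : BddLip S qd) (bwd : BddLip S wd)
    (sq : Small S err (fun p => q p - qd p)) (sw : Small S err (fun p => w p - wd p))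
    (hq : ∀ p ∈ S, ‖q p‖ = 1) (hqd : ∀ p ∈ S, ‖qd p‖ = 1)
    (hwd : ∀ p ∈ S, inner ℝ (qd p) (wd p) = 0)
    (ha : ∀ t X Y, ‖errQ (qd (t, X)) (q (t, X)) - errQ (qd (t, Y)) (q (t, Y))‖ ≤ N t X Y)
    (hb : ∀ t X Y, ‖errW (wd (t, X)) (q (t, X)) (w (t, X))
      - errW (wd (t, Y)) (q (t, Y)) (w (t, Y))‖ ≤ N t X Y) :
    Incr S err N (fun p => q p - qd p) ∧ Incr S err N (fun p => w p - wd p) := by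
  have ba : BddLip S (fun p => errQ (qd p) (q p)) := bqd.cross bq
  have bb : BddLip S (fun p => errW (wd p) (q p) (w p)) := bw.add (bq.cross (bq.cross bwd))
  have sa : Small S err (fun p => errQ (qd p) (q p)) := by
    refine (Small.cross bqd sq).congr fun p _ => ?_
    rw [cross_sub, cross_self, sub_zero, errQ]
  have sin : Small S err (fun p => inner ℝ (q p - qd p) (wd p)) := Small.inner_left sq bwd
  have hin : ∀ p ∈ S, inner ℝ (q p - qd p) (wd p) = inner ℝ (q p) (wd p) := fun p hp => by
    rw [inner_sub_left, hwd p hp, sub_zero]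
  have sb : Small S err (fun p => errW (wd p) (q p) (w p)) := by
    refine (sw.add (sin.smul_left bq) herr).congr fun p hp => ?_
    rw [errW_eq (hq p hp), hin p hp]
    abel
  have c1 : Coupled S err N (fun p => errQ (qd p) (q p)) := (Coupled.of_small ba sa herr).mono ha
  have c2 : Coupled S err N (fun p => errW (wd p) (q p) (w p)) :=
    (Coupled.of_small bb sb herr).mono hb
  have c3 : Coupled S err N (fun p => inner ℝ (q p - qd p) (q p - qd p)) :=
    Coupled.of_mul (B := fun p : E3 × E3 => inner ℝ p.1 p.2) isBoundedBilinearMap_inner herr hN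
      (bq.sub bqd) (bq.sub bqd) sq sq
  have c4 : Coupled S err N (fun p => inner ℝ (q p - qd p) (q p - qd p) • qd p) :=
    c3.bilin (isBoundedBilinearMap_smul (𝕜 := ℝ) (E := E3)).swap herr hN bqd
  have c5 : Coupled S err N (fun p => q p - qd p) := by
    refine (((Coupled.cross bqd c1 herr hN).add (c4.clm ((1 / 2 : ℝ) • ContinuousLinearMap.id ℝ E3))
      herr hN).clm (-ContinuousLinearMap.id ℝ E3)).congr fun p hp => ?_
    have h1 : inner ℝ (q p - qd p) (q p - qd p) = 2 - 2 * inner ℝ (qd p) (q p) := by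
      rw [real_inner_self_eq_norm_sq, norm_sub_sq_real, hq p hp, hqd p hp, real_inner_comm]
      ring
    simp only [neg_apply, smul_apply, ContinuousLinearMap.id_apply]
    rw [h1, errQ, cross_cross_of_norm_one (hqd p hp)]
    module
  have c6 : Coupled S err N (fun p => inner ℝ (wd p) (q p - qd p)) :=
    c5.bilin (B := fun p : E3 × E3 => inner ℝ p.1 p.2) isBoundedBilinearMap_inner herr hN bwd
  have c7 : Coupled S err N (fun p => inner ℝ (wd p) (q p - qd p) • q p) :=
    c6.bilin (isBoundedBilinearMap_smul (𝕜 := ℝ) (E := E3)).swap herr hN bq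
  have c8 : Coupled S err N (fun p => w p - wd p) := by
    refine (c2.sub c7 herr hN).congr fun p hp => ?_
    rw [real_inner_comm, hin p hp, errW_eq (hq p hp)]
    abel
  exact ⟨c5.diff, c8.diff⟩

end

theorem BddSmoothOn.bddLip_tube {E F : Type*} [NormedAddCommGroup E] [NormedSpace ℝ E]
    [NormedAddCommGroup F] [NormedSpace ℝ F] {φ : ℝ × E → F} {t₀ : ℝ} {c : ℝ → E} {ρ : ℝ}
    (h : BddSmoothOn φ (tube t₀ c ρ)) : BddLip (tube t₀ c ρ) φ := h.bddLip le_rfl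

attribute [local irreducible] redField flowLine muDes uDes b3Des RDes OmDes thrust errR errOm moment
  OmDesDot wDesDot desired nomTension inelasticTension qDes wDes relAtt

namespace GoodTube

variable {P : Params} {ref : Reference} {t₀ ρ : ℝ} {x : ℝ → Slow} (hG : GoodTube P ref t₀ x ρ)
include hG

theorem incr_rod : Incr (manifoldTube t₀ x ρ) (slowErr P ref)
    (fun t X Y => √(errSq P ref t X Y)) (fun p => p.2.mech.rod) := by
  have e0 := slowErr_nonneg P ref
  have n0 : ∀ t X Y, 0 ≤ √(errSq P ref t X Y) := fun _ _ _ => Real.sqrt_nonneg _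
  have h1 := direction_coupled (S := manifoldTube t₀ x ρ) (err := slowErr P ref)
    (N := fun t X Y => √(errSq P ref t X Y)) e0 n0 (hG.bddLip hG.rod_q) (hG.bddLip hG.rod_w)
    (hG.bddLip hG.qd) (hG.bddLip hG.wd) (small_rod_q P ref _) (small_rod_w P ref _)
    (fun p hp => hp.2.1) (fun p _ => hG.href.norm_qd p.1) (fun p _ => inner_qd_wd ref p.1)
    (fun t X Y => Real.le_sqrt_of_sq_le (le_trans (by
      unfold rodSq; exact le_add_of_nonneg_right (sq_nonneg _)) (rodSq_le P ref t X Y)))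
    (fun t X Y => Real.le_sqrt_of_sq_le (le_trans (by
      unfold rodSq; exact le_add_of_nonneg_left (sq_nonneg _)) (rodSq_le P ref t X Y)))
  have hx : Incr (manifoldTube t₀ x ρ) (slowErr P ref)
      (fun t X Y => √(errSq P ref t X Y)) (fun p => p.2.mech.rod.x) := by
    refine ⟨1, zero_le_one, fun t X Y _ _ => ?_⟩
    have h2 : ‖(X.mech.rod.x - ref.xd t) - (Y.mech.rod.x - ref.xd t)‖ ≤ √(errSq P ref t X Y) :=
      Real.le_sqrt_of_sq_le (le_trans (by
        unfold posSq; exact le_add_of_nonneg_right (sq_nonneg _)) (posSq_le P ref t X Y))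
    rw [sub_sub_sub_cancel_right] at h2
    rw [one_mul]
    exact h2.trans (le_add_of_nonneg_right
      (mul_nonneg (add_nonneg (e0 _) (e0 _)) (norm_nonneg _)))
  have hv : Incr (manifoldTube t₀ x ρ) (slowErr P ref)
      (fun t X Y => √(errSq P ref t X Y)) (fun p => p.2.mech.rod.v) := by
    refine ⟨1, zero_le_one, fun t X Y _ _ => ?_⟩
    have h2 : ‖(X.mech.rod.v - deriv ref.xd t) - (Y.mech.rod.v - deriv ref.xd t)‖
        ≤ √(errSq P ref t X Y) :=
      Real.le_sqrt_of_sq_le (le_trans (by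
        unfold posSq; exact le_add_of_nonneg_left (sq_nonneg _)) (posSq_le P ref t X Y))
    rw [sub_sub_sub_cancel_right] at h2
    rw [one_mul]
    exact h2.trans (le_add_of_nonneg_right
      (mul_nonneg (add_nonneg (e0 _) (e0 _)) (norm_nonneg _)))
  have hq : Incr (manifoldTube t₀ x ρ) (slowErr P ref)
      (fun t X Y => √(errSq P ref t X Y)) (fun p => p.2.mech.rod.q) :=
    h1.1.congr fun t X Y _ _ => sub_sub_sub_cancel_right _ _ _
  have hw : Incr (manifoldTube t₀ x ρ) (slowErr P ref)
      (fun t X Y => √(errSq P ref t X Y)) (fun p => p.2.mech.rod.w) :=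
    h1.2.congr fun t X Y _ _ => sub_sub_sub_cancel_right _ _ _
  exact hx.prodMk (hv.prodMk (hq.prodMk hw e0 n0) e0 n0) e0 n0

theorem incr_cable (j : Fin 2) : Incr (manifoldTube t₀ x ρ) (slowErr P ref)
      (fun t X Y => √(errSq P ref t X Y))
      (fun p => p.2.mech.qc j - RodTransport.qDes P ref j (p.1, p.2.mech.rod)) ∧
    Incr (manifoldTube t₀ x ρ) (slowErr P ref) (fun t X Y => √(errSq P ref t X Y))
      (fun p => p.2.mech.wc j - RodTransport.wDes P ref j (p.1, p.2.mech.1)) := by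
  have e0 := slowErr_nonneg P ref
  have n0 : ∀ t X Y, 0 ≤ √(errSq P ref t X Y) := fun _ _ _ => Real.sqrt_nonneg _
  have h1 := direction_coupled (S := manifoldTube t₀ x ρ) (err := slowErr P ref)
    (N := fun t X Y => √(errSq P ref t X Y)) e0 n0 (hG.bddLip (hG.qc j)) (hG.bddLip (hG.wc j))
    (hG.bddLip (hG.qDes j)) (hG.bddLip (hG.wDes j)) (small_qc P ref _ j) (small_wc P ref _ j)
    (fun p hp => (hp.2.2.2 j).1) (fun p hp => norm_qDes (hG.muDes_ne hp.1 j))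
    (fun p _ => by unfold RodTransport.wDes; exact inner_cross_self_left _ _)
    (fun t X Y => Real.le_sqrt_of_sq_le (le_trans (by
      unfold cableSq; exact le_add_of_nonneg_right (sq_nonneg _)) (cableSq_le P ref t X Y j)))
    (fun t X Y => Real.le_sqrt_of_sq_le (le_trans (by
      unfold cableSq; exact le_add_of_nonneg_left (sq_nonneg _)) (cableSq_le P ref t X Y j)))
  exact h1

theorem incr_att (j : Fin 2) : Incr (manifoldTube t₀ x ρ) (slowErr P ref)
      (fun t X Y => √(errSq P ref t X Y))
      (fun p => p.2.att j - RodTransport.RDes P ref j (p.1, p.2.mech)) ∧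
    Incr (manifoldTube t₀ x ρ) (slowErr P ref) (fun t X Y => √(errSq P ref t X Y))
      (fun p => p.2.om j - RodTransport.OmDes P ref j (p.1, p.2.1)) := by
  have e0 := slowErr_nonneg P ref
  have n0 : ∀ t X Y, 0 ≤ √(errSq P ref t X Y) := fun _ _ _ => Real.sqrt_nonneg _
  have a1 : ∀ t X Y, ‖RodTransport.errR P ref j t X - RodTransport.errR P ref j t Y‖
      ≤ √(errSq P ref t X Y) := fun t X Y =>
    Real.le_sqrt_of_sq_le (le_trans (le_trans (by
      unfold attSq; exact le_add_of_nonneg_right (sq_nonneg _)) (attSq_le P ref t X Y j))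
      (attSum_le P ref t X Y))
  have a2 : ∀ t X Y, ‖RodTransport.errOm P ref j t X - RodTransport.errOm P ref j t Y‖
      ≤ √(errSq P ref t X Y) := fun t X Y =>
    Real.le_sqrt_of_sq_le (le_trans (le_trans (by
      unfold attSq; exact le_add_of_nonneg_left (sq_nonneg _)) (attSq_le P ref t X Y j))
      (attSum_le P ref t X Y))
  have c1 := (hG.relAtt_coupled_errR j).mono a1
  have b0 := hG.bddLip (hG.errOm j)
  have c2' := Coupled.of_small b0 (hG.errOm_small j) e0
  have c2 : Coupled (manifoldTube t₀ x ρ) (slowErr P ref) (fun t X Y => √(errSq P ref t X Y))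
      (fun p => RodTransport.errOm P ref j p.1 p.2) := c2'.mono a2
  have c3 : Coupled (manifoldTube t₀ x ρ) (slowErr P ref) (fun t X Y => √(errSq P ref t X Y))
      (fun p => p.2.att j ∘L (RodTransport.relAtt P ref j p.1 p.2 - 1)) :=
    c1.bilin isBoundedBilinearMap_comp e0 n0 (hG.bddLip (hG.att j))
  have c4 : Coupled (manifoldTube t₀ x ρ) (slowErr P ref) (fun t X Y => √(errSq P ref t X Y))
      (fun p => (RodTransport.relAtt P ref j p.1 p.2 - 1)
        (RodTransport.OmDes P ref j (p.1, p.2.1))) :=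
    c1.bilin (isBoundedBilinearMap_apply (𝕜 := ℝ) (E := E3) (F := E3)).swap e0 n0
      (hG.bddLip (hG.OmDes j))
  have c5 : Coupled (manifoldTube t₀ x ρ) (slowErr P ref) (fun t X Y => √(errSq P ref t X Y))
      (fun p => -(p.2.att j ∘L (RodTransport.relAtt P ref j p.1 p.2 - 1))) :=
    c3.clm (-ContinuousLinearMap.id ℝ L3)
  have c6 : Coupled (manifoldTube t₀ x ρ) (slowErr P ref) (fun t X Y => √(errSq P ref t X Y))
      (fun p => p.2.att j - RodTransport.RDes P ref j (p.1, p.2.mech)) := by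
    refine c5.congr fun p hp => ?_
    have h1 : p.2.att j ∘L RodTransport.relAtt P ref j p.1 p.2 =
        RodTransport.RDes P ref j (p.1, p.2.mech) := by
      unfold RodTransport.relAtt
      rw [← ContinuousLinearMap.comp_assoc, orth_comm (isRot_att hp j).orth]
      rfl
    rw [ContinuousLinearMap.comp_sub, h1, neg_sub]
    rfl
  have c7 := c2.add c4 e0 n0
  have c8 : Coupled (manifoldTube t₀ x ρ) (slowErr P ref) (fun t X Y => √(errSq P ref t X Y))
      (fun p => p.2.om j - RodTransport.OmDes P ref j (p.1, p.2.1)) := by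
    refine c7.congr fun p hp => ?_
    unfold RodTransport.errOm
    rw [sub_apply, one_apply_e3]
    abel
  exact ⟨c6.diff, c8.diff⟩

theorem incr_state : Incr (manifoldTube t₀ x ρ) (slowErr P ref)
    (fun t X Y => √(errSq P ref t X Y)) (fun p => p.2) := by
  have e0 := slowErr_nonneg P ref
  have n0 : ∀ t X Y, 0 ≤ √(errSq P ref t X Y) := fun _ _ _ => Real.sqrt_nonneg _
  have hrod := hG.incr_rod
  have hqd : ∀ j, Incr (manifoldTube t₀ x ρ) (slowErr P ref) (fun t X Y => √(errSq P ref t X Y))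
      (fun p => RodTransport.qDes P ref j (p.1, p.2.mech.rod)) := fun j =>
    hrod.lip (φ := RodTransport.qDes P ref j) (fun t X hX => rod_mem_tube hX.1)
      (hG.qDes₀ j).bddLip_tube
  have hq : ∀ j, Incr (manifoldTube t₀ x ρ) (slowErr P ref) (fun t X Y => √(errSq P ref t X Y))
      (fun p => p.2.mech.qc j) := fun j =>
    (((hG.incr_cable j).1.add (hqd j) e0 n0)).congr fun t X Y _ _ => by
      simp only [sub_add_cancel]
  have hconf : Incr (manifoldTube t₀ x ρ) (slowErr P ref) (fun t X Y => √(errSq P ref t X Y))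
      (fun p => p.2.mech.1) := hrod.prodMk (Incr.pi2 hq e0 n0) e0 n0
  have hwd : ∀ j, Incr (manifoldTube t₀ x ρ) (slowErr P ref) (fun t X Y => √(errSq P ref t X Y))
      (fun p => RodTransport.wDes P ref j (p.1, p.2.mech.1)) := fun j =>
    hconf.lip (φ := RodTransport.wDes P ref j) (fun t X hX => conf_mem_tube hX.1)
      (hG.wDes₀ j).bddLip_tube
  have hw : ∀ j, Incr (manifoldTube t₀ x ρ) (slowErr P ref) (fun t X Y => √(errSq P ref t X Y))
      (fun p => p.2.mech.wc j) := fun j =>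
    (((hG.incr_cable j).2.add (hwd j) e0 n0)).congr fun t X Y _ _ => by
      simp only [sub_add_cancel]
  have hmech : Incr (manifoldTube t₀ x ρ) (slowErr P ref) (fun t X Y => √(errSq P ref t X Y))
      (fun p => p.2.mech) := hconf.prodMk (Incr.pi2 hw e0 n0) e0 n0
  have hRd : ∀ j, Incr (manifoldTube t₀ x ρ) (slowErr P ref) (fun t X Y => √(errSq P ref t X Y))
      (fun p => RodTransport.RDes P ref j (p.1, p.2.mech)) := fun j =>
    hmech.lip (φ := RodTransport.RDes P ref j) (fun t X hX => mech_mem_tube hX.1)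
      (hG.RDes₀ j).bddLip_tube
  have hR : ∀ j, Incr (manifoldTube t₀ x ρ) (slowErr P ref) (fun t X Y => √(errSq P ref t X Y))
      (fun p => p.2.att j) := fun j =>
    (((hG.incr_att j).1.add (hRd j) e0 n0)).congr fun t X Y _ _ => by
      simp only [sub_add_cancel]
  have hatt : Incr (manifoldTube t₀ x ρ) (slowErr P ref) (fun t X Y => √(errSq P ref t X Y))
      (fun p => p.2.1) := hmech.prodMk (Incr.pi2 hR e0 n0) e0 n0
  have hOd : ∀ j, Incr (manifoldTube t₀ x ρ) (slowErr P ref) (fun t X Y => √(errSq P ref t X Y))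
      (fun p => RodTransport.OmDes P ref j (p.1, p.2.1)) := fun j =>
    hatt.lip (φ := RodTransport.OmDes P ref j) (fun t X hX => att_mem_tube hX.1)
      (hG.OmDes₀ j).bddLip_tube
  have hO : ∀ j, Incr (manifoldTube t₀ x ρ) (slowErr P ref) (fun t X Y => √(errSq P ref t X Y))
      (fun p => p.2.om j) := fun j =>
    (((hG.incr_att j).2.add (hOd j) e0 n0)).congr fun t X Y _ _ => by
      simp only [sub_add_cancel]
  exact hatt.prodMk (Incr.pi2 hO e0 n0) e0 n0

/-- A Lyapunov function for the distance of two trajectories of the reduced model that are close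
to the desired trajectory. -/
theorem exists_lyapunov : ∃ (W : ℝ → Slow → Slow → ℝ) (η c C : ℝ), 0 < η ∧ 0 < c ∧ 0 ≤ C ∧
    ContinuousAlong (manifoldTube t₀ x ρ) W ∧
    (∀ t X Y, (t, X) ∈ manifoldTube t₀ x ρ → (t, Y) ∈ manifoldTube t₀ x ρ →
      slowErr P ref (t, X) ≤ η → slowErr P ref (t, Y) ≤ η →
      c * ‖X - Y‖ ^ 2 ≤ W t X Y) ∧
    (∀ t X Y, (t, X) ∈ manifoldTube t₀ x ρ → (t, Y) ∈ manifoldTube t₀ x ρ →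
      W t X Y ≤ C * ‖X - Y‖ ^ 2) ∧
    ∀ (X Y : ℝ → Slow) (t : ℝ) (v : Slow), (t, X t) ∈ manifoldTube t₀ x ρ →
      (t, Y t) ∈ manifoldTube t₀ x ρ →
      slowErr P ref (t, X t) ≤ η → slowErr P ref (t, Y t) ≤ η →
      HasDerivWithinAt X (redField P ref (t, X t) + v) (Ici t) t →
      HasDerivWithinAt Y (redField P ref (t, Y t)) (Ici t) t →
      ∃ w, HasDerivWithinAt (fun s => W s (X s) (Y s)) w (Ici t) t ∧
        w ≤ -c * ‖X t - Y t‖ ^ 2 + C * (‖X t - Y t‖ * ‖v‖) := by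
  obtain ⟨M, hM⟩ := hG.slowErr_bdd
  have e0 := slowErr_nonneg P ref
  have n0 : ∀ t X Y, 0 ≤ √(errSq P ref t X Y) := fun _ _ _ => Real.sqrt_nonneg _
  obtain ⟨K, hK, hle⟩ := hG.incr_state.sq_le e0 n0 hM
  obtain ⟨W, hcW, m, C, hm, hC, hW, hd⟩ := hG.dissipates_all
  have q0 : ∀ t X Y, 0 ≤ errSq P ref t X Y := fun t X Y =>
    (rodSq_nonneg ref t X Y).trans (rodSq_le P ref t X Y)
  have hle' : ∀ η, 0 ≤ η → 2 * η * (K + 1) ≤ 1 / 2 → ∀ t X Y, (t, X) ∈ manifoldTube t₀ x ρ →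
      (t, Y) ∈ manifoldTube t₀ x ρ →
      slowErr P ref (t, X) ≤ η → slowErr P ref (t, Y) ≤ η →
      ‖X - Y‖ ^ 2 ≤ 2 * (K + 1) * errSq P ref t X Y := by
    intro η _ hη t X Y hX hY eX eY
    have h1 := hle t X Y hX hY
    rw [Real.sq_sqrt (q0 t X Y)] at h1
    have h2 : (slowErr P ref (t, X) + slowErr P ref (t, Y)) * ‖X - Y‖ ^ 2
        ≤ 2 * η * ‖X - Y‖ ^ 2 := mul_le_mul_of_nonneg_right (by linarith) (sq_nonneg _)
    have h3 := mul_le_mul_of_nonneg_right hη (sq_nonneg ‖X - Y‖)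
    have h4 := mul_le_mul_of_nonneg_left h2 hK
    have h5 := q0 t X Y
    have h6 : 0 ≤ (slowErr P ref (t, X) + slowErr P ref (t, Y)) * ‖X - Y‖ ^ 2 :=
      mul_nonneg (add_nonneg (e0 _) (e0 _)) (sq_nonneg _)
    nlinarith
  set c₀ := m / (2 * (K + 1)) with hc₀
  have hc₀p : 0 < c₀ := by positivity
  have hc₀m : c₀ * (2 * (K + 1)) = m := by rw [hc₀]; field_simp
  have hm' : ∀ η, 0 ≤ η → 2 * η * (K + 1) ≤ 1 / 2 → ∀ t X Y, (t, X) ∈ manifoldTube t₀ x ρ →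
      (t, Y) ∈ manifoldTube t₀ x ρ →
      slowErr P ref (t, X) ≤ η → slowErr P ref (t, Y) ≤ η →
      c₀ * ‖X - Y‖ ^ 2 ≤ m * errSq P ref t X Y := by
    intro η h0 hη t X Y hX hY eX eY
    have h1 := mul_le_mul_of_nonneg_left (hle' η h0 hη t X Y hX hY eX eY) hc₀p.le
    rw [← mul_assoc, hc₀m] at h1
    exact h1
  obtain ⟨η, hη, hη1, hη2⟩ : ∃ η : ℝ, 0 < η ∧ 2 * η * (K + 1) ≤ 1 / 2 ∧ 2 * C * η ≤ c₀ / 2 := by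
    refine ⟨min (1 / (4 * (K + 1))) (c₀ / (4 * (C + 1))), by positivity, ?_, ?_⟩
    · calc 2 * min (1 / (4 * (K + 1))) (c₀ / (4 * (C + 1))) * (K + 1)
          ≤ 2 * (1 / (4 * (K + 1))) * (K + 1) := by gcongr; exact min_le_left _ _
        _ = 1 / 2 := by field_simp; norm_num
    · calc 2 * C * min (1 / (4 * (K + 1))) (c₀ / (4 * (C + 1)))
          ≤ 2 * (C + 1) * (c₀ / (4 * (C + 1))) := by
            gcongr
            · linarith
            · exact min_le_right _ _
        _ = c₀ / 2 := by field_simp; norm_num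
  refine ⟨W, η, c₀ / 2, C, hη, by positivity, hC, hcW, fun t X Y hX hY eX eY => ?_,
    fun t X Y hX hY => (hW t X Y hX hY).2, fun X Y t v hX hY eX eY dX dY => ?_⟩
  · have h1 := hm' η hη.le hη1 t X Y hX hY eX eY
    have h2 := (hW t X Y hX hY).1
    have h3 : 0 ≤ c₀ * ‖X - Y‖ ^ 2 := by positivity
    linarith
  · obtain ⟨w, hw, hle⟩ := hd X Y t v hX hY dX dY
    refine ⟨w, hw, hle.trans ?_⟩
    have h1 := hm' η hη.le hη1 t (X t) (Y t) hX hY eX eY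
    have h2 : (slowErr P ref (t, X t) + slowErr P ref (t, Y t)) * ‖X t - Y t‖ ^ 2
        ≤ 2 * η * ‖X t - Y t‖ ^ 2 := mul_le_mul_of_nonneg_right (by linarith) (sq_nonneg _)
    have h3 := mul_le_mul_of_nonneg_left h2 hC
    have h4 := mul_le_mul_of_nonneg_right hη2 (sq_nonneg ‖X t - Y t‖)
    linarith

end GoodTube

end RodTransport
end

noncomputable section
namespace RodTransport

/-! ### Global solutions of differential equations -/

section ODE

variable {E : Type*} [NormedAddCommGroup E] [NormedSpace ℝ E]

theorem le_one_of_continuation {ψ : ℝ → ℝ} {t₀ : ℝ} (hψ : ContinuousOn ψ (Ici t₀))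
    (h0 : ψ t₀ ≤ 1)
    (h : ∀ T, t₀ ≤ T → (∀ t ∈ Icc t₀ T, ψ t ≤ 1) → ψ T < 1) : ∀ t, t₀ ≤ t → ψ t ≤ 1 := by
  by_contra! hcon
  obtain ⟨a, ha0, ha⟩ := hcon
  set A : Set ℝ := {t | t₀ ≤ t ∧ 1 < ψ t} with hA
  have hne : A.Nonempty := ⟨a, ha0, ha⟩
  have hbdd : BddBelow A := ⟨t₀, fun t ht => ht.1⟩
  set s := sInf A with hs
  have hs0 : t₀ ≤ s := le_csInf hne fun t ht => ht.1
  have hlt : ∀ t, t₀ ≤ t → t < s → ψ t ≤ 1 := fun t h1 h2 => by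
    by_contra! h3
    exact absurd (csInf_le hbdd (show t ∈ A from ⟨h1, h3⟩)) (not_le.2 h2)
  have hs1 : ψ s ≤ 1 := by
    rcases hs0.eq_or_lt with h1 | h1
    · rwa [← h1]
    · by_contra! h2
      have h3 : ∀ᶠ t in 𝓝[Ico t₀ s] s, 1 < ψ t :=
        ((hψ s hs0).mono Ico_subset_Ici_self).eventually_const_lt h2
      have : (𝓝[Ico t₀ s] s).NeBot := by
        rw [nhdsWithin_Ico_eq_nhdsLT h1]; infer_instance
      obtain ⟨t, ht, ht'⟩ := (h3.and self_mem_nhdsWithin).exists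
      exact absurd (hlt t ht'.1 ht'.2) (not_le.2 ht)
  have hs2 : ψ s < 1 := h s hs0 fun t ht => by
    rcases ht.2.eq_or_lt with h1 | h1
    · rwa [h1]
    · exact hlt t ht.1 h1
  have h3 : ∀ᶠ t in 𝓝[Ici t₀] s, ψ t < 1 := (hψ s hs0).eventually_lt_const hs2
  obtain ⟨δ, hδ, h4⟩ := Metric.mem_nhdsWithin_iff.1 h3
  obtain ⟨b, hb, hbs⟩ := exists_lt_of_csInf_lt hne (show sInf A < s + δ by linarith)
  have hsb : s ≤ b := csInf_le hbdd hb
  have h5 : ψ b < 1 := h4 ⟨by rw [Metric.mem_ball, Real.dist_eq, abs_lt]; constructor <;> linarith,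
    hb.1⟩
  exact absurd hb.2 (not_lt.2 h5.le)

theorem hasDerivWithinAt_Ici_of_Icc {u : ℝ → E} {u' : E} {t₀ b t : ℝ} (htb : t < b)
    (h : HasDerivWithinAt u u' (Icc t₀ b) t) : HasDerivWithinAt u u' (Ici t₀) t :=
  h.mono_of_mem_nhdsWithin (by
    rw [← Ici_inter_Iic]
    exact inter_mem self_mem_nhdsWithin (mem_nhdsWithin_of_mem_nhds (Iic_mem_nhds htb)))

theorem eqOn_Icc_of_lipschitz {F : ℝ → E → E} {L : ℝ} {t₀ T : ℝ}
    {S : ℝ → Set E} (hL : ∀ t, t₀ ≤ t → ∀ u ∈ S t, ∀ v ∈ S t, ‖F t u - F t v‖ ≤ L * ‖u - v‖)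
    {u v : ℝ → E} (hu : ∀ t ∈ Icc t₀ T, HasDerivWithinAt u (F t (u t)) (Icc t₀ T) t)
    (hv : ∀ t ∈ Icc t₀ T, HasDerivWithinAt v (F t (v t)) (Icc t₀ T) t)
    (huS : ∀ t ∈ Icc t₀ T, u t ∈ S t) (hvS : ∀ t ∈ Icc t₀ T, v t ∈ S t)
    (h0 : u t₀ = v t₀) : EqOn u v (Icc t₀ T) := by
  have hd : ∀ {w : ℝ → E}, (∀ t ∈ Icc t₀ T, HasDerivWithinAt w (F t (w t)) (Icc t₀ T) t) →
      ∀ t ∈ Ico t₀ T, HasDerivWithinAt w (F t (w t)) (Ici t) t := fun hw t ht =>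
    (hasDerivWithinAt_Ici_of_Icc ht.2 (hw t (Ico_subset_Icc_self ht))).mono (Ici_subset_Ici.2 ht.1)
  refine ODE_solution_unique_of_mem_Icc_right (v := F) (s := S) (K := L.toNNReal) (fun t ht => ?_)
    (fun t ht => (hu t ht).continuousWithinAt) (hd hu)
    (fun t ht => huS t (Ico_subset_Icc_self ht)) (fun t ht => (hv t ht).continuousWithinAt) (hd hv)
    (fun t ht => hvS t (Ico_subset_Icc_self ht)) h0
  refine LipschitzOnWith.of_dist_le_mul fun x hx y hy => ?_
  rw [dist_eq_norm, dist_eq_norm]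
  exact (hL t ht.1 x hx y hy).trans (mul_le_mul_of_nonneg_right (Real.le_coe_toNNReal L)
    (norm_nonneg _))

/-- A bounded vector field that is Lipschitz in the state has global solutions. -/
theorem exists_global_solution [CompleteSpace E] {F : ℝ → E → E} {M L t₀ : ℝ}
    (hM : ∀ t, t₀ ≤ t → ∀ u, ‖F t u‖ ≤ M)
    (hL : ∀ t, t₀ ≤ t → ∀ u v, ‖F t u - F t v‖ ≤ L * ‖u - v‖)
    (hc : ∀ u, ContinuousOn (fun t => F t u) (Ici t₀)) (u₀ : E) :
    ∃ u : ℝ → E, u t₀ = u₀ ∧ ∀ t, t₀ ≤ t → HasDerivWithinAt u (F t (u t)) (Ici t₀) t := by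
  have h1 : ∀ n : ℕ, ∃ u : ℝ → E, u t₀ = u₀ ∧
      ∀ t ∈ Icc t₀ (t₀ + n), HasDerivWithinAt u (F t (u t)) (Icc t₀ (t₀ + n)) t := fun n => by
    have hn : t₀ ≤ t₀ + n := le_add_of_nonneg_right n.cast_nonneg
    have hp : IsPicardLindelof F (tmin := t₀) (tmax := t₀ + n) ⟨t₀, left_mem_Icc.2 hn⟩ u₀
        (M.toNNReal * n) 0 M.toNNReal L.toNNReal := by
      refine ⟨fun t ht => LipschitzOnWith.of_dist_le_mul fun x _ y _ => ?_,
        fun u _ => (hc u).mono Icc_subset_Ici_self,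
        fun t ht u _ => (hM t ht.1 u).trans (Real.le_coe_toNNReal M), ?_⟩
      · rw [dist_eq_norm, dist_eq_norm]
        exact (hL t ht.1 x y).trans (mul_le_mul_of_nonneg_right (Real.le_coe_toNNReal L)
          (norm_nonneg _))
      · simp
    exact hp.exists_eq_forall_mem_Icc_hasDerivWithinAt₀
  choose α hα0 hα using h1
  have huniq : ∀ m n : ℕ, m ≤ n → EqOn (α m) (α n) (Icc t₀ (t₀ + m)) := fun m n hmn => by
    have hsub : Icc t₀ (t₀ + m) ⊆ Icc t₀ (t₀ + n) :=
      Icc_subset_Icc_right (by simpa using hmn)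
    exact eqOn_Icc_of_lipschitz (F := F) (S := fun _ => univ)
      (fun t ht u _ v _ => hL t ht u v) (hα m)
      (fun t ht => (hα n t (hsub ht)).mono hsub) (fun _ _ => mem_univ _) (fun _ _ => mem_univ _)
      (by rw [hα0, hα0])
  set N : ℝ → ℕ := fun t => ⌈t - t₀⌉₊ + 1 with hN
  have hNt : ∀ t, t < t₀ + N t := fun t => by
    have := Nat.le_ceil (t - t₀)
    simp only [hN]; push_cast; linarith
  set u : ℝ → E := fun t => α (N t) t with hu
  have hu_eq : ∀ n : ℕ, ∀ t, t₀ ≤ t → t ≤ t₀ + n → u t = α n t := fun n t h1 h2 => by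
    rcases le_total (N t) n with h | h
    · exact huniq _ _ h ⟨h1, (hNt t).le⟩
    · exact (huniq _ _ h ⟨h1, h2⟩).symm
  refine ⟨u, by rw [hu_eq 0 t₀ le_rfl (by simp), hα0], fun t ht => ?_⟩
  have h2 := hα (N t) t ⟨ht, (hNt t).le⟩
  have h3 : HasDerivWithinAt u (F t (α (N t) t)) (Icc t₀ (t₀ + N t)) t :=
    h2.congr (fun s hs => hu_eq _ s hs.1 hs.2) rfl
  exact hasDerivWithinAt_Ici_of_Icc (hNt t) h3

/-- The radial retraction to the ball of radius `r`. -/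
def radialRetr (r : ℝ) (v : E) : E := (r / max r ‖v‖) • v

theorem radialRetr_of_norm_le {r : ℝ} (hr : 0 < r) {v : E} (hv : ‖v‖ ≤ r) :
    radialRetr r v = v := by
  rw [radialRetr, max_eq_left hv, div_self hr.ne', one_smul]

theorem norm_radialRetr_le {r : ℝ} (hr : 0 < r) (v : E) : ‖radialRetr r v‖ ≤ r := by
  have h1 : 0 < max r ‖v‖ := lt_max_of_lt_left hr
  rw [radialRetr, norm_smul, Real.norm_of_nonneg (by positivity), div_mul_eq_mul_div, div_le_iff₀ h1]
  gcongr
  exact le_max_right _ _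

theorem norm_radialRetr_sub_le {r : ℝ} (hr : 0 < r) (v w : E) :
    ‖radialRetr r v - radialRetr r w‖ ≤ 2 * ‖v - w‖ := by
  have hv : 0 < max r ‖v‖ := lt_max_of_lt_left hr
  have hw : 0 < max r ‖w‖ := lt_max_of_lt_left hr
  have h1 : radialRetr r v - radialRetr r w = (r / max r ‖v‖) • (v - w)
      + ((max r ‖w‖ - max r ‖v‖) * (r / max r ‖v‖ * (1 / max r ‖w‖))) • w := by
    rw [radialRetr, radialRetr]
    match_scalars
    · ring
    · field_simp
      ring
  have h2 : r / max r ‖v‖ ≤ 1 := (div_le_one hv).2 (le_max_left _ _)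
  have h2' : 0 ≤ r / max r ‖v‖ := by positivity
  have h3 : |max r ‖w‖ - max r ‖v‖| ≤ ‖v - w‖ := by
    rw [max_comm r, max_comm r, norm_sub_rev]
    refine (abs_max_sub_max_le_abs ‖w‖ ‖v‖ r).trans ?_
    exact abs_norm_sub_norm_le _ _
  have h4 : 1 / max r ‖w‖ * ‖w‖ ≤ 1 := by
    rw [one_div, inv_mul_le_iff₀ hw, mul_one]; exact le_max_right _ _
  rw [h1]
  refine (norm_add_le _ _).trans ?_
  rw [norm_smul, norm_smul, Real.norm_of_nonneg h2', Real.norm_eq_abs, abs_mul,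
    abs_of_nonneg (by positivity : 0 ≤ r / max r ‖v‖ * (1 / max r ‖w‖))]
  calc r / max r ‖v‖ * ‖v - w‖
        + |max r ‖w‖ - max r ‖v‖| * (r / max r ‖v‖ * (1 / max r ‖w‖)) * ‖w‖
      = r / max r ‖v‖ * ‖v - w‖
        + |max r ‖w‖ - max r ‖v‖| * (r / max r ‖v‖ * (1 / max r ‖w‖ * ‖w‖)) := by ring
    _ ≤ 1 * ‖v - w‖ + ‖v - w‖ * (1 * 1) := by gcongr
    _ = 2 * ‖v - w‖ := by ring

/-- If a-priori estimates keep the solutions of a differential equation inside a region to which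
the state space can be retracted, then the solution of the initial value problem exists globally
and is unique. -/
theorem exists_unique_of_apriori [CompleteSpace E] {F : ℝ → E → E} {M L t₀ : ℝ}
    {φ : ℝ → E → ℝ} {π : ℝ → E → E} {u₀ : E}
    (hM : ∀ t, t₀ ≤ t → ∀ u, φ t u ≤ 1 → ‖F t u‖ ≤ M)
    (hL : ∀ t, t₀ ≤ t → ∀ u v, φ t u ≤ 1 → φ t v ≤ 1 → ‖F t u - F t v‖ ≤ L * ‖u - v‖)
    (hF : ∀ p : ℝ → E, ContinuousOn p (Ici t₀) → (∀ t, t₀ ≤ t → φ t (p t) ≤ 1) →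
      ContinuousOn (fun t => F t (p t)) (Ici t₀))
    (hφ : ∀ p : ℝ → E, ContinuousOn p (Ici t₀) → ContinuousOn (fun t => φ t (p t)) (Ici t₀))
    (hπ : ∀ t, t₀ ≤ t → ∀ u, φ t (π t u) ≤ 1)
    (hπ1 : ∀ t, t₀ ≤ t → ∀ u, φ t u ≤ 1 → π t u = u)
    (hπL : ∀ t, t₀ ≤ t → ∀ u v, ‖π t u - π t v‖ ≤ 2 * ‖u - v‖)
    (hπc : ∀ u, ContinuousOn (fun t => π t u) (Ici t₀)) (hu₀ : φ t₀ u₀ ≤ 1)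
    (hap : ∀ (u : ℝ → E) (T : ℝ), t₀ ≤ T → u t₀ = u₀ → (∀ t ∈ Icc t₀ T, φ t (u t) ≤ 1) →
      ContinuousOn u (Icc t₀ T) →
      (∀ t ∈ Ico t₀ T, HasDerivWithinAt u (F t (u t)) (Ici t) t) → φ T (u T) < 1) :
    ∃ u : ℝ → E, u t₀ = u₀ ∧ (∀ t, t₀ ≤ t → φ t (u t) ≤ 1) ∧
      (∀ t, t₀ ≤ t → HasDerivWithinAt u (F t (u t)) (Ici t₀) t) ∧
      ∀ v : ℝ → E, v t₀ = u₀ → (∀ t, t₀ ≤ t → HasDerivWithinAt v (F t (v t)) (Ici t₀) t) →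
        EqOn v u (Ici t₀) := by
  have hL' : ∀ t, t₀ ≤ t → ∀ u v, ‖F t (π t u) - F t (π t v)‖ ≤ |L| * 2 * ‖u - v‖ :=
    fun t ht u v => (hL t ht _ _ (hπ t ht u) (hπ t ht v)).trans (by
      rw [mul_assoc]
      exact mul_le_mul (le_abs_self L) (hπL t ht u v) (norm_nonneg _) (abs_nonneg _))
  obtain ⟨u, hu0, hu⟩ := exists_global_solution (F := fun t u => F t (π t u))
    (fun t ht u => hM t ht _ (hπ t ht u)) hL'
    (fun u => hF (fun t => π t u) (hπc u) fun t ht => hπ t ht u) u₀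
  have hcont : ∀ {v : ℝ → E} {v' : ℝ → E},
      (∀ t, t₀ ≤ t → HasDerivWithinAt v (v' t) (Ici t₀) t) → ContinuousOn v (Ici t₀) :=
    fun hv t ht => (hv t ht).continuousWithinAt
  have hin : ∀ t, t₀ ≤ t → φ t (u t) ≤ 1 := by
    refine le_one_of_continuation (hφ u (hcont hu)) (by rw [hu0]; exact hu₀) fun T hT h => ?_
    refine hap u T hT hu0 h ((hcont hu).mono Icc_subset_Ici_self) fun t ht => ?_
    have h1 := (hu t ht.1).mono (Ici_subset_Ici.2 ht.1)
    rwa [hπ1 t ht.1 _ (h t (Ico_subset_Icc_self ht))] at h1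
  have hu' : ∀ t, t₀ ≤ t → HasDerivWithinAt u (F t (u t)) (Ici t₀) t := fun t ht => by
    have h1 := hu t ht
    rwa [hπ1 t ht _ (hin t ht)] at h1
  refine ⟨u, hu0, hin, hu', fun v hv0 hv => ?_⟩
  have hvin : ∀ t, t₀ ≤ t → φ t (v t) ≤ 1 :=
    le_one_of_continuation (hφ v (hcont hv)) (by rw [hv0]; exact hu₀) fun T hT h =>
      hap v T hT hv0 h ((hcont hv).mono Icc_subset_Ici_self) fun t ht =>
        (hv t ht.1).mono (Ici_subset_Ici.2 ht.1)
  intro T hT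
  exact eqOn_Icc_of_lipschitz (F := F) (S := fun t => {u | φ t u ≤ 1})
    (fun t ht u hu v hv => hL t ht u v hu hv)
    (fun t ht => (hv t ht.1).mono Icc_subset_Ici_self)
    (fun t ht => (hu' t ht.1).mono Icc_subset_Ici_self) (fun t ht => hvin t ht.1)
    (fun t ht => hin t ht.1) (by rw [hv0, hu0]) (right_mem_Icc.2 hT)

end ODE

end RodTransport
end

noncomputable section
namespace RodTransport

/-! ### Estimates for singularly perturbed systems -/

section

variable {E : Type*} [NormedAddCommGroup E] [InnerProductSpace ℝ E]

theorem stiff_osc_le {k c μ B δ : ℝ} (hk : 0 < k) (hc : 0 < c) (hμ : 0 < μ) (hB : 0 ≤ B)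
    (hδ : 0 < δ) (hδ1 : δ * (2 + (c * B) ^ 2 / (k * μ)) ≤ c * μ) {M : E →L[ℝ] E}
    (hsym : ∀ u v, inner ℝ (M u) v = inner ℝ u (M v)) (hlow : ∀ u, μ * ‖u‖ ^ 2 ≤ inner ℝ u (M u))
    (hM : ‖M‖ ≤ B) (a b p q : E) :
    2 * k * inner ℝ (b + p) (M a) + 2 * inner ℝ b (-M (k • a + c • b) + q)
      + 2 * δ * (inner ℝ (b + p) b + inner ℝ a (-M (k • a + c • b) + q)) ≤
    -min (δ * k * μ) (c * μ) * (‖a‖ ^ 2 + ‖b‖ ^ 2)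
      + (2 * k * B + 2 * δ + 2) * ((‖a‖ + ‖b‖) * (‖p‖ + ‖q‖)) := by
  have hMv : ∀ v, ‖M v‖ ≤ B * ‖v‖ := fun v => M.le_of_opNorm_le hM v
  have e1 : 2 * k * inner ℝ (b + p) (M a) + 2 * inner ℝ b (-M (k • a + c • b) + q)
      + 2 * δ * (inner ℝ (b + p) b + inner ℝ a (-M (k • a + c • b) + q)) =
      2 * k * inner ℝ p (M a) - 2 * c * inner ℝ b (M b) + 2 * inner ℝ b q
      + 2 * δ * ‖b‖ ^ 2 + 2 * δ * inner ℝ p b - 2 * δ * k * inner ℝ a (M a)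
      - 2 * δ * c * inner ℝ a (M b) + 2 * δ * inner ℝ a q := by
    simp only [map_add, map_smul, inner_add_left, inner_add_right, inner_neg_right,
      inner_smul_right, real_inner_self_eq_norm_sq]
    ring
  have h1 : inner ℝ p (M a) ≤ ‖p‖ * (B * ‖a‖) :=
    (real_inner_le_norm _ _).trans (by gcongr; exact hMv a)
  have h2 := real_inner_le_norm b q
  have h3 := real_inner_le_norm p b
  have h4 := real_inner_le_norm a q
  have h5 : -inner ℝ a (M b) ≤ ‖a‖ * (B * ‖b‖) :=
    (neg_le_abs _).trans ((abs_real_inner_le_norm _ _).trans (by gcongr; exact hMv b))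
  have h6 := hlow a
  have h7 := hlow b
  have h8 : 2 * (c * B) * (‖a‖ * ‖b‖) ≤ k * μ * ‖a‖ ^ 2 + (c * B) ^ 2 / (k * μ) * ‖b‖ ^ 2 := by
    have hkμ : 0 < k * μ := by positivity
    have : (c * B) ^ 2 / (k * μ) * (k * μ) = (c * B) ^ 2 := by field_simp
    have h9 : (k * μ) * (2 * (c * B) * (‖a‖ * ‖b‖)) ≤
        (k * μ) * (k * μ * ‖a‖ ^ 2 + (c * B) ^ 2 / (k * μ) * ‖b‖ ^ 2) := by
      have h10 : (k * μ) * (k * μ * ‖a‖ ^ 2 + (c * B) ^ 2 / (k * μ) * ‖b‖ ^ 2) =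
          (k * μ * ‖a‖) ^ 2 + (c * B * ‖b‖) ^ 2 := by
        linear_combination ‖b‖ ^ 2 * this
      rw [h10]
      nlinarith [sq_nonneg (k * μ * ‖a‖ - c * B * ‖b‖)]
    exact le_of_mul_le_mul_left h9 hkμ
  have h9 := mul_le_mul_of_nonneg_left h8 hδ.le
  have h10 := mul_le_mul_of_nonneg_right hδ1 (sq_nonneg ‖b‖)
  have m1 : min (δ * k * μ) (c * μ) * ‖a‖ ^ 2 ≤ δ * k * μ * ‖a‖ ^ 2 := by
    gcongr; exact min_le_left _ _
  have m2 : min (δ * k * μ) (c * μ) * ‖b‖ ^ 2 ≤ c * μ * ‖b‖ ^ 2 := by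
    gcongr; exact min_le_right _ _
  have k1 := mul_le_mul_of_nonneg_left h1 (by positivity : 0 ≤ 2 * k)
  have k3 := mul_le_mul_of_nonneg_left h3 (by positivity : 0 ≤ 2 * δ)
  have k4 := mul_le_mul_of_nonneg_left h4 (by positivity : 0 ≤ 2 * δ)
  have k5 := mul_le_mul_of_nonneg_left h5 (by positivity : 0 ≤ 2 * δ * c)
  have k6 := mul_le_mul_of_nonneg_left h6 (by positivity : 0 ≤ 2 * δ * k)
  have k7 := mul_le_mul_of_nonneg_left h7 (by positivity : 0 ≤ 2 * c)
  have a0 := norm_nonneg a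
  have b0 := norm_nonneg b
  have p0 := norm_nonneg p
  have q0 := norm_nonneg q
  have r1 : 0 ≤ (2 * δ + 2) * (‖a‖ * ‖p‖) + 2 * (‖a‖ * ‖q‖) + 2 * k * B * (‖a‖ * ‖q‖)
      + (2 * k * B + 2) * (‖b‖ * ‖p‖) + (2 * k * B + 2 * δ) * (‖b‖ * ‖q‖) := by positivity
  rw [e1]
  clear hsym hlow hM hMv e1 h1 h3 h4 h5 h6 h7 h8 hδ1
  linarith

theorem exists_mixing {k c μ B : ℝ} (hk : 0 < k) (hc : 0 < c) (hμ : 0 < μ) :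
    ∃ δ : ℝ, 0 < δ ∧ δ * (2 + (c * B) ^ 2 / (k * μ)) ≤ c * μ ∧ 4 * δ ^ 2 ≤ k * μ := by
  have hD : 0 < 2 + (c * B) ^ 2 / (k * μ) := by positivity
  refine ⟨min (c * μ / (2 + (c * B) ^ 2 / (k * μ))) (√(k * μ) / 2), by positivity, ?_, ?_⟩
  · rw [← le_div_iff₀ hD]; exact min_le_left _ _
  · have h1 : min (c * μ / (2 + (c * B) ^ 2 / (k * μ))) (√(k * μ) / 2) ≤ √(k * μ) / 2 :=
      min_le_right _ _
    have h2 := Real.sq_sqrt (by positivity : 0 ≤ k * μ)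
    have h3 : 0 ≤ min (c * μ / (2 + (c * B) ^ 2 / (k * μ))) (√(k * μ) / 2) := by positivity
    nlinarith

theorem stiff_lyap_le {k B δ : ℝ} (hk : 0 < k) (hB : 0 ≤ B) (hδ : 0 < δ) {M : E →L[ℝ] E}
    (hM : ‖M‖ ≤ B) (a b : E) : k * inner ℝ a (M a) + ‖b‖ ^ 2 + 2 * δ * inner ℝ a b ≤
      (k * B + 1 + δ) * (‖a‖ ^ 2 + ‖b‖ ^ 2) := by
  have h1 : inner ℝ a (M a) ≤ ‖a‖ * (B * ‖a‖) :=
    (real_inner_le_norm _ _).trans (by gcongr; exact M.le_of_opNorm_le hM _)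
  have h2 := mul_le_mul_of_nonneg_left h1 hk.le
  have h3 : 2 * inner ℝ a b ≤ ‖a‖ ^ 2 + ‖b‖ ^ 2 := by
    have := real_inner_le_norm a b
    linarith [two_mul_le_add_sq ‖a‖ ‖b‖]
  have h3 := mul_le_mul_of_nonneg_left h3 hδ.le
  have h4 : 0 ≤ k * B * ‖b‖ ^ 2 := by positivity
  have h5 := sq_nonneg ‖a‖
  linarith

theorem le_stiff_lyap {k μ δ : ℝ} (hk : 0 < k) (hδ : 0 < δ) (hδ2 : 4 * δ ^ 2 ≤ k * μ)
    {M : E →L[ℝ] E} (hlow : ∀ u, μ * ‖u‖ ^ 2 ≤ inner ℝ u (M u)) (a b : E) :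
    min (k * μ / 2) (1 / 2) * (‖a‖ ^ 2 + ‖b‖ ^ 2) ≤
      k * inner ℝ a (M a) + ‖b‖ ^ 2 + 2 * δ * inner ℝ a b := by
  have h1 := mul_le_mul_of_nonneg_left (hlow a) hk.le
  have h2 : -(2 * δ * inner ℝ a b) ≤ k * μ / 2 * ‖a‖ ^ 2 + 1 / 2 * ‖b‖ ^ 2 := by
    have h3 := (neg_le_abs _).trans (abs_real_inner_le_norm a b)
    have h5 := mul_le_mul_of_nonneg_right hδ2 (sq_nonneg ‖a‖)
    have h6 := mul_le_mul_of_nonneg_left h3 (by positivity : 0 ≤ 2 * δ)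
    have h7 := sq_nonneg (2 * δ * ‖a‖ - ‖b‖)
    linarith
  have h3 : min (k * μ / 2) (1 / 2) * ‖a‖ ^ 2 ≤ k * μ / 2 * ‖a‖ ^ 2 := by
    gcongr; exact min_le_left _ _
  have h4 : min (k * μ / 2) (1 / 2) * ‖b‖ ^ 2 ≤ 1 / 2 * ‖b‖ ^ 2 := by
    gcongr; exact min_le_right _ _
  linarith

theorem mul_add_mul_add_le {c D C ε a b p q : ℝ} (hc : 0 < c) (hD : 0 ≤ D) (ha : 0 ≤ a)
    (hb : 0 ≤ b) (hp : p ≤ C * ε) (hq : q ≤ C * ε) :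
    D * ((a + b) * (p + q)) ≤ c / 4 * (a ^ 2 + b ^ 2) + 8 * (D * C) ^ 2 / c * ε ^ 2 := by
  have h1 : D * ((a + b) * (p + q)) ≤ D * ((a + b) * (C * ε + C * ε)) := by gcongr
  have hKc : 8 * (D * C) ^ 2 / c * c = 8 * (D * C) ^ 2 := by field_simp
  have h2 : c * (D * ((a + b) * (C * ε + C * ε))) ≤
      c * (c / 4 * (a ^ 2 + b ^ 2) + 8 * (D * C) ^ 2 / c * ε ^ 2) := by
    have h3 : c * (c / 4 * (a ^ 2 + b ^ 2) + 8 * (D * C) ^ 2 / c * ε ^ 2) =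
        (c * a / 2) ^ 2 + (c * b / 2) ^ 2 + 8 * (D * C * ε) ^ 2 := by
      linear_combination ε ^ 2 * hKc
    rw [h3]
    have h4 := sq_nonneg (c * a / 2 - 2 * (D * C * ε))
    have h5 := sq_nonneg (c * b / 2 - 2 * (D * C * ε))
    linarith
  exact h1.trans (le_of_mul_le_mul_left h2 hc)

/-- The derivative of the Lyapunov function of a stiff oscillator. -/
theorem stiff_lyap_deriv_le {k c μ B D C₁ δ ε : ℝ} (hk : 0 < k) (hc : 0 < c) (hμ : 0 < μ)
    (hB : 0 ≤ B) (hD : 0 ≤ D) (hδ : 0 < δ) (hδ1 : δ * (2 + (c * B) ^ 2 / (k * μ)) ≤ c * μ)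
    (hε : 0 < ε) (hε1 : ε < min (δ * k * μ) (c * μ) / (2 * k * D + 1)) {M M' : E →L[ℝ] E}
    (hsym : ∀ u v, inner ℝ (M u) v = inner ℝ u (M v)) (hlow : ∀ u, μ * ‖u‖ ^ 2 ≤ inner ℝ u (M u))
    (hM : ‖M‖ ≤ B) (hM' : ‖M'‖ ≤ D) (a b : E) {p q : E} (hp : ‖p‖ ≤ C₁ * ε) (hq : ‖q‖ ≤ C₁ * ε) :
    ε * (k * (inner ℝ a (M' a + M (ε⁻¹ • (b + p))) + inner ℝ (ε⁻¹ • (b + p)) (M a))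
        + 2 * inner ℝ b (ε⁻¹ • (-M (k • a + c • b) + q))
        + 2 * δ * (inner ℝ a (ε⁻¹ • (-M (k • a + c • b) + q)) + inner ℝ (ε⁻¹ • (b + p)) b)) ≤
      -(min (δ * k * μ) (c * μ) / 4) * (‖a‖ ^ 2 + ‖b‖ ^ 2)
        + 8 * ((2 * k * B + 2 * δ + 2) * C₁) ^ 2 / min (δ * k * μ) (c * μ) * ε ^ 2 := by
  have e1 := stiff_osc_le hk hc hμ hB hδ hδ1 hsym hlow hM a b p q
  have e2 : inner ℝ a (M' a) ≤ ‖a‖ * (D * ‖a‖) :=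
    (real_inner_le_norm _ _).trans (by gcongr; exact M'.le_of_opNorm_le hM' _)
  have hc₀ : 0 < min (δ * k * μ) (c * μ) := by positivity
  have e4 := mul_add_mul_add_le (D := 2 * k * B + 2 * δ + 2) hc₀ (by positivity) (norm_nonneg a)
    (norm_nonneg b) hp hq
  have e5 : ε * (k * (inner ℝ a (M' a + M (ε⁻¹ • (b + p))) + inner ℝ (ε⁻¹ • (b + p)) (M a))
        + 2 * inner ℝ b (ε⁻¹ • (-M (k • a + c • b) + q))
        + 2 * δ * (inner ℝ a (ε⁻¹ • (-M (k • a + c • b) + q)) + inner ℝ (ε⁻¹ • (b + p)) b)) =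
      ε * (k * inner ℝ a (M' a)) +
        (2 * k * inner ℝ (b + p) (M a) + 2 * inner ℝ b (-M (k • a + c • b) + q)
      + 2 * δ * (inner ℝ (b + p) b + inner ℝ a (-M (k • a + c • b) + q))) := by
    have hs : inner ℝ a (M (b + p)) = inner ℝ (b + p) (M a) := by
      rw [← hsym, real_inner_comm]
    rw [inner_add_right a (M' a), map_smul, inner_smul_right, inner_smul_right,
      inner_smul_right, real_inner_smul_left, real_inner_smul_left, hs]
    field_simp
    ring
  rw [e5]
  rw [lt_div_iff₀ (by positivity)] at hε1
  have h2 := mul_le_mul_of_nonneg_right hε1.le (sq_nonneg ‖a‖)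
  have h3 : 0 ≤ ε * ‖a‖ ^ 2 := by positivity
  have e6 := mul_le_mul_of_nonneg_left (mul_le_mul_of_nonneg_left e2 hk.le) hε.le
  have e7 : 0 ≤ min (δ * k * μ) (c * μ) * ‖b‖ ^ 2 := by positivity
  generalize min (δ * k * μ) (c * μ) = c₀ at *
  clear hsym hlow hM hM' e2 e5 hδ1 hp hq
  linarith

theorem forall_le_of_deriv_le {c₀ c₂ K C ε t₀ T : ℝ} {V N w : ℝ → ℝ} (hc₀ : 0 < c₀) (hc₂ : 0 < c₂)
    (hK : 0 ≤ K) (hC : 0 ≤ C) (hε : 0 < ε) (hV : ContinuousOn V (Icc t₀ T))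
    (hV' : ∀ t ∈ Ico t₀ T, HasDerivWithinAt V (w t) (Ici t) t)
    (hup : ∀ t ∈ Icc t₀ T, V t ≤ c₂ * N t) (h0 : N t₀ ≤ C * ε ^ 2)
    (hw : ∀ t ∈ Ico t₀ T, ε * w t ≤ -(c₀ / 4) * N t + K * ε ^ 2) :
    ∀ t ∈ Icc t₀ T, V t ≤ (4 * c₂ * K / c₀ + c₂ * C + 1) * ε ^ 2 := by
  rcases lt_or_ge T t₀ with hT | hT
  · intro t ht; exact absurd (ht.1.trans ht.2) (not_le.2 hT)
  refine image_le_of_deriv_right_lt_deriv_boundary' hV hV' (B' := fun _ => 0) ?_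
    continuousOn_const (fun t _ => hasDerivWithinAt_const _ _ _) fun t ht hVt => ?_
  · refine (hup t₀ (left_mem_Icc.2 hT)).trans ?_
    calc c₂ * N t₀ ≤ c₂ * (C * ε ^ 2) := by gcongr
      _ = (c₂ * C) * ε ^ 2 := by ring
      _ ≤ _ := by
        gcongr
        have : 0 ≤ 4 * c₂ * K / c₀ := by positivity
        linarith
  · have h1 := hup t (Ico_subset_Icc_self ht)
    rw [hVt] at h1
    have h3 : c₀ * (4 * c₂ * K / c₀) = 4 * c₂ * K := by field_simp
    have h4 : c₂ * (ε * w t) < 0 := by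
      have h5 := mul_le_mul_of_nonneg_left (hw t ht) hc₂.le
      have h6 := mul_le_mul_of_nonneg_left h1 hc₀.le
      have h7 : 0 < c₀ * (c₂ * C + 1) * ε ^ 2 := by positivity
      have h8 : c₀ * ((4 * c₂ * K / c₀ + c₂ * C + 1) * ε ^ 2) =
          4 * c₂ * K * ε ^ 2 + c₀ * (c₂ * C + 1) * ε ^ 2 := by linear_combination ε ^ 2 * h3
      rw [h8] at h6
      linarith
    have h5 : ε * w t < 0 := (pos_iff_neg_of_mul_neg h4).1 hc₂
    exact (pos_iff_neg_of_mul_neg h5).1 hε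

/-- The solution of a stiff oscillator with small perturbations and a small initial value is
small. -/
theorem stiff_osc_bound {k c μ B D C₁ C₂ : ℝ} (hk : 0 < k) (hc : 0 < c) (hμ : 0 < μ) (hB : 0 ≤ B)
    (hD : 0 ≤ D) : ∃ ε₁ C : ℝ, 0 < ε₁ ∧ 0 ≤ C ∧
    ∀ (ε t₀ T : ℝ) (a b p q : ℝ → E) (M M' : ℝ → E →L[ℝ] E), 0 < ε → ε < ε₁ →
      ContinuousOn a (Icc t₀ T) → ContinuousOn b (Icc t₀ T) → ContinuousOn M (Icc t₀ T) →
      (∀ t ∈ Ico t₀ T, HasDerivWithinAt a (ε⁻¹ • (b t + p t)) (Ici t) t) →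
      (∀ t ∈ Ico t₀ T, HasDerivWithinAt b (ε⁻¹ • (-M t (k • a t + c • b t) + q t)) (Ici t) t) →
      (∀ t ∈ Ico t₀ T, HasDerivWithinAt M (M' t) (Ici t) t) →
      (∀ t ∈ Ico t₀ T, ‖M' t‖ ≤ D) →
      (∀ t ∈ Icc t₀ T, ∀ u v, inner ℝ (M t u) v = inner ℝ u (M t v)) →
      (∀ t ∈ Icc t₀ T, ∀ u, μ * ‖u‖ ^ 2 ≤ inner ℝ u (M t u)) →
      (∀ t ∈ Icc t₀ T, ‖M t‖ ≤ B) →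
      (∀ t ∈ Ico t₀ T, ‖p t‖ ≤ C₁ * ε) → (∀ t ∈ Ico t₀ T, ‖q t‖ ≤ C₁ * ε) →
      ‖a t₀‖ ≤ C₂ * ε → ‖b t₀‖ ≤ C₂ * ε →
      ∀ t ∈ Icc t₀ T, ‖a t‖ ≤ C * ε ∧ ‖b t‖ ≤ C * ε := by
  obtain ⟨δ, hδ, hδ1, hδ2⟩ := exists_mixing (B := B) hk hc hμ
  have hc₀ : 0 < min (δ * k * μ) (c * μ) := by positivity
  have hc₁ : 0 < min (k * μ / 2) (1 / 2) := by positivity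
  have hc₂ : 0 < k * B + 1 + δ := by positivity
  have hK : 0 ≤ 8 * ((2 * k * B + 2 * δ + 2) * C₁) ^ 2 / min (δ * k * μ) (c * μ) := by positivity
  obtain ⟨G, hG⟩ : ∃ G, G = 4 * (k * B + 1 + δ) *
    (8 * ((2 * k * B + 2 * δ + 2) * C₁) ^ 2 / min (δ * k * μ) (c * μ)) / min (δ * k * μ) (c * μ)
      + (k * B + 1 + δ) * (2 * C₂ ^ 2) + 1 := ⟨_, rfl⟩
  have hGp : 0 < G := by rw [hG]; positivity
  refine ⟨min (δ * k * μ) (c * μ) / (2 * k * D + 1), √(G / min (k * μ / 2) (1 / 2)),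
    by positivity, by positivity, ?_⟩
  intro ε t₀ T a b p q M M' hε hε1 ca cb cM da db dM hM' hsym hlow hMB hp hq ha0 hb0
  have hV' : ∀ t ∈ Ico t₀ T, ∃ w, HasDerivWithinAt
      (fun t => k * inner ℝ (a t) (M t (a t)) + ‖b t‖ ^ 2 + 2 * δ * inner ℝ (a t) (b t)) w (Ici t) t ∧
      ε * w ≤ -(min (δ * k * μ) (c * μ) / 4) * (‖a t‖ ^ 2 + ‖b t‖ ^ 2)
        + 8 * ((2 * k * B + 2 * δ + 2) * C₁) ^ 2 / min (δ * k * μ) (c * μ) * ε ^ 2 :=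
    fun t ht => by
      have ht' := Ico_subset_Icc_self ht
      have d1 := ((((da t ht).inner ℝ ((dM t ht).clm_apply (da t ht))).const_mul k).add
        ((db t ht).norm_sq)).add (((da t ht).inner ℝ (db t ht)).const_mul (2 * δ))
      exact ⟨_, d1, stiff_lyap_deriv_le hk hc hμ hB hD hδ hδ1 hε hε1 (hsym t ht') (hlow t ht')
        (hMB t ht') (hM' t ht) (a t) (b t) (hp t ht) (hq t ht)⟩
  choose! w hw hwle using hV'
  have hVc : ContinuousOn (fun t => k * inner ℝ (a t) (M t (a t)) + ‖b t‖ ^ 2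
      + 2 * δ * inner ℝ (a t) (b t)) (Icc t₀ T) :=
    (((ContinuousOn.inner (𝕜 := ℝ) ca (cM.clm_apply ca)).const_mul k).add (cb.norm.pow 2)).add
      ((ContinuousOn.inner (𝕜 := ℝ) ca cb).const_mul (2 * δ))
  have h0 : ‖a t₀‖ ^ 2 + ‖b t₀‖ ^ 2 ≤ 2 * C₂ ^ 2 * ε ^ 2 := by
    have h2 : ‖a t₀‖ ^ 2 ≤ (C₂ * ε) ^ 2 := by gcongr
    have h3 : ‖b t₀‖ ^ 2 ≤ (C₂ * ε) ^ 2 := by gcongr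
    linarith [mul_pow C₂ ε 2]
  have hbound := forall_le_of_deriv_le (N := fun t => ‖a t‖ ^ 2 + ‖b t‖ ^ 2) hc₀ hc₂ hK
    (by positivity) hε hVc hw
    (fun t ht => stiff_lyap_le hk hB hδ (hMB t ht) (a t) (b t)) h0 hwle
  rw [← hG] at hbound
  intro t ht
  have h1 := (le_stiff_lyap hk hδ hδ2 (hlow t ht) (a t) (b t)).trans (hbound t ht)
  have h2 : ‖a t‖ ^ 2 + ‖b t‖ ^ 2 ≤ (√(G / min (k * μ / 2) (1 / 2)) * ε) ^ 2 := by
    rw [mul_pow, Real.sq_sqrt (by positivity), div_mul_eq_mul_div, le_div_iff₀ hc₁]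
    linarith
  have h3 : 0 ≤ √(G / min (k * μ / 2) (1 / 2)) * ε := by positivity
  constructor
  · exact abs_le_of_sq_le_sq' (by have := sq_nonneg ‖b t‖; linarith) h3 |>.2
  · exact abs_le_of_sq_le_sq' (by have := sq_nonneg ‖a t‖; linarith) h3 |>.2

end

theorem hasDerivAt_layer (γ ε t₀ t : ℝ) :
    HasDerivAt (fun t => 2 - Real.exp (-γ * ((t - t₀) / ε)))
      (γ / ε * Real.exp (-γ * ((t - t₀) / ε))) t := by
  have h1 : HasDerivAt (fun t => -γ * ((t - t₀) / ε)) (-γ * (1 / ε)) t :=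
    (((hasDerivAt_id t).sub_const t₀).div_const ε).const_mul (-γ)
  exact ((h1.exp).const_sub 2).congr_deriv (by ring)

theorem layer_le_one {γ ε t₀ t : ℝ} (hγ : 0 < γ) (hε : 0 < ε) (ht : t₀ ≤ t) :
    Real.exp (-γ * ((t - t₀) / ε)) ≤ 1 := by
  rw [Real.exp_le_one_iff]
  have : 0 ≤ (t - t₀) / ε := div_nonneg (by linarith) hε.le
  nlinarith

section

variable {E : Type*} [NormedAddCommGroup E] [NormedSpace ℝ E]

/-- Estimate of the deviation of the slow state on bounded intervals. -/
theorem slow_short_bound {L C γ C₂ T₁ : ℝ} (hL : 0 ≤ L) (hC : 0 ≤ C) (hγ : 0 < γ) (hC₂ : 0 ≤ C₂) :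
    ∃ A : ℝ, 0 ≤ A ∧ ∀ (ε t₀ T : ℝ) (u u' : ℝ → E), 0 < ε → T ≤ t₀ + T₁ →
      ContinuousOn u (Icc t₀ T) → (∀ t ∈ Ico t₀ T, HasDerivWithinAt u (u' t) (Ici t) t) →
      (∀ t ∈ Ico t₀ T, ‖u' t‖ ≤ L * ‖u t‖ + C * (ε + Real.exp (-γ * ((t - t₀) / ε)))) →
      ‖u t₀‖ ≤ C₂ * ε → ∀ t ∈ Icc t₀ T, ‖u t‖ ≤ A * ε := by
  set A₀ := C + C / γ + C₂ + 1 with hA₀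
  have hA₀p : 0 < A₀ := by positivity
  refine ⟨2 * A₀ * Real.exp (2 * (L + 1) * T₁), by positivity, ?_⟩
  intro ε t₀ T u u' hε hT cu du hle h0 t ht
  set b : ℝ → ℝ := fun t => A₀ * ε * Real.exp (2 * (L + 1) * (t - t₀)) with hb
  have db : ∀ t, HasDerivAt b (2 * (L + 1) * b t) t := fun t => by
    have h1 : HasDerivAt (fun t => 2 * (L + 1) * (t - t₀)) (2 * (L + 1) * 1) t :=
      ((hasDerivAt_id t).sub_const t₀).const_mul _
    exact ((h1.exp).const_mul (A₀ * ε)).congr_deriv (by simp only [hb]; ring)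
  have dB := fun t => (db t).mul (hasDerivAt_layer γ ε t₀ t)
  have hb1 : ∀ t, t₀ ≤ t → A₀ * ε ≤ b t := fun t ht => by
    have : 1 ≤ Real.exp (2 * (L + 1) * (t - t₀)) :=
      Real.one_le_exp (mul_nonneg (by positivity) (by linarith))
    simp only [hb]
    exact le_mul_of_one_le_right (by positivity) this
  have key := image_norm_le_of_norm_deriv_right_lt_deriv_boundary' cu du (by
      refine h0.trans ?_
      change C₂ * ε ≤ b t₀ * (2 - Real.exp (-γ * ((t₀ - t₀) / ε)))
      have h1 := hb1 t₀ le_rfl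
      have h2 : C₂ * ε ≤ A₀ * ε := by
        gcongr; have : 0 ≤ C / γ := by positivity
        linarith
      simp only [sub_self, zero_div, mul_zero, Real.exp_zero]
      linarith) (fun s _ => (dB s).continuousAt.continuousWithinAt)
    (fun s _ => (dB s).hasDerivWithinAt) (fun s hs hus => by
      refine (hle s hs).trans_lt ?_
      rw [hus]
      have h1 := hb1 s hs.1
      have h2 := layer_le_one hγ hε hs.1
      have h3 := Real.exp_pos (-γ * ((s - t₀) / ε))
      change L * (b s * (2 - Real.exp (-γ * ((s - t₀) / ε)))) + _ <
        2 * (L + 1) * b s * (2 - Real.exp (-γ * ((s - t₀) / ε)))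
          + b s * (γ / ε * Real.exp (-γ * ((s - t₀) / ε)))
      generalize Real.exp (-γ * ((s - t₀) / ε)) = z at *
      have h4 : A₀ * γ * z ≤ b s * (γ / ε * z) := by
        calc A₀ * γ * z = A₀ * ε * (γ / ε * z) := by field_simp
          _ ≤ _ := by gcongr
      have h5 : C * z ≤ A₀ * γ * z := by
        gcongr
        have : C / γ * γ = C := by field_simp
        rw [hA₀]
        nlinarith
      have h6 : C * ε < A₀ * ε := by
        gcongr
        have : 0 ≤ C / γ := by positivity
        linarith
      have h7 : 0 < b s := lt_of_lt_of_le (by positivity) h1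
      have h8 : b s ≤ b s * (2 - z) := le_mul_of_one_le_right h7.le (by linarith)
      have h9 : 0 ≤ L * (b s * (2 - z)) := mul_nonneg hL (h7.le.trans h8)
      nlinarith) ht
  refine key.trans ?_
  have h1 : b t ≤ A₀ * ε * Real.exp (2 * (L + 1) * T₁) := by
    change A₀ * ε * Real.exp _ ≤ _
    gcongr
    linarith [ht.2]
  have h3 := Real.exp_pos (-γ * ((t - t₀) / ε))
  have h4 : 0 ≤ b t := le_trans (by positivity) (hb1 t ht.1)
  change b t * (2 - Real.exp (-γ * ((t - t₀) / ε))) ≤ _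
  nlinarith

end

theorem slow_barrier_lt {c C Cv γ q A ε d z : ℝ} (hc : 0 < c) (hC : 0 < C) (hCv : 0 ≤ Cv)
    (hγ : 0 < γ) (hε : 0 < ε) (hA : 0 < A) (hA1 : C * Cv * q * C < A * c)
    (hA2 : C * Cv * q ≤ A * (2 * γ)) (hd : 0 ≤ d) (hdA : d ≤ q * A * ε) (hz : 0 ≤ z) (hz1 : z ≤ 1)
    (hup : (A * ε) ^ 2 * (2 - z) ^ 2 ≤ C * d ^ 2) :
    -c * d ^ 2 + C * (d * (Cv * (ε + z))) <
      (A * ε) ^ 2 * (((2 : ℕ) : ℝ) * (2 - z) ^ (2 - 1) * (γ / ε * z)) := by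
  have h7 : (A * ε) ^ 2 ≤ C * d ^ 2 :=
    le_trans (le_mul_of_one_le_right (sq_nonneg _) (one_le_pow₀ (by linarith))) hup
  have h8 : C * (d * (Cv * (ε + z))) ≤ (C * Cv * q) * A * ε * (ε + z) := by
    calc C * (d * (Cv * (ε + z))) ≤ C * (q * A * ε * (Cv * (ε + z))) := by gcongr
      _ = _ := by ring
  have h9 : (C * Cv * q) * A * ε * z ≤ (A * ε) ^ 2 * (2 * 1 * (γ / ε * z)) := by
    have e1 : (A * ε) ^ 2 * (2 * 1 * (γ / ε * z)) = (A * (2 * γ)) * (A * ε * z) := by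
      field_simp
    rw [e1]
    calc (C * Cv * q) * A * ε * z = (C * Cv * q) * (A * ε * z) := by ring
      _ ≤ _ := mul_le_mul_of_nonneg_right hA2 (by positivity)
  have h10 : (A * ε) ^ 2 * (2 * 1 * (γ / ε * z)) ≤
      (A * ε) ^ 2 * (((2 : ℕ) : ℝ) * (2 - z) ^ (2 - 1) * (γ / ε * z)) := by
    have : (1 : ℝ) ≤ (2 - z) ^ (2 - 1) := one_le_pow₀ (by linarith)
    push_cast
    gcongr
  have h11 : (C * Cv * q) * A * ε * ε < c * d ^ 2 := by
    have e2 : C * ((C * Cv * q) * A * ε * ε) < C * (c * d ^ 2) := by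
      calc C * ((C * Cv * q) * A * ε * ε) = (C * Cv * q * C) * (A * ε ^ 2) := by ring
        _ < (A * c) * (A * ε ^ 2) := mul_lt_mul_of_pos_right hA1 (by positivity)
        _ = c * (A * ε) ^ 2 := by ring
        _ ≤ c * (C * d ^ 2) := mul_le_mul_of_nonneg_left h7 hc.le
        _ = _ := by ring
    exact lt_of_mul_lt_mul_left e2 hC.le
  linarith

/-- Estimate of the deviation of the slow state by a Lyapunov function. -/
theorem slow_long_bound {c C Cv γ A₁ : ℝ} (hc : 0 < c) (hC : 0 < C) (hCv : 0 ≤ Cv) (hγ : 0 < γ)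
    (hA₁ : 0 ≤ A₁) : ∃ A : ℝ, 0 ≤ A ∧ ∀ (ε t₀ s T : ℝ) (d w w' : ℝ → ℝ), 0 < ε → t₀ ≤ s →
      ContinuousOn w (Icc s T) → (∀ t ∈ Ico s T, HasDerivWithinAt w (w' t) (Ici t) t) →
      (∀ t ∈ Icc s T, 0 ≤ d t) → (∀ t ∈ Icc s T, c * d t ^ 2 ≤ w t) →
      (∀ t ∈ Icc s T, w t ≤ C * d t ^ 2) →
      (∀ t ∈ Ico s T, w' t ≤ -c * d t ^ 2
        + C * (d t * (Cv * (ε + Real.exp (-γ * ((t - t₀) / ε)))))) →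
      d s ≤ A₁ * ε → ∀ t ∈ Icc s T, d t ≤ A * ε := by
  obtain ⟨q, hq⟩ : ∃ q, q = 2 / √c := ⟨_, rfl⟩
  have hqp : 0 < q := by rw [hq]; positivity
  obtain ⟨A, hA⟩ : ∃ A, A = C * Cv * q * C / c + C * Cv * q / (2 * γ) + (C + 1) * A₁ + 1 := ⟨_, rfl⟩
  have hAp : 0 < A := by rw [hA]; positivity
  have hA1 : C * Cv * q * C < A * c := by
    rw [← div_lt_iff₀ hc, hA]
    have : 0 ≤ C * Cv * q / (2 * γ) + (C + 1) * A₁ := by positivity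
    linarith
  have hA2 : C * Cv * q ≤ A * (2 * γ) := by
    rw [← div_le_iff₀ (by positivity), hA]
    have : 0 ≤ C * Cv * q * C / c + (C + 1) * A₁ := by positivity
    linarith
  have hA3 : (C + 1) * A₁ ≤ A := by
    have : 0 ≤ C * Cv * q * C / c + C * Cv * q / (2 * γ) := by positivity
    rw [hA]
    linarith
  clear hA
  refine ⟨q * A, by positivity, ?_⟩
  intro ε t₀ s T d w w' hε hs cw dw hd hlow hup hle h0 t ht
  have hsT : s ≤ T := ht.1.trans ht.2
  have dB := fun t => ((hasDerivAt_layer γ ε t₀ t).pow 2).const_mul ((A * ε) ^ 2)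
  have hq2 : q ^ 2 * c = 4 := by
    rw [hq, div_pow, Real.sq_sqrt hc.le]; field_simp; norm_num
  have hdle : ∀ t ∈ Icc s T, w t ≤ (A * ε) ^ 2 * (2 - Real.exp (-γ * ((t - t₀) / ε))) ^ 2 →
      d t ≤ q * A * ε := fun t ht hw => by
    have h3 := Real.exp_pos (-γ * ((t - t₀) / ε))
    have h2 := layer_le_one hγ hε (hs.trans ht.1)
    have h4 : (2 - Real.exp (-γ * ((t - t₀) / ε))) ^ 2 ≤ 4 := by nlinarith
    have h5 := mul_le_mul_of_nonneg_left h4 (sq_nonneg (A * ε))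
    have h6 : c * d t ^ 2 ≤ c * (q * A * ε) ^ 2 := by
      have : c * (q * A * ε) ^ 2 = (A * ε) ^ 2 * 4 := by
        linear_combination (A * ε) ^ 2 * hq2
      rw [this]
      exact (hlow t ht).trans (hw.trans h5)
    exact abs_le_of_sq_le_sq' (le_of_mul_le_mul_left h6 hc) (by positivity) |>.2
  refine hdle t ht (image_le_of_deriv_right_lt_deriv_boundary' cw dw
    (B := fun t => (A * ε) ^ 2 * (2 - Real.exp (-γ * ((t - t₀) / ε))) ^ 2) ?_
    (fun s _ => (dB s).continuousAt.continuousWithinAt)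
    (fun s _ => (dB s).hasDerivWithinAt) (fun r hr hwr => ?_) ht)
  · have h1 := hup s (left_mem_Icc.2 hsT)
    have h2 := layer_le_one hγ hε hs
    have h3 : 1 ≤ (2 - Real.exp (-γ * ((s - t₀) / ε))) ^ 2 := one_le_pow₀ (by linarith)
    have h4 : d s ^ 2 ≤ (A₁ * ε) ^ 2 := by
      have := hd s (left_mem_Icc.2 hsT); gcongr
    have h5 : C * A₁ ^ 2 ≤ A ^ 2 := by
      have h7 : ((C + 1) * A₁) ^ 2 ≤ A ^ 2 := by gcongr
      refine le_trans ?_ h7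
      rw [mul_pow]
      exact mul_le_mul_of_nonneg_right (by linarith [sq_nonneg C]) (sq_nonneg _)
    calc w s ≤ C * (A₁ * ε) ^ 2 := h1.trans (by gcongr)
      _ = (C * A₁ ^ 2) * ε ^ 2 := by ring
      _ ≤ A ^ 2 * ε ^ 2 := by gcongr
      _ = (A * ε) ^ 2 * 1 := by ring
      _ ≤ _ := by gcongr
  · have hr' := Ico_subset_Icc_self hr
    exact (hle r hr).trans_lt (slow_barrier_lt hc hC hCv hγ hε hAp hA1 hA2 (hd r hr')
      (hdle r hr' hwr.le) (Real.exp_pos _).le (layer_le_one hγ hε (hs.trans hr.1))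
      (hwr ▸ hup r hr'))

end RodTransport
end

noncomputable section
namespace RodTransport

/-! ### The constraints are preserved -/

section

variable {E F : Type*} [NormedAddCommGroup E] [NormedSpace ℝ E] [NormedAddCommGroup F]
  [NormedSpace ℝ F]

theorem hasDerivWithinAt_fst {u : ℝ → E × F} {d : E × F} {s : Set ℝ} {t : ℝ}
    (h : HasDerivWithinAt u d s t) : HasDerivWithinAt (fun t => (u t).1) d.1 s t :=
  (ContinuousLinearMap.fst ℝ E F).hasFDerivAt.comp_hasDerivWithinAt t h

theorem hasDerivWithinAt_snd {u : ℝ → E × F} {d : E × F} {s : Set ℝ} {t : ℝ}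
    (h : HasDerivWithinAt u d s t) : HasDerivWithinAt (fun t => (u t).2) d.2 s t :=
  (ContinuousLinearMap.snd ℝ E F).hasFDerivAt.comp_hasDerivWithinAt t h

theorem eq_zero_of_norm_deriv_le {φ φ' : ℝ → E} {α : ℝ → ℝ} {t₀ T : ℝ}
    (hφ : ContinuousOn φ (Icc t₀ T)) (hα : ContinuousOn α (Icc t₀ T))
    (hφ' : ∀ t ∈ Ico t₀ T, HasDerivWithinAt φ (φ' t) (Ici t) t)
    (hle : ∀ t ∈ Ico t₀ T, ‖φ' t‖ ≤ α t * ‖φ t‖) (h0 : φ t₀ = 0) :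
    ∀ t ∈ Icc t₀ T, φ t = 0 := by
  obtain ⟨K, hK⟩ := isCompact_Icc.exists_bound_of_continuousOn hα
  exact eq_zero_of_abs_deriv_le_mul_abs_self_of_eq_zero_right (K := K) hφ hφ' h0 fun t ht =>
    (hle t ht).trans (mul_le_mul_of_nonneg_right
      ((le_abs_self _).trans (hK t (Ico_subset_Icc_self ht))) (norm_nonneg _))

end

theorem norm_eq_one_of_cross_deriv {q w : ℝ → E3} {t₀ T : ℝ} (hq : ContinuousOn q (Icc t₀ T))
    (hq' : ∀ t ∈ Ico t₀ T, HasDerivWithinAt q (w t ×ᵥ q t) (Ici t) t) (h0 : ‖q t₀‖ = 1) :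
    ∀ t ∈ Icc t₀ T, ‖q t‖ = 1 := by
  have h1 : ∀ t ∈ Icc t₀ T, ‖q t‖ ^ 2 - 1 = 0 :=
    eq_zero_of_norm_deriv_le (α := fun _ => 0) ((hq.norm.pow 2).sub continuousOn_const)
      continuousOn_const (fun t ht => ((hq' t ht).norm_sq).sub_const 1)
      (fun t ht => by rw [inner_cross_self_right]; simp) (by rw [h0]; norm_num)
  intro t ht
  have h2 : ‖q t‖ ^ 2 = 1 ^ 2 := by linarith [h1 t ht]
  exact (pow_left_inj₀ (norm_nonneg _) zero_le_one two_ne_zero).1 h2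

theorem inner_eq_zero_of_cross_deriv {q w w' : ℝ → E3} {α : ℝ → ℝ} {t₀ T : ℝ}
    (hq : ContinuousOn q (Icc t₀ T)) (hw : ContinuousOn w (Icc t₀ T))
    (hα : ContinuousOn α (Icc t₀ T))
    (hq' : ∀ t ∈ Ico t₀ T, HasDerivWithinAt q (w t ×ᵥ q t) (Ici t) t)
    (hw' : ∀ t ∈ Ico t₀ T, HasDerivWithinAt w (w' t) (Ici t) t)
    (h : ∀ t ∈ Ico t₀ T, inner ℝ (w' t) (q t) = α t * inner ℝ (w t) (q t))
    (h0 : inner ℝ (w t₀) (q t₀) = 0) : ∀ t ∈ Icc t₀ T, inner ℝ (w t) (q t) = 0 := by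
  refine eq_zero_of_norm_deriv_le (α := fun t => |α t|) (ContinuousOn.inner (𝕜 := ℝ) hw hq) hα.abs
    (fun t ht => (hw' t ht).inner ℝ (hq' t ht)) (fun t ht => ?_) h0
  rw [inner_cross_self_left, zero_add, h t ht, norm_mul, Real.norm_eq_abs]

theorem det_sq_of_orth {R : L3} (h : ContinuousLinearMap.adjoint R ∘L R = 1) : R.det ^ 2 = 1 := by
  have h1 : ∀ a b, inner ℝ (R a) (R b) = inner ℝ a b := fun a b => by
    rw [← ContinuousLinearMap.adjoint_inner_right, ← ContinuousLinearMap.comp_apply, h]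
    rfl
  have h2 := inner_map_cross R (e 0) (e 1) (e 2)
  have h3 := normsq_cross (R (e 0)) (R (e 1))
  have h4 : R.det = inner ℝ (R (e 0) ×ᵥ R (e 1)) (R (e 2)) := by
    rw [h2]; simp [inner_e3, e]
  have h01 := h1 (e 0) (e 1)
  have h02 := h1 (e 0) (e 2)
  have h12 := h1 (e 1) (e 2)
  have h00 := h1 (e 0) (e 0)
  have h11 := h1 (e 1) (e 1)
  have h22 := h1 (e 2) (e 2)
  rw [h4]
  have gram : ∀ a b c : E3, (inner ℝ (a ×ᵥ b) c) ^ 2 =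
      inner ℝ a a * (inner ℝ b b * inner ℝ c c - inner ℝ b c ^ 2)
      - inner ℝ a b * (inner ℝ a b * inner ℝ c c - inner ℝ b c * inner ℝ a c)
      + inner ℝ a c * (inner ℝ a b * inner ℝ b c - inner ℝ b b * inner ℝ a c) := fun a b c => by
    simp only [inner_e3, cross0, cross1, cross2]; ring
  rw [gram, h00, h11, h22, h01, h02, h12]
  simp [inner_e3, e]

theorem mem_SO3_of_hat_deriv {R : ℝ → L3} {w : ℝ → E3} {t₀ T : ℝ} (hR : ContinuousOn R (Icc t₀ T))
    (hw : ContinuousOn w (Icc t₀ T))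
    (hR' : ∀ t ∈ Ico t₀ T, HasDerivWithinAt R (R t ∘L hat (w t)) (Ici t) t) (h0 : R t₀ ∈ SO3) :
    ∀ t ∈ Icc t₀ T, R t ∈ SO3 := by
  have cadj : ContinuousOn (fun t => ContinuousLinearMap.adjoint (R t)) (Icc t₀ T) :=
    adjL.continuous.comp_continuousOn hR
  have hhat : ContinuousOn (fun t => hat (w t)) (Icc t₀ T) := by
    simp only [hat_eq]; exact crossL.continuous.comp_continuousOn hw
  have h1 : ∀ t ∈ Icc t₀ T, ContinuousLinearMap.adjoint (R t) ∘L R t - 1 = 0 := by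
    refine eq_zero_of_norm_deriv_le (α := fun t => 2 * ‖hat (w t)‖)
      ((cadj.clm_comp hR).sub continuousOn_const) (hhat.norm.const_mul 2)
      (fun t ht => ((((adjL.hasFDerivAt.comp_hasDerivWithinAt t (hR' t ht)).clm_comp
        (hR' t ht))).sub_const 1)) (fun t ht => ?_) (by rw [h0.1, sub_self])
    have h2 : (adjL (R t ∘L hat (w t))) ∘L R t + adjL (R t) ∘L (R t ∘L hat (w t)) =
        (ContinuousLinearMap.adjoint (R t) ∘L R t - 1) ∘L hat (w t)
        - hat (w t) ∘L (ContinuousLinearMap.adjoint (R t) ∘L R t - 1) := by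
      rw [adjL_apply, adjL_apply, ContinuousLinearMap.adjoint_comp, adjoint_hat]
      ext1 v
      simp only [add_apply, sub_apply, ContinuousLinearMap.comp_apply, neg_apply, map_sub, one_apply_e3]
      abel
    change ‖(adjL (R t ∘L hat (w t))) ∘L R t + adjL (R t) ∘L (R t ∘L hat (w t))‖ ≤ _
    rw [h2]
    refine (norm_sub_le _ _).trans ?_
    have e1 := ContinuousLinearMap.opNorm_comp_le
      (ContinuousLinearMap.adjoint (R t) ∘L R t - 1) (hat (w t))
    have e2 := ContinuousLinearMap.opNorm_comp_le (hat (w t))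
      (ContinuousLinearMap.adjoint (R t) ∘L R t - 1)
    linarith
  have horth : ∀ t ∈ Icc t₀ T, ContinuousLinearMap.adjoint (R t) ∘L R t = 1 := fun t ht =>
    sub_eq_zero.1 (h1 t ht)
  have hdet : ContinuousOn (fun t => (R t).det) (Icc t₀ T) := by
    simp only [det_e3]
    fun_prop
  intro t ht
  refine ⟨horth t ht, ?_⟩
  by_contra hne
  have hneg : (R t).det = -1 := by
    rcases eq_or_eq_neg_of_sq_eq_sq _ 1 ((det_sq_of_orth (horth t ht)).trans (one_pow 2).symm)
      with h | h
    · exact absurd h hne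
    · exact h
  have hsub : Icc t₀ t ⊆ Icc t₀ T := Icc_subset_Icc_right ht.2
  obtain ⟨s, hs, hs0⟩ := intermediate_value_Icc' ht.1 (hdet.mono hsub)
    (show (0 : ℝ) ∈ Icc _ _ by rw [h0.2, hneg]; norm_num)
  have := det_sq_of_orth (horth s (hsub hs))
  simp only at hs0
  rw [hs0] at this
  norm_num at this

theorem onManifold_of_solution {P : Params} {ref : Reference} {X : ℝ → Slow} {Z : ℝ → Fast}
    {ε t₀ T : ℝ} (hX : ContinuousOn X (Icc t₀ T)) (hZ : ContinuousOn Z (Icc t₀ T))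
    (hl : ∀ t ∈ Icc t₀ T, ∀ j, 0 < cableLength P ε (Z t) j)
    (hX' : ∀ t ∈ Ico t₀ T, HasDerivWithinAt X (f P ref t (X t) (Z t) ε) (Ici t) t)
    (h0 : (X t₀).OnManifold) : ∀ t ∈ Icc t₀ T, (X t).OnManifold := by
  have c1 := hX.fst
  have cm := c1.fst
  have cc := cm.fst
  have cr := cc.fst
  have cq : ContinuousOn (fun t => (X t).mech.rod.q) (Icc t₀ T) := cr.snd.snd.fst
  have cw : ContinuousOn (fun t => (X t).mech.rod.w) (Icc t₀ T) := cr.snd.snd.snd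
  have cqc : ∀ j, ContinuousOn (fun t => (X t).mech.qc j) (Icc t₀ T) := continuousOn_pi.1 cc.snd
  have cwc : ∀ j, ContinuousOn (fun t => (X t).mech.wc j) (Icc t₀ T) := continuousOn_pi.1 cm.snd
  have catt : ∀ j, ContinuousOn (fun t => (X t).att j) (Icc t₀ T) := continuousOn_pi.1 c1.snd
  have com : ∀ j, ContinuousOn (fun t => (X t).om j) (Icc t₀ T) := continuousOn_pi.1 hX.snd
  have dm : ∀ t ∈ Ico t₀ T, HasDerivWithinAt (fun t => (X t).mech)
      (mechField P (thrust P ref t (X t).mech (X t).att) ε (X t).mech (Z t)) (Ici t) t :=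
    fun t ht => hasDerivWithinAt_fst (hasDerivWithinAt_fst (hX' t ht))
  have dq : ∀ t ∈ Ico t₀ T, HasDerivWithinAt (fun t => (X t).mech.rod.q)
      ((X t).mech.rod.w ×ᵥ (X t).mech.rod.q) (Ici t) t := fun t ht =>
    hasDerivWithinAt_fst (hasDerivWithinAt_snd (hasDerivWithinAt_snd (hasDerivWithinAt_fst
      (hasDerivWithinAt_fst (dm t ht)))))
  have dw : ∀ t ∈ Ico t₀ T, HasDerivWithinAt (fun t => (X t).mech.rod.w)
      (rodAngAcc P (tension P (Z t)) (X t).mech) (Ici t) t := fun t ht =>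
    hasDerivWithinAt_snd (hasDerivWithinAt_snd (hasDerivWithinAt_snd (hasDerivWithinAt_fst
      (hasDerivWithinAt_fst (dm t ht)))))
  have dqc : ∀ j, ∀ t ∈ Ico t₀ T, HasDerivWithinAt (fun t => (X t).mech.qc j)
      ((X t).mech.wc j ×ᵥ (X t).mech.qc j) (Ici t) t := fun j t ht =>
    hasDerivWithinAt_pi.1 (hasDerivWithinAt_snd (hasDerivWithinAt_fst (dm t ht))) j
  have dwc : ∀ j, ∀ t ∈ Ico t₀ T, HasDerivWithinAt (fun t => (X t).mech.wc j)
      (cableAngAcc P (thrust P ref t (X t).mech (X t).att) ε (X t).mech (Z t) j) (Ici t) t :=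
    fun j t ht => hasDerivWithinAt_pi.1 (hasDerivWithinAt_snd (dm t ht)) j
  have datt : ∀ j, ∀ t ∈ Ico t₀ T, HasDerivWithinAt (fun t => (X t).att j)
      ((X t).att j ∘L hat ((X t).om j)) (Ici t) t := fun j t ht =>
    hasDerivWithinAt_pi.1 (hasDerivWithinAt_snd (hasDerivWithinAt_fst (hX' t ht))) j
  have hq := norm_eq_one_of_cross_deriv cq dq h0.1
  have hw := inner_eq_zero_of_cross_deriv (α := fun _ => 0) cq cw continuousOn_const dq dw
    (fun t _ => by
      simp only [rodAngAcc, inner_neg_left, real_inner_smul_left]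
      rw [real_inner_comm, inner_cross_self_left]; simp) h0.2.1
  have cZ : ∀ j, ContinuousOn (fun t => Z t j) (Icc t₀ T) := continuousOn_pi.1 hZ
  have hwc : ∀ j, ∀ t ∈ Icc t₀ T, inner ℝ ((X t).mech.wc j) ((X t).mech.qc j) = 0 := fun j => by
    refine inner_eq_zero_of_cross_deriv
      (α := fun t => -((cableLength P ε (Z t) j)⁻¹ * (2 * (ε * (Z t j).2)))) (cqc j) (cwc j) ?_
      (dqc j) (dwc j) (fun t _ => ?_) (h0.2.2 j).2.1
    · have h1 : ContinuousOn (fun t => cableLength P ε (Z t) j) (Icc t₀ T) :=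
        continuousOn_const.add ((cZ j).fst.const_mul _)
      exact ((h1.inv₀ fun t ht => (hl t ht j).ne').mul (((cZ j).snd.const_mul ε).const_mul 2)).neg
    · simp only [cableAngAcc, inner_sub_left, real_inner_smul_left]
      rw [real_inner_comm, inner_cross_self_left]; ring
  intro t ht
  exact ⟨hq t ht, hw t ht, fun j => ⟨norm_eq_one_of_cross_deriv (cqc j) (dqc j) (h0.2.2 j).1 t ht,
    hwc j t ht, mem_SO3_of_hat_deriv (catt j) (com j) (datt j) (h0.2.2 j).2.2 t ht⟩⟩

end RodTransport
end

noncomputable section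
namespace RodTransport

/-! ### Smoothness of the singularly perturbed system -/

/-- States near the trajectory `x`, with bounded fast state and small parameter. -/
def elasticSet (t₀ : ℝ) (x : ℝ → Slow) (ρ R ε₁ : ℝ) : Set (ℝ × (Slow × (Fast × ℝ))) :=
  {p | (p.1, p.2.1) ∈ tube t₀ x ρ ∧ ‖p.2.2.1‖ ≤ R ∧ 0 ≤ p.2.2.2 ∧ p.2.2.2 ≤ ε₁}

theorem segment_subset_elasticSet {t₀ ρ R ε₁ t : ℝ} {x : ℝ → Slow} {u v : Slow × (Fast × ℝ)}
    (hu : (t, u) ∈ elasticSet t₀ x ρ R ε₁) (hv : (t, v) ∈ elasticSet t₀ x ρ R ε₁) :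
    segment ℝ (t, u) (t, v) ⊆ elasticSet t₀ x ρ R ε₁ := by
  rintro p ⟨a, b, ha, hb, hab, rfl⟩
  obtain ⟨h1, h2, h3, h4⟩ := hu
  obtain ⟨k1, k2, k3, k4⟩ := hv
  have ht : a • t + b • t = t := by rw [← add_smul, hab, one_smul]
  refine ⟨?_, ?_, ?_, ?_⟩
  · exact segment_subset_tube h1 k1 ⟨a, b, ha, hb, hab, rfl⟩
  · have := convex_closedBall (0 : Fast) R (mem_closedBall_zero_iff.2 h2)
      (mem_closedBall_zero_iff.2 k2) ha hb hab
    exact mem_closedBall_zero_iff.1 this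
  · exact add_nonneg (mul_nonneg ha h3) (mul_nonneg hb k3)
  · exact (convex_Iic ε₁ h4 k4 ha hb hab : _ ∈ Iic ε₁)

theorem BddDerivOn.exists_lipschitz_elasticSet {F : Type*} [NormedAddCommGroup F] [NormedSpace ℝ F]
    {φ : ℝ × (Slow × (Fast × ℝ)) → F} {t₀ ρ R ε₁ : ℝ} {x : ℝ → Slow}
    (h : BddDerivOn φ (elasticSet t₀ x ρ R ε₁)) : ∃ L, 0 ≤ L ∧ ∀ t u v,
      (t, u) ∈ elasticSet t₀ x ρ R ε₁ → (t, v) ∈ elasticSet t₀ x ρ R ε₁ →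
      ‖φ (t, u) - φ (t, v)‖ ≤ L * ‖u - v‖ := by
  obtain ⟨L, hL, hl⟩ := h.exists_lipschitz
  refine ⟨L, hL, fun t u v hu hv => (hl _ _ (segment_subset_elasticSet hu hv)).trans (le_of_eq ?_)⟩
  rw [Prod.mk_sub_mk, sub_self, Prod.norm_mk, norm_zero, max_eq_right (norm_nonneg _)]

theorem half_le_cableLength {P : Params} {R ε₁ ε : ℝ} {w : Fast} (hR : ε₁ ^ 2 * R ≤ P.Lc / 2)
    (hw : ‖w‖ ≤ R) (hε : 0 ≤ ε) (hε₁ : ε ≤ ε₁) (j : Fin 2) :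
    P.Lc / 2 ≤ cableLength P ε w j := by
  have h1 : |(w j).1| ≤ R := ((norm_fst_le (w j)).trans (norm_le_pi_norm w j)).trans hw
  have h2 : ε ^ 2 * |(w j).1| ≤ ε₁ ^ 2 * R := by gcongr
  have h3 := mul_le_mul_of_nonneg_left (neg_abs_le (w j).1) (sq_nonneg ε)
  rw [cableLength]
  linarith

section

variable {E : Type*} [NormedAddCommGroup E] [NormedSpace ℝ E]

theorem MechSmooth.comp {F : Type*} [NormedAddCommGroup F] [NormedSpace ℝ F] {s : F → Mech}
    {S : Set E} {S' : Set F} (hs : MechSmooth s S') {φ : E → F} (hφ : BddDerivOn φ S)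
    (hm : ∀ p ∈ S, φ p ∈ S') : MechSmooth (fun p => s (φ p)) S :=
  ⟨hs.v.comp hφ hm, hs.q.comp hφ hm, hs.w.comp hφ hm, fun j => (hs.qc j).comp hφ hm,
    fun j => (hs.wc j).comp hφ hm⟩

end

attribute [local irreducible] thrust moment

namespace GoodTube

variable {P : Params} {ref : Reference} {t₀ ρ : ℝ} {x : ℝ → Slow} (hG : GoodTube P ref t₀ x ρ)
  (R ε₁ : ℝ)
include hG

theorem elastic_pull {F : Type*} [NormedAddCommGroup F] [NormedSpace ℝ F] {φ : ℝ × Slow → F}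
    (h : BddSmoothOn φ (tube t₀ x ρ)) :
    BddSmoothOn (fun p : ℝ × (Slow × (Fast × ℝ)) => φ (p.1, p.2.1)) (elasticSet t₀ x ρ R ε₁) :=
  h.comp (bddDerivOn_clm (prFst Slow (Fast × ℝ)) _) fun _ hp => hp.1

theorem elastic_mechSmooth : MechSmooth (fun p : ℝ × (Slow × (Fast × ℝ)) => p.2.1.mech)
    (elasticSet t₀ x ρ R ε₁) :=
  hG.mechSmooth.comp (bddDerivOn_clm (prFst Slow (Fast × ℝ)) _) fun _ hp => hp.1

omit hG in
theorem elastic_fast : BddSmoothOn (fun p : ℝ × (Slow × (Fast × ℝ)) => p.2.2.1)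
    (elasticSet t₀ x ρ R ε₁) :=
  ⟨bddDerivOn_clm (ContinuousLinearMap.fst ℝ Fast ℝ ∘L ContinuousLinearMap.snd ℝ Slow (Fast × ℝ) ∘L
    ContinuousLinearMap.snd ℝ ℝ (Slow × (Fast × ℝ))) _, R, fun _ hp => hp.2.1⟩

omit hG in
theorem elastic_eps : BddSmoothOn (fun p : ℝ × (Slow × (Fast × ℝ)) => p.2.2.2)
    (elasticSet t₀ x ρ R ε₁) :=
  ⟨bddDerivOn_clm (ContinuousLinearMap.snd ℝ Fast ℝ ∘L ContinuousLinearMap.snd ℝ Slow (Fast × ℝ) ∘L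
    ContinuousLinearMap.snd ℝ ℝ (Slow × (Fast × ℝ))) _, ε₁, fun _ hp => by
      rw [Real.norm_of_nonneg hp.2.2.1]; exact hp.2.2.2⟩

theorem elastic_thrust (j : Fin 2) : BddSmoothOn (fun p : ℝ × (Slow × (Fast × ℝ)) =>
    RodTransport.thrust P ref p.1 p.2.1.mech p.2.1.att j) (elasticSet t₀ x ρ R ε₁) :=
  hG.elastic_pull R ε₁ (hG.thrust j)

theorem g_smooth : BddSmoothOn (fun p : ℝ × (Slow × (Fast × ℝ)) =>
    g P ref p.1 p.2.1 p.2.2.1 p.2.2.2) (elasticSet t₀ x ρ R ε₁) :=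
  (hG.elastic_mechSmooth R ε₁).fastMech P (hG.elastic_thrust R ε₁) (elastic_eps R ε₁)
    (elastic_fast R ε₁)

theorem f_smooth (hR : ε₁ ^ 2 * R ≤ P.Lc / 2) : BddSmoothOn (fun p : ℝ × (Slow × (Fast × ℝ)) =>
    f P ref p.1 p.2.1 p.2.2.1 p.2.2.2) (elasticSet t₀ x ρ R ε₁) := by
  have h1 : BddSmoothOn (fun p : ℝ × (Slow × (Fast × ℝ)) =>
      mechField P (RodTransport.thrust P ref p.1 p.2.1.mech p.2.1.att) p.2.2.2 p.2.1.mech p.2.2.1)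
      (elasticSet t₀ x ρ R ε₁) :=
    (hG.elastic_mechSmooth R ε₁).mechField P (hG.elastic_thrust R ε₁) (elastic_eps R ε₁)
      (elastic_fast R ε₁) (half_pos P.Lc_pos)
      fun j p hp => half_le_cableLength hR hp.2.1 hp.2.2.1 hp.2.2.2 j
  have hatt := fun j => hG.elastic_pull R ε₁ (hG.att j)
  have hom := fun j => hG.elastic_pull R ε₁ (hG.om j)
  have hmom := fun j => hG.elastic_pull R ε₁ (hG.moment j)
  have h2 : BddSmoothOn (fun p : ℝ × (Slow × (Fast × ℝ)) =>
      fun j => p.2.1.att j ∘L hat (p.2.1.om j)) (elasticSet t₀ x ρ R ε₁) :=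
    bddSmoothOn_pi2 fun j => (hatt j).clm_mul (hom j).hat
  have h3 : BddSmoothOn (fun p : ℝ × (Slow × (Fast × ℝ)) => fun j => Jinv P (J P (p.2.1.om j) ×ᵥ
      p.2.1.om j + RodTransport.moment P ref j p.1 p.2.1)) (elasticSet t₀ x ρ R ε₁) :=
    bddSmoothOn_pi2 fun j => by
      have h4 : BddSmoothOn (fun p : ℝ × (Slow × (Fast × ℝ)) => J P (p.2.1.om j))
        (elasticSet t₀ x ρ R ε₁) := (hom j).clm_comp (J P)
      have h5 : BddSmoothOn (fun p : ℝ × (Slow × (Fast × ℝ)) => J P (p.2.1.om j) ×ᵥ p.2.1.om j)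
        (elasticSet t₀ x ρ R ε₁) := h4.cross (hom j)
      have h6 : BddSmoothOn (fun p : ℝ × (Slow × (Fast × ℝ)) => J P (p.2.1.om j) ×ᵥ p.2.1.om j
        + RodTransport.moment P ref j p.1 p.2.1) (elasticSet t₀ x ρ R ε₁) := h5.add (hmom j)
      exact h6.clm_comp (Jinv P)
  exact (h1.prodMk h2).prodMk h3

end GoodTube

/-! ### The structure of the fast equations -/

/-- The elongations of the cables. -/
def fastPos : Fast →L[ℝ] EuclideanSpace ℝ (Fin 2) :=
  LinearMap.toContinuousLinearMap
    { toFun := fun w => WithLp.toLp 2 fun j => (w j).1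
      map_add' := fun _ _ => rfl
      map_smul' := fun _ _ => rfl }

/-- The rates of elongation of the cables. -/
def fastVel : Fast →L[ℝ] EuclideanSpace ℝ (Fin 2) :=
  LinearMap.toContinuousLinearMap
    { toFun := fun w => WithLp.toLp 2 fun j => (w j).2
      map_add' := fun _ _ => rfl
      map_smul' := fun _ _ => rfl }

theorem fastVel_apply (w : Fast) (j : Fin 2) : fastVel w j = (w j).2 := rfl

theorem norm_fast_le (w : Fast) : ‖w‖ ≤ ‖fastPos w‖ + ‖fastVel w‖ := by
  refine (pi_norm_le_iff_of_nonneg (by positivity)).2 fun j => ?_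
  refine max_le ?_ ?_
  · exact (PiLp.norm_apply_le (fastPos w) j).trans (le_add_of_nonneg_right (norm_nonneg _))
  · exact (PiLp.norm_apply_le (fastVel w) j).trans (le_add_of_nonneg_left (norm_nonneg _))

/-- The tension matrix as an operator. -/
def tensionOp (P : Params) (s : Mech) : EuclideanSpace ℝ (Fin 2) →L[ℝ] EuclideanSpace ℝ (Fin 2) :=
  Matrix.toEuclideanCLM (n := Fin 2) (𝕜 := ℝ) (tensionMatrix P s)

theorem tensionOp_apply (P : Params) (s : Mech) (v : EuclideanSpace ℝ (Fin 2)) (j : Fin 2) :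
    tensionOp P s v j = (tensionMatrix P s).mulVec v j := by
  rw [tensionOp, Matrix.ofLp_toEuclideanCLM]

theorem tensionOp_eq (P : Params) (s : Mech) : tensionOp P s =
    tensionMatrix P s 0 0 • Matrix.toEuclideanCLM (n := Fin 2) (𝕜 := ℝ) !![1, 0; 0, 0]
    + tensionMatrix P s 0 1 • Matrix.toEuclideanCLM (n := Fin 2) (𝕜 := ℝ) !![0, 1; 0, 0]
    + tensionMatrix P s 1 0 • Matrix.toEuclideanCLM (n := Fin 2) (𝕜 := ℝ) !![0, 0; 1, 0]
    + tensionMatrix P s 1 1 • Matrix.toEuclideanCLM (n := Fin 2) (𝕜 := ℝ) !![0, 0; 0, 1] := by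
  ext v i
  simp only [add_apply, smul_apply, PiLp.add_apply, PiLp.smul_apply, tensionOp_apply,
    Matrix.ofLp_toEuclideanCLM]
  fin_cases i <;> simp [Matrix.mulVec, dotProduct, Fin.sum_univ_two]

theorem inner_fin_two (u v : EuclideanSpace ℝ (Fin 2)) : inner ℝ u v = u 0 * v 0 + u 1 * v 1 := by
  simp [PiLp.inner_apply, Fin.sum_univ_two]; ring

theorem tensionOp_symm (P : Params) (s : Mech) (u v : EuclideanSpace ℝ (Fin 2)) :
    inner ℝ (tensionOp P s u) v = inner ℝ u (tensionOp P s v) := by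
  have h : tensionMatrix P s 0 1 = tensionMatrix P s 1 0 := by
    simp only [tensionMatrix, Matrix.of_apply, Fin.isValue, zero_ne_one, one_ne_zero, if_false]
    rw [real_inner_comm, real_inner_comm (s.rod.q ×ᵥ s.qc 1), mul_comm (sgn 0)]
  simp only [inner_fin_two, Fin.sum_univ_two, tensionOp_apply, Matrix.mulVec, dotProduct, h]
  ring

theorem le_inner_tensionOp (P : Params) (s : Mech) (u : EuclideanSpace ℝ (Fin 2)) :
    P.mQ⁻¹ * ‖u‖ ^ 2 ≤ inner ℝ u (tensionOp P s u) := by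
  have hm := P.mr_pos
  have h : inner ℝ u (tensionOp P s u) = P.mQ⁻¹ * ‖u‖ ^ 2
      + P.mr⁻¹ * ‖u 0 • s.qc 0 + u 1 • s.qc 1‖ ^ 2
      + (2 / 3 * P.mr)⁻¹ * ‖u 1 • (s.rod.q ×ᵥ s.qc 1) - u 0 • (s.rod.q ×ᵥ s.qc 0)‖ ^ 2 := by
    rw [← real_inner_self_eq_norm_sq u]
    simp only [inner_fin_two, Fin.sum_univ_two, tensionOp_apply, Matrix.mulVec, dotProduct,
      tensionMatrix, Matrix.of_apply, inner_e3, normsq_e3]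
    simp [sgn]
    ring
  rw [h]
  have : 0 ≤ P.mr⁻¹ * ‖u 0 • s.qc 0 + u 1 • s.qc 1‖ ^ 2 := by positivity
  have : 0 ≤ (2 / 3 * P.mr)⁻¹ * ‖u 1 • (s.rod.q ×ᵥ s.qc 1) - u 0 • (s.rod.q ×ᵥ s.qc 0)‖ ^ 2 := by
    positivity
  linarith

theorem MechSmooth.tensionOp {E : Type*} [NormedAddCommGroup E] [NormedSpace ℝ E] {S : Set E}
    {s : E → Mech} (P : Params) (hs : MechSmooth s S) :
    BddSmoothOn (fun p => tensionOp P (s p)) S := by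
  simp only [tensionOp_eq]
  have h := hs.tensionMatrix P
  exact ((((h 0 0).smul (bddSmoothOn_const _ _)).add ((h 0 1).smul (bddSmoothOn_const _ _))).add
    ((h 1 0).smul (bddSmoothOn_const _ _))).add ((h 1 1).smul (bddSmoothOn_const _ _))

theorem fastPos_g (P : Params) (ref : Reference) (t ε : ℝ) (X : Slow) (w : Fast) :
    fastPos (g P ref t X w ε) = fastVel w := rfl

theorem fastVel_h (P : Params) (ref : Reference) (t : ℝ) (X : Slow) :
    fastVel (h P ref t X) = 0 := rfl

theorem fastVel_g_zero (P : Params) (ref : Reference) (t : ℝ) (X : Slow) (w : Fast) :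
    fastVel (g P ref t X w 0) = -(tensionOp P X.mech
      (P.kbar • fastPos (w - h P ref t X) + P.cbar • fastVel (w - h P ref t X))) := by
  have h0 : g P ref t X (h P ref t X) 0 = 0 := (fastMech_eq_zero_iff P _ _ _).2 rfl
  have key : ∀ w, fastVel (g P ref t X w 0) =
      WithLp.toLp 2 (fun j => P.Lc * ‖X.mech.wc j‖ ^ 2 + inner ℝ (X.mech.qc j)
        (endAcc P 0 X.mech j - P.mQ⁻¹ • thrust P ref t X.mech X.att j))
      - tensionOp P X.mech (P.kbar • fastPos w + P.cbar • fastVel w) := fun w => by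
    ext j
    rw [PiLp.sub_apply, tensionOp_apply, fastVel_apply]
    simp only [g, fastMech, cableLength]
    rw [add_sub_assoc, residual_eq]
    have : (P.kbar • fastPos w + P.cbar • fastVel w).ofLp = tension P w := rfl
    rw [this]
    ring
  have e1 := key w
  have e2 := key (h P ref t X)
  rw [h0, map_zero] at e2
  rw [e1, map_sub, map_sub]
  have e3 : P.kbar • (fastPos w - fastPos (h P ref t X)) + P.cbar • (fastVel w - fastVel (h P ref t X))
      = (P.kbar • fastPos w + P.cbar • fastVel w)
        - (P.kbar • fastPos (h P ref t X) + P.cbar • fastVel (h P ref t X)) := by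
    simp only [smul_sub]; abel
  rw [e3, map_sub, ← sub_eq_zero.1 e2.symm]
  abel

end RodTransport
end

noncomputable section
namespace RodTransport

/-! ### The boundary layer -/

section

variable {E F : Type*} [NormedAddCommGroup E] [NormedSpace ℝ E] [NormedAddCommGroup F]
  [NormedSpace ℝ F]

theorem BddDerivOn.exists_deriv_bound {φ : ℝ × E → F} {S : Set (ℝ × E)} (h : BddDerivOn φ S) :
    ∃ D, 0 ≤ D ∧ ∀ p ∈ S, ∀ v : E, ‖_root_.fderiv ℝ φ p (1, v)‖ ≤ D * (1 + ‖v‖) := by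
  obtain ⟨D, hD⟩ := h.fderiv.bdd_val
  refine ⟨max D 0, le_max_right _ _, fun p hp v => ?_⟩
  refine (ContinuousLinearMap.le_of_opNorm_le _ ((hD p hp).trans (le_max_left D 0)) _).trans ?_
  gcongr
  rw [Prod.norm_mk, norm_one]
  exact max_le (by linarith [norm_nonneg v]) (by linarith)

theorem BddDerivOn.hasDerivWithinAt_along {φ : ℝ × E → F} {S : Set (ℝ × E)} (h : BddDerivOn φ S)
    {X : ℝ → E} {v : E} {I : Set ℝ} {t : ℝ} (ht : (t, X t) ∈ S) (hX : HasDerivWithinAt X v I t) :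
    HasDerivWithinAt (fun t => φ (t, X t)) (_root_.fderiv ℝ φ (t, X t) (1, v)) I t :=
  (h.differentiableAt ht).hasFDerivAt.comp_hasDerivWithinAt t
    ((hasDerivWithinAt_id t I).prodMk hX)

theorem BddDerivOn.continuousOn_along {φ : ℝ × E → F} {S : Set (ℝ × E)} (h : BddDerivOn φ S)
    {X : ℝ → E} {I : Set ℝ} (hI : ∀ t ∈ I, (t, X t) ∈ S) (hX : ContinuousOn X I) :
    ContinuousOn (fun t => φ (t, X t)) I := fun t ht =>
  ContinuousAt.comp_continuousWithinAt (f := fun t => (t, X t))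
    (h.differentiableAt (hI t ht)).continuousAt
    (continuousWithinAt_id.prodMk (hX t ht))

theorem norm_sub_last (u : E) (v : F) (a b : ℝ) :
    ‖((u, (v, a)) : E × (F × ℝ)) - (u, (v, b))‖ = |a - b| := by
  simp [Prod.norm_def]

end

theorem mul_exp_neg_mul_le {γ s : ℝ} (hγ : 0 < γ) : s * Real.exp (-γ * s) ≤ 1 / γ := by
  have h1 := Real.add_one_le_exp (γ * s)
  have h2 : γ * s * Real.exp (-γ * s) ≤ 1 := by
    calc γ * s * Real.exp (-γ * s) ≤ Real.exp (γ * s) * Real.exp (-γ * s) := by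
          gcongr; linarith
      _ = 1 := by rw [← Real.exp_add]; simp
  rw [le_div_iff₀ hγ]
  linarith

theorem hasDerivWithinAt_rescaled {r : ℝ → Fast} {d : Fast} {ε t₀ t : ℝ} (hε : 0 < ε)
    (ht : t₀ ≤ t) (h : HasDerivWithinAt r d (Ici 0) ((t - t₀) / ε)) :
    HasDerivWithinAt (fun t => r ((t - t₀) / ε)) (ε⁻¹ • d) (Ici t) t := by
  have h1 : HasDerivWithinAt (fun t => (t - t₀) / ε) (1 / ε) (Ici t) t :=
    (((hasDerivAt_id t).sub_const t₀).div_const ε).hasDerivWithinAt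
  rw [← one_div]
  exact h.scomp t h1 fun s hs => div_nonneg (by linarith [mem_Ici.1 hs]) hε.le

theorem fastPos_deriv_eq (P : Params) (ref : Reference) {t t₀ ε : ℝ} (hε : ε ≠ 0) (X x₀ : Slow)
    (Z H r : Fast) :
    fastPos (ε⁻¹ • g P ref t X Z ε - H - ε⁻¹ • g P ref t₀ x₀ (r + h P ref t₀ x₀) 0) =
      ε⁻¹ • (fastVel (Z - h P ref t X - r) + -(ε • fastPos H)) := by
  rw [map_sub, map_sub, map_smul, map_smul, fastPos_g, fastPos_g, map_sub, map_sub,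
    map_add, fastVel_h, fastVel_h, add_zero, sub_zero, smul_add, smul_neg, smul_smul,
    inv_mul_cancel₀ hε, one_smul, smul_sub]
  abel

theorem fastVel_deriv_eq (P : Params) (ref : Reference) {t t₀ ε : ℝ} (hε : ε ≠ 0) (X x₀ : Slow)
    (Z H r : Fast) :
    fastVel (ε⁻¹ • g P ref t X Z ε - H - ε⁻¹ • g P ref t₀ x₀ (r + h P ref t₀ x₀) 0) =
      ε⁻¹ • (-tensionOp P X.mech (P.kbar • fastPos (Z - h P ref t X - r)
          + P.cbar • fastVel (Z - h P ref t X - r))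
        + (fastVel (g P ref t X Z ε - g P ref t X Z 0) - ε • fastVel H
          - (tensionOp P X.mech - tensionOp P x₀.mech) (P.kbar • fastPos r + P.cbar • fastVel r))) := by
  have e1 := fastVel_g_zero P ref t₀ x₀ (r + h P ref t₀ x₀)
  rw [add_sub_cancel_right] at e1
  have e2 := fastVel_g_zero P ref t X Z
  have e3 : Z - h P ref t X = (Z - h P ref t X - r) + r := (sub_add_cancel _ _).symm
  rw [e3] at e2
  generalize Z - h P ref t X - r = d at *
  rw [eq_inv_smul_iff₀ hε, map_sub, map_sub, map_smul, map_smul, smul_sub, smul_sub,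
    smul_inv_smul₀ hε, smul_inv_smul₀ hε, e1, map_sub, e2]
  simp only [map_add, map_smul, smul_add, smul_sub, sub_apply]
  abel

theorem layer_perturbation_le {D γ ε σ LM N C₂ : ℝ} (hγ : 0 < γ) (hε : 0 < ε) (hD : 0 ≤ D)
    (hLM : 0 ≤ LM) (hC₂ : 0 ≤ C₂) (hN : 0 ≤ N) (hσ : 0 ≤ σ) :
    (D * (ε * σ) + LM * C₂ * ε) * (N * Real.exp (-γ * σ)) ≤ (D / γ + LM * C₂) * N * ε := by
  have e1 : Real.exp (-γ * σ) ≤ 1 := by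
    rw [Real.exp_le_one_iff]
    nlinarith
  have e2 := mul_exp_neg_mul_le (s := σ) hγ
  generalize Real.exp (-γ * σ) = z at *
  have e5 : D * N * ε * (σ * z) ≤ D * N * ε * (1 / γ) :=
    mul_le_mul_of_nonneg_left e2 (by positivity)
  have e6 : LM * C₂ * ε * N * z ≤ LM * C₂ * ε * N * 1 :=
    mul_le_mul_of_nonneg_left e1 (by positivity)
  calc (D * (ε * σ) + LM * C₂ * ε) * (N * z)
      = D * N * ε * (σ * z) + LM * C₂ * ε * N * z := by ring
    _ ≤ D * N * ε * (1 / γ) + LM * C₂ * ε * N * 1 := add_le_add e5 e6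
    _ = _ := by ring

attribute [local irreducible] g f h tensionOp

namespace GoodTube

variable {P : Params} {ref : Reference} {t₀ ρ : ℝ} {x : ℝ → Slow} (hG : GoodTube P ref t₀ x ρ)
include hG

theorem tensionOp_smooth :
    BddSmoothOn (fun p : ℝ × Slow => tensionOp P p.2.mech) (tube t₀ x ρ) := hG.mechSmooth.tensionOp P

theorem center_mem {t : ℝ} (ht : t₀ ≤ t) : (t, x t) ∈ tube t₀ x ρ :=
  center_mem_tube hG.pos.le ht

theorem exists_along_bounds {R ε₀ : ℝ} (hε₀ : 0 < ε₀) (hε₀R : ε₀ ^ 2 * R ≤ P.Lc / 2) :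
    ∃ C, 0 ≤ C ∧ ∀ (ε T : ℝ) (X : ℝ → Slow) (Z : ℝ → Fast), 0 < ε → ε ≤ ε₀ →
      ContinuousOn X (Icc t₀ T) →
      (∀ t ∈ Icc t₀ T, (t, X t) ∈ tube t₀ x ρ) → (∀ t ∈ Icc t₀ T, ‖Z t‖ ≤ R) →
      (∀ t ∈ Ico t₀ T, HasDerivWithinAt X (f P ref t (X t) (Z t) ε) (Ici t) t) →
      ∃ (H : ℝ → Fast) (M' : ℝ → EuclideanSpace ℝ (Fin 2) →L[ℝ] EuclideanSpace ℝ (Fin 2)),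
        ContinuousOn (fun t => RodTransport.h P ref t (X t)) (Icc t₀ T) ∧
        ContinuousOn (fun t => tensionOp P (X t).mech) (Icc t₀ T) ∧
        (∀ t ∈ Ico t₀ T, HasDerivWithinAt (fun t => RodTransport.h P ref t (X t)) (H t) (Ici t) t ∧
          HasDerivWithinAt (fun t => tensionOp P (X t).mech) (M' t) (Ici t) t ∧
          ‖H t‖ ≤ C ∧ ‖M' t‖ ≤ C) ∧
        ∀ t ∈ Icc t₀ T, ‖tensionOp P (X t).mech‖ ≤ C ∧
          ‖g P ref t (X t) (Z t) ε - g P ref t (X t) (Z t) 0‖ ≤ C * ε ∧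
          ‖RodTransport.h P ref t (X t) - RodTransport.h P ref t (x t)‖ ≤ C * ‖X t - x t‖ ∧
          ‖tensionOp P (X t).mech - tensionOp P (x t).mech‖ ≤ C * ‖X t - x t‖ := by
  obtain ⟨Lg, hLg, hgL⟩ := (hG.g_smooth R ε₀).toBddDerivOn.exists_lipschitz_elasticSet
  obtain ⟨Cf, hfC⟩ := (hG.f_smooth R ε₀ hε₀R).bdd_val
  obtain ⟨Dh, hDh, hhD⟩ := hG.root.toBddDerivOn.exists_deriv_bound
  obtain ⟨Lh, hLh, hhL⟩ := hG.root.toBddDerivOn.exists_lipschitz_tube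
  obtain ⟨DM, hDM, hMD⟩ := hG.tensionOp_smooth.toBddDerivOn.exists_deriv_bound
  obtain ⟨LM, hLM, hML⟩ := hG.tensionOp_smooth.toBddDerivOn.exists_lipschitz_tube
  obtain ⟨B, hB⟩ := hG.tensionOp_smooth.bdd_val
  obtain ⟨C, hC0, h1, h2, h3, h4, h5, h6⟩ : ∃ C : ℝ, 0 ≤ C ∧ Lg ≤ C ∧ Dh * (1 + |Cf|) ≤ C ∧ Lh ≤ C ∧
      DM * (1 + |Cf|) ≤ C ∧ LM ≤ C ∧ |B| ≤ C := by
    have a1 : 0 ≤ Dh * (1 + |Cf|) := by positivity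
    have a2 : 0 ≤ DM * (1 + |Cf|) := by positivity
    have a3 := abs_nonneg B
    exact ⟨Lg + Dh * (1 + |Cf|) + Lh + DM * (1 + |Cf|) + LM + |B|, by positivity, by linarith,
      by linarith, by linarith, by linarith, by linarith, by linarith⟩
  refine ⟨C, hC0, fun ε T X Z hε hεε₀ cX hXt hZR dX => ?_⟩
  have hS : ∀ s ∈ Icc t₀ T, (s, (X s, (Z s, ε))) ∈ elasticSet t₀ x ρ R ε₀ := fun s hs =>
    ⟨hXt s hs, hZR s hs, hε.le, hεε₀⟩
  have hS0 : ∀ s ∈ Icc t₀ T, (s, (X s, (Z s, (0 : ℝ)))) ∈ elasticSet t₀ x ρ R ε₀ := fun s hs =>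
    ⟨hXt s hs, hZR s hs, le_rfl, hε₀.le⟩
  have hfb : ∀ s ∈ Icc t₀ T, ‖f P ref s (X s) (Z s) ε‖ ≤ |Cf| := fun s hs =>
    (hfC _ (hS s hs)).trans (le_abs_self _)
  refine ⟨fun t => _root_.fderiv ℝ (fun p : ℝ × Slow => RodTransport.h P ref p.1 p.2) (t, X t)
      (1, f P ref t (X t) (Z t) ε),
    fun t => _root_.fderiv ℝ (fun p : ℝ × Slow => tensionOp P p.2.mech) (t, X t)
      (1, f P ref t (X t) (Z t) ε), hG.root.toBddDerivOn.continuousOn_along hXt cX,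
    hG.tensionOp_smooth.toBddDerivOn.continuousOn_along hXt cX, fun t ht => ?_, fun t ht => ?_⟩
  · have ht' := Ico_subset_Icc_self ht
    refine ⟨hG.root.toBddDerivOn.hasDerivWithinAt_along (hXt t ht') (dX t ht),
      hG.tensionOp_smooth.toBddDerivOn.hasDerivWithinAt_along (hXt t ht') (dX t ht), ?_, ?_⟩
    · exact ((hhD _ (hXt t ht') _).trans (mul_le_mul_of_nonneg_left
        (add_le_add_right (hfb t ht') 1) hDh)).trans h2
    · exact ((hMD _ (hXt t ht') _).trans (mul_le_mul_of_nonneg_left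
        (add_le_add_right (hfb t ht') 1) hDM)).trans h4
  · have hx : (t, x t) ∈ tube t₀ x ρ := hG.center_mem ht.1
    refine ⟨((hB _ (hXt t ht)).trans (le_abs_self _)).trans h6, ?_,
      (hhL t _ _ (hXt t ht) hx).trans (mul_le_mul_of_nonneg_right h3 (norm_nonneg _)),
      (hML t _ _ (hXt t ht) hx).trans (mul_le_mul_of_nonneg_right h5 (norm_nonneg _))⟩
    have e2 := hgL t _ _ (hS t ht) (hS0 t ht)
    have e3 : ‖((X t, (Z t, ε)) : Slow × (Fast × ℝ)) - (X t, (Z t, 0))‖ = ε := by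
      rw [norm_sub_last, sub_zero, abs_of_pos hε]
    rw [e3] at e2
    exact e2.trans (mul_le_mul_of_nonneg_right h1 hε.le)

omit hG in
theorem norm_layer_tension_le {K γ τ : ℝ} {r : Fast} (hr : ‖r‖ ≤ K * Real.exp (-γ * τ)) :
    ‖P.kbar • fastPos r + P.cbar • fastVel r‖ ≤
      ((P.kbar * ‖fastPos‖ + P.cbar * ‖fastVel‖) * K) * Real.exp (-γ * τ) := by
  have hk := P.kbar_pos
  have hc := P.cbar_pos
  calc ‖P.kbar • fastPos r + P.cbar • fastVel r‖
      ≤ P.kbar * (‖fastPos‖ * ‖r‖) + P.cbar * (‖fastVel‖ * ‖r‖) := by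
        refine (norm_add_le _ _).trans ?_
        rw [norm_smul, norm_smul, Real.norm_of_nonneg hk.le, Real.norm_of_nonneg hc.le]
        exact add_le_add (mul_le_mul_of_nonneg_left (fastPos.le_opNorm r) hk.le)
          (mul_le_mul_of_nonneg_left (fastVel.le_opNorm r) hc.le)
    _ = (P.kbar * ‖fastPos‖ + P.cbar * ‖fastVel‖) * ‖r‖ := by ring
    _ ≤ (P.kbar * ‖fastPos‖ + P.cbar * ‖fastVel‖) * (K * Real.exp (-γ * τ)) :=
        mul_le_mul_of_nonneg_left hr (by positivity)
    _ = _ := by ring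

omit hG in
theorem norm_fastVel_perturbation_le {C C₂ N γ ε t : ℝ} (hC : 0 ≤ C) (hC₂ : 0 ≤ C₂) (hN : 0 ≤ N)
    (hγ : 0 < γ) (hε : 0 < ε) (ht : t₀ ≤ t) {G H : Fast}
    {A : EuclideanSpace ℝ (Fin 2) →L[ℝ] EuclideanSpace ℝ (Fin 2)} {w : EuclideanSpace ℝ (Fin 2)}
    (hGC : ‖G‖ ≤ C * ε) (hH : ‖H‖ ≤ C) (hA : ‖A‖ ≤ C * (t - t₀) + C * C₂ * ε)
    (hw : ‖w‖ ≤ N * Real.exp (-γ * ((t - t₀) / ε))) :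
    ‖fastVel G - ε • fastVel H - A w‖ ≤
      (2 * ‖fastVel‖ * C + (C / γ + C * C₂) * N) * ε := by
  have h1 : ‖fastVel G‖ ≤ ‖fastVel‖ * (C * ε) :=
    (fastVel.le_opNorm G).trans (mul_le_mul_of_nonneg_left hGC (norm_nonneg _))
  have h2 : ‖ε • fastVel H‖ ≤ ε * (‖fastVel‖ * C) := by
    rw [norm_smul, Real.norm_of_nonneg hε.le]
    exact mul_le_mul_of_nonneg_left
      ((fastVel.le_opNorm H).trans (mul_le_mul_of_nonneg_left hH (norm_nonneg _))) hε.le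
  have h3 : ‖A w‖ ≤ (C / γ + C * C₂) * N * ε := by
    have e0 : 0 ≤ C * (t - t₀) + C * C₂ * ε := (norm_nonneg _).trans hA
    have e4 : t - t₀ = ε * ((t - t₀) / ε) := (mul_div_cancel₀ _ hε.ne').symm
    have e5 := layer_perturbation_le (σ := (t - t₀) / ε) hγ hε hC hC hC₂ hN
      (div_nonneg (by linarith) hε.le)
    rw [← e4] at e5
    exact ((A.le_of_opNorm_le hA w).trans (mul_le_mul_of_nonneg_left hw e0)).trans e5
  have h4 := (norm_sub_le (fastVel G - ε • fastVel H) (A w)).trans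
    (add_le_add ((norm_sub_le _ _).trans (add_le_add h1 h2)) h3)
  linarith

/-- Along solutions, the fast state stays close to the quasi-steady state plus the boundary layer
term. -/
theorem exists_fast_bound {R K γ C₂ ε₀ : ℝ} (hγ : 0 < γ) (hC₂ : 0 ≤ C₂) (hε₀ : 0 < ε₀)
    (hε₀R : ε₀ ^ 2 * R ≤ P.Lc / 2) {r : ℝ → Fast}
    (hr : IsBoundaryLayerTrajectory P ref t₀ (x t₀) r)
    (hrK : ∀ τ, 0 ≤ τ → ‖r τ‖ ≤ K * Real.exp (-γ * τ)) :
    ∃ ε₁ C, 0 < ε₁ ∧ 0 ≤ C ∧ ∀ (ε T : ℝ) (X : ℝ → Slow) (Z : ℝ → Fast), 0 < ε → ε < ε₁ →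
      ContinuousOn X (Icc t₀ T) → ContinuousOn Z (Icc t₀ T) →
      (∀ t ∈ Icc t₀ T, (t, X t) ∈ tube t₀ x ρ) → (∀ t ∈ Icc t₀ T, ‖Z t‖ ≤ R) →
      (∀ t ∈ Ico t₀ T, HasDerivWithinAt X (f P ref t (X t) (Z t) ε) (Ici t) t) →
      (∀ t ∈ Ico t₀ T, HasDerivWithinAt Z (ε⁻¹ • g P ref t (X t) (Z t) ε) (Ici t) t) →
      ‖X t₀ - x t₀‖ ≤ C₂ * ε → ‖Z t₀ - RodTransport.h P ref t₀ (x t₀) - r 0‖ ≤ C₂ * ε →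
      ∀ t ∈ Icc t₀ T, ‖Z t - RodTransport.h P ref t (X t) - r ((t - t₀) / ε)‖ ≤ C * ε := by
  obtain ⟨C, hC, hCX⟩ := hG.exists_along_bounds hε₀ hε₀R
  have hk := P.kbar_pos
  have hc := P.cbar_pos
  have hQ : 0 < P.mQ⁻¹ := inv_pos.2 P.mQ_pos
  have hK : 0 ≤ K := by
    have := (norm_nonneg _).trans (hrK 0 le_rfl)
    simpa using this
  have np0 := norm_nonneg fastPos
  have nv0 := norm_nonneg fastVel
  obtain ⟨N, hN⟩ : ∃ N, N = (P.kbar * ‖fastPos‖ + P.cbar * ‖fastVel‖) * K := ⟨_, rfl⟩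
  have hN0 : 0 ≤ N := by rw [hN]; positivity
  obtain ⟨C₁, hC₁, hC₁p, hC₁q⟩ : ∃ C₁, 0 ≤ C₁ ∧ ‖fastPos‖ * C ≤ C₁ ∧
      2 * ‖fastVel‖ * C + (C / γ + C * C₂) * N ≤ C₁ := by
    have h1 : 0 ≤ ‖fastPos‖ * C := by positivity
    have h2 : 0 ≤ 2 * ‖fastVel‖ * C + (C / γ + C * C₂) * N := by positivity
    exact ⟨‖fastPos‖ * C + (2 * ‖fastVel‖ * C + (C / γ + C * C₂) * N), by positivity, by linarith,
      by linarith⟩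
  obtain ⟨C₃, hC₃p, hC₃v⟩ : ∃ C₃, ‖fastPos‖ * (C₂ + C * C₂) ≤ C₃ ∧
      ‖fastVel‖ * (C₂ + C * C₂) ≤ C₃ := ⟨_, le_max_left _ _, le_max_right _ _⟩
  obtain ⟨ε₁, A, hε₁, hA, hosc⟩ := stiff_osc_bound (E := EuclideanSpace ℝ (Fin 2)) (k := P.kbar)
    (c := P.cbar) (μ := P.mQ⁻¹) (B := C) (D := C) (C₁ := C₁) (C₂ := C₃) hk hc hQ hC hC
  refine ⟨min ε₀ ε₁, A + A, lt_min hε₀ hε₁, add_nonneg hA hA, ?_⟩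
  intro ε T X Z hε hεlt cX cZ hXt hZR dX dZ hX0 hZ0 t ht
  obtain ⟨H, M', ch, cM, hd, hb⟩ := hCX ε T X Z hε (hεlt.trans_le (min_le_left _ _)).le cX hXt hZR dX
  clear hCX
  have hT : t₀ ≤ T := ht.1.trans ht.2
  have ht₀ : t₀ ∈ Icc t₀ T := left_mem_Icc.2 hT
  have hτ : ∀ s, t₀ ≤ s → 0 ≤ (s - t₀) / ε := fun s hs => div_nonneg (by linarith) hε.le
  have crr : ContinuousOn (fun s => r ((s - t₀) / ε)) (Icc t₀ T) := by
    have h1 : ContinuousOn r (Ici 0) := fun τ hτ => (hr τ hτ).continuousWithinAt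
    exact h1.comp (by fun_prop) fun s hs => hτ s hs.1
  obtain ⟨d, hdd⟩ : ∃ d : ℝ → Fast, d = fun s =>
    Z s - RodTransport.h P ref s (X s) - r ((s - t₀) / ε) := ⟨_, rfl⟩
  have cd : ContinuousOn d (Icc t₀ T) := by rw [hdd]; exact (cZ.sub ch).sub crr
  have dd : ∀ s ∈ Ico t₀ T, HasDerivWithinAt d (ε⁻¹ • g P ref s (X s) (Z s) ε - H s
      - ε⁻¹ • g P ref t₀ (x t₀) (r ((s - t₀) / ε) + RodTransport.h P ref t₀ (x t₀)) 0) (Ici s) s :=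
    fun s hs => by
      rw [hdd]
      exact ((dZ s hs).sub (hd s hs).1).sub (hasDerivWithinAt_rescaled hε hs.1 (hr _ (hτ s hs.1)))
  have hMdiff : ∀ s ∈ Icc t₀ T, ‖tensionOp P (X s).mech - tensionOp P (x t₀).mech‖ ≤
      C * (s - t₀) + C * C₂ * ε := fun s hs => by
    have h1 := norm_image_sub_le_of_norm_deriv_right_le_segment cM (fun s hs => (hd s hs).2.1)
      (fun s hs => (hd s hs).2.2.2) s hs
    have h2 := (hb t₀ ht₀).2.2.2.trans (mul_le_mul_of_nonneg_left hX0 hC)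
    calc ‖tensionOp P (X s).mech - tensionOp P (x t₀).mech‖
        = ‖(tensionOp P (X s).mech - tensionOp P (X t₀).mech)
          + (tensionOp P (X t₀).mech - tensionOp P (x t₀).mech)‖ := by rw [sub_add_sub_cancel]
      _ ≤ _ := (norm_add_le _ _).trans (by linarith)
  have da : ∀ s ∈ Ico t₀ T, HasDerivWithinAt (fun s => fastPos (d s))
      (ε⁻¹ • (fastVel (d s) + -(ε • fastPos (H s)))) (Ici s) s := fun s hs => by
    have h1 := fastPos.hasFDerivAt.comp_hasDerivWithinAt s (dd s hs)
    rw [fastPos_deriv_eq P ref hε.ne'] at h1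
    rw [hdd] at h1 ⊢
    exact h1
  have db : ∀ s ∈ Ico t₀ T, HasDerivWithinAt (fun s => fastVel (d s))
      (ε⁻¹ • (-tensionOp P (X s).mech (P.kbar • fastPos (d s) + P.cbar • fastVel (d s))
        + (fastVel (g P ref s (X s) (Z s) ε - g P ref s (X s) (Z s) 0) - ε • fastVel (H s)
          - (tensionOp P (X s).mech - tensionOp P (x t₀).mech)
            (P.kbar • fastPos (r ((s - t₀) / ε)) + P.cbar • fastVel (r ((s - t₀) / ε)))))) (Ici s) s :=
    fun s hs => by
      have h1 := fastVel.hasFDerivAt.comp_hasDerivWithinAt s (dd s hs)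
      rw [fastVel_deriv_eq P ref hε.ne'] at h1
      rw [hdd] at h1 ⊢
      exact h1
  have hd0 : ‖d t₀‖ ≤ (C₂ + C * C₂) * ε := by
    have h1 : d t₀ = (Z t₀ - RodTransport.h P ref t₀ (x t₀) - r 0)
        - (RodTransport.h P ref t₀ (X t₀) - RodTransport.h P ref t₀ (x t₀)) := by
      rw [hdd]
      simp only [sub_self, zero_div]
      abel
    have h2 := (hb t₀ ht₀).2.2.1.trans (mul_le_mul_of_nonneg_left hX0 hC)
    rw [h1]
    refine (norm_sub_le _ _).trans ?_
    linarith
  have hpb : ∀ s ∈ Ico t₀ T, ‖-(ε • fastPos (H s))‖ ≤ C₁ * ε := fun s hs => by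
    rw [norm_neg, norm_smul, Real.norm_of_nonneg hε.le, mul_comm]
    exact mul_le_mul_of_nonneg_right (((fastPos.le_opNorm _).trans
      (mul_le_mul_of_nonneg_left (hd s hs).2.2.1 np0)).trans hC₁p) hε.le
  have hqb : ∀ s ∈ Ico t₀ T, ‖fastVel (g P ref s (X s) (Z s) ε - g P ref s (X s) (Z s) 0)
      - ε • fastVel (H s) - (tensionOp P (X s).mech - tensionOp P (x t₀).mech)
        (P.kbar • fastPos (r ((s - t₀) / ε)) + P.cbar • fastVel (r ((s - t₀) / ε)))‖ ≤ C₁ * ε :=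
    fun s hs => by
      have hs' := Ico_subset_Icc_self hs
      have h1 := norm_layer_tension_le (P := P) (hrK _ (hτ s hs.1))
      rw [← hN] at h1
      exact (norm_fastVel_perturbation_le hC hC₂ hN0 hγ hε hs.1 (hb s hs').2.1 (hd s hs).2.2.1
        (hMdiff s hs') h1).trans (mul_le_mul_of_nonneg_right hC₁q hε.le)
  have ha0 : ‖fastPos (d t₀)‖ ≤ C₃ * ε := by
    have h1 := (fastPos.le_opNorm (d t₀)).trans (mul_le_mul_of_nonneg_left hd0 np0)
    rw [← mul_assoc] at h1
    exact h1.trans (mul_le_mul_of_nonneg_right hC₃p hε.le)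
  have hb0 : ‖fastVel (d t₀)‖ ≤ C₃ * ε := by
    have h1 := (fastVel.le_opNorm (d t₀)).trans (mul_le_mul_of_nonneg_left hd0 nv0)
    rw [← mul_assoc] at h1
    exact h1.trans (mul_le_mul_of_nonneg_right hC₃v hε.le)
  have hmain := hosc ε t₀ T (fun s => fastPos (d s)) (fun s => fastVel (d s)) _ _
    (fun s => tensionOp P (X s).mech) M' hε
    (hεlt.trans_le (min_le_right _ _)) (fastPos.continuous.comp_continuousOn cd)
    (fastVel.continuous.comp_continuousOn cd) cM da db (fun s hs => (hd s hs).2.1)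
    (fun s hs => (hd s hs).2.2.2) (fun s _ => tensionOp_symm P _)
    (fun s _ => le_inner_tensionOp P _) (fun s hs => (hb s hs).1) hpb hqb ha0 hb0 t ht
  have h1 := norm_fast_le (d t)
  have h2 : ‖d t‖ ≤ (A + A) * ε := by linarith [hmain.1, hmain.2]
  rw [hdd] at h2
  exact h2

end GoodTube

end RodTransport
end

noncomputable section
namespace RodTransport

/-! ### The slow motion -/

attribute [local irreducible] g f h desired

namespace GoodTube

variable {P : Params} {ref : Reference} {t₀ ρ : ℝ} {x : ℝ → Slow} (hG : GoodTube P ref t₀ x ρ)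
include hG

theorem exists_slowErr_lipschitz : ∃ L, 0 ≤ L ∧ ∀ t X Y, (t, X) ∈ tube t₀ x ρ →
    (t, Y) ∈ tube t₀ x ρ → slowErr P ref (t, X) ≤ slowErr P ref (t, Y) + L * ‖X - Y‖ := by
  obtain ⟨L, hL, hl⟩ := hG.desired.toBddDerivOn.exists_lipschitz_tube
  refine ⟨L, hL, fun t X Y hX hY => ?_⟩
  have h1 : ‖(X - RodTransport.desired P ref t X) - (Y - RodTransport.desired P ref t Y)‖ ≤
      L * ‖X - Y‖ := hl t X Y hX hY
  have h2 := norm_sub_norm_le (X - RodTransport.desired P ref t X)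
    (Y - RodTransport.desired P ref t Y)
  have h3 : ‖X - RodTransport.desired P ref t X‖ ≤
      ‖Y - RodTransport.desired P ref t Y‖ + L * ‖X - Y‖ := by linarith
  exact h3

/-- The fast state enters the slow equations through its deviation from the quasi-steady state. -/
theorem exists_residual_bound {R ε₀ : ℝ} (hε₀ : 0 < ε₀) (hε₀R : ε₀ ^ 2 * R ≤ P.Lc / 2)
    (hRh : ∀ p ∈ tube t₀ x ρ, ‖RodTransport.h P ref p.1 p.2‖ ≤ R) :
    ∃ L, 0 ≤ L ∧ (∀ t X Z ε, (t, X) ∈ tube t₀ x ρ → ‖Z‖ ≤ R → 0 ≤ ε → ε ≤ ε₀ →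
      ‖f P ref t X Z ε - redField P ref (t, X)‖ ≤ L * (‖Z - RodTransport.h P ref t X‖ + ε)) ∧
      ∀ t X Y, (t, X) ∈ tube t₀ x ρ → (t, Y) ∈ tube t₀ x ρ →
        ‖redField P ref (t, X) - redField P ref (t, Y)‖ ≤ L * ‖X - Y‖ := by
  obtain ⟨L, hL, hl⟩ := (hG.f_smooth R ε₀ hε₀R).toBddDerivOn.exists_lipschitz_elasticSet
  obtain ⟨Lh, hLh, hhl⟩ := hG.root.toBddDerivOn.exists_lipschitz_tube
  have hS : ∀ t X, (t, X) ∈ tube t₀ x ρ →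
      (t, (X, (RodTransport.h P ref t X, (0 : ℝ)))) ∈ elasticSet t₀ x ρ R ε₀ := fun t X hX =>
    ⟨hX, hRh _ hX, le_rfl, hε₀.le⟩
  refine ⟨L * (1 + Lh), by positivity, fun t X Z ε hX hZ hε hεε₀ => ?_, fun t X Y hX hY => ?_⟩
  · have h1 := hl t (X, (Z, ε)) _ ⟨hX, hZ, hε, hεε₀⟩ (hS t X hX)
    have h2 : ‖((X, (Z, ε)) : Slow × (Fast × ℝ)) - (X, (RodTransport.h P ref t X, 0))‖ ≤
        ‖Z - RodTransport.h P ref t X‖ + ε := by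
      simp only [Prod.mk_sub_mk, sub_self, sub_zero, Prod.norm_mk]
      rw [norm_zero, Real.norm_of_nonneg hε]
      have := norm_nonneg (Z - RodTransport.h P ref t X)
      exact max_le (by linarith) (max_le (by linarith) (by linarith))
    have h3 : ‖f P ref t X Z ε - redField P ref (t, X)‖ ≤ _ :=
      h1.trans (mul_le_mul_of_nonneg_left h2 hL)
    have h4 : 0 ≤ L * Lh * (‖Z - RodTransport.h P ref t X‖ + ε) := by positivity
    linarith
  · have h1 := hl t _ _ (hS t X hX) (hS t Y hY)
    have h2 := hhl t X Y hX hY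
    have h3 : ‖((X, (RodTransport.h P ref t X, 0)) : Slow × (Fast × ℝ))
        - (Y, (RodTransport.h P ref t Y, 0))‖ ≤ (1 + Lh) * ‖X - Y‖ := by
      simp only [Prod.mk_sub_mk, sub_self, Prod.norm_mk]
      rw [norm_zero]
      have e1 := norm_nonneg (X - Y)
      have e2 := mul_nonneg hLh e1
      exact max_le (by linarith) (max_le (by linarith) (by linarith))
    have h4 : ‖redField P ref (t, X) - redField P ref (t, Y)‖ ≤ _ :=
      h1.trans (mul_le_mul_of_nonneg_left h3 hL)
    rwa [← mul_assoc] at h4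

/-- Along solutions whose fast state follows the quasi-steady state and the boundary layer term,
the slow state stays close to the trajectory of the reduced model. -/
theorem exists_slow_bound {R ε₀ Cz K γ C₂ : ℝ} (hε₀ : 0 < ε₀) (hε₀R : ε₀ ^ 2 * R ≤ P.Lc / 2)
    (hRh : ∀ p ∈ tube t₀ x ρ, ‖RodTransport.h P ref p.1 p.2‖ ≤ R) (hCz : 0 ≤ Cz) (hK : 0 ≤ K)
    (hγ : 0 < γ) (hC₂ : 0 ≤ C₂) (hxm : ∀ t, t₀ ≤ t → (x t).OnManifold)
    (hx : ∀ t, t₀ ≤ t → HasDerivWithinAt x (redField P ref (t, x t)) (Ici t₀) t)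
    (hxe : Tendsto (fun t => slowErr P ref (t, x t)) atTop (𝓝 0)) :
    ∃ ρ₁ A, 0 < ρ₁ ∧ ρ₁ ≤ ρ ∧ 0 ≤ A ∧ ∀ (ε T : ℝ) (X : ℝ → Slow) (Z : ℝ → Fast), 0 < ε → ε ≤ ε₀ →
      ContinuousOn X (Icc t₀ T) → (∀ t ∈ Icc t₀ T, (t, X t) ∈ manifoldTube t₀ x ρ₁) →
      (∀ t ∈ Icc t₀ T, ‖Z t‖ ≤ R) →
      (∀ t ∈ Ico t₀ T, HasDerivWithinAt X (f P ref t (X t) (Z t) ε) (Ici t) t) →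
      (∀ t ∈ Icc t₀ T, ‖Z t - RodTransport.h P ref t (X t)‖ ≤
        Cz * ε + K * Real.exp (-γ * ((t - t₀) / ε))) →
      ‖X t₀ - x t₀‖ ≤ C₂ * ε → ∀ t ∈ Icc t₀ T, ‖X t - x t‖ ≤ A * ε := by
  obtain ⟨W, η, c, C, hη, hc, hC, hcW, hlow, hup, hder⟩ := hG.exists_lyapunov
  obtain ⟨Le, hLe, hle⟩ := hG.exists_slowErr_lipschitz
  obtain ⟨L, hL, hres, hred⟩ := hG.exists_residual_bound hε₀ hε₀R hRh
  obtain ⟨T₁, hT₁0, hT₁⟩ : ∃ T₁, 0 ≤ T₁ ∧ ∀ t, t₀ + T₁ ≤ t → slowErr P ref (t, x t) ≤ η / 2 := by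
    obtain ⟨a, ha⟩ := eventually_atTop.1 (hxe.eventually (ge_mem_nhds (half_pos hη)))
    exact ⟨max 0 (a - t₀), le_max_left _ _, fun t ht => ha t (by
      linarith [le_max_right 0 (a - t₀)])⟩
  obtain ⟨Cv, hCv0, hCv⟩ : ∃ Cv, 0 ≤ Cv ∧ ∀ ε z : ℝ, 0 ≤ ε → 0 ≤ z →
      L * (Cz * ε + K * z + ε) ≤ Cv * (ε + z) := by
    refine ⟨L * (Cz + K + 1), by positivity, fun ε z hε hz => ?_⟩
    have h1 : 0 ≤ L * ((Cz + 1) * z + K * ε) := by positivity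
    linarith
  obtain ⟨A₁, hA₁, hshort⟩ := slow_short_bound (E := Slow) (T₁ := T₁) hL hCv0 hγ hC₂
  obtain ⟨A₂, hA₂, hlong⟩ := slow_long_bound hc (by linarith : 0 < C + 1) hCv0 hγ hA₁
  obtain ⟨ρ₁, hρ₁, hρ₁ρ, hρ₁L⟩ : ∃ ρ₁, 0 < ρ₁ ∧ ρ₁ ≤ ρ ∧ Le * ρ₁ ≤ η / 2 := by
    refine ⟨min ρ (η / 2 / (Le + 1)), lt_min hG.pos (by positivity), min_le_left _ _, ?_⟩
    calc Le * min ρ (η / 2 / (Le + 1)) ≤ (Le + 1) * (η / 2 / (Le + 1)) :=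
          mul_le_mul (by linarith) (min_le_right _ _)
            (le_min hG.pos.le (by positivity)) (by linarith)
      _ = η / 2 := mul_div_cancel₀ _ (by positivity)
  refine ⟨ρ₁, max A₁ A₂, hρ₁, hρ₁ρ, le_max_of_le_left hA₁, ?_⟩
  intro ε T X Z hε hεε₀ cX hXt hZR dX hZb hX0
  have hXt' : ∀ t ∈ Icc t₀ T, (t, X t) ∈ manifoldTube t₀ x ρ := fun t ht =>
    ⟨tube_mono hρ₁ρ (hXt t ht).1, (hXt t ht).2⟩
  have hxt : ∀ t, t₀ ≤ t → (t, x t) ∈ manifoldTube t₀ x ρ := fun t ht =>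
    ⟨hG.center_mem ht, hxm t ht⟩
  have cx : ContinuousOn x (Ici t₀) := fun t ht => (hx t ht).continuousWithinAt
  have dx : ∀ t, t₀ ≤ t → HasDerivWithinAt x (redField P ref (t, x t)) (Ici t) t := fun t ht =>
    (hx t ht).mono (Ici_subset_Ici.2 ht)
  have hv : ∀ t ∈ Icc t₀ T, ‖f P ref t (X t) (Z t) ε - redField P ref (t, X t)‖ ≤
      Cv * (ε + Real.exp (-γ * ((t - t₀) / ε))) := fun t ht =>
    ((hres t (X t) (Z t) ε (hXt' t ht).1 (hZR t ht) hε.le hεε₀).trans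
      (mul_le_mul_of_nonneg_left (add_le_add_left (hZb t ht) ε) hL)).trans
      (hCv ε _ hε.le (Real.exp_pos _).le)
  have hA : ∀ t ∈ Icc t₀ (min T (t₀ + T₁)), ‖X t - x t‖ ≤ A₁ * ε := by
    have hsub : Icc t₀ (min T (t₀ + T₁)) ⊆ Icc t₀ T := Icc_subset_Icc_right (min_le_left _ _)
    have hsub' : Ico t₀ (min T (t₀ + T₁)) ⊆ Ico t₀ T := Ico_subset_Ico_right (min_le_left _ _)
    refine hshort ε t₀ (min T (t₀ + T₁)) (fun t => X t - x t)
      (fun t => f P ref t (X t) (Z t) ε - redField P ref (t, x t)) hε (min_le_right _ _)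
      ((cX.mono hsub).sub (cx.mono Icc_subset_Ici_self))
      (fun t ht => (dX t (hsub' ht)).sub (dx t ht.1)) (fun t ht => ?_) hX0
    have ht' := Ico_subset_Icc_self (hsub' ht)
    have h1 := hred t _ _ (hXt' t ht').1 (hxt t ht.1).1
    have h2 := hv t ht'
    calc ‖f P ref t (X t) (Z t) ε - redField P ref (t, x t)‖
        = ‖(redField P ref (t, X t) - redField P ref (t, x t))
          + (f P ref t (X t) (Z t) ε - redField P ref (t, X t))‖ := by
            rw [add_comm, sub_add_sub_cancel]
      _ ≤ _ := (norm_add_le _ _).trans (add_le_add h1 h2)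
  intro t ht
  rcases le_total t (t₀ + T₁) with h1 | h1
  · exact (hA t ⟨ht.1, le_min ht.2 h1⟩).trans
      (mul_le_mul_of_nonneg_right (le_max_left _ _) hε.le)
  · have hsub : Icc (t₀ + T₁) T ⊆ Icc t₀ T := Icc_subset_Icc_left (by linarith)
    have hsub' : Ico (t₀ + T₁) T ⊆ Ico t₀ T := Ico_subset_Ico_left (by linarith)
    have hex : ∀ t ∈ Icc (t₀ + T₁) T, slowErr P ref (t, x t) ≤ η := fun t ht =>
      (hT₁ t ht.1).trans (by linarith)
    have heX : ∀ t ∈ Icc (t₀ + T₁) T, slowErr P ref (t, X t) ≤ η := fun t ht => by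
      have e1 := hle t (X t) (x t) (hXt' t (hsub ht)).1 (hxt t (hsub ht).1).1
      have e2 := hT₁ t ht.1
      have e3 := mul_le_mul_of_nonneg_left (hXt t (hsub ht)).1.2 hLe
      simp only at e3
      linarith
    have hd : ∀ t ∈ Ico (t₀ + T₁) T, ∃ w, HasDerivWithinAt (fun s => W s (X s) (x s)) w (Ici t) t ∧
        w ≤ -c * ‖X t - x t‖ ^ 2 + C * (‖X t - x t‖ *
          ‖f P ref t (X t) (Z t) ε - redField P ref (t, X t)‖) := fun t ht => by
      have ht' := Ico_subset_Icc_self ht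
      refine hder X x t _ (hXt' t (hsub ht')) (hxt t (hsub ht').1) (heX t ht') (hex t ht') ?_
        (dx t (hsub ht').1)
      rw [add_sub_cancel]
      exact dX t (hsub' ht)
    choose! w hw hwle using hd
    have h2 := hlong ε t₀ (t₀ + T₁) T (fun t => ‖X t - x t‖) (fun s => W s (X s) (x s)) w hε
      (by linarith) (hcW X x _ (cX.mono hsub) (cx.mono fun s hs => (hsub hs).1)
        (fun s hs => hXt' s (hsub hs)) fun s hs => hxt s (hsub hs).1) hw
      (fun _ _ => norm_nonneg _)
      (fun s hs => hlow s _ _ (hXt' s (hsub hs)) (hxt s (hsub hs).1) (heX s hs) (hex s hs))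
      (fun s hs => (hup s _ _ (hXt' s (hsub hs)) (hxt s (hsub hs).1)).trans
        (mul_le_mul_of_nonneg_right (by linarith) (sq_nonneg _)))
      (fun s hs => (hwle s hs).trans (add_le_add_right (mul_le_mul (by linarith)
        (mul_le_mul_of_nonneg_left (hv s (hsub (Ico_subset_Icc_self hs))) (norm_nonneg _))
        (by positivity) (by linarith)) _))
      (hA (t₀ + T₁) ⟨by linarith, le_min (h1.trans ht.2) le_rfl⟩) t ⟨h1, ht.2⟩
    exact h2.trans (mul_le_mul_of_nonneg_right (le_max_right _ _) hε.le)

end GoodTube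

end RodTransport
end

noncomputable section
namespace RodTransport

/-! ### Solutions of the singularly perturbed system -/

attribute [local irreducible] g f h

/-- The right-hand side of the system for the slow and the fast state. -/
def elasticField (P : Params) (ref : Reference) (ε t : ℝ) (u : Slow × Fast) : Slow × Fast :=
  (f P ref t u.1 u.2 ε, ε⁻¹ • g P ref t u.1 u.2 ε)

theorem norm_sub_mid {E F : Type*} [NormedAddCommGroup E] [NormedAddCommGroup F] (u v : E × F)
    (a : ℝ) : ‖((u.1, (u.2, a)) : E × (F × ℝ)) - (v.1, (v.2, a))‖ = ‖u - v‖ := by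
  simp [Prod.norm_def]

theorem norm_elasticField_le {P : Params} {ref : Reference} {ε t a b : ℝ} {u : Slow × Fast}
    (hε : 0 < ε) (hf : ‖f P ref t u.1 u.2 ε‖ ≤ a) (hg : ‖g P ref t u.1 u.2 ε‖ ≤ b) :
    ‖elasticField P ref ε t u‖ ≤ max a (ε⁻¹ * b) := by
  rw [elasticField, Prod.norm_mk, norm_smul, Real.norm_of_nonneg (inv_pos.2 hε).le]
  exact max_le_max hf (mul_le_mul_of_nonneg_left hg (inv_pos.2 hε).le)

theorem norm_elasticField_sub_le {P : Params} {ref : Reference} {ε t a b : ℝ} {u v : Slow × Fast}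
    (hε : 0 < ε) (hf : ‖f P ref t u.1 u.2 ε - f P ref t v.1 v.2 ε‖ ≤ a)
    (hg : ‖g P ref t u.1 u.2 ε - g P ref t v.1 v.2 ε‖ ≤ b) :
    ‖elasticField P ref ε t u - elasticField P ref ε t v‖ ≤ max a (ε⁻¹ * b) := by
  rw [elasticField, elasticField, Prod.mk_sub_mk, ← smul_sub, Prod.norm_mk, norm_smul,
    Real.norm_of_nonneg (inv_pos.2 hε).le]
  exact max_le_max hf (mul_le_mul_of_nonneg_left hg (inv_pos.2 hε).le)

theorem hasDerivWithinAt_slow {P : Params} {ref : Reference} {ε t : ℝ} {u : ℝ → Slow × Fast}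
    {s : Set ℝ} (h : HasDerivWithinAt u (elasticField P ref ε t (u t)) s t) :
    HasDerivWithinAt (fun t => (u t).1) (f P ref t (u t).1 (u t).2 ε) s t :=
  hasDerivWithinAt_fst h

theorem hasDerivWithinAt_fast {P : Params} {ref : Reference} {ε t : ℝ} {u : ℝ → Slow × Fast}
    {s : Set ℝ} (h : HasDerivWithinAt u (elasticField P ref ε t (u t)) s t) :
    HasDerivWithinAt (fun t => (u t).2) (ε⁻¹ • g P ref t (u t).1 (u t).2 ε) s t :=
  hasDerivWithinAt_snd h

theorem IsElasticSolution.hasDerivWithinAt {P : Params} {ref : Reference} {t₀ ε t : ℝ} {ξ : Slow}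
    {η : Fast} {X : ℝ → Slow} {Z : ℝ → Fast} (h : IsElasticSolution P ref t₀ ε ξ η X Z)
    (ht : t₀ ≤ t) :
    HasDerivWithinAt (fun t => (X t, Z t)) (elasticField P ref ε t (X t, Z t)) (Ici t₀) t :=
  (h.ode_x t ht).prodMk (h.ode_z t ht)

theorem continuousOn_elasticField {P : Params} {ref : Reference} {ε : ℝ} {p : ℝ → Slow × Fast}
    {I : Set ℝ} (hf : ContinuousOn (fun t => f P ref t (p t).1 (p t).2 ε) I)
    (hg : ContinuousOn (fun t => g P ref t (p t).1 (p t).2 ε) I) :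
    ContinuousOn (fun t => elasticField P ref ε t (p t)) I :=
  hf.prodMk ((continuous_const_smul ε⁻¹).comp_continuousOn hg)

/-- A priori bounds on the slow and fast states, as a sublevel set. -/
def gauge (x : ℝ → Slow) (ρ R t : ℝ) (u : Slow × Fast) : ℝ := max (‖u.1 - x t‖ / ρ) (‖u.2‖ / R)

/-- A retraction to the set described by the a priori bounds. -/
def gaugeRetr (x : ℝ → Slow) (ρ R t : ℝ) (u : Slow × Fast) : Slow × Fast :=
  (x t + radialRetr ρ (u.1 - x t), radialRetr R u.2)

section

variable {x : ℝ → Slow} {ρ R t t₀ : ℝ} (hρ : 0 < ρ) (hR : 0 < R)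
include hρ hR

theorem gauge_le_one_iff {u : Slow × Fast} : gauge x ρ R t u ≤ 1 ↔ ‖u.1 - x t‖ ≤ ρ ∧ ‖u.2‖ ≤ R := by
  rw [gauge, max_le_iff, div_le_one hρ, div_le_one hR]

theorem gauge_lt_one_iff {u : Slow × Fast} : gauge x ρ R t u < 1 ↔ ‖u.1 - x t‖ < ρ ∧ ‖u.2‖ < R := by
  rw [gauge, max_lt_iff, div_lt_one hρ, div_lt_one hR]

theorem gauge_gaugeRetr (u : Slow × Fast) : gauge x ρ R t (gaugeRetr x ρ R t u) ≤ 1 := by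
  rw [gauge_le_one_iff hρ hR]
  refine ⟨?_, norm_radialRetr_le hR _⟩
  have : (gaugeRetr x ρ R t u).1 - x t = radialRetr ρ (u.1 - x t) := add_sub_cancel_left _ _
  rw [this]
  exact norm_radialRetr_le hρ _

theorem gaugeRetr_of_le {u : Slow × Fast} (hu : gauge x ρ R t u ≤ 1) : gaugeRetr x ρ R t u = u := by
  obtain ⟨h1, h2⟩ := (gauge_le_one_iff hρ hR).1 hu
  rw [gaugeRetr, radialRetr_of_norm_le hρ h1, radialRetr_of_norm_le hR h2, add_sub_cancel]

theorem norm_gaugeRetr_sub_le (u v : Slow × Fast) :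
    ‖gaugeRetr x ρ R t u - gaugeRetr x ρ R t v‖ ≤ 2 * ‖u - v‖ := by
  refine max_le ?_ ?_
  · have h1 : (gaugeRetr x ρ R t u - gaugeRetr x ρ R t v).1 =
        radialRetr ρ (u.1 - x t) - radialRetr ρ (v.1 - x t) := add_sub_add_left_eq_sub _ _ _
    have h2 := norm_radialRetr_sub_le hρ (u.1 - x t) (v.1 - x t)
    rw [sub_sub_sub_cancel_right] at h2
    rw [h1]
    exact h2.trans (mul_le_mul_of_nonneg_left (norm_fst_le (u - v)) zero_le_two)
  · exact (norm_radialRetr_sub_le hR u.2 v.2).trans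
      (mul_le_mul_of_nonneg_left (norm_snd_le (u - v)) zero_le_two)

omit hρ hR in
theorem continuousOn_gauge (hx : ContinuousOn x (Ici t₀)) {p : ℝ → Slow × Fast}
    (hp : ContinuousOn p (Ici t₀)) : ContinuousOn (fun t => gauge x ρ R t (p t)) (Ici t₀) :=
  ((hp.fst.sub hx).norm.div_const ρ).sup (hp.snd.norm.div_const R)

theorem continuousOn_gaugeRetr (hx : ContinuousOn x (Ici t₀)) (u : Slow × Fast) :
    ContinuousOn (fun t => gaugeRetr x ρ R t u) (Ici t₀) := by
  have h1 : LipschitzWith 2 (radialRetr ρ : Slow → Slow) := LipschitzWith.of_dist_le_mul fun v w => by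
    rw [dist_eq_norm, dist_eq_norm]
    exact norm_radialRetr_sub_le hρ v w
  exact (hx.add (h1.continuous.comp_continuousOn (continuousOn_const.sub hx))).prodMk
    continuousOn_const

end

attribute [local irreducible] elasticField gauge gaugeRetr Slow.OnManifold MarginAtLeast

namespace GoodTube

variable {P : Params} {ref : Reference} {t₀ ρ : ℝ} {x : ℝ → Slow} (hG : GoodTube P ref t₀ x ρ)
include hG

omit hG in
theorem mem_elasticSet_of_gauge {R ε₀ ρ₁ ε t : ℝ} (hR : 0 < R) (hρ₁ : 0 < ρ₁) (hρ₁ρ : ρ₁ ≤ ρ)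
    (hε : 0 < ε) (hεε₀ : ε ≤ ε₀) (ht : t₀ ≤ t) {u : Slow × Fast} (hu : gauge x ρ₁ R t u ≤ 1) :
    (t, (u.1, (u.2, ε))) ∈ elasticSet t₀ x ρ R ε₀ := by
  obtain ⟨h1, h2⟩ := (gauge_le_one_iff hρ₁ hR).1 hu
  exact ⟨⟨ht, h1.trans hρ₁ρ⟩, h2, hε.le, hεε₀⟩

theorem exists_elasticField_bound {R ε₀ ε : ℝ} (hε : 0 < ε) (hε₀R : ε₀ ^ 2 * R ≤ P.Lc / 2) :
    ∃ M, ∀ (t : ℝ) (u : Slow × Fast), (t, (u.1, (u.2, ε))) ∈ elasticSet t₀ x ρ R ε₀ →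
      ‖elasticField P ref ε t u‖ ≤ M := by
  obtain ⟨Cf, hCf⟩ : ∃ C, ∀ p ∈ elasticSet t₀ x ρ R ε₀, ‖f P ref p.1 p.2.1 p.2.2.1 p.2.2.2‖ ≤ C :=
    (hG.f_smooth R ε₀ hε₀R).bdd_val
  obtain ⟨Cg, hCg⟩ : ∃ C, ∀ p ∈ elasticSet t₀ x ρ R ε₀, ‖g P ref p.1 p.2.1 p.2.2.1 p.2.2.2‖ ≤ C :=
    (hG.g_smooth R ε₀).bdd_val
  refine ⟨max Cf (ε⁻¹ * Cg), fun t u hu => ?_⟩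
  have h1 : ‖f P ref t u.1 u.2 ε‖ ≤ Cf := hCf (t, (u.1, (u.2, ε))) hu
  have h2 : ‖g P ref t u.1 u.2 ε‖ ≤ Cg := hCg (t, (u.1, (u.2, ε))) hu
  exact norm_elasticField_le hε h1 h2

theorem exists_f_lipschitz {R ε₀ : ℝ} (hε₀R : ε₀ ^ 2 * R ≤ P.Lc / 2) :
    ∃ L, ∀ (t ε : ℝ) (u v : Slow × Fast), (t, (u.1, (u.2, ε))) ∈ elasticSet t₀ x ρ R ε₀ →
      (t, (v.1, (v.2, ε))) ∈ elasticSet t₀ x ρ R ε₀ →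
      ‖f P ref t u.1 u.2 ε - f P ref t v.1 v.2 ε‖ ≤ L * ‖u - v‖ := by
  obtain ⟨L, hL⟩ : ∃ L, ∀ (t : ℝ) (p q : Slow × (Fast × ℝ)), (t, p) ∈ elasticSet t₀ x ρ R ε₀ →
      (t, q) ∈ elasticSet t₀ x ρ R ε₀ →
      ‖f P ref t p.1 p.2.1 p.2.2 - f P ref t q.1 q.2.1 q.2.2‖ ≤ L * ‖p - q‖ := by
    obtain ⟨L, -, hL⟩ := (hG.f_smooth R ε₀ hε₀R).toBddDerivOn.exists_lipschitz_elasticSet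
    exact ⟨L, hL⟩
  refine ⟨L, fun t ε u v hu hv => ?_⟩
  rw [← norm_sub_mid u v ε]
  exact hL t (u.1, (u.2, ε)) (v.1, (v.2, ε)) hu hv

theorem exists_g_lipschitz (R ε₀ : ℝ) :
    ∃ L, ∀ (t ε : ℝ) (u v : Slow × Fast), (t, (u.1, (u.2, ε))) ∈ elasticSet t₀ x ρ R ε₀ →
      (t, (v.1, (v.2, ε))) ∈ elasticSet t₀ x ρ R ε₀ →
      ‖g P ref t u.1 u.2 ε - g P ref t v.1 v.2 ε‖ ≤ L * ‖u - v‖ := by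
  obtain ⟨L, hL⟩ : ∃ L, ∀ (t : ℝ) (p q : Slow × (Fast × ℝ)), (t, p) ∈ elasticSet t₀ x ρ R ε₀ →
      (t, q) ∈ elasticSet t₀ x ρ R ε₀ →
      ‖g P ref t p.1 p.2.1 p.2.2 - g P ref t q.1 q.2.1 q.2.2‖ ≤ L * ‖p - q‖ := by
    obtain ⟨L, -, hL⟩ := (hG.g_smooth R ε₀).toBddDerivOn.exists_lipschitz_elasticSet
    exact ⟨L, hL⟩
  refine ⟨L, fun t ε u v hu hv => ?_⟩
  rw [← norm_sub_mid u v ε]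
  exact hL t (u.1, (u.2, ε)) (v.1, (v.2, ε)) hu hv

theorem exists_elasticField_lipschitz {R ε₀ ε : ℝ} (hε : 0 < ε) (hε₀R : ε₀ ^ 2 * R ≤ P.Lc / 2) :
    ∃ L, ∀ (t : ℝ) (u v : Slow × Fast), (t, (u.1, (u.2, ε))) ∈ elasticSet t₀ x ρ R ε₀ →
      (t, (v.1, (v.2, ε))) ∈ elasticSet t₀ x ρ R ε₀ →
      ‖elasticField P ref ε t u - elasticField P ref ε t v‖ ≤ L * ‖u - v‖ := by
  obtain ⟨Lf, hLf⟩ := hG.exists_f_lipschitz hε₀R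
  obtain ⟨Lg, hLg⟩ := hG.exists_g_lipschitz R ε₀
  refine ⟨max Lf (ε⁻¹ * Lg), fun t u v hu hv => ?_⟩
  refine (norm_elasticField_sub_le hε (hLf t ε u v hu hv) (hLg t ε u v hu hv)).trans (le_of_eq ?_)
  rw [max_mul_of_nonneg _ _ (norm_nonneg _), mul_assoc]

theorem continuousOn_elasticField_along {R ε₀ ε : ℝ} (hε₀R : ε₀ ^ 2 * R ≤ P.Lc / 2)
    {p : ℝ → Slow × Fast} (hp : ContinuousOn p (Ici t₀))
    (hS : ∀ t ∈ Ici t₀, (t, ((p t).1, ((p t).2, ε))) ∈ elasticSet t₀ x ρ R ε₀) :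
    ContinuousOn (fun t => elasticField P ref ε t (p t)) (Ici t₀) := by
  have h1 : ContinuousOn (fun t => ((p t).1, ((p t).2, ε))) (Ici t₀) :=
    hp.fst.prodMk (hp.snd.prodMk continuousOn_const)
  have h2 : ContinuousOn (fun t => f P ref t (p t).1 (p t).2 ε) (Ici t₀) :=
    (hG.f_smooth R ε₀ hε₀R).toBddDerivOn.continuousOn_along hS h1
  have h3 : ContinuousOn (fun t => g P ref t (p t).1 (p t).2 ε) (Ici t₀) :=
    (hG.g_smooth R ε₀).toBddDerivOn.continuousOn_along hS h1
  exact continuousOn_elasticField h2 h3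

omit hG in
theorem mem_manifoldTube_of_solution {R ε₀ ρ₁ ε T : ℝ} {X : ℝ → Slow} {Z : ℝ → Fast}
    (hε : 0 < ε) (hεε₀ : ε ≤ ε₀) (hε₀R : ε₀ ^ 2 * R ≤ P.Lc / 2)
    (hX0 : (X t₀).OnManifold) (hX : ∀ t ∈ Icc t₀ T, ‖X t - x t‖ ≤ ρ₁)
    (hZ : ∀ t ∈ Icc t₀ T, ‖Z t‖ ≤ R) (cX : ContinuousOn X (Icc t₀ T))
    (cZ : ContinuousOn Z (Icc t₀ T))
    (dX : ∀ t ∈ Ico t₀ T, HasDerivWithinAt X (f P ref t (X t) (Z t) ε) (Ici t) t) :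
    ∀ t ∈ Icc t₀ T, (t, X t) ∈ manifoldTube t₀ x ρ₁ := fun t ht =>
  ⟨⟨ht.1, hX t ht⟩, onManifold_of_solution cX cZ (fun s hs j => (half_pos P.Lc_pos).trans_le
    (half_le_cableLength hε₀R (hZ s hs) hε.le hεε₀ j)) dX hX0 t ht⟩

theorem exists_elastic_solution {R ε₀ ρ₁ ε : ℝ} (hR : 0 < R) (hρ₁ : 0 < ρ₁) (hρ₁ρ : ρ₁ ≤ ρ)
    (hε : 0 < ε) (hεε₀ : ε ≤ ε₀) (hε₀R : ε₀ ^ 2 * R ≤ P.Lc / 2) (cx : ContinuousOn x (Ici t₀))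
    {ξ : Slow} {η : Fast} (hξm : ξ.OnManifold) (hξ : ‖ξ - x t₀‖ ≤ ρ₁) (hη : ‖η‖ ≤ R)
    (hap : ∀ (T : ℝ) (X : ℝ → Slow) (Z : ℝ → Fast), t₀ ≤ T → X t₀ = ξ → Z t₀ = η →
      ContinuousOn X (Icc t₀ T) → ContinuousOn Z (Icc t₀ T) →
      (∀ t ∈ Icc t₀ T, (t, X t) ∈ manifoldTube t₀ x ρ₁) → (∀ t ∈ Icc t₀ T, ‖Z t‖ ≤ R) →
      (∀ t ∈ Ico t₀ T, HasDerivWithinAt X (f P ref t (X t) (Z t) ε) (Ici t) t) →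
      (∀ t ∈ Ico t₀ T, HasDerivWithinAt Z (ε⁻¹ • g P ref t (X t) (Z t) ε) (Ici t) t) →
      ‖X T - x T‖ < ρ₁ ∧ ‖Z T‖ < R) :
    ∃ (X : ℝ → Slow) (Z : ℝ → Fast), IsElasticSolution P ref t₀ ε ξ η X Z ∧
      (∀ X' Z', IsElasticSolution P ref t₀ ε ξ η X' Z' → EqOn X' X (Ici t₀) ∧ EqOn Z' Z (Ici t₀)) ∧
      ∀ t, t₀ ≤ t → (t, X t) ∈ manifoldTube t₀ x ρ₁ ∧ ‖Z t‖ ≤ R := by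
  obtain ⟨M, hM⟩ := hG.exists_elasticField_bound hε hε₀R
  obtain ⟨L, hL⟩ := hG.exists_elasticField_lipschitz hε hε₀R
  have hS : ∀ t, t₀ ≤ t → ∀ u : Slow × Fast, gauge x ρ₁ R t u ≤ 1 →
      (t, (u.1, (u.2, ε))) ∈ elasticSet t₀ x ρ R ε₀ := fun t ht u hu =>
    mem_elasticSet_of_gauge hR hρ₁ hρ₁ρ hε hεε₀ ht hu
  have hgauge := fun t u => gauge_le_one_iff (x := x) (t := t) (u := u) hρ₁ hR
  have hman : ∀ (T : ℝ) (u : ℝ → Slow × Fast), u t₀ = (ξ, η) →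
      (∀ t ∈ Icc t₀ T, gauge x ρ₁ R t (u t) ≤ 1) → ContinuousOn u (Icc t₀ T) →
      (∀ t ∈ Ico t₀ T, HasDerivWithinAt u (elasticField P ref ε t (u t)) (Ici t) t) →
      ∀ t ∈ Icc t₀ T, (t, (u t).1) ∈ manifoldTube t₀ x ρ₁ := fun T u hu0 hu1 cu du => by
    have h0 : (u t₀).1.OnManifold := by rw [hu0]; exact hξm
    exact mem_manifoldTube_of_solution (X := fun t => (u t).1) (Z := fun t => (u t).2) hε hεε₀ hε₀R
      h0 (fun s hs => ((hgauge s _).1 (hu1 s hs)).1) (fun s hs => ((hgauge s _).1 (hu1 s hs)).2)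
      cu.fst cu.snd (fun t ht => hasDerivWithinAt_slow (du t ht))
  obtain ⟨u, hu0, hu1, du, huniq⟩ := exists_unique_of_apriori (E := Slow × Fast) (t₀ := t₀)
    (F := elasticField P ref ε) (φ := gauge x ρ₁ R)
    (π := gaugeRetr x ρ₁ R) (u₀ := (ξ, η)) (fun t ht u hu => hM t u (hS t ht u hu))
    (fun t ht u v hu hv => hL t u v (hS t ht u hu) (hS t ht v hv))
    (fun p hp hp1 => hG.continuousOn_elasticField_along hε₀R hp fun t ht => hS t ht _ (hp1 t ht))
    (fun p hp => continuousOn_gauge cx hp) (fun t _ u => gauge_gaugeRetr hρ₁ hR u)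
    (fun t _ u hu => gaugeRetr_of_le hρ₁ hR hu) (fun t _ u v => norm_gaugeRetr_sub_le hρ₁ hR u v)
    (fun u => continuousOn_gaugeRetr hρ₁ hR cx u) ((hgauge t₀ (ξ, η)).2 ⟨hξ, hη⟩)
    (fun u T hT hu0 hu1 cu du => (gauge_lt_one_iff hρ₁ hR).2
      (hap T (fun t => (u t).1) (fun t => (u t).2) hT
        (congrArg Prod.fst hu0) (congrArg Prod.snd hu0) cu.fst cu.snd (hman T u hu0 hu1 cu du)
        (fun t ht => ((hgauge t _).1 (hu1 t ht)).2) (fun t ht => hasDerivWithinAt_slow (du t ht))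
        (fun t ht => hasDerivWithinAt_fast (du t ht))))
  have cu : ContinuousOn u (Ici t₀) := fun t ht => (du t ht).continuousWithinAt
  have hm : ∀ t, t₀ ≤ t → (t, (u t).1) ∈ manifoldTube t₀ x ρ₁ := fun t ht =>
    hman t u hu0 (fun s hs => hu1 s hs.1) (cu.mono Icc_subset_Ici_self)
      (fun s hs => (du s hs.1).mono (Ici_subset_Ici.2 hs.1)) t (right_mem_Icc.2 ht)
  have hZ : ∀ t, t₀ ≤ t → ‖(u t).2‖ ≤ R := fun t ht => ((hgauge t _).1 (hu1 t ht)).2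
  obtain ⟨c, hc, hmar⟩ := hG.margin
  refine ⟨fun t => (u t).1, fun t => (u t).2, ⟨congrArg Prod.fst hu0, congrArg Prod.snd hu0,
    fun t ht => (hm t ht).2, fun t ht j => (half_pos P.Lc_pos).trans_le
      (half_le_cableLength hε₀R (hZ t ht) hε.le hεε₀ j),
    fun t ht => ⟨c, hc, hmar _ (tube_mono hρ₁ρ (hm t ht).1)⟩, fun t ht => hasDerivWithinAt_slow (du t ht),
    fun t ht => hasDerivWithinAt_fast (du t ht)⟩, fun X' Z' h' => ?_, fun t ht => ⟨hm t ht, hZ t ht⟩⟩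
  have h1 := huniq (fun t => (X' t, Z' t)) (Prod.ext h'.init_x h'.init_z)
    fun t ht => h'.hasDerivWithinAt ht
  exact ⟨fun t ht => congrArg Prod.fst (h1 ht), fun t ht => congrArg Prod.snd (h1 ht)⟩

end GoodTube

end RodTransport
end

noncomputable section
namespace RodTransport

/-! ### Uniform approximation on the half-line -/

attribute [local irreducible] g f h Slow.OnManifold MarginAtLeast desired

/-- `X`, `Z` solve the elastic model on `[t₀, T]` and stay within given bounds of `x`. -/
structure IsBoundedSolutionOn (P : Params) (ref : Reference) (t₀ ε : ℝ) (x : ℝ → Slow) (ρ R T : ℝ)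
    (X : ℝ → Slow) (Z : ℝ → Fast) : Prop where
  cont_x : ContinuousOn X (Icc t₀ T)
  cont_z : ContinuousOn Z (Icc t₀ T)
  mem : ∀ t ∈ Icc t₀ T, (t, X t) ∈ manifoldTube t₀ x ρ
  norm_le : ∀ t ∈ Icc t₀ T, ‖Z t‖ ≤ R
  ode_x : ∀ t ∈ Ico t₀ T, HasDerivWithinAt X (f P ref t (X t) (Z t) ε) (Ici t) t
  ode_z : ∀ t ∈ Ico t₀ T, HasDerivWithinAt Z (ε⁻¹ • g P ref t (X t) (Z t) ε) (Ici t) t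

theorem IsElasticSolution.isBoundedSolutionOn {P : Params} {ref : Reference} {t₀ ε ρ R : ℝ}
    {x X : ℝ → Slow} {Z : ℝ → Fast} {ξ : Slow} {η : Fast}
    (h : IsElasticSolution P ref t₀ ε ξ η X Z)
    (hm : ∀ t, t₀ ≤ t → (t, X t) ∈ manifoldTube t₀ x ρ ∧ ‖Z t‖ ≤ R) (T : ℝ) :
    IsBoundedSolutionOn P ref t₀ ε x ρ R T X Z where
  cont_x := fun t ht => (h.ode_x t ht.1).continuousWithinAt.mono Icc_subset_Ici_self
  cont_z := fun t ht => (h.ode_z t ht.1).continuousWithinAt.mono Icc_subset_Ici_self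
  mem := fun t ht => (hm t ht.1).1
  norm_le := fun t ht => (hm t ht.1).2
  ode_x := fun t ht => (h.ode_x t ht.1).mono (Ici_subset_Ici.2 ht.1)
  ode_z := fun t ht => (h.ode_z t ht.1).mono (Ici_subset_Ici.2 ht.1)

theorem norm_le_of_sub_sub {E : Type*} [NormedAddCommGroup E] {a b c : E} {k₁ k₂ k₃ : ℝ}
    (h₁ : ‖a - b - c‖ ≤ k₁) (h₂ : ‖b‖ ≤ k₂) (h₃ : ‖c‖ ≤ k₃) : ‖a‖ ≤ k₁ + k₂ + k₃ := by
  have : a = a - b - c + b + c := by abel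
  rw [this]
  exact (norm_add₃_le).trans (add_le_add (add_le_add h₁ h₂) h₃)

theorem norm_sub_le_of_sub_sub {E : Type*} [NormedAddCommGroup E] {a b c : E} {k₁ k₃ : ℝ}
    (h₁ : ‖a - b - c‖ ≤ k₁) (h₃ : ‖c‖ ≤ k₃) : ‖a - b‖ ≤ k₁ + k₃ := by
  have : a - b = a - b - c + c := by abel
  rw [this]
  exact (norm_add_le _ _).trans (add_le_add h₁ h₃)

theorem norm_sub_sub_le_of_sub {E : Type*} [NormedAddCommGroup E] {a b b' c : E} {k₁ k₂ : ℝ}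
    (h₁ : ‖a - b - c‖ ≤ k₁) (h₂ : ‖b - b'‖ ≤ k₂) : ‖a - b' - c‖ ≤ k₁ + k₂ := by
  have : a - b' - c = a - b - c + (b - b') := by abel
  rw [this]
  exact (norm_add_le _ _).trans (add_le_add h₁ h₂)

theorem norm_le_of_exp_bound {E : Type*} [NormedAddCommGroup E] {r : ℝ → E} {K γ : ℝ}
    (hγ : 0 < γ) (hK : 0 ≤ K) (hr : ∀ τ, 0 ≤ τ → ‖r τ‖ ≤ K * Real.exp (-γ * τ)) {τ : ℝ}
    (hτ : 0 ≤ τ) : ‖r τ‖ ≤ K :=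
  (hr τ hτ).trans (mul_le_of_le_one_right hK (Real.exp_le_one_iff.2 (by nlinarith)))

theorem exists_pos_sq_mul_le {R b : ℝ} (hR : 0 < R) (hb : 0 < b) :
    ∃ ε, 0 < ε ∧ ε ^ 2 * R ≤ b := by
  refine ⟨min 1 (b / R), lt_min one_pos (div_pos hb hR), ?_⟩
  have h0 : 0 < min 1 (b / R) := lt_min one_pos (div_pos hb hR)
  calc min 1 (b / R) ^ 2 * R ≤ min 1 (b / R) * R := by
        refine mul_le_mul_of_nonneg_right ?_ hR.le
        rw [sq]
        exact mul_le_of_le_one_left h0.le (min_le_left _ _)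
    _ ≤ b := (mul_le_mul_of_nonneg_right (min_le_right _ _) hR.le).trans
        (div_mul_cancel₀ b hR.ne').le

theorem exists_pos_mul_lt {A B : ℝ} (hA : 0 ≤ A) (hB : 0 < B) :
    ∃ ε₁, 0 < ε₁ ∧ ∀ ε, 0 < ε → ε < ε₁ → A * ε < B := by
  refine ⟨B / (A + 1), by positivity, fun ε hε h => ?_⟩
  have h1 := (lt_div_iff₀ (by positivity : 0 < A + 1)).1 h
  nlinarith

namespace GoodTube

variable {P : Params} {ref : Reference} {t₀ ρ : ℝ} {x : ℝ → Slow} (hG : GoodTube P ref t₀ x ρ)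
include hG

theorem exists_h_bound :
    ∃ C, 0 ≤ C ∧ ∀ p ∈ tube t₀ x ρ, ‖RodTransport.h P ref p.1 p.2‖ ≤ C := by
  obtain ⟨C, hC⟩ : ∃ C, ∀ p ∈ tube t₀ x ρ, ‖RodTransport.h P ref p.1 p.2‖ ≤ C := hG.root.bdd_val
  exact ⟨|C|, abs_nonneg C, fun p hp => (hC p hp).trans (le_abs_self C)⟩

theorem exists_h_lipschitz :
    ∃ L, 0 ≤ L ∧ ∀ t y z, (t, y) ∈ tube t₀ x ρ → (t, z) ∈ tube t₀ x ρ →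
      ‖RodTransport.h P ref t y - RodTransport.h P ref t z‖ ≤ L * ‖y - z‖ :=
  hG.root.toBddDerivOn.exists_lipschitz_tube

theorem exists_uniform_bounds {K γ C₂ : ℝ} (hγ : 0 < γ) (hK : 0 ≤ K) (hC₂ : 0 ≤ C₂)
    {r : ℝ → Fast} (hr : IsBoundaryLayerTrajectory P ref t₀ (x t₀) r)
    (hrK : ∀ τ, 0 ≤ τ → ‖r τ‖ ≤ K * Real.exp (-γ * τ)) (hxm : ∀ t, t₀ ≤ t → (x t).OnManifold)
    (hx : ∀ t, t₀ ≤ t → HasDerivWithinAt x (redField P ref (t, x t)) (Ici t₀) t)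
    (hxe : Tendsto (fun t => slowErr P ref (t, x t)) atTop (𝓝 0)) :
    ∃ ρ₁ R ε₁ C, 0 < ρ₁ ∧ ρ₁ ≤ ρ ∧ 0 < R ∧ 0 < ε₁ ∧ ε₁ ^ 2 * R ≤ P.Lc / 2 ∧
      (∀ ε, 0 < ε → ε < ε₁ → C₂ * ε ≤ ρ₁) ∧
      (∀ ε η, 0 < ε → ε < ε₁ → ‖η - RodTransport.h P ref t₀ (x t₀) - r 0‖ ≤ C₂ * ε → ‖η‖ ≤ R) ∧
      ∀ (ε T : ℝ) (X : ℝ → Slow) (Z : ℝ → Fast), 0 < ε → ε < ε₁ →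
        IsBoundedSolutionOn P ref t₀ ε x ρ₁ R T X Z → ‖X t₀ - x t₀‖ ≤ C₂ * ε →
        ‖Z t₀ - RodTransport.h P ref t₀ (x t₀) - r 0‖ ≤ C₂ * ε → ∀ t ∈ Icc t₀ T,
          ‖X t - x t‖ < ρ₁ ∧ ‖Z t‖ < R ∧ ‖X t - x t‖ ≤ C * ε ∧
          ‖Z t - RodTransport.h P ref t (x t) - r ((t - t₀) / ε)‖ ≤ C * ε := by
  obtain ⟨Ch, hCh0, hCh⟩ := hG.exists_h_bound
  obtain ⟨Lh, hLh0, hLh⟩ := hG.exists_h_lipschitz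
  obtain ⟨R, hRdef⟩ : ∃ R, R = Ch + K + 1 := ⟨_, rfl⟩
  have hR : 0 < R := by linarith
  obtain ⟨ε₀, hε₀, hε₀R⟩ := exists_pos_sq_mul_le hR (half_pos P.Lc_pos)
  obtain ⟨εf, Cz, hεf, hCz, hfast⟩ := hG.exists_fast_bound (R := R) hγ hC₂ hε₀ hε₀R hr hrK
  obtain ⟨ρ₁, A, hρ₁, hρ₁ρ, hA, hslow⟩ := hG.exists_slow_bound (R := R) (Cz := Cz) (K := K) (γ := γ)
    (C₂ := C₂) hε₀ hε₀R (fun p hp => (hCh p hp).trans (by linarith)) hCz hK hγ hC₂ hxm hx hxe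
  obtain ⟨εs, hεs, hs⟩ := exists_pos_mul_lt (A := A + Cz + C₂) (by positivity) (lt_min hρ₁ one_pos)
  have hsplit : ∀ ε, 0 < ε → ε < εs → A * ε < ρ₁ ∧ C₂ * ε < ρ₁ ∧ Cz * ε < 1 ∧ C₂ * ε < 1 :=
    fun ε h1 h2 => by
    obtain ⟨h3, h4⟩ := lt_min_iff.1 (hs ε h1 h2)
    have e1 := mul_nonneg hA h1.le
    have e2 := mul_nonneg hCz h1.le
    have e3 := mul_nonneg hC₂ h1.le
    rw [add_mul, add_mul] at h3 h4
    refine ⟨?_, ?_, ?_, ?_⟩ <;> linarith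
  have hmin : ∀ ε, ε < min ε₀ (min εf εs) → ε < ε₀ ∧ ε < εf ∧ ε < εs := fun ε h =>
    ⟨(lt_min_iff.1 h).1, (lt_min_iff.1 (lt_min_iff.1 h).2).1, (lt_min_iff.1 (lt_min_iff.1 h).2).2⟩
  have hε₁ : 0 < min ε₀ (min εf εs) := lt_min hε₀ (lt_min hεf hεs)
  have hε₁R : min ε₀ (min εf εs) ^ 2 * R ≤ P.Lc / 2 :=
    (mul_le_mul_of_nonneg_right (pow_le_pow_left₀ hε₁.le (min_le_left _ _) 2) hR.le).trans hε₀R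
  refine ⟨ρ₁, R, min ε₀ (min εf εs), A + Cz + Lh * A, hρ₁, hρ₁ρ, hR, hε₁, hε₁R,
    fun ε h1 h2 => (hsplit ε h1 (hmin ε h2).2.2).2.1.le, fun ε η h1 h2 h3 => ?_,
    fun ε T X Z h1 h2 hs hX0 hZ0 => ?_⟩
  · have h4 := norm_le_of_sub_sub h3 (hCh _ (hG.center_mem le_rfl))
      (norm_le_of_exp_bound hγ hK hrK le_rfl)
    have h5 := (hsplit ε h1 (hmin ε h2).2.2).2.2.2
    linarith
  obtain ⟨k1, k2, k3⟩ := hmin ε h2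
  obtain ⟨a1, a2, a3, a4⟩ := hsplit ε h1 k3
  have hT : ∀ t ∈ Icc t₀ T, (t, X t) ∈ tube t₀ x ρ := fun t ht => tube_mono hρ₁ρ (hs.mem t ht).1
  have hτ : ∀ t ∈ Icc t₀ T, 0 ≤ (t - t₀) / ε := fun t ht => div_nonneg (sub_nonneg.2 ht.1) h1.le
  have hZ := hfast ε T X Z h1 k2 hs.cont_x hs.cont_z hT hs.norm_le hs.ode_x hs.ode_z hX0 hZ0
  have hX := hslow ε T X Z h1 k1.le hs.cont_x hs.mem hs.norm_le hs.ode_x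
    (fun t ht => norm_sub_le_of_sub_sub (hZ t ht) (hrK _ (hτ t ht))) hX0
  intro t ht
  have e1 := mul_nonneg hA h1.le
  have e2 := mul_nonneg hCz h1.le
  have e3 := mul_nonneg (mul_nonneg hLh0 hA) h1.le
  have b1 := hX t ht
  refine ⟨b1.trans_lt a1, ?_, ?_, ?_⟩
  · have b2 := norm_le_of_sub_sub (hZ t ht) (hCh _ (hT t ht))
      (norm_le_of_exp_bound hγ hK hrK (hτ t ht))
    linarith
  · rw [add_mul, add_mul]
    linarith
  · have b3 := (hLh t _ _ (hT t ht) (hG.center_mem ht.1)).trans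
      (mul_le_mul_of_nonneg_left b1 hLh0)
    have b4 := norm_sub_sub_le_of_sub (hZ t ht) b3
    rw [add_mul, add_mul, mul_assoc Lh A ε]
    linarith

end GoodTube

theorem IsReducedTrajectory.goodCurve {P : Params} {ref : Reference} {t₀ : ℝ} {x : ℝ → Slow}
    (hx : IsReducedTrajectory P ref t₀ x) (href : ref.Admissible t₀)
    (hxconv : ConvergesExponentially P ref t₀ x) : GoodCurve P ref t₀ x := by
  obtain ⟨K, γ, hγ, hK⟩ := hxconv
  refine ⟨href, hx.onManifold, hx.margin, |K|, fun t ht => (hK t ht).trans ?_⟩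
  refine (mul_le_mul_of_nonneg_right (le_abs_self K) (Real.exp_pos _).le).trans
    (mul_le_of_le_one_right (abs_nonneg K) (Real.exp_le_one_iff.2 ?_))
  nlinarith [sub_nonneg.2 ht]

theorem ConvergesExponentially.tendsto_slowErr {P : Params} {ref : Reference} {t₀ : ℝ}
    {x : ℝ → Slow} (h : ConvergesExponentially P ref t₀ x) :
    Tendsto (fun t => slowErr P ref (t, x t)) atTop (𝓝 0) := by
  obtain ⟨K, γ, hγ, hK⟩ := h
  have h1 : Tendsto (fun t : ℝ => γ * (t - t₀)) atTop atTop :=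
    (tendsto_atTop_add_const_right _ (-t₀) tendsto_id).const_mul_atTop hγ
  have h2 : Tendsto (fun t : ℝ => K * Real.exp (-γ * (t - t₀))) atTop (𝓝 0) := by
    have := (Real.tendsto_exp_neg_atTop_nhds_zero.comp h1).const_mul K
    simpa [Function.comp_def, neg_mul] using this
  refine squeeze_zero' (Eventually.of_forall fun t => slowErr_nonneg P ref _) ?_ h2
  filter_upwards [eventually_ge_atTop t₀] with t ht using hK t ht

theorem exists_Ioo_norm_le {E : Type*} [NormedAddCommGroup E] {u : ℝ → E}
    (h : u =O[𝓝[>] (0 : ℝ)] fun ε => ε) :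
    ∃ C ε₁, 0 ≤ C ∧ 0 < ε₁ ∧ ∀ ε, 0 < ε → ε < ε₁ → ‖u ε‖ ≤ C * ε := by
  obtain ⟨C, hC, h1⟩ := h.exists_nonneg
  obtain ⟨ε₁, hε₁, h2⟩ := mem_nhdsGT_iff_exists_Ioo_subset.1 h1.bound
  refine ⟨C, ε₁, hC, hε₁, fun ε h3 h4 => ?_⟩
  have h5 : ‖u ε‖ ≤ C * ‖ε‖ := h2 ⟨h3, h4⟩
  rwa [Real.norm_of_nonneg h3.le] at h5

end RodTransport

end

attribute [local irreducible] RodTransport.g RodTransport.f RodTransport.h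
  RodTransport.Slow.OnManifold RodTransport.MarginAtLeast RodTransport.desired

theorem proposition4p5 (P : RodTransport.Params) (ref : RodTransport.Reference) (t₀ : ℝ)
    (href : ref.Admissible t₀)
    (x : ℝ → RodTransport.Slow) (hx : RodTransport.IsReducedTrajectory P ref t₀ x)
    (hxconv : RodTransport.ConvergesExponentially P ref t₀ x)
    (r : ℝ → RodTransport.Fast)
    (hr : RodTransport.IsBoundaryLayerTrajectory P ref t₀ (x t₀) r)
    (hrconv : ∃ K γ : ℝ, 0 < γ ∧ ∀ τ, 0 ≤ τ → ‖r τ‖ ≤ K * Real.exp (-γ * τ))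
    (ξ : ℝ → RodTransport.Slow) (η : ℝ → RodTransport.Fast)
    (hξ : ∀ᶠ ε in 𝓝[>] (0 : ℝ), (ξ ε).OnManifold)
    (hξx : (fun ε => ξ ε - x t₀) =O[𝓝[>] (0 : ℝ)] fun ε => ε)
    (hηr : (fun ε => η ε - RodTransport.h P ref t₀ (x t₀) - r 0) =O[𝓝[>] (0 : ℝ)] fun ε => ε) :
    ∃ εs : ℝ, 0 < εs ∧ ∃ (X : ℝ → ℝ → RodTransport.Slow) (Z : ℝ → ℝ → RodTransport.Fast),
      (∀ ε, 0 < ε → ε < εs →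
        RodTransport.IsElasticSolution P ref t₀ ε (ξ ε) (η ε) (X ε) (Z ε) ∧
        ∀ (x' : ℝ → RodTransport.Slow) (z' : ℝ → RodTransport.Fast),
          RodTransport.IsElasticSolution P ref t₀ ε (ξ ε) (η ε) x' z' →
            EqOn x' (X ε) (Ici t₀) ∧ EqOn z' (Z ε) (Ici t₀)) ∧
      (∃ C : ℝ, ∀ ε, 0 < ε → ε < εs → ∀ t, t₀ ≤ t →
        ‖X ε t - x t‖ ≤ C * ε ∧
        ‖Z ε t - RodTransport.h P ref t (x t) - r ((t - t₀) / ε)‖ ≤ C * ε) ∧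
      ∀ t₁, t₀ < t₁ → ∃ εss : ℝ, 0 < εss ∧ εss < εs ∧ ∃ C : ℝ,
        ∀ ε, 0 < ε → ε < εss → ∀ t, t₁ < t →
          ‖Z ε t - RodTransport.h P ref t (x t)‖ ≤ C * ε := by
  obtain ⟨K, γ, hγ, hrK⟩ := hrconv
  have hK : 0 ≤ K := by simpa using (norm_nonneg _).trans (hrK 0 le_rfl)
  have hGC := hx.goodCurve href hxconv
  obtain ⟨ρ, hG⟩ := (RodTransport.eventually_goodTube hGC).exists
  obtain ⟨Ca, εa, hCa, hεa, hξb⟩ := RodTransport.exists_Ioo_norm_le hξx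
  obtain ⟨Cb, εb, hCb, hεb, hηb⟩ := RodTransport.exists_Ioo_norm_le hηr
  obtain ⟨εc, hεc, hξc⟩ := mem_nhdsGT_iff_exists_Ioo_subset.1 hξ
  obtain ⟨ρ₁, R, ε₁, C, hρ₁, hρ₁ρ, hR, hε₁, hε₁R, hi1, hi2, hmain⟩ :=
    hG.exists_uniform_bounds hγ hK (le_max_of_le_left hCa : 0 ≤ max Ca Cb) hr hrK hx.onManifold hx.ode
      hxconv.tendsto_slowErr
  have hεs : 0 < min ε₁ (min εa (min εb εc)) := lt_min hε₁ (lt_min hεa (lt_min hεb hεc))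
  have hlt : ∀ ε, 0 < ε → ε < min ε₁ (min εa (min εb εc)) → ε < ε₁ ∧ (ξ ε).OnManifold ∧
      ‖ξ ε - x t₀‖ ≤ max Ca Cb * ε ∧
      ‖η ε - RodTransport.h P ref t₀ (x t₀) - r 0‖ ≤ max Ca Cb * ε := fun ε h0 h => by
    obtain ⟨h1, h⟩ := lt_min_iff.1 h
    obtain ⟨h2, h⟩ := lt_min_iff.1 h
    obtain ⟨h3, h4⟩ := lt_min_iff.1 h
    exact ⟨h1, hξc ⟨h0, h4⟩, (hξb ε h0 h2).trans (mul_le_mul_of_nonneg_right (le_max_left _ _) h0.le),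
      (hηb ε h0 h3).trans (mul_le_mul_of_nonneg_right (le_max_right _ _) h0.le)⟩
  have hsol : ∀ ε, 0 < ε → ε < min ε₁ (min εa (min εb εc)) →
      ∃ (X : ℝ → RodTransport.Slow) (Z : ℝ → RodTransport.Fast),
        RodTransport.IsElasticSolution P ref t₀ ε (ξ ε) (η ε) X Z ∧
        (∀ X' Z', RodTransport.IsElasticSolution P ref t₀ ε (ξ ε) (η ε) X' Z' →
          EqOn X' X (Ici t₀) ∧ EqOn Z' Z (Ici t₀)) ∧
        ∀ t, t₀ ≤ t → (t, X t) ∈ RodTransport.manifoldTube t₀ x ρ₁ ∧ ‖Z t‖ ≤ R := fun ε h0 h => by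
    obtain ⟨h1, h2, h3, h4⟩ := hlt ε h0 h
    refine hG.exists_elastic_solution hR hρ₁ hρ₁ρ h0 h1.le hε₁R
      (fun t ht => (hx.ode t ht).continuousWithinAt) h2 (h3.trans (hi1 ε h0 h1)) (hi2 ε _ h0 h1 h4)
      fun T X Z hT hX0 hZ0 cX cZ hm hZ dX dZ => ?_
    have h5 := hmain ε T X Z h0 h1 ⟨cX, cZ, hm, hZ, dX, dZ⟩ (by rw [hX0]; exact h3)
      (by rw [hZ0]; exact h4) T (right_mem_Icc.2 hT)
    exact ⟨h5.1, h5.2.1⟩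
  choose! X Z hXZ huniq hbdd using hsol
  have hest : ∀ ε, 0 < ε → ε < min ε₁ (min εa (min εb εc)) → ∀ t, t₀ ≤ t →
      ‖X ε t - x t‖ ≤ C * ε ∧
      ‖Z ε t - RodTransport.h P ref t (x t) - r ((t - t₀) / ε)‖ ≤ C * ε := fun ε h0 h t ht => by
    obtain ⟨h1, h2, h3, h4⟩ := hlt ε h0 h
    have hs := hXZ ε h0 h
    exact (hmain ε t (X ε) (Z ε) h0 h1 (hs.isBoundedSolutionOn (hbdd ε h0 h) t)
      (by rw [hs.init_x]; exact h3) (by rw [hs.init_z]; exact h4) t (right_mem_Icc.2 ht)).2.2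
  refine ⟨min ε₁ (min εa (min εb εc)), hεs, X, Z, fun ε h0 h => ⟨hXZ ε h0 h, huniq ε h0 h⟩,
    ⟨C, hest⟩, fun t₁ ht₁ => ⟨min ε₁ (min εa (min εb εc)) / 2, half_pos hεs, half_lt_self hεs,
      C + K * (1 / γ / (t₁ - t₀)), fun ε h0 h t ht => ?_⟩⟩
  have hs : 0 < t₁ - t₀ := sub_pos.2 ht₁
  have hts : 0 < t - t₀ := hs.trans (sub_lt_sub_right ht _)
  have e1 := RodTransport.mul_exp_neg_mul_le (s := (t - t₀) / ε) hγ
  have e2 : Real.exp (-γ * ((t - t₀) / ε)) ≤ 1 / γ / (t₁ - t₀) * ε := by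
    rw [div_mul_eq_mul_div, div_le_iff₀ h0, mul_comm (t - t₀)] at e1
    rw [div_mul_eq_mul_div (1 / γ), le_div_iff₀ hs]
    exact (mul_le_mul_of_nonneg_left (sub_lt_sub_right ht _).le (Real.exp_pos _).le).trans e1
  have e3 := RodTransport.norm_sub_le_of_sub_sub
    (hest ε h0 (h.trans (half_lt_self hεs)) t (ht₁.trans ht).le).2 (hrK _ (div_nonneg hts.le h0.le))
  rw [add_mul, mul_assoc K]
  exact e3.trans (add_le_add le_rfl (mul_le_mul_of_nonneg_left e2 hK))
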